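/- **Setting.** Let $\mathbb K$ be a field of characteristic $0$. For $m,n\ge 0$ let $F_m$ be the free group on $x_1,\dots,x_m$, and let $\mathbf A(m,n)=\mathcal A(X_n,F_m)$ be the space of $F_m$-coloured Jacobi diagrams on $n$ oriented arcs. Explicitly, it is the $\mathbb K$-vector space generated by chord diagrams on $n$ arcs with beads coloured by $x_i^{\pm1}$ on the arcs, modulo: chords and their ends are unnamed; adjacent beads $x_i^{\pm1}$, $x_i^{\mp1}$ cancel; the two ends of a chord may simultaneously be replaced by their conjugates $x\,(\cdot)\,x^{-1}$ with a bead $x=x_i^{\pm 1}$; and the 4T relation. These are the morphism spaces of a linear symmetric strict monoidal category $\mathbf A$ with objects $0,1,2,\dots$. Its tensor product is juxtaposition. The composite $D'\circ D$ of $D':n\to p$ with $D:m\to n$ replaces each bead $x_j$ (respectively $x_j^{-1}$) of $D'$ by a parallel (respectively reversed) copy of the $j$-th arc of $D$, and sums over all ways of placing each chord end of $D$ on one of the copies of its arc, with sign $-1$ for each end placed on a reversed copy. Let $\widehat{\mathbf A}$, with $\widehat{\mathbf A}(m,n)=\prod_k\mathbf A_k(m,n)$, be the completion of $\mathbf A$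 with respect to the number $k$ of chords, and let $P_{m,n}:m+n\to n+m$ be its symmetry. The Casimir Hopf algebra in $\widehat{\mathbf A}$ is the object $1$ with the following morphisms (tuples list the words on the arcs): $\mu=(x_1x_2):2\to1$, $\eta=(1):0\to1$, $\Delta=(x_1,x_1):1\to2$, $\epsilon=():1\to0$, $S=(x_1^{-1}):1\to1$, and $c:0\to2$, one chord joining two arcs without beads. Put $\mu^{[0]}=\eta$, $\mu^{[1]}=\mathrm{id}$, $\mu^{[q]}=\mu(\mu^{[q-1]}\otimes\mathrm{id})$ for $q\ge 2$. Let $\mu_n:n+n\to n$ be the multiplication of the $n$-th tensor power of $(1,\mu,\eta)$. For $g:a\to n$ and $f:b\to n$ with $a=0$ or $b=0$ let $g*f=\mu_n(g\otimes f)$. Inverses, $\exp_*$ and power series of morphisms $0\to n$ are taken in the algebra $(\widehat{\mathbf A}(0,n),*,\eta^{\otimes n})$. **Drinfeld associators.** Let $\mathfrak t_n$ be the Lie algebra over $\mathbb K$ generated by $t_{ij}$ ($1\le i\ne j\le n$) with relations $t_{ij}=t_{ji}$, $[t_{ij},t_{ik}+t_{jk}]=0$ for distinct $i,j,k$, and $[t_{ij},t_{kl}]=0$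 for distinct $i,j,k,l$. A Drinfeld associator is a series $\varphi(X,Y)\in\mathbb K\langle\langle X,Y\rangle\rangle$ that is group-like ($X,Y$ being primitive) and satisfies, in the degree completions of $U(\mathfrak t_4)$ and $U(\mathfrak t_3)$, $$\varphi(t_{12},t_{23}+t_{24})\,\varphi(t_{13}+t_{23},t_{34})=\varphi(t_{23},t_{34})\,\varphi(t_{12}+t_{13},t_{24}+t_{34})\,\varphi(t_{12},t_{23}),$$ $$e^{(t_{13}+t_{23})/2}=\varphi(t_{13},t_{12})\,e^{t_{13}/2}\,\varphi(t_{13},t_{23})^{-1}\,e^{t_{23}/2}\,\varphi(t_{12},t_{23}),$$ $$e^{(t_{12}+t_{13})/2}=\varphi(t_{23},t_{13})^{-1}\,e^{t_{13}/2}\,\varphi(t_{12},t_{13})\,e^{t_{12}/2}\,\varphi(t_{12},t_{23})^{-1}.$$ **Ribbon quasi-Hopf algebras.** A ribbon quasi-Hopf algebra in $\widehat{\mathbf A}$ on the object $1$ consists of an (associative, unital) algebra $(1,\mu,\eta)$; algebra morphisms $\Delta:1\to2$, $\epsilon:1\to0$; an algebra anti-automorphism $S:1\to1$; and convolution-invertible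 $\varphi:0\to3$, $\alpha,\beta:0\to1$, $R:0\to2$, $\mathbf r:0\to1$ such that, with $\mathrm{id}=\mathrm{id}_1$ and $P=P_{1,1}$, 1. $(\epsilon\otimes\mathrm{id})\Delta=\mathrm{id}=(\mathrm{id}\otimes\epsilon)\Delta$, $\;(\mathrm{id}\otimes\Delta)\Delta=\varphi*(\Delta\otimes\mathrm{id})\Delta*\varphi^{-1}$; 2. $(\eta\otimes\varphi)*(\mathrm{id}\otimes\Delta\otimes\mathrm{id})\varphi*(\varphi\otimes\eta)=(\mathrm{id}\otimes\mathrm{id}\otimes\Delta)\varphi*(\Delta\otimes\mathrm{id}\otimes\mathrm{id})\varphi$, $\;(\mathrm{id}\otimes\epsilon\otimes\mathrm{id})\varphi=\eta\otimes\eta$; 3. $\mu^{[3]}(S\otimes\alpha\otimes\mathrm{id})\Delta=\alpha\epsilon$, $\;\mu^{[3]}(\mathrm{id}\otimes\beta\otimes S)\Delta=\beta\epsilon$; 4. $\mu^{[5]}(\mathrm{id}\otimes\beta\otimes S\otimes\alpha\otimes\mathrm{id})\varphi=\eta$, $\;\mu^{[5]}(S\otimes\alpha\otimes\mathrm{id}\otimes\beta\otimes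 S)\varphi^{-1}=\eta$; 5. $R*\Delta*R^{-1}=P\Delta$; 6. $(\Delta\otimes\mathrm{id})R=\varphi_{312}*R_{13}*\varphi_{132}^{-1}*R_{23}*\varphi$, $\;(\mathrm{id}\otimes\Delta)R=\varphi_{231}^{-1}*R_{13}*\varphi_{213}*R_{12}*\varphi^{-1}$, where $R_{12}=R\otimes\eta$, $R_{13}=(\mathrm{id}\otimes\eta\otimes\mathrm{id})R$, $R_{23}=\eta\otimes R$, and $\varphi^{\pm1}_{ijk}$ is $\varphi^{\pm1}$ with its first, second and third tensor factors moved to the positions $i$, $j$, $k$; 7. $S\mathbf r=\mathbf r$, $\;\Delta\mathbf r=PR*R*(\mathbf r\otimes\mathbf r)$. It is *triangular* if $PR=R$, *cocommutative* if $P\Delta=\Delta$, and *special* if $\mu(\mathrm{id}\otimes x)=\mu(x\otimes\mathrm{id})$ for every $x:0\to1$. **Theorem.** Let $\varphi(X,Y)$ be a Drinfeld associator over $\mathbb K$ and let $\beta:0\to1$ in $\widehat{\mathbf A}$ be convolution-invertible. Put $c_{12}=(\mathrm{id}\otimes\mathrm{id}\otimes\eta)c$, $c_{23}=(\eta\otimes\mathrm{id}\otimes\mathrm{id})c$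 and $$\varphi=\varphi(c_{12},c_{23}):0\to3,\qquad R=\exp_*(c/2):0\to2,\qquad \mathbf r=\exp_*(\mu c/2):0\to1.$$ Then $\mu^{[3]}(\mathrm{id}\otimes S\otimes\mathrm{id})\varphi$ is convolution-invertible. Let $\nu:0\to1$ be its convolution inverse, and let $\alpha=\nu*\beta^{-1}$. Then $(1,\mu,\eta,\Delta,\epsilon,\varphi,S,\alpha,\beta,R,\mathbf r)$, with the Casimir Hopf algebra operations $\mu,\eta,\Delta,\epsilon,S$, is a triangular, cocommutative, special ribbon quasi-Hopf algebra in $\widehat{\mathbf A}$. -/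

import Mathlib

namespace JacobiHB

/-- The letters from which diagrams on `n` arcs in a handlebody with free fundamental group
`F(x_0, …, x_{m-1})` are written: a bead `x_i` (`gen i true`), a bead `x_i⁻¹` (`gen i false`), and
the end number `b` of the chord with label `p` (`cend (p, b)`). -/
inductive Letter (m : ℕ) : Type
  | gen (i : Fin m) (s : Bool) : Letter m
  | cend (e : ℕ × Bool) : Letter m
  deriving DecidableEq

/-- `n` oriented arcs; on each of them the beads and chord ends are listed along the arc. -/
abbrev Word (m n : ℕ) : Type := Fin n → List (Letter m)

namespace Letter
variable {m : ℕ}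

/-- Change the names of the chord ends. -/
def mapEnd (τ : ℕ × Bool → ℕ × Bool) : Letter m → Letter m
  | gen i s => gen i s
  | cend e => cend (τ e)

/-- Both ends of the chord `p` get conjugated by `x_j^{±1}`. -/
def around (p : ℕ) (j : Fin m) (s : Bool) : Letter m → List (Letter m)
  | gen i t => [gen i t]
  | cend e => if e.1 = p then [gen j s, cend e, gen j (!s)] else [cend e]

/-- Insert the chord end `e` immediately before the chord end `c`. -/
def before (e c : ℕ × Bool) : Letter m → List (Letter m)
  | gen i t => [gen i t]
  | cend d => if d = c then [cend e, cend d] else [cend d]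

/-- Insert the chord end `e` immediately after the chord end `c`. -/
def after (e c : ℕ × Bool) : Letter m → List (Letter m)
  | gen i t => [gen i t]
  | cend d => if d = c then [cend d, cend e] else [cend d]

/-- The chord end carried by a letter, if any. -/
def end? : Letter m → Option (ℕ × Bool)
  | gen _ _ => none
  | cend e => some e

end Letter

/-- Relabel the chords by `σ` and exchange the two ends of the chords `p` with `f p = true`. -/
def relabelEnd (σ : ℕ → ℕ) (f : ℕ → Bool) (e : ℕ × Bool) : ℕ × Bool :=
  (σ e.1, xor (f e.1) e.2)

namespace Word
variable {m m' n : ℕ}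

/-- How often a chord end occurs. -/
def endCount (w : Word m n) (e : ℕ × Bool) : ℕ := ∑ i, (w i).count (Letter.cend e)

/-- A restricted coloured chord diagram: each chord label either does not occur, or each of its two
ends occurs exactly once. -/
def IsChordDiagram (w : Word m n) : Prop :=
  ∀ p : ℕ, w.endCount (p, true) = w.endCount (p, false) ∧ w.endCount (p, true) ≤ 1

/-- The set of chord ends that occur; a chord diagram with `k` chords has `2 * k` of them. -/
def ends (w : Word m n) : Finset (ℕ × Bool) :=
  Finset.univ.biUnion fun i => ((w i).filterMap Letter.end?).toFinset

/-- Letterwise substitution. -/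
def subst (f : Letter m → List (Letter m')) (w : Word m n) : Word m' n :=
  fun i => (w i).flatMap f

/-- Rename all the chord ends. -/
def mapEnds (τ : ℕ × Bool → ℕ × Bool) (w : Word m n) : Word m n :=
  fun i => (w i).map (Letter.mapEnd τ)

/-- Put letters at the start of the arc `i`. -/
def prepend (i : Fin n) (l : List (Letter m)) (w : Word m n) : Word m n :=
  Function.update w i (l ++ w i)

end Word

/-- Restricted `F(x_0, …, x_{m-1})`-coloured chord diagrams on `n` arcs. -/
abbrev Diag (m n : ℕ) : Type := {w : Word m n // w.IsChordDiagram}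

/-- The relations between coloured chord diagrams: the names of the chords and of their ends do not
matter; `x x⁻¹ = 1` for adjacent beads; both ends of one chord may be conjugated simultaneously by a
bead; and the 4T relation: for a chord `p` and the end `e` of a further chord (whose other end is
anywhere), the differences (`e` just before minus `e` just after an end of `p`), summed over the two
ends of `p`, vanish. -/
inductive ChordRel (K : Type*) [Field K] {m n : ℕ} : (Diag m n →₀ K) → Prop
  | relabel (σ : ℕ → ℕ) (hσ : Function.Injective σ) (f : ℕ → Bool) (a b : Diag m n)
      (hb : b.1 = a.1.mapEnds (relabelEnd σ f)) :
      ChordRel K (Finsupp.single a 1 - Finsupp.single b 1)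
  | cancel (a b : Diag m n) (i : Fin n) (u v : List (Letter m)) (j : Fin m) (s : Bool)
      (ha : a.1 i = u ++ [Letter.gen j s, Letter.gen j (!s)] ++ v)
      (hb : b.1 = Function.update a.1 i (u ++ v)) :
      ChordRel K (Finsupp.single a 1 - Finsupp.single b 1)
  | slide (p : ℕ) (j : Fin m) (s : Bool) (a b : Diag m n)
      (hb : b.1 = a.1.subst (Letter.around p j s)) :
      ChordRel K (Finsupp.single a 1 - Finsupp.single b 1)
  | fourT (w : Word m n) (p : ℕ) (e : ℕ × Bool) (hp : ∀ s, w.endCount (p, s) = 1)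
      (he : w.endCount e = 0) (a b c d : Diag m n)
      (ha : a.1 = w.subst (Letter.before e (p, false)))
      (hb : b.1 = w.subst (Letter.after e (p, false)))
      (hc : c.1 = w.subst (Letter.before e (p, true)))
      (hd : d.1 = w.subst (Letter.after e (p, true))) :
      ChordRel K (Finsupp.single a 1 - Finsupp.single b 1 + Finsupp.single c 1
        - Finsupp.single d 1)

/-- The space `A(m, n)` of Jacobi diagrams on `n` arcs in the handlebody of genus `m`, presented by
restricted coloured chord diagrams modulo 4T. -/
abbrev A (K : Type*) [Field K] (m n : ℕ) : Type _ :=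
  (Diag m n →₀ K) ⧸ Submodule.span K {r : Diag m n →₀ K | ChordRel K r}

section cls
variable (K : Type*) [Field K] {m m' n : ℕ}

open Classical in
/-- The class of a diagram (zero for a word which is not a chord diagram). -/
noncomputable def cls (w : Word m n) : A K m n :=
  if h : w.IsChordDiagram then Submodule.Quotient.mk (Finsupp.single (⟨w, h⟩ : Diag m n) 1) else 0

/-- Linear extension of `cls`. -/
noncomputable def clsL : (Word m n →₀ K) →ₗ[K] A K m n := Finsupp.linearCombination K (cls K)

variable {K}

theorem cls_eq_zero {w : Word m n} (h : ¬ w.IsChordDiagram) : cls K w = 0 := by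
  rw [cls, dif_neg h]

theorem clsL_single (w : Word m n) : clsL K (Finsupp.single w 1) = cls K w := by
  simp [clsL]

theorem endCount_subst {f : Letter m → List (Letter m')} {d : ℕ × Bool} {g : Letter m → ℕ}
    (h : ∀ l, (f l).count (.cend d) = g l) (w : Word m n) :
    (w.subst f).endCount d = ∑ i, ((w i).map g).sum := by
  unfold Word.endCount Word.subst
  refine Finset.sum_congr rfl fun i _ => ?_
  rw [List.count_flatMap]
  congr 1
  exact List.map_congr_left fun l _ => h l

theorem sum_count (c : ℕ × Bool) (l : List (Letter m)) :
    (l.map fun x => if x = Letter.cend c then 1 else 0).sum = l.count (.cend c) := by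
  induction l with
  | nil => simp
  | cons x l ih => simp [List.count_cons, ih, add_comm]

theorem endCount_before (w : Word m n) (e c d : ℕ × Bool) :
    (w.subst (Letter.before e c)).endCount d
      = w.endCount d + if d = e then w.endCount c else 0 := by
  rw [endCount_subst (g := fun x => (if x = Letter.cend d then 1 else 0) +
    if d = e then (if x = Letter.cend c then 1 else 0) else 0)]
  · simp only [Word.endCount]
    split_ifs with h
    · rw [← Finset.sum_add_distrib]
      refine Finset.sum_congr rfl fun i _ => ?_
      rw [List.sum_map_add, sum_count, sum_count]
    · simp [sum_count]
  · rintro (_ | x)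
    · simp [Letter.before]
    · rcases eq_or_ne x c with rfl | hx
      · rcases eq_or_ne d e with rfl | hd
        · simp [Letter.before, List.count_cons, add_comm]
        · simp [Letter.before, List.count_cons, hd, hd.symm]
      · simp [Letter.before, List.count_cons, hx]

theorem endCount_after (w : Word m n) (e c d : ℕ × Bool) :
    (w.subst (Letter.after e c)).endCount d
      = w.endCount d + if d = e then w.endCount c else 0 := by
  rw [← endCount_before, endCount_subst (fun _ => rfl), endCount_subst (fun _ => rfl)]
  refine Finset.sum_congr rfl fun i _ => ?_
  congr 2
  funext x
  cases x with
  | gen => rfl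
  | cend x => simp only [Letter.after, Letter.before]; split_ifs <;> simp [List.count_cons, add_comm]

theorem endCount_around (w : Word m n) (p : ℕ) (j : Fin m) (s : Bool) (d : ℕ × Bool) :
    (w.subst (Letter.around p j s)).endCount d = w.endCount d := by
  rw [endCount_subst (g := fun x => (if x = Letter.cend d then 1 else 0))]
  · simp [Word.endCount, sum_count]
  · rintro (_ | x)
    · simp [Letter.around]
    · simp only [Letter.around]
      split_ifs <;> simp_all

theorem isChordDiagram_congr {w : Word m n} {w' : Word m' n}
    (h : ∀ d, w.endCount d = w'.endCount d) : w.IsChordDiagram ↔ w'.IsChordDiagram := by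
  simp [Word.IsChordDiagram, h]

theorem relabelEnd_injective {σ : ℕ → ℕ} (hσ : Function.Injective σ) (f : ℕ → Bool) :
    Function.Injective (relabelEnd σ f) := by
  rintro ⟨a, b⟩ ⟨c, d⟩ h
  simp only [relabelEnd, Prod.mk.injEq] at h
  obtain rfl := hσ h.1
  simpa using h.2

theorem endCount_mapEnds {τ : ℕ × Bool → ℕ × Bool} (hτ : Function.Injective τ) (w : Word m n)
    (d : ℕ × Bool) : (w.mapEnds τ).endCount (τ d) = w.endCount d := by
  have hinj : Function.Injective (Letter.mapEnd τ : Letter m → Letter m) := by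
    rintro (_ | _) (_ | _) h <;> simp_all [Letter.mapEnd, hτ.eq_iff]
  unfold Word.endCount Word.mapEnds
  refine Finset.sum_congr rfl fun i _ => ?_
  exact List.count_map_of_injective (w i) _ hinj (Letter.cend d)

theorem endCount_mapEnds_of_notMem {τ : ℕ × Bool → ℕ × Bool} (w : Word m n)
    (d : ℕ × Bool) (hd : d ∉ Set.range τ) : (w.mapEnds τ).endCount d = 0 := by
  unfold Word.endCount Word.mapEnds
  refine Finset.sum_eq_zero fun i _ => List.count_eq_zero.2 fun h => ?_
  obtain ⟨x, _, hx⟩ := List.mem_map.1 h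
  cases x with
  | gen => simp [Letter.mapEnd] at hx
  | cend x => simp only [Letter.mapEnd, Letter.cend.injEq] at hx; exact hd ⟨x, hx⟩

theorem isChordDiagram_mapEnds {σ : ℕ → ℕ} (hσ : Function.Injective σ) (f : ℕ → Bool)
    (w : Word m n) : (w.mapEnds (relabelEnd σ f)).IsChordDiagram ↔ w.IsChordDiagram := by
  have key : ∀ p b, (w.mapEnds (relabelEnd σ f)).endCount (σ p, b) = w.endCount (p, xor (f p) b) := by
    intro p b
    rw [← endCount_mapEnds (relabelEnd_injective hσ f) w]
    simp [relabelEnd]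
  constructor
  · intro h p
    have := h (σ p)
    rw [key, key] at this
    cases hf : f p <;> simp [hf] at this <;> omega
  · intro h q
    by_cases hq : q ∈ Set.range σ
    · obtain ⟨p, rfl⟩ := hq
      have := h p
      rw [key, key]
      cases hf : f p <;> simp <;> omega
    · have : ∀ b, (q, b) ∉ Set.range (relabelEnd σ f) := by
        rintro b ⟨e, he⟩
        exact hq ⟨e.1, congrArg Prod.fst he⟩
      simp [endCount_mapEnds_of_notMem _ _ (this _)]

theorem mk_eq_of_rel {a b : Diag m n} (h : ChordRel K (Finsupp.single a 1 - Finsupp.single b 1)) :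
    (Submodule.Quotient.mk (Finsupp.single a 1) : A K m n)
      = Submodule.Quotient.mk (Finsupp.single b 1) :=
  (Submodule.Quotient.eq _).2 (Submodule.subset_span h)

theorem cls_mapEnds {σ : ℕ → ℕ} (hσ : Function.Injective σ) (f : ℕ → Bool) (w : Word m n) :
    cls K (w.mapEnds (relabelEnd σ f)) = cls K w := by
  unfold cls
  have := isChordDiagram_mapEnds hσ f w
  by_cases h : w.IsChordDiagram
  · rw [dif_pos h, dif_pos (this.2 h)]
    exact (mk_eq_of_rel (.relabel σ hσ f _ _ rfl)).symm
  · rw [dif_neg h, dif_neg (mt this.1 h)]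

theorem cls_around (p : ℕ) (j : Fin m) (s : Bool) (w : Word m n) :
    cls K (w.subst (Letter.around p j s)) = cls K w := by
  unfold cls
  have := isChordDiagram_congr (endCount_around w p j s)
  by_cases h : w.IsChordDiagram
  · rw [dif_pos h, dif_pos (this.2 h)]
    exact (mk_eq_of_rel (.slide p j s _ _ rfl)).symm
  · rw [dif_neg h, dif_neg (mt this.1 h)]

theorem cls_cancel {w w' : Word m n} {i : Fin n} {u v : List (Letter m)} {j : Fin m} {s : Bool}
    (ha : w i = u ++ [Letter.gen j s, Letter.gen j (!s)] ++ v)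
    (hb : w' = Function.update w i (u ++ v)) : cls K w = cls K w' := by
  unfold cls
  have : w.IsChordDiagram ↔ w'.IsChordDiagram := by
    refine isChordDiagram_congr fun d => Finset.sum_congr rfl fun k _ => ?_
    subst hb
    by_cases hk : k = i
    · subst hk; simp [ha]
    · simp [Function.update_of_ne hk]
  by_cases h : w.IsChordDiagram
  · rw [dif_pos h, dif_pos (this.1 h)]
    exact mk_eq_of_rel (.cancel _ _ i u v j s ha hb)
  · rw [dif_neg h, dif_neg (mt this.2 h)]

theorem subst_eq_self {f : Letter m → List (Letter m)} {w : Word m n} {c : ℕ × Bool}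
    (h0 : w.endCount c = 0) (hf : ∀ l, l ≠ Letter.cend c → f l = [l]) : w.subst f = w := by
  funext i
  have h0 : Letter.cend c ∉ w i := by
    have := (Finset.sum_eq_zero_iff.1 h0) i (Finset.mem_univ _)
    exact List.count_eq_zero.1 this
  have : ∀ l : List (Letter m), Letter.cend c ∉ l → l.flatMap f = l := by
    intro l
    induction l with
    | nil => simp
    | cons x l ih =>
      intro h
      simp only [List.mem_cons, not_or] at h
      rw [List.flatMap_cons, ih h.2, hf x (Ne.symm h.1)]; rfl
  exact this _ h0

theorem before_eq {e c : ℕ × Bool} (l : Letter m) (h : l ≠ .cend c) : Letter.before e c l = [l] := by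
  cases l <;> simp_all [Letter.before]

theorem after_eq {e c : ℕ × Bool} (l : Letter m) (h : l ≠ .cend c) : Letter.after e c l = [l] := by
  cases l <;> simp_all [Letter.after]

theorem cls_fourT (w : Word m n) (p : ℕ) (e : ℕ × Bool) (hpe : e.1 ≠ p) :
    cls K (w.subst (Letter.before e (p, false))) - cls K (w.subst (Letter.after e (p, false)))
      + cls K (w.subst (Letter.before e (p, true))) - cls K (w.subst (Letter.after e (p, true))) = 0 := by
  have hne : ∀ s, (p, s) ≠ e := fun s h => hpe (by rw [← h])
  have hadm : ∀ s, (w.subst (Letter.before e (p, s))).IsChordDiagram →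
      w.endCount (p, false) = w.endCount (p, true) ∧ w.endCount (p, true) ≤ 1 := by
    intro s h
    have := h p
    simp only [endCount_before, hne, if_false] at this
    omega
  have hba : ∀ s, (w.subst (Letter.before e (p, s))).IsChordDiagram ↔
      (w.subst (Letter.after e (p, s))).IsChordDiagram := fun s =>
    isChordDiagram_congr fun d => by rw [endCount_before, endCount_after]
  by_cases hp : w.endCount (p, false) = 1 ∧ w.endCount (p, true) = 1
  · have hft : (w.subst (Letter.before e (p, false))).IsChordDiagram ↔
        (w.subst (Letter.before e (p, true))).IsChordDiagram :=
      isChordDiagram_congr fun d => by rw [endCount_before, endCount_before, hp.1, hp.2]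
    by_cases h : (w.subst (Letter.before e (p, false))).IsChordDiagram
    · have h1 := (hba _).1 h
      have h2 := hft.1 h
      have h3 := (hba _).1 h2
      have he : w.endCount e = 0 := by
        have := h e.1
        have hc := endCount_before w e (p, false) e
        rw [if_pos rfl, hp.1] at hc
        rcases e with ⟨q, b⟩
        cases b <;> simp only at this hc <;> omega
      unfold cls
      rw [dif_pos h, dif_pos h1, dif_pos h2, dif_pos h3]
      simp only [← Submodule.Quotient.mk_sub, ← Submodule.Quotient.mk_add]
      refine (Submodule.Quotient.mk_eq_zero _).2 (Submodule.subset_span ?_)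
      exact ChordRel.fourT w p e (by rintro (_ | _); exacts [hp.1, hp.2]) he _ _ _ _ rfl rfl rfl rfl
    · have h1 := mt (hba _).2 h
      have h2 := mt hft.2 h
      have h3 := mt (hba _).2 h2
      unfold cls
      rw [dif_neg h, dif_neg h1, dif_neg h2, dif_neg h3]; simp
  · have key : ∀ s, cls K (w.subst (Letter.before e (p, s))) = cls K (w.subst (Letter.after e (p, s))) := by
      intro s
      by_cases h : (w.subst (Letter.before e (p, s))).IsChordDiagram
      · have := hadm s h
        have h0 : w.endCount (p, s) = 0 := by cases s <;> omega
        rw [subst_eq_self h0 (fun l => before_eq l), subst_eq_self h0 (fun l => after_eq l)]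
      · unfold cls
        rw [dif_neg h, dif_neg (mt (hba s).2 h)]
    rw [key, key]; simp
end cls

/-- Letters of a cabled diagram: a letter that is kept, or a copy of the chord end `e` of the inner
diagram, lying on a copy of its strand with the original (`s = true`) or reversed (`s = false`)
orientation. -/
inductive CabLetter (m : ℕ) : Type
  | keep (l : Letter m) : CabLetter m
  | copy (e : ℕ × Bool) (s : Bool) : CabLetter m
  deriving DecidableEq

namespace CabLetter
variable {m : ℕ}

/-- A letter of the inner diagram on a parallel copy of its strand. -/
def ofLetter : Letter m → CabLetter m
  | .gen i s => keep (.gen i s)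
  | .cend e => copy e true

/-- The effect of reversing the orientation of a copied strand on a letter. -/
def flip : CabLetter m → CabLetter m
  | keep (.gen i s) => keep (.gen i (!s))
  | keep (.cend e) => keep (.cend e)
  | copy e s => copy e (!s)

end CabLetter

section cabling
variable {m n p : ℕ}

/-- What the letters of the outer diagram are replaced with: the bead `x_j` by a copy of the strand
`j` of the inner diagram `D`, the bead `x_j⁻¹` by a reversed copy. -/
def expand (D : Word m n) : Letter n → List (CabLetter m)
  | .gen j true => (D j).map CabLetter.ofLetter
  | .gen j false => ((D j).map CabLetter.ofLetter).reverse.map CabLetter.flip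
  | .cend e => [.keep (.cend e)]

/-- All letters of the cabled diagram, together with the arcs on which they lie. -/
def cable (D' : Word n p) (D : Word m n) : List (Fin p × CabLetter m) :=
  (List.finRange p).flatMap fun i => ((D' i).flatMap (expand D)).map (Prod.mk i)

variable (K : Type*) [Field K]

/-- Linear extension of `Word.prepend`. -/
noncomputable def pre (i : Fin p) (l : List (Letter m)) :
    (Word m p →₀ K) →ₗ[K] (Word m p →₀ K) :=
  Finsupp.lmapDomain K K (Word.prepend i l)

/-- Sign of a chord end on a copied strand: reversed strands contribute `-1`. -/
def sgn (s : Bool) : K := if s then 1 else -1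

/-- Sum over all ways to put each chord end of `S` on exactly one of its copies, with the sign that
is the product of the signs of the chosen copies; the copies not chosen are omitted. -/
noncomputable def distribute :
    Finset (ℕ × Bool) → List (Fin p × CabLetter m) → (Word m p →₀ K)
  | S, [] => if S = ∅ then Finsupp.single (fun _ => []) 1 else 0
  | S, (i, .keep l) :: L => pre K i [l] (distribute S L)
  | S, (i, .copy e s) :: L =>
      distribute S L +
        if e ∈ S then sgn K s • pre K i [.cend e] (distribute (S.erase e) L) else 0

/-- Composition of an outer diagram `D'` with an inner diagram `D` whose chords have distinct
labels: the strands of `D` are cabled along the beads of `D'` and glued in. -/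
noncomputable def glue (D' : Word n p) (D : Word m n) : Word m p →₀ K :=
  distribute K D.ends (cable D' D)

end cabling

section lemmas
variable {K : Type*} [Field K] {m m' n p : ℕ}

theorem pre_single (i : Fin p) (l : List (Letter m)) (w : Word m p) (a : K) :
    pre K i l (Finsupp.single w a) = Finsupp.single (w.prepend i l) a := by
  simp [pre, Finsupp.mapDomain_single]

theorem pre_append (i : Fin p) (l l' : List (Letter m)) (v : Word m p →₀ K) :
    pre K i (l ++ l') v = pre K i l (pre K i l' v) := by
  have : (pre K i (l ++ l') : (Word m p →₀ K) →ₗ[K] _) = pre K i l ∘ₗ pre K i l' := by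
    ext w : 1
    ext1
    simp [pre_single, Word.prepend]
  rw [this]; rfl

theorem pre_nil (i : Fin p) (v : Word m p →₀ K) : pre K i [] v = v := by
  have : (pre K i [] : (Word m p →₀ K) →ₗ[K] _) = LinearMap.id := by
    ext w : 1
    ext1
    simp [pre_single, Word.prepend]
  rw [this]; rfl

/-- Linear extension of `Word.subst`. -/
noncomputable def substL (f : Letter m → List (Letter m')) :
    (Word m p →₀ K) →ₗ[K] (Word m' p →₀ K) := Finsupp.lmapDomain K K (Word.subst f)

theorem substL_single (f : Letter m → List (Letter m')) (w : Word m p) (a : K) :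
    substL f (Finsupp.single w a) = Finsupp.single (w.subst f) a := by
  simp [substL, Finsupp.mapDomain_single]

theorem substL_pre (f : Letter m → List (Letter m')) (i : Fin p) (l : List (Letter m))
    (v : Word m p →₀ K) : substL f (pre K i l v) = pre K i (l.flatMap f) (substL f v) := by
  have : (substL f ∘ₗ pre K i l : (Word m p →₀ K) →ₗ[K] _) = pre K i (l.flatMap f) ∘ₗ substL f := by
    ext w : 1
    ext1
    simp only [LinearMap.comp_apply, Finsupp.lsingle_apply, pre_single, substL_single]
    congr 1
    funext k
    by_cases hk : k = i
    · subst hk; simp [Word.subst, Word.prepend]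
    · simp [Word.subst, Word.prepend, Function.update_of_ne hk]
  exact LinearMap.congr_fun this v

/-- letterwise substitution on kept letters -/
def substCab (f : Letter m → List (Letter m)) : CabLetter m → List (CabLetter m)
  | .keep l => (f l).map .keep
  | .copy e s => [.copy e s]

/-- Letterwise substitution in a cabled diagram. -/
def onStrand (g : CabLetter m → List (CabLetter m')) (q : Fin p × CabLetter m) :
    List (Fin p × CabLetter m') := (g q.2).map (Prod.mk q.1)

theorem distribute_keep (S : Finset (ℕ × Bool)) (i : Fin p) (l : List (Letter m))
    (L : List (Fin p × CabLetter m)) :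
    distribute K S ((l.map CabLetter.keep).map (Prod.mk i) ++ L) = pre K i l (distribute K S L) := by
  induction l with
  | nil => simp [pre_nil]
  | cons x l ih =>
    rw [List.map_cons, List.map_cons, List.cons_append, distribute, ih, ← pre_append]; rfl

theorem distribute_substCab (f : Letter m → List (Letter m)) (L : List (Fin p × CabLetter m))
    (hf : ∀ q ∈ L, ∀ e s, q.2 = .copy e s → f (.cend e) = [.cend e]) (S : Finset (ℕ × Bool)) :
    distribute K S (L.flatMap (onStrand (substCab f))) = substL f (distribute K S L) := by
  induction L generalizing S with
  | nil =>
    simp only [List.flatMap_nil, distribute]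
    split_ifs
    · rw [substL_single]; rfl
    · simp
  | cons q L ih =>
    have ih := ih fun q hq => hf q (List.mem_cons_of_mem _ hq)
    obtain ⟨i, l | ⟨e, s⟩⟩ := q
    · rw [List.flatMap_cons, onStrand, substCab, distribute_keep, ih, distribute, substL_pre]; simp
    · have hc := hf _ List.mem_cons_self e s rfl
      simp only [List.flatMap_cons, onStrand, substCab, List.map_cons, List.map_nil,
        List.singleton_append, distribute, map_add, ih]
      split_ifs
      · simp [substL_pre, hc]
      · simp

/- relabelling everything -/

/-- Rename the chord ends in a cabled diagram. -/
def mapEndCab (τ : ℕ × Bool → ℕ × Bool) : CabLetter m → CabLetter m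
  | .keep l => .keep (l.mapEnd τ)
  | .copy e s => .copy (τ e) s

theorem mapEndCab_keep (τ : ℕ × Bool → ℕ × Bool) (l : Letter m) :
    mapEndCab τ (.keep l) = .keep (l.mapEnd τ) := rfl

theorem mapEndCab_copy (τ : ℕ × Bool → ℕ × Bool) (e : ℕ × Bool) (s : Bool) :
    mapEndCab τ (.copy e s : CabLetter m) = .copy (τ e) s := rfl

/-- Linear extension of `Word.mapEnds`. -/
noncomputable def mapEndsL (τ : ℕ × Bool → ℕ × Bool) :
    (Word m p →₀ K) →ₗ[K] (Word m p →₀ K) := Finsupp.lmapDomain K K (Word.mapEnds τ)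

theorem mapEndsL_single (τ : ℕ × Bool → ℕ × Bool) (w : Word m p) (a : K) :
    mapEndsL τ (Finsupp.single w a) = Finsupp.single (w.mapEnds τ) a := by
  simp [mapEndsL, Finsupp.mapDomain_single]

theorem mapEndsL_pre (τ : ℕ × Bool → ℕ × Bool) (i : Fin p) (l : Letter m) (v : Word m p →₀ K) :
    mapEndsL τ (pre K i [l] v) = pre K i [l.mapEnd τ] (mapEndsL τ v) := by
  have : (mapEndsL τ ∘ₗ pre K i [l] : (Word m p →₀ K) →ₗ[K] _)
      = pre K i [l.mapEnd τ] ∘ₗ mapEndsL τ := by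
    ext w : 1
    ext1
    simp only [LinearMap.comp_apply, Finsupp.lsingle_apply, pre_single, mapEndsL_single]
    congr 1
    funext k
    by_cases hk : k = i
    · subst hk; simp [Word.mapEnds, Word.prepend]
    · simp [Word.mapEnds, Word.prepend, Function.update_of_ne hk]
  exact LinearMap.congr_fun this v

theorem distribute_mapEnd {τ : ℕ × Bool → ℕ × Bool} (hτ : Function.Injective τ)
    (L : List (Fin p × CabLetter m)) (S : Finset (ℕ × Bool)) :
    distribute K (S.image τ) (L.map fun q => (q.1, mapEndCab τ q.2))
      = mapEndsL τ (distribute K S L) := by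
  induction L generalizing S with
  | nil =>
    simp only [List.map_nil, distribute, Finset.image_eq_empty]
    split_ifs
    · rw [mapEndsL_single]; rfl
    · simp
  | cons q L ih =>
    obtain ⟨i, l | ⟨e, s⟩⟩ := q
    · simp only [List.map_cons, mapEndCab_keep, distribute, mapEndsL_pre, ih]
    · simp only [List.map_cons, mapEndCab_copy, distribute, map_add, ih]
      have : τ e ∈ S.image τ ↔ e ∈ S := by simp [hτ.eq_iff]
      rw [← Finset.image_erase hτ, ih]
      by_cases h : e ∈ S
      · rw [if_pos (this.2 h), if_pos h, map_smul, mapEndsL_pre]; rfl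
      · rw [if_neg (mt this.1 h), if_neg h, map_zero]

/- cancellation -/

/-- Put several letters at the start of the arcs. -/
def preL (L : List (Fin p × Letter m)) (w : Word m p) : Word m p :=
  L.foldr (fun q w => w.prepend q.1 [q.2]) w

theorem preL_apply (L : List (Fin p × Letter m)) (w : Word m p) (i : Fin p) :
    preL L w i = (L.filter (fun q => q.1 = i)).map Prod.snd ++ w i := by
  induction L with
  | nil => simp [preL]
  | cons q L ih =>
    have : preL (q :: L) w = (preL L w).prepend q.1 [q.2] := rfl
    rw [this, Word.prepend]
    by_cases h : q.1 = i
    · subst h; simp [ih]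
    · rw [Function.update_of_ne (Ne.symm h), ih]; simp [h]

/-- Equality of classes after putting any letters in front. -/
def EqV (v v' : Word m p →₀ K) : Prop :=
  ∀ L : List (Fin p × Letter m),
    clsL K (Finsupp.lmapDomain K K (preL L) v) = clsL K (Finsupp.lmapDomain K K (preL L) v')

theorem EqV.rfl {v : Word m p →₀ K} : EqV v v := fun _ => Eq.refl _

theorem EqV.trans {v v' v'' : Word m p →₀ K} (h : EqV v v') (h' : EqV v' v'') : EqV v v'' :=
  fun L => (h L).trans (h' L)

theorem EqV.symm {v v' : Word m p →₀ K} (h : EqV v v') : EqV v' v := fun L => (h L).symm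

theorem EqV.add {v v' u u' : Word m p →₀ K} (h : EqV v v') (h' : EqV u u') :
    EqV (v + u) (v' + u') := fun L => by simp only [map_add, h L, h' L]

theorem EqV.smul {v v' : Word m p →₀ K} (c : K) (h : EqV v v') : EqV (c • v) (c • v') :=
  fun L => by simp only [map_smul, h L]

theorem EqV.pre_one {v v' : Word m p →₀ K} (i : Fin p) (l : Letter m) (h : EqV v v') :
    EqV (pre K i [l] v) (pre K i [l] v') := fun L => by
  have : ∀ v : Word m p →₀ K, Finsupp.lmapDomain K K (preL L) (pre K i [l] v)
      = Finsupp.lmapDomain K K (preL (L ++ [(i, l)])) v := by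
    intro v
    have e : (preL (L ++ [(i, l)]) : Word m p → Word m p) = preL L ∘ Word.prepend i [l] := by
      funext w; simp [preL]
    rw [e, Finsupp.lmapDomain_comp]; rfl
  rw [this, this, h]

theorem EqV.clsL {v v' : Word m p →₀ K} (h : EqV v v') : JacobiHB.clsL K v = JacobiHB.clsL K v' := by
  have := h []
  have e : (preL [] : Word m p → Word m p) = id := Eq.refl _
  rwa [e, Finsupp.lmapDomain_id] at this

theorem EqV.cancel (i : Fin p) (j : Fin m) (s : Bool) (v : Word m p →₀ K) :
    EqV (pre K i [.gen j s, .gen j (!s)] v) v := by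
  intro L
  have : (JacobiHB.clsL K ∘ₗ Finsupp.lmapDomain K K (preL L)) ∘ₗ pre K i [.gen j s, .gen j (!s)]
      = JacobiHB.clsL K ∘ₗ Finsupp.lmapDomain K K (preL L) := by
    ext w : 1
    ext1
    simp only [LinearMap.comp_apply, Finsupp.lsingle_apply, pre_single, Finsupp.lmapDomain_apply,
      Finsupp.mapDomain_single, clsL_single]
    refine cls_cancel (i := i) (j := j) (s := s)
      (u := (L.filter (fun q => q.1 = i)).map Prod.snd) (v := w i) ?_ ?_
    · simp [preL_apply, Word.prepend]
    · funext k
      by_cases hk : k = i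
      · subst hk; simp [preL_apply]
      · rw [Function.update_of_ne hk, preL_apply, preL_apply, Word.prepend, Function.update_of_ne hk]
  exact LinearMap.congr_fun this v

/-- Cabled diagrams which give the same class in every context to the right of them. -/
def EqL (K : Type*) [Field K] (L L' : List (Fin p × CabLetter m)) : Prop :=
  ∀ S b, EqV (distribute K S (L ++ b)) (distribute K S (L' ++ b))

theorem EqL.rfl {L : List (Fin p × CabLetter m)} : EqL K L L := fun _ _ => EqV.rfl

theorem EqL.trans {L L' L'' : List (Fin p × CabLetter m)} (h : EqL K L L') (h' : EqL K L' L'') :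
    EqL K L L'' := fun S b => (h S b).trans (h' S b)

theorem EqL.cons {L L' : List (Fin p × CabLetter m)} (q : Fin p × CabLetter m) (h : EqL K L L') :
    EqL K (q :: L) (q :: L') := by
  intro S b
  obtain ⟨i, l | ⟨e, s⟩⟩ := q
  · simp only [List.cons_append, distribute]
    exact (h S b).pre_one i l
  · simp only [List.cons_append, distribute]
    refine (h S b).add ?_
    split_ifs
    · exact ((h _ b).pre_one i _).smul _
    · exact EqV.rfl

theorem EqL.append {L L' M M' : List (Fin p × CabLetter m)} (h : EqL K L L') (h' : EqL K M M') :
    EqL K (L ++ M) (L' ++ M') := by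
  have h1 : EqL K (L ++ M) (L' ++ M) := fun S b => by
    simpa only [List.append_assoc] using h S (M ++ b)
  refine h1.trans ?_
  clear h h1
  induction L' with
  | nil => exact h'
  | cons q L' ih => exact ih.cons q

theorem EqL.flatMap {α : Type*} {f g : α → List (Fin p × CabLetter m)} (l : List α)
    (h : ∀ x ∈ l, EqL K (f x) (g x)) : EqL K (l.flatMap f) (l.flatMap g) := by
  induction l with
  | nil => exact EqL.rfl
  | cons x l ih =>
    exact (h x List.mem_cons_self).append (ih fun y hy => h y (List.mem_cons_of_mem _ hy))

theorem EqL.distribute {L L' : List (Fin p × CabLetter m)} (h : EqL K L L')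
    (S : Finset (ℕ × Bool)) : EqV (distribute K S L) (JacobiHB.distribute K S L') := by
  simpa using h S []

/-- a letter which is not an end of the outer diagram -/
def IsInner : CabLetter m → Prop
  | .keep (.cend _) => False
  | _ => True

theorem EqL.pair (i : Fin p) (x : CabLetter m) (hx : IsInner x) :
    EqL K [(i, x), (i, x.flip)] [] := by
  intro S b
  rcases x with (⟨j, s⟩ | e) | ⟨e, s⟩
  · simp only [CabLetter.flip, List.cons_append, List.nil_append, JacobiHB.distribute]
    rw [← pre_append]
    exact EqV.cancel i j s _
  · exact hx.elim
  · simp only [CabLetter.flip, List.cons_append, List.nil_append, JacobiHB.distribute]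
    have : (JacobiHB.distribute K S b + (if e ∈ S then
        sgn K (!s) • pre K i [Letter.cend e] (JacobiHB.distribute K (S.erase e) b) else 0) +
        if e ∈ S then sgn K s • pre K i [Letter.cend e] (JacobiHB.distribute K (S.erase e) b +
          if e ∈ S.erase e then sgn K (!s) • pre K i [Letter.cend e]
            (JacobiHB.distribute K ((S.erase e).erase e) b) else 0) else 0)
        = JacobiHB.distribute K S b := by
      by_cases h : e ∈ S
      · cases s <;> simp [h, sgn]
      · simp [h]
    rw [this]
    exact EqV.rfl

/-- Reversed copy. -/
def inv (l : List (CabLetter m)) : List (CabLetter m) := l.reverse.map CabLetter.flip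

theorem flip_flip (x : CabLetter m) : x.flip.flip = x := by
  rcases x with (_ | _) | _ <;> simp [CabLetter.flip]

theorem inv_inv (l : List (CabLetter m)) : inv (inv l) = l := by
  simp only [inv, ← List.map_reverse, List.reverse_reverse, List.map_map]
  conv_rhs => rw [← List.map_id l]
  exact List.map_congr_left fun x _ => flip_flip x

theorem isInner_flip {x : CabLetter m} (h : IsInner x) : IsInner x.flip := by
  rcases x with (_ | _) | _ <;> simp_all [CabLetter.flip, IsInner]

theorem isInner_inv {l : List (CabLetter m)} (h : ∀ x ∈ l, IsInner x) : ∀ x ∈ inv l, IsInner x := by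
  intro x hx
  obtain ⟨y, hy, rfl⟩ := List.mem_map.1 hx
  exact isInner_flip (h y (List.mem_reverse.1 hy))

theorem EqL.inv_right (i : Fin p) (l : List (CabLetter m)) (h : ∀ x ∈ l, IsInner x) :
    EqL K ((l ++ inv l).map (Prod.mk i)) [] := by
  induction l with
  | nil => exact EqL.rfl
  | cons x l ih =>
    have ih := ih fun y hy => h y (List.mem_cons_of_mem _ hy)
    have e : ((x :: l ++ inv (x :: l)).map (Prod.mk i))
        = [(i, x)] ++ ((l ++ inv l).map (Prod.mk i) ++ [(i, x.flip)]) := by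
      simp [inv]
    rw [e]
    refine (EqL.rfl.append (ih.append EqL.rfl)).trans ?_
    exact EqL.pair i x (h x List.mem_cons_self)

theorem isInner_ofLetter (x : Letter m) : IsInner (CabLetter.ofLetter x) := by
  cases x <;> trivial

theorem isInner_expand (D : Word m n) (j : Fin n) (s : Bool) :
    ∀ x ∈ expand D (.gen j s), IsInner x := by
  have h : ∀ x ∈ (D j).map CabLetter.ofLetter, IsInner x := by
    intro x hx
    obtain ⟨y, _, rfl⟩ := List.mem_map.1 hx
    exact isInner_ofLetter y
  cases s
  · exact isInner_inv h
  · exact h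

theorem expand_not (D : Word m n) (j : Fin n) (s : Bool) :
    expand D (.gen j (!s)) = inv (expand D (.gen j s)) := by
  cases s
  · show _ = inv (inv _)
    rw [inv_inv]; rfl
  · rfl

end lemmas

section lemmas2
variable {K : Type*} [Field K] {m m' n p : ℕ}

theorem clsL_mapEndsL {σ : ℕ → ℕ} (hσ : Function.Injective σ) (f : ℕ → Bool) (v : Word m p →₀ K) :
    clsL K (mapEndsL (relabelEnd σ f) v) = clsL K v := by
  have : clsL K ∘ₗ mapEndsL (relabelEnd σ f) = (clsL K : (Word m p →₀ K) →ₗ[K] _) := by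
    ext w : 1
    ext1
    simp [mapEndsL_single, clsL_single, cls_mapEnds hσ]
  exact LinearMap.congr_fun this v

theorem clsL_around (q : ℕ) (j : Fin m) (s : Bool) (v : Word m p →₀ K) :
    clsL K (substL (Letter.around q j s) v) = clsL K v := by
  have : clsL K ∘ₗ substL (Letter.around q j s) = (clsL K : (Word m p →₀ K) →ₗ[K] _) := by
    ext w : 1
    ext1
    simp [substL_single, clsL_single, cls_around]
  exact LinearMap.congr_fun this v

theorem clsL_fourT (q : ℕ) (e : ℕ × Bool) (hq : e.1 ≠ q) (v : Word m p →₀ K) :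
    clsL K (substL (Letter.before e (q, false)) v) - clsL K (substL (Letter.after e (q, false)) v)
      + clsL K (substL (Letter.before e (q, true)) v)
      - clsL K (substL (Letter.after e (q, true)) v) = 0 := by
  have : clsL K ∘ₗ substL (Letter.before e (q, false))
      - clsL K ∘ₗ substL (Letter.after e (q, false))
      + clsL K ∘ₗ substL (Letter.before e (q, true))
      - clsL K ∘ₗ substL (Letter.after e (q, true)) = (0 : (Word m p →₀ K) →ₗ[K] _) := by
    ext w : 1
    ext1
    simpa [substL_single, clsL_single] using cls_fourT w q e hq
  exact LinearMap.congr_fun this v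

theorem mem_ends {w : Word m n} {e : ℕ × Bool} : e ∈ w.ends ↔ ∃ i, Letter.cend e ∈ w i := by
  simp only [Word.ends, Finset.mem_biUnion, Finset.mem_univ, true_and, List.mem_toFinset,
    List.mem_filterMap]
  refine exists_congr fun i => ⟨?_, fun h => ⟨_, h, rfl⟩⟩
  rintro ⟨_ | x, h, hx⟩
  · simp [Letter.end?] at hx
  · simp only [Letter.end?, Option.some.injEq] at hx
    rwa [← hx]

theorem mem_ends_iff {w : Word m n} {e : ℕ × Bool} : e ∈ w.ends ↔ w.endCount e ≠ 0 := by
  rw [mem_ends, Word.endCount, Ne, Finset.sum_eq_zero_iff]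
  simp [List.count_eq_zero]

theorem ends_mapEnds (τ : ℕ × Bool → ℕ × Bool) (w : Word m n) :
    (w.mapEnds τ).ends = w.ends.image τ := by
  ext d
  simp only [mem_ends, Finset.mem_image, Word.mapEnds, List.mem_map]
  constructor
  · rintro ⟨i, _ | x, h, hx⟩
    · simp [Letter.mapEnd] at hx
    · exact ⟨x, ⟨i, h⟩, by simpa [Letter.mapEnd] using hx⟩
  · rintro ⟨x, ⟨i, h⟩, rfl⟩
    exact ⟨i, _, h, rfl⟩

theorem mapEnds_mapEnds (τ τ' : ℕ × Bool → ℕ × Bool) (w : Word m n) :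
    (w.mapEnds τ).mapEnds τ' = w.mapEnds (τ' ∘ τ) := by
  funext i
  simp only [Word.mapEnds, List.map_map]
  exact List.map_congr_left fun x _ => by cases x <;> rfl

theorem expand_mapEnds (τ : ℕ × Bool → ℕ × Bool) (D : Word m n) (x : Letter n) :
    expand (D.mapEnds τ) (x.mapEnd τ) = (expand D x).map (mapEndCab τ) := by
  have h1 : ∀ x : Letter m, CabLetter.ofLetter (x.mapEnd τ) = mapEndCab τ (.ofLetter x) := by
    rintro (_ | _) <;> rfl
  have h2 : ∀ x : CabLetter m, IsInner x → (mapEndCab τ x).flip = mapEndCab τ x.flip := by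
    rintro ((_ | _) | _) h
    · rfl
    · exact h.elim
    · rfl
  rcases x with ⟨j, _ | _⟩ | x
  · simp only [Letter.mapEnd, expand, Word.mapEnds, ← List.map_reverse, List.map_map]
    refine List.map_congr_left fun x _ => ?_
    simp only [Function.comp, h1]
    exact h2 _ (isInner_ofLetter x)
  · simp only [Letter.mapEnd, expand, Word.mapEnds, List.map_map]
    exact List.map_congr_left fun x _ => h1 x
  · rfl

theorem cable_mapEnds (τ : ℕ × Bool → ℕ × Bool) (D' : Word n p) (D : Word m n) :
    cable (D'.mapEnds τ) (D.mapEnds τ) = (cable D' D).map fun q => (q.1, mapEndCab τ q.2) := by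
  simp only [cable, List.map_flatMap]
  congr 1
  funext i
  have : ∀ x, (expand (D.mapEnds τ) (x.mapEnd τ)) = (expand D x).map (mapEndCab τ) :=
    expand_mapEnds τ D
  show List.flatMap _ ((D' i).map (Letter.mapEnd τ)) = _
  simp only [List.flatMap_map, this, List.map_map]
  rfl

theorem glue_mapEnds {τ : ℕ × Bool → ℕ × Bool} (hτ : Function.Injective τ) (D' : Word n p)
    (D : Word m n) : glue K (D'.mapEnds τ) (D.mapEnds τ) = mapEndsL τ (glue K D' D) := by
  rw [glue, glue, cable_mapEnds, ends_mapEnds, distribute_mapEnd hτ]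

/- general form of cable under changes -/

theorem cable_eq (D' : Word n p) (D : Word m n) :
    cable D' D = (List.finRange p).flatMap fun i =>
      (D' i).flatMap fun x => (expand D x).map (Prod.mk i) := by
  simp only [cable, List.map_flatMap]

theorem cable_flatMap_inner {D D₂ : Word m n} (g : CabLetter m → List (CabLetter m))
    (hg : ∀ x, expand D₂ x = (expand D x).flatMap g) (D' : Word n p) :
    cable D' D₂ = (cable D' D).flatMap (onStrand g) := by
  simp only [cable_eq, List.flatMap_assoc, List.flatMap_map]
  congr 1; funext i
  congr 1; funext x
  rw [hg, List.map_flatMap]; rfl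

theorem cable_subst {f : Letter n → List (Letter n)} {g : CabLetter m → List (CabLetter m)}
    (D : Word m n) (hg : ∀ x, (f x).flatMap (expand D) = (expand D x).flatMap g) (D' : Word n p) :
    cable (D'.subst f) D = (cable D' D).flatMap (onStrand g) := by
  simp only [cable_eq, List.flatMap_assoc, List.flatMap_map, Word.subst]
  congr 1; funext i
  congr 1; funext x
  have := congrArg (List.map (Prod.mk i)) (hg x)
  rw [List.map_flatMap, List.map_flatMap] at this
  rw [this]; rfl

/- cancellation -/

theorem EqL.cable_right {D D₂ : Word m n} (D' : Word n p)
    (h : ∀ (i : Fin p) j s, EqL K ((expand D (.gen j s)).map (Prod.mk i))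
      ((expand D₂ (.gen j s)).map (Prod.mk i))) : EqL K (cable D' D) (cable D' D₂) := by
  rw [cable_eq, cable_eq]
  refine EqL.flatMap _ fun i _ => EqL.flatMap _ fun x _ => ?_
  rcases x with ⟨j, s⟩ | x
  · exact h i j s
  · exact EqL.rfl

theorem glue_cancel_right (D' : Word n p) {D D₂ : Word m n} {i : Fin n} {u v : List (Letter m)}
    {j : Fin m} {s : Bool} (hD : D i = u ++ [.gen j s, .gen j (!s)] ++ v)
    (hD₂ : D₂ = Function.update D i (u ++ v)) : clsL K (glue K D' D) = clsL K (glue K D' D₂) := by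
  have he : D.ends = D₂.ends := by
    ext e
    rw [mem_ends, mem_ends]
    refine exists_congr fun k => ?_
    subst hD₂
    by_cases hk : k = i
    · subst hk; simp [hD]
    · rw [Function.update_of_ne hk]
  rw [glue, glue, he]
  refine (EqL.distribute (EqL.cable_right D' fun k j' t => ?_) _).clsL
  subst hD₂
  by_cases hj : j' = i
  · subst hj
    cases t
    · simp only [expand, hD, Function.update_self, List.map_append, List.reverse_append]
      refine EqL.append EqL.rfl ?_
      conv_rhs => rw [← List.nil_append (List.map (Prod.mk k) _)]
      refine EqL.append ?_ EqL.rfl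
      have := EqL.pair (K := K) k (.keep (.gen j s)) trivial
      simpa [CabLetter.ofLetter, CabLetter.flip] using this
    · simp only [expand, hD, Function.update_self, List.map_append]
      refine EqL.append ?_ EqL.rfl
      conv_rhs => rw [← List.append_nil (List.map (Prod.mk k) (List.map CabLetter.ofLetter u))]
      exact EqL.append EqL.rfl (EqL.pair k (.keep (.gen j s)) trivial)
  · have : expand (Function.update D i (u ++ v)) (.gen j' t) = expand D (.gen j' t) := by
      cases t <;> simp [expand, Function.update_of_ne hj]
    rw [this]; exact EqL.rfl

end lemmas2

section lemmas3
variable {K : Type*} [Field K] {m m' n p : ℕ}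

theorem glue_cancel_left {D' D₂' : Word n p} (D : Word m n) {i : Fin p} {u v : List (Letter n)}
    {j : Fin n} {s : Bool} (hD : D' i = u ++ [.gen j s, .gen j (!s)] ++ v)
    (hD₂ : D₂' = Function.update D' i (u ++ v)) : clsL K (glue K D' D) = clsL K (glue K D₂' D) := by
  rw [glue, glue]
  refine (EqL.distribute ?_ _).clsL
  rw [cable_eq, cable_eq]
  refine EqL.flatMap _ fun k _ => ?_
  subst hD₂
  by_cases hk : k = i
  · subst hk
    rw [Function.update_self, hD, List.flatMap_append, List.flatMap_append, List.flatMap_append]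
    refine EqL.append ?_ EqL.rfl
    conv_rhs => rw [← List.append_nil (List.flatMap _ u)]
    refine EqL.append EqL.rfl ?_
    have := EqL.inv_right (K := K) k _ (isInner_expand D j s)
    rw [← expand_not, List.map_append] at this
    simpa using this
  · rw [Function.update_of_ne hk]; exact EqL.rfl

theorem mem_ends_of_copy {D : Word m n} {x : Letter n} {e : ℕ × Bool} {t : Bool}
    (h : CabLetter.copy e t ∈ expand D x) : e ∈ D.ends := by
  have key : ∀ j t, CabLetter.copy e t ∈ (D j).map CabLetter.ofLetter → e ∈ D.ends := by
    intro j t h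
    obtain ⟨y, hy, hxy⟩ := List.mem_map.1 h
    cases y with
    | gen => simp [CabLetter.ofLetter] at hxy
    | cend y =>
      simp only [CabLetter.ofLetter, CabLetter.copy.injEq] at hxy
      exact mem_ends.2 ⟨j, hxy.1 ▸ hy⟩
  rcases x with ⟨j, _ | _⟩ | x
  · obtain ⟨y, hy, hxy⟩ := List.mem_map.1 h
    rw [← flip_flip y, hxy] at hy
    rw [List.mem_reverse] at hy
    exact key j (!t) hy
  · exact key j t h
  · simp [expand] at h

theorem mem_expand_keep {D : Word m n} {x : Letter n} {e : ℕ × Bool}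
    (h : CabLetter.keep (.cend e) ∈ expand D x) : x = .cend e := by
  rcases x with ⟨j, s⟩ | x
  · exact (isInner_expand D j s _ h).elim
  · simpa [expand, eq_comm] using h

theorem mem_cable {D' : Word n p} {D : Word m n} {q : Fin p × CabLetter m}
    (h : q ∈ cable D' D) : ∃ x ∈ D' q.1, q.2 ∈ expand D x := by
  rw [cable_eq] at h
  simp only [List.mem_flatMap, List.mem_map] at h
  obtain ⟨i, _, x, hx, y, hy, rfl⟩ := h
  exact ⟨x, hx, hy⟩

theorem flatMap_eq_self {α : Type*} {g : α → List α} (l : List α) (h : ∀ x ∈ l, g x = [x]) :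
    l.flatMap g = l := by
  induction l with
  | nil => rfl
  | cons x l ih =>
    rw [List.flatMap_cons, h x List.mem_cons_self, ih fun y hy => h y (List.mem_cons_of_mem _ hy)]
    rfl

theorem glue_subst_left {f : Letter n → List (Letter n)} {g : Letter m → List (Letter m)}
    (D' : Word n p) (D : Word m n) (hf : ∀ j s, f (.gen j s) = [.gen j s])
    (hg : ∀ j s, g (.gen j s) = [.gen j s])
    (hfg : ∀ x, (f (.cend x)).flatMap (expand D) = (g (.cend x)).map .keep)
    (hD : ∀ x ∈ D.ends, g (.cend x) = [.cend x]) :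
    glue K (D'.subst f) D = substL g (glue K D' D) := by
  rw [glue, glue, cable_subst (g := substCab g) D, distribute_substCab]
  · rintro ⟨i, y⟩ hq e s rfl
    obtain ⟨x, -, hx⟩ := mem_cable hq
    exact hD e (mem_ends_of_copy hx)
  · rintro (⟨j, s⟩ | x)
    · rw [hf, List.flatMap_singleton, flatMap_eq_self]
      intro y hy
      have := isInner_expand D j s y hy
      rcases y with (_ | _) | _
      · simp [substCab, hg]
      · exact this.elim
      · rfl
    · rw [hfg]; simp [expand, substCab]

theorem substL_pre_one {f : Letter m → List (Letter m')} {l : Letter m} {l' : List (Letter m')}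
    (h : f l = l') (i : Fin p) (v : Word m p →₀ K) :
    substL f (pre K i [l] v) = pre K i l' (substL f v) := by
  rw [substL_pre, List.flatMap_singleton, h]

theorem distribute_keep_cons (S : Finset (ℕ × Bool)) (i : Fin p) (l : Letter m)
    (L : List (Fin p × CabLetter m)) :
    distribute K S ((i, .keep l) :: L) = pre K i [l] (distribute K S L) := rfl

theorem distribute_copy_cons (S : Finset (ℕ × Bool)) (i : Fin p) (e : ℕ × Bool) (s : Bool)
    (L : List (Fin p × CabLetter m)) :
    distribute K S ((i, .copy e s) :: L) = distribute K S L +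
        if e ∈ S then sgn K s • pre K i [.cend e] (distribute K (S.erase e) L) else 0 := rfl

theorem distribute_copy_cons_of_mem {S : Finset (ℕ × Bool)} (i : Fin p) {e : ℕ × Bool} (s : Bool)
    (L : List (Fin p × CabLetter m)) (h : e ∈ S) :
    distribute K S ((i, .copy e s) :: L) = distribute K S L +
        sgn K s • pre K i [.cend e] (distribute K (S.erase e) L) := by
  rw [distribute_copy_cons, if_pos h]

theorem distribute_copy_cons_of_notMem {S : Finset (ℕ × Bool)} (i : Fin p) {e : ℕ × Bool} (s : Bool)
    (L : List (Fin p × CabLetter m)) (h : e ∉ S) :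
    distribute K S ((i, .copy e s) :: L) = distribute K S L := by
  rw [distribute_copy_cons, if_neg h, add_zero]

/- sliding a copied chord -/

/-- Conjugation of the copies of the ends of the chord `q`. -/
def copyAround (q : ℕ) (j : Fin m) (s : Bool) : CabLetter m → List (CabLetter m)
  | .keep l => [.keep l]
  | .copy e t => if e.1 = q then [.keep (.gen j s), .copy e t, .keep (.gen j (!s))]
      else [.copy e t]

theorem distribute_copyAround (q : ℕ) (j : Fin m) (s : Bool) (L : List (Fin p × CabLetter m))
    (hL : ∀ i e, (i, CabLetter.keep (.cend e)) ∈ L → e.1 ≠ q) (S : Finset (ℕ × Bool)) :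
    EqV (distribute K S (L.flatMap (onStrand (copyAround q j s))))
      (substL (Letter.around q j s) (distribute K S L)) := by
  induction L generalizing S with
  | nil =>
    have h := distribute_substCab (K := K) (p := p) (Letter.around q j s) [] (by simp) S
    rw [← h]; exact EqV.rfl
  | cons x L ih =>
    have ih := ih fun i e h => hL i e (List.mem_cons_of_mem _ h)
    obtain ⟨i, l | ⟨e, t⟩⟩ := x
    · have : Letter.around q j s l = [l] := by
        rcases l with l | e
        · rfl
        · have := hL i e List.mem_cons_self
          simp [Letter.around, this]
      rw [List.flatMap_cons, distribute_keep_cons, substL_pre_one this]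
      exact (ih S).pre_one i l
    · by_cases h : e.1 = q
      · have h1 : onStrand (copyAround q j s) (i, .copy e t)
            = [(i, .keep (.gen j s)), (i, .copy e t), (i, .keep (.gen j (!s)))] := by
          simp [onStrand, copyAround, h]
        have h2 : Letter.around q j s (.cend e) = [.gen j s, .cend e, .gen j (!s)] := by
          simp [Letter.around, h]
        rw [List.flatMap_cons, h1]
        simp only [List.cons_append, List.nil_append, distribute_keep_cons]
        by_cases he : e ∈ S
        · rw [distribute_copy_cons_of_mem _ _ _ he, distribute_copy_cons_of_mem _ _ _ he]
          simp only [distribute_keep_cons, map_add, map_smul]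
          refine EqV.add ?_ (EqV.smul _ ?_)
          · rw [← pre_append]
            exact (EqV.cancel i j s _).trans (ih S)
          · rw [substL_pre_one h2, ← pre_append, ← pre_append]
            have h3 := ((((ih (S.erase e)).pre_one i (.gen j (!s))).pre_one i (.cend e)).pre_one i
              (.gen j s))
            rw [← pre_append, ← pre_append, ← pre_append, ← pre_append] at h3
            exact h3
        · rw [distribute_copy_cons_of_notMem _ _ _ he, distribute_copy_cons_of_notMem _ _ _ he]
          simp only [distribute_keep_cons]
          rw [← pre_append]
          exact (EqV.cancel i j s _).trans (ih S)
      · have h1 : onStrand (copyAround q j s) (i, .copy e t) = [(i, .copy e t)] := by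
          simp [onStrand, copyAround, h]
        have h2 : Letter.around q j s (.cend e) = [.cend e] := by
          simp [Letter.around, h]
        rw [List.flatMap_cons, h1]
        simp only [List.cons_append, List.nil_append, distribute_copy_cons, map_add]
        refine (ih S).add ?_
        split_ifs
        · rw [map_smul, substL_pre_one h2]
          exact ((ih _).pre_one i _).smul _
        · rw [map_zero]; exact EqV.rfl

theorem expand_flatMap_inner {f : Letter m → List (Letter m)} {g : CabLetter m → List (CabLetter m)}
    (h1 : ∀ x, (f x).map CabLetter.ofLetter = g (.ofLetter x))
    (h2 : ∀ x : Letter m, inv (g (.ofLetter x)) = g (CabLetter.ofLetter x).flip)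
    (h3 : ∀ e, g (.keep (.cend e)) = [.keep (.cend e)]) (D : Word m n) (x : Letter n) :
    expand (D.subst f) x = (expand D x).flatMap g := by
  have h4 : ∀ l : List (Letter m), (l.flatMap f).map CabLetter.ofLetter
      = (l.map CabLetter.ofLetter).flatMap g := by
    intro l
    rw [List.map_flatMap, List.flatMap_map]
    simp only [h1]
  have h5 : ∀ l : List (Letter m), inv ((l.map CabLetter.ofLetter).flatMap g)
      = (inv (l.map CabLetter.ofLetter)).flatMap g := by
    intro l
    induction l with
    | nil => rfl
    | cons x l ih =>
      simp only [inv] at ih h2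
      simp only [inv, List.map_cons, List.flatMap_cons, List.reverse_append, List.map_append, ih,
        List.reverse_cons, List.flatMap_append, h2, List.map_nil, List.flatMap_nil, List.append_nil]
  rcases x with ⟨j, _ | _⟩ | x
  · show inv (((D j).flatMap f).map _) = (inv _).flatMap g
    rw [h4, h5]
  · exact h4 _
  · simp [expand, h3]

theorem ends_subst_around (q : ℕ) (j : Fin m) (s : Bool) (D : Word m n) :
    (D.subst (Letter.around q j s)).ends = D.ends := by
  ext e; rw [mem_ends_iff, mem_ends_iff, endCount_around]

theorem glue_slide_right (D' : Word n p) (D : Word m n) (q : ℕ) (j : Fin m) (s : Bool)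
    (hD' : ∀ e ∈ D'.ends, e.1 ≠ q) :
    clsL K (glue K D' (D.subst (Letter.around q j s))) = clsL K (glue K D' D) := by
  rw [glue, glue, ends_subst_around, cable_flatMap_inner (copyAround q j s)
    (expand_flatMap_inner ?_ ?_ ?_ D)]
  · rw [(distribute_copyAround q j s _ ?_ _).clsL, clsL_around]
    intro i e h
    obtain ⟨x, hx, h⟩ := mem_cable h
    rw [mem_expand_keep h] at hx
    exact hD' e (mem_ends.2 ⟨i, hx⟩)
  · rintro (_ | e)
    · rfl
    · simp only [Letter.around, CabLetter.ofLetter, copyAround]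
      split_ifs <;> rfl
  · rintro (_ | e)
    · rfl
    · simp only [CabLetter.ofLetter, copyAround, CabLetter.flip]
      split_ifs <;> simp [inv, CabLetter.flip]
  · intro e; rfl

end lemmas3

section lemmas4
variable {K : Type*} [Field K] {m m' n p : ℕ}

/- 4T relation in the inner diagram -/

/-- Insertion of a copy of `e` before each copy of `c`. -/
def copyBefore (e c : ℕ × Bool) : CabLetter m → List (CabLetter m)
  | .keep l => [.keep l]
  | .copy d t => if d = c then (if t then [.copy e t, .copy d t] else [.copy d t, .copy e t])
      else [.copy d t]

/-- Insertion of a copy of `e` after each copy of `c`. -/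
def copyAfter (e c : ℕ × Bool) : CabLetter m → List (CabLetter m)
  | .keep l => [.keep l]
  | .copy d t => if d = c then (if t then [.copy d t, .copy e t] else [.copy e t, .copy d t])
      else [.copy d t]

/-- the change of a word when an end is moved across another end -/
noncomputable def jump (e c : ℕ × Bool) : (Word m p →₀ K) →ₗ[K] (Word m p →₀ K) :=
  substL (Letter.before e c) - substL (Letter.after e c)

theorem clsL_jump (q : ℕ) (e : ℕ × Bool) (hq : e.1 ≠ q) (v : Word m p →₀ K) :
    clsL K (jump e (q, false) v) + clsL K (jump e (q, true) v) = 0 := by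
  rw [← clsL_fourT q e hq v]
  simp only [jump, LinearMap.sub_apply, map_sub]
  abel

theorem jump_pre_of_ne {e c : ℕ × Bool} {l : Letter m} (h : l ≠ .cend c) (i : Fin p)
    (v : Word m p →₀ K) : jump e c (pre K i [l] v) = pre K i [l] (jump e c v) := by
  simp only [jump, LinearMap.sub_apply, map_sub, substL_pre_one (before_eq l h),
    substL_pre_one (after_eq l h)]

theorem substL_distribute_self {f : Letter m → List (Letter m)} {c : ℕ × Bool}
    (hf : ∀ l, l ≠ Letter.cend c → f l = [l]) {S : Finset (ℕ × Bool)} (hc : c ∉ S)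
    {L : List (Fin p × CabLetter m)} (hL : ∀ i, (i, CabLetter.keep (.cend c)) ∉ L) :
    substL f (distribute K S L) = distribute K S L := by
  induction L generalizing S with
  | nil =>
    have h := distribute_substCab (K := K) (p := p) f [] (by simp) S
    rw [← h]; rfl
  | cons x L ih =>
    have ih := fun S hS => @ih S hS fun i h => hL i (List.mem_cons_of_mem _ h)
    obtain ⟨i, l | ⟨e, t⟩⟩ := x
    · have : l ≠ .cend c := fun h => hL i (h ▸ List.mem_cons_self)
      rw [distribute_keep_cons, substL_pre_one (hf l this), ih S hc]
    · by_cases he : e ∈ S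
      · have h : Letter.cend (m := m) e ≠ .cend c := fun h => hc (by cases h; exact he)
        rw [distribute_copy_cons_of_mem _ _ _ he, map_add, map_smul, substL_pre_one (hf _ h),
          ih S hc, ih _ (fun h => hc (Finset.mem_of_mem_erase h))]
      · rw [distribute_copy_cons_of_notMem _ _ _ he, ih S hc]

theorem jump_pre_self {e c : ℕ × Bool} {S : Finset (ℕ × Bool)} (hc : c ∉ S)
    {L : List (Fin p × CabLetter m)} (hL : ∀ i, (i, CabLetter.keep (.cend c)) ∉ L) (i : Fin p) :
    jump e c (pre K i [.cend c] (distribute K S L))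
      = pre K i [.cend e] (pre K i [.cend c] (distribute K S L))
        - pre K i [.cend c] (pre K i [.cend e] (distribute K S L)) := by
  have h1 : Letter.before (m := m) e c (.cend c) = [.cend e] ++ [.cend c] := by simp [Letter.before]
  have h2 : Letter.after (m := m) e c (.cend c) = [.cend c] ++ [.cend e] := by simp [Letter.after]
  rw [jump, LinearMap.sub_apply, substL_pre_one h1, substL_pre_one h2,
    substL_distribute_self before_eq hc hL, substL_distribute_self after_eq hc hL, pre_append,
    pre_append]

theorem onStrand_keep_before (e c : ℕ × Bool) (i : Fin p) (l : Letter m) :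
    onStrand (copyBefore e c) (i, .keep l) = [(i, .keep l)] := rfl
theorem onStrand_keep_after (e c : ℕ × Bool) (i : Fin p) (l : Letter m) :
    onStrand (copyAfter e c) (i, .keep l) = [(i, .keep l)] := rfl
theorem onStrand_copy_before {e c d : ℕ × Bool} (h : d ≠ c) (i : Fin p) (t : Bool) :
    onStrand (copyBefore e c : CabLetter m → _) (i, .copy d t) = [(i, .copy d t)] := by
  simp [onStrand, copyBefore, h]
theorem onStrand_copy_after {e c d : ℕ × Bool} (h : d ≠ c) (i : Fin p) (t : Bool) :
    onStrand (copyAfter e c : CabLetter m → _) (i, .copy d t) = [(i, .copy d t)] := by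
  simp [onStrand, copyAfter, h]
theorem onStrand_self_before (e c : ℕ × Bool) (i : Fin p) (t : Bool) :
    onStrand (copyBefore e c : CabLetter m → _) (i, .copy c t) = if t then
      [(i, .copy e t), (i, .copy c t)] else [(i, .copy c t), (i, .copy e t)] := by
  cases t <;> simp [onStrand, copyBefore]
theorem onStrand_self_after (e c : ℕ × Bool) (i : Fin p) (t : Bool) :
    onStrand (copyAfter e c : CabLetter m → _) (i, .copy c t) = if t then
      [(i, .copy c t), (i, .copy e t)] else [(i, .copy e t), (i, .copy c t)] := by
  cases t <;> simp [onStrand, copyAfter]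

theorem distribute_copyBefore_notMem {e c : ℕ × Bool} (hec : e ≠ c) {S : Finset (ℕ × Bool)}
    (he : e ∉ S) (L : List (Fin p × CabLetter m)) :
    distribute K S (L.flatMap (onStrand (copyBefore e c))) = distribute K S L := by
  induction L generalizing S with
  | nil => rfl
  | cons x L ih =>
    have he' : ∀ d, e ∉ S.erase d := fun d h => he (Finset.mem_of_mem_erase h)
    obtain ⟨i, l | ⟨d, t⟩⟩ := x
    · rw [List.flatMap_cons, onStrand_keep_before, List.singleton_append, distribute_keep_cons,
        distribute_keep_cons, ih he]
    · rw [List.flatMap_cons]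
      by_cases h : d = c
      · subst h
        rw [onStrand_self_before]
        cases t <;> simp [distribute_copy_cons, ih, he, he']
      · rw [onStrand_copy_before h, List.singleton_append, distribute_copy_cons,
          distribute_copy_cons, ih he, ih (he' _)]

theorem distribute_copy_notMem {e c : ℕ × Bool} {S : Finset (ℕ × Bool)}
    (hc : c ∉ S) (L : List (Fin p × CabLetter m)) :
    distribute K S (L.flatMap (onStrand (copyBefore e c)))
      = distribute K S (L.flatMap (onStrand (copyAfter e c))) := by
  induction L generalizing S with
  | nil => rfl
  | cons x L ih =>
    have hc' : ∀ d, c ∉ S.erase d := fun d h => hc (Finset.mem_of_mem_erase h)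
    obtain ⟨i, l | ⟨d, t⟩⟩ := x
    · rw [List.flatMap_cons, List.flatMap_cons, onStrand_keep_before, onStrand_keep_after,
        List.singleton_append, distribute_keep_cons, List.singleton_append,
        distribute_keep_cons, ih hc]
    · rw [List.flatMap_cons, List.flatMap_cons]
      by_cases h : d = c
      · subst h
        rw [onStrand_self_before, onStrand_self_after]
        cases t <;> simp [distribute_copy_cons, ih, hc, hc']
      · rw [onStrand_copy_before h, onStrand_copy_after h, List.singleton_append,
          distribute_copy_cons, List.singleton_append, distribute_copy_cons, ih hc, ih (hc' _)]

theorem distribute_copyAfter_notMem {e c : ℕ × Bool} (hec : e ≠ c) {S : Finset (ℕ × Bool)}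
    (he : e ∉ S) (L : List (Fin p × CabLetter m)) :
    distribute K S (L.flatMap (onStrand (copyAfter e c))) = distribute K S L := by
  induction L generalizing S with
  | nil => rfl
  | cons x L ih =>
    have he' : ∀ d, e ∉ S.erase d := fun d h => he (Finset.mem_of_mem_erase h)
    obtain ⟨i, l | ⟨d, t⟩⟩ := x
    · rw [List.flatMap_cons, onStrand_keep_after, List.singleton_append, distribute_keep_cons,
        distribute_keep_cons, ih he]
    · rw [List.flatMap_cons]
      by_cases h : d = c
      · subst h
        rw [onStrand_self_after]
        cases t <;> simp [distribute_copy_cons, ih, he, he']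
      · rw [onStrand_copy_after h, List.singleton_append, distribute_copy_cons,
          distribute_copy_cons, ih he, ih (he' _)]

theorem distribute_copy_jump {e c : ℕ × Bool} (hec : e ≠ c) {S : Finset (ℕ × Bool)}
    (he : e ∈ S) {L : List (Fin p × CabLetter m)}
    (hL : ∀ i, (i, CabLetter.keep (.cend c)) ∉ L) (hL' : ∀ i t, (i, CabLetter.copy e t) ∉ L) :
    distribute K S (L.flatMap (onStrand (copyBefore e c)))
      - distribute K S (L.flatMap (onStrand (copyAfter e c)))
      = jump e c (distribute K (S.erase e) L) := by
  induction L generalizing S with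
  | nil =>
    have h1 := distribute_substCab (K := K) (p := p) (m := m) (Letter.before e c) [] (by simp) (S.erase e)
    have h2 := distribute_substCab (K := K) (p := p) (m := m) (Letter.after e c) [] (by simp) (S.erase e)
    rw [jump, LinearMap.sub_apply, ← h1, ← h2]
    simp
  | cons x L ih =>
    have hM : ∀ i, (i, CabLetter.keep (.cend c)) ∉ L := fun i h => hL i (List.mem_cons_of_mem _ h)
    have hM' : ∀ i t, (i, CabLetter.copy e t) ∉ L := fun i t h => hL' i t (List.mem_cons_of_mem _ h)
    have ih := fun S hS => @ih S hS hM hM'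
    rw [List.flatMap_cons, List.flatMap_cons]
    obtain ⟨i, l | ⟨d, t⟩⟩ := x
    · have : l ≠ .cend c := fun h => hL i (h ▸ List.mem_cons_self)
      rw [onStrand_keep_before, onStrand_keep_after, List.singleton_append, List.singleton_append,
        distribute_keep_cons, distribute_keep_cons, distribute_keep_cons, jump_pre_of_ne this,
        ← ih S he, map_sub]
    · have hd : d ≠ e := fun h => hL' i t (h ▸ List.mem_cons_self)
      have hde : d ∈ S.erase e ↔ d ∈ S := by simp [hd]
      by_cases h : d = c
      · subst h
        by_cases hdS : d ∈ S
        · have hed : e ∈ S.erase d := by simp [he, hec]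
          have e1 : distribute K (S.erase e) (L.flatMap (onStrand (copyBefore e d)))
            = distribute K (S.erase e) L := distribute_copyBefore_notMem hec (by simp) L
          have e2 : distribute K (S.erase e) (L.flatMap (onStrand (copyAfter e d)))
            = distribute K (S.erase e) L := distribute_copyAfter_notMem hec (by simp) L
          have e3 : distribute K ((S.erase e).erase d) (L.flatMap (onStrand (copyBefore e d)))
            = distribute K ((S.erase e).erase d) L := distribute_copyBefore_notMem hec (by simp) L
          have e4 : distribute K ((S.erase e).erase d) (L.flatMap (onStrand (copyAfter e d)))
            = distribute K ((S.erase e).erase d) L := distribute_copyAfter_notMem hec (by simp) L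
          have e5 : distribute K (S.erase d) (L.flatMap (onStrand (copyBefore e d)))
            = distribute K (S.erase d) (L.flatMap (onStrand (copyAfter e d))) :=
            distribute_copy_notMem (by simp) L
          have hcomm : (S.erase d).erase e = (S.erase e).erase d := Finset.erase_right_comm
          have hR : distribute K (S.erase e) ((i, .copy d t) :: L) = distribute K (S.erase e) L +
              sgn K t • pre K i [.cend d] (distribute K ((S.erase e).erase d) L) :=
            distribute_copy_cons_of_mem _ _ _ (hde.2 hdS)
          rw [hR, map_add, map_smul, jump_pre_self (by simp) hM, ← ih S he, onStrand_self_before,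
            onStrand_self_after]
          have hde' : d ∈ S.erase e := hde.2 hdS
          cases t
          · simp only [Bool.false_eq_true, if_false, List.cons_append, List.nil_append,
              distribute_copy_cons, he, hdS, hed, hde', if_true, e1, e2, e3, e4, e5, hcomm]
            simp only [sgn, Bool.false_eq_true, if_false, map_add, map_smul, smul_add, smul_smul,
              smul_sub]
            module
          · simp only [if_true, List.cons_append, List.nil_append,
              distribute_copy_cons, he, hdS, hed, hde', e1, e2, e3, e4, e5, hcomm]
            simp only [sgn, if_true, map_add, map_smul, smul_add, smul_smul, smul_sub]
            module
        · have hed : d ∉ S.erase e := mt hde.1 hdS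
          have e0 := ih S he
          rw [distribute_copy_cons_of_notMem _ _ _ hed, ← e0, onStrand_self_before,
            onStrand_self_after]
          have e1 : distribute K (S.erase e) (L.flatMap (onStrand (copyBefore e d)))
            = distribute K (S.erase e) L := distribute_copyBefore_notMem hec (by simp) L
          have e2 : distribute K (S.erase e) (L.flatMap (onStrand (copyAfter e d)))
            = distribute K (S.erase e) L := distribute_copyAfter_notMem hec (by simp) L
          cases t <;> simp [distribute_copy_cons, he, hdS, e1, e2]
      · rw [onStrand_copy_before h, onStrand_copy_after h]
        simp only [List.cons_append, List.nil_append]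
        have hl : Letter.cend (m := m) d ≠ .cend c := fun h' => h (by simpa using h')
        by_cases hdS : d ∈ S
        · have : e ∈ S.erase d := by simp [he, hd.symm]
          rw [distribute_copy_cons_of_mem _ _ _ hdS, distribute_copy_cons_of_mem _ _ _ hdS,
            distribute_copy_cons_of_mem _ _ _ (hde.2 hdS), map_add, map_smul, jump_pre_of_ne hl,
            ← ih S he, Finset.erase_right_comm, ← ih _ this, map_sub, smul_sub]
          abel
        · rw [distribute_copy_cons_of_notMem _ _ _ hdS, distribute_copy_cons_of_notMem _ _ _ hdS,
            distribute_copy_cons_of_notMem _ _ _ (mt hde.1 hdS), ih S he]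

theorem expand_before (e c : ℕ × Bool) (D : Word m n) (x : Letter n) :
    expand (D.subst (Letter.before e c)) x = (expand D x).flatMap (copyBefore e c) := by
  refine expand_flatMap_inner ?_ ?_ (fun _ => rfl) D x
  · rintro (_ | x)
    · rfl
    · simp only [Letter.before, CabLetter.ofLetter, copyBefore]
      split_ifs <;> rfl
  · rintro (_ | x)
    · rfl
    · simp only [CabLetter.ofLetter, copyBefore, CabLetter.flip]
      split_ifs <;> simp_all [inv, CabLetter.flip]

theorem expand_after (e c : ℕ × Bool) (D : Word m n) (x : Letter n) :
    expand (D.subst (Letter.after e c)) x = (expand D x).flatMap (copyAfter e c) := by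
  refine expand_flatMap_inner ?_ ?_ (fun _ => rfl) D x
  · rintro (_ | x)
    · rfl
    · simp only [Letter.after, CabLetter.ofLetter, copyAfter]
      split_ifs <;> rfl
  · rintro (_ | x)
    · rfl
    · simp only [CabLetter.ofLetter, copyAfter, CabLetter.flip]
      split_ifs <;> simp_all [inv, CabLetter.flip]

theorem ends_before {e c : ℕ × Bool} {w : Word m n} (hc : w.endCount c = 1) :
    (w.subst (Letter.before e c)).ends = insert e w.ends := by
  ext d
  rw [mem_ends_iff, endCount_before, Finset.mem_insert, mem_ends_iff, hc]
  split_ifs with h <;> simp [h]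

theorem ends_after {e c : ℕ × Bool} {w : Word m n} (hc : w.endCount c = 1) :
    (w.subst (Letter.after e c)).ends = insert e w.ends := by
  ext d
  rw [mem_ends_iff, endCount_after, Finset.mem_insert, mem_ends_iff, hc]
  split_ifs with h <;> simp [h]

theorem glue_fourT_right_aux (D' : Word n p) (w : Word m n) (c e : ℕ × Bool) (hec : e ≠ c)
    (hc : w.endCount c = 1) (he : w.endCount e = 0) (hD' : c ∉ D'.ends) :
    glue K D' (w.subst (Letter.before e c)) - glue K D' (w.subst (Letter.after e c))
      = jump e c (glue K D' w) := by
  have hew : e ∉ w.ends := by rw [mem_ends_iff]; simp [he]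
  rw [glue, glue, glue, ends_before hc, ends_after hc,
    cable_flatMap_inner _ (expand_before e c w), cable_flatMap_inner _ (expand_after e c w),
    distribute_copy_jump hec (Finset.mem_insert_self _ _), Finset.erase_insert hew]
  · intro i h
    obtain ⟨x, hx, h⟩ := mem_cable h
    rw [mem_expand_keep h] at hx
    exact hD' (mem_ends.2 ⟨i, hx⟩)
  · intro i t h
    obtain ⟨x, hx, h⟩ := mem_cable h
    exact hew (mem_ends_of_copy h)

theorem glue_fourT_right (D' : Word n p) (w : Word m n) (q : ℕ) (e : ℕ × Bool)
    (hq : ∀ s, w.endCount (q, s) = 1) (he : w.endCount e = 0) (hD' : ∀ e ∈ D'.ends, e.1 ≠ q) :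
    clsL K (glue K D' (w.subst (Letter.before e (q, false))))
      - clsL K (glue K D' (w.subst (Letter.after e (q, false))))
      + clsL K (glue K D' (w.subst (Letter.before e (q, true))))
      - clsL K (glue K D' (w.subst (Letter.after e (q, true)))) = 0 := by
  have hne : e.1 ≠ q := by
    intro h
    have := hq e.2
    rw [← h] at this
    exact absurd (this.symm.trans he) one_ne_zero
  have h : ∀ s, _ := fun s => glue_fourT_right_aux (K := K) D' w (q, s) e
    (fun h => hne (by rw [h])) (hq s) he (fun h => hD' _ h rfl)
  rw [add_sub_assoc, ← map_sub, ← map_sub, h, h]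
  exact clsL_jump q e hne _

/- sliding an outer chord -/

/-- conjugate kept ends of the chord `q` -/
def keepAround (q : ℕ) (g : List (CabLetter m)) : CabLetter m → List (CabLetter m)
  | .keep (.cend d) => if d.1 = q then g ++ [.keep (.cend d)] ++ inv g else [.keep (.cend d)]
  | x => [x]

/-- Conjugate the kept end `c` by a copy of `e`. -/
def keepAroundEnd (c e : ℕ × Bool) (t : Bool) : CabLetter m → List (CabLetter m)
  | .keep (.cend d) => if d = c then [.copy e t, .keep (.cend d), .copy e (!t)]
      else [.keep (.cend d)]
  | x => [x]

theorem onStrand_keepAroundEnd_self (c e : ℕ × Bool) (t : Bool) (i : Fin p) :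
    onStrand (keepAroundEnd c e t : CabLetter m → _) (i, .keep (.cend c))
      = [(i, .copy e t), (i, .keep (.cend c)), (i, .copy e (!t))] := by
  simp [onStrand, keepAroundEnd]

theorem onStrand_keepAroundEnd_of_ne {c : ℕ × Bool} (e : ℕ × Bool) (t : Bool) (i : Fin p)
    {x : CabLetter m} (h : x ≠ .keep (.cend c)) :
    onStrand (keepAroundEnd c e t) (i, x) = [(i, x)] := by
  rcases x with (_ | d) | _
  · rfl
  · have : d ≠ c := fun h' => h (by rw [h'])
    simp [onStrand, keepAroundEnd, this]
  · rfl

theorem flatMap_keepAroundEnd_self (c e : ℕ × Bool) (t : Bool) {L : List (Fin p × CabLetter m)}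
    (hL : ∀ i, (i, CabLetter.keep (.cend c)) ∉ L) :
    L.flatMap (onStrand (keepAroundEnd c e t)) = L :=
  flatMap_eq_self L fun x hx => onStrand_keepAroundEnd_of_ne e t x.1 fun h => hL x.1 (h ▸ hx)

theorem distribute_keepAroundEnd {c e : ℕ × Bool} (t : Bool) {S : Finset (ℕ × Bool)} (hc : c ∉ S)
    (L : List (Fin p × CabLetter m)) (hL : (L.map Prod.snd).count (.keep (.cend c)) ≤ 1) :
    distribute K S (L.flatMap (onStrand (keepAroundEnd c e t))) = distribute K S L +
      if e ∈ S then sgn K t • jump e c (distribute K (S.erase e) L) else 0 := by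
  induction L generalizing S with
  | nil =>
    have h1 := distribute_substCab (K := K) (p := p) (m := m) (Letter.before e c) [] (by simp)
      (S.erase e)
    have h2 := distribute_substCab (K := K) (p := p) (m := m) (Letter.after e c) [] (by simp)
      (S.erase e)
    rw [jump, LinearMap.sub_apply, ← h1, ← h2]
    simp
  | cons x L ih =>
    have hM : (L.map Prod.snd).count (.keep (.cend c)) ≤ 1 :=
      le_trans (by rw [List.map_cons, List.count_cons]; exact Nat.le_add_right _ _) hL
    have ih := fun S hS => @ih S hS hM
    have hc' : ∀ d, c ∉ S.erase d := fun d h => hc (Finset.mem_of_mem_erase h)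
    obtain ⟨i, x⟩ := x
    by_cases hx : x = .keep (.cend c)
    · subst hx
      have hL0 : ∀ i, (i, CabLetter.keep (.cend c)) ∉ L := by
        intro i h
        have : 0 < (L.map Prod.snd).count (.keep (.cend c)) :=
          List.count_pos_iff.2 (List.mem_map.2 ⟨_, h, rfl⟩)
        simp only [List.map_cons, List.count_cons_self] at hL
        omega
      rw [List.flatMap_cons, flatMap_keepAroundEnd_self c e t hL0, onStrand_keepAroundEnd_self]
      simp only [List.cons_append, List.nil_append, distribute_copy_cons, distribute_keep_cons]
      by_cases he : e ∈ S
      · simp only [he, if_true, Finset.mem_erase, ne_eq, not_true_eq_false, false_and, if_false,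
          add_zero, jump_pre_self (hc' e) hL0, map_add, map_smul, smul_sub]
        cases t <;> simp [sgn] <;> abel
      · simp [he]
    · rw [List.flatMap_cons, onStrand_keepAroundEnd_of_ne e t i hx, List.singleton_append]
      rcases x with l | ⟨d, u⟩
      · have hl : l ≠ .cend c := fun h => hx (by rw [h])
        rw [distribute_keep_cons, ih S hc, map_add]
        split_ifs
        · rw [distribute_keep_cons (S.erase e), jump_pre_of_ne hl, map_smul]; rfl
        · rw [map_zero]; rfl
      · by_cases hd : d ∈ S
        · have hl : Letter.cend (m := m) d ≠ .cend c := fun h => hc (by cases h; exact hd)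
          rw [distribute_copy_cons_of_mem _ _ _ hd, distribute_copy_cons_of_mem _ _ _ hd, ih S hc,
            ih _ (hc' d)]
          by_cases he : e ∈ S
          · by_cases hde : d = e
            · subst hde
              simp [he, distribute_copy_cons]
              abel
            · have h1 : e ∈ S.erase d := by simp [he, Ne.symm hde]
              have h2 : d ∈ S.erase e := by simp [hd, hde]
              simp only [he, h1, if_true, distribute_copy_cons_of_mem _ _ _ h2, map_add, map_smul,
                jump_pre_of_ne hl, Finset.erase_right_comm (a := e), smul_add]
              rw [smul_comm (sgn K t)]
              abel
          · have h1 : e ∉ S.erase d := fun h => he (Finset.mem_of_mem_erase h)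
            simp [he]
        · rw [distribute_copy_cons_of_notMem _ _ _ hd, distribute_copy_cons_of_notMem _ _ _ hd,
            ih S hc]
          split_ifs
          · rw [distribute_copy_cons_of_notMem _ _ _ (fun h => hd (Finset.mem_of_mem_erase h))]
          · rfl

theorem map_snd_onStrand (f : CabLetter m → List (CabLetter m)) (L : List (Fin p × CabLetter m)) :
    (L.flatMap (onStrand f)).map Prod.snd = (L.map Prod.snd).flatMap f := by
  rw [List.map_flatMap, List.flatMap_map]
  congr 1; funext x
  simp [onStrand]

theorem count_flatMap_of {α : Type*} [DecidableEq α] {f : α → List α} {c : α}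
    (h : ∀ x, (f x).count c = [x].count c) (l : List α) : (l.flatMap f).count c = l.count c := by
  induction l with
  | nil => rfl
  | cons x l ih =>
    rw [List.flatMap_cons, List.count_append, ih, h, ← List.count_append]; rfl

theorem keepAround_cons (q : ℕ) (x : CabLetter m) (hx : IsInner x) (g : List (CabLetter m))
    (y : CabLetter m) :
    keepAround q (x :: g) y = (keepAround q [x] y).flatMap (keepAround q g) := by
  have hin : ∀ x, IsInner x → keepAround q g x = [x] := by
    rintro ((_ | _) | _) h
    · rfl
    · exact h.elim
    · rfl
  rcases y with (_ | d) | _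
  · simp [keepAround]
  · by_cases h : d.1 = q
    · have h1 : ∀ g : List (CabLetter m), keepAround q g (.keep (.cend d))
          = g ++ [.keep (.cend d)] ++ inv g := fun g => by simp [keepAround, h]
      rw [h1, h1]
      simp [hin x hx, inv, hin _ (isInner_flip hx), h1]
    · simp [keepAround, h]
  · simp [keepAround]

theorem clsL_keepAround (q : ℕ) (g : List (CabLetter m)) (hg : ∀ x ∈ g, IsInner x)
    (hgq : ∀ e t, CabLetter.copy e t ∈ g → e.1 ≠ q) {S : Finset (ℕ × Bool)}
    (hS : ∀ s, (q, s) ∉ S) (L : List (Fin p × CabLetter m))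
    (hL : ∀ s, (L.map Prod.snd).count (.keep (.cend (q, s))) ≤ 1)
    (hLq : ∀ i e t, (i, CabLetter.copy e t) ∈ L → e.1 ≠ q) :
    clsL K (distribute K S (L.flatMap (onStrand (keepAround q g))))
      = clsL K (distribute K S L) := by
  induction g generalizing L with
  | nil =>
    rw [flatMap_eq_self L]
    rintro ⟨i, (_ | d) | _⟩ -
    · rfl
    · by_cases h : d.1 = q <;> simp [onStrand, keepAround, inv, h]
    · rfl
  | cons x g ih =>
    have hx := hg x List.mem_cons_self
    have hg' : ∀ x ∈ g, IsInner x := fun y hy => hg y (List.mem_cons_of_mem _ hy)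
    have hsplit : L.flatMap (onStrand (keepAround q (x :: g)))
        = (L.flatMap (onStrand (keepAround q [x]))).flatMap (onStrand (keepAround q g)) := by
      rw [List.flatMap_assoc]
      congr 1; funext y
      rw [onStrand, keepAround_cons q x hx g, List.map_flatMap, onStrand, List.flatMap_map]
      rfl
    have hcount : ∀ (c : ℕ × Bool) (y : CabLetter m), (keepAround q [x] y).count (.keep (.cend c))
        = [y].count (.keep (.cend c)) := by
      intro c y
      have h1 : ∀ x : CabLetter m, IsInner x → (x == CabLetter.keep (.cend c)) = false := by
        intro x hx
        rw [beq_eq_false_iff_ne]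
        rintro rfl
        exact hx
      rcases y with (_ | d) | _
      · rfl
      · by_cases h : d.1 = q
        · simp [keepAround, h, inv, List.count_cons, h1 x hx, h1 _ (isInner_flip hx)]
        · simp [keepAround, h]
      · rfl
    rw [hsplit, ih hg' (fun e t h => hgq e t (List.mem_cons_of_mem _ h))]
    · rcases x with (⟨j, s⟩ | e) | ⟨e, t⟩
      · have : (keepAround q [.keep (.gen j s)] : CabLetter m → _)
            = substCab (Letter.around q j s) := by
          funext y
          rcases y with (_ | d) | _
          · rfl
          · by_cases h : d.1 = q <;>
              simp [keepAround, substCab, Letter.around, h, inv, CabLetter.flip]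
          · rfl
        rw [this, distribute_substCab, clsL_around]
        rintro ⟨i, y⟩ hy e t rfl
        have := hLq i e t hy
        simp [Letter.around, this]
      · exact hx.elim
      · have heq : e.1 ≠ q := hgq e t List.mem_cons_self
        have hc2 : ∀ (c c' : ℕ × Bool) (y : CabLetter m), (keepAroundEnd c' e t y).count
            (.keep (.cend c)) = [y].count (.keep (.cend c)) := by
          intro c c' y
          rcases y with (_ | d) | _
          · rfl
          · by_cases h : d = c' <;> simp [keepAroundEnd, h, List.count_cons]
          · rfl
        have : L.flatMap (onStrand (keepAround q [.copy e t]))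
            = (L.flatMap (onStrand (keepAroundEnd (q, false) e t))).flatMap
              (onStrand (keepAroundEnd (q, true) e t)) := by
          rw [List.flatMap_assoc]
          congr 1; funext ⟨i, y⟩
          rcases y with (_ | ⟨d, u⟩) | _
          · rfl
          · by_cases h : d = q
            · subst h
              cases u <;> simp [onStrand, keepAround, keepAroundEnd, inv, CabLetter.flip]
            · simp [onStrand, keepAround, keepAroundEnd, h]
          · rfl
        rw [this, distribute_keepAroundEnd t (hS _), distribute_keepAroundEnd t (hS _) _ (hL _)]
        · by_cases he : e ∈ S
          · rw [if_pos he, if_pos he, distribute_keepAroundEnd t _ _ (hL _), if_neg (by simp),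
              add_zero, map_add, map_add, map_smul, map_smul, add_assoc, ← smul_add,
              clsL_jump q e heq, smul_zero, add_zero]
            exact fun h => hS _ (Finset.mem_of_mem_erase h)
          · simp [he]
        · rw [map_snd_onStrand, count_flatMap_of (hc2 _ _)]
          exact hL _
    · intro s
      rw [map_snd_onStrand, count_flatMap_of (hcount _)]
      exact hL s
    · intro i e t h
      obtain ⟨⟨i', y⟩, hy, h⟩ := List.mem_flatMap.1 h
      obtain ⟨z, hz, hzz⟩ := List.mem_map.1 h
      obtain ⟨rfl, rfl⟩ := Prod.mk.inj hzz
      rcases y with (_ | d) | ⟨d, u⟩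
      · simp [keepAround] at hz
      · by_cases hd : d.1 = q
        · simp only [keepAround, hd, if_true, inv, List.reverse_cons, List.reverse_nil,
            List.nil_append, List.map_cons, List.map_nil, List.cons_append, List.mem_cons,
            List.not_mem_nil, or_false] at hz
          rcases hz with h | h | h
          · exact hgq e t (h ▸ List.mem_cons_self)
          · cases h
          · have : x = .copy e (!t) := by rw [← flip_flip x, ← h]; rfl
            exact hgq e (!t) (this ▸ List.mem_cons_self)
        · simp [keepAround, hd] at hz
      · simp only [keepAround, List.mem_singleton, CabLetter.copy.injEq] at hz
        rw [hz.1]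
        exact hLq i' d u hy

theorem count_cable_keep (D' : Word n p) (D : Word m n) (c : ℕ × Bool) :
    ((cable D' D).map Prod.snd).count (.keep (.cend c)) = D'.endCount c := by
  have key : ∀ x : Letter n, (expand D x).count (.keep (.cend c))
      = if x = .cend c then 1 else 0 := by
    rintro (⟨j, s⟩ | x)
    · rw [if_neg (by simp), List.count_eq_zero]
      exact fun h => isInner_expand D j s _ h
    · by_cases h : x = c <;> simp [expand, h]
  rw [cable, List.map_flatMap, Word.endCount, List.count_flatMap, ← List.ofFn_eq_map,
    List.sum_ofFn]
  refine Finset.sum_congr rfl fun i _ => ?_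
  have : (List.map (Prod.mk i) ((D' i).flatMap (expand D))).map Prod.snd
      = (D' i).flatMap (expand D) := by simp
  simp only [Function.comp]
  rw [this, List.count_flatMap, ← sum_count]
  congr 1
  exact List.map_congr_left fun x _ => key x

theorem glue_slide_left (D' : Word n p) (D : Word m n) (q : ℕ) (j : Fin n) (s : Bool)
    (hD' : ∀ t, D'.endCount (q, t) ≤ 1) (hD : ∀ e ∈ D.ends, e.1 ≠ q) :
    clsL K (glue K (D'.subst (Letter.around q j s)) D) = clsL K (glue K D' D) := by
  rw [glue, glue, cable_subst (g := keepAround q (expand D (.gen j s))) D, clsL_keepAround]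
  · exact isInner_expand D j s
  · exact fun e t h => hD e (mem_ends_of_copy h)
  · exact fun s h => hD _ h rfl
  · exact fun s => (count_cable_keep D' D _).trans_le (hD' s)
  · intro i e t h
    obtain ⟨x, -, hx⟩ := mem_cable h
    exact hD e (mem_ends_of_copy hx)
  · rintro (⟨j', s'⟩ | x)
    · rw [Letter.around, List.flatMap_singleton, flatMap_eq_self]
      intro y hy
      have := isInner_expand D j' s' y hy
      rcases y with (_ | _) | _
      · rfl
      · exact this.elim
      · rfl
    · by_cases h : x.1 = q
      · have h1 : Letter.around q j s (.cend x) = [.gen j s, .cend x, .gen j (!s)] := by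
          simp [Letter.around, h]
        rw [h1]
        simp only [List.flatMap_cons, List.flatMap_nil, List.append_nil, expand_not]
        simp [expand, keepAround, h]
      · simp [Letter.around, h, expand, keepAround]

theorem glue_fourT_left (D' : Word n p) (D : Word m n) (q : ℕ) (e : ℕ × Bool) (hne : e.1 ≠ q)
    (hD : ∀ e ∈ D.ends, e.1 ≠ q) :
    clsL K (glue K (D'.subst (Letter.before e (q, false))) D)
      - clsL K (glue K (D'.subst (Letter.after e (q, false))) D)
      + clsL K (glue K (D'.subst (Letter.before e (q, true))) D)
      - clsL K (glue K (D'.subst (Letter.after e (q, true))) D) = 0 := by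
  have h1 : ∀ s, glue K (D'.subst (Letter.before e (q, s))) D
      = substL (Letter.before e (q, s)) (glue K D' D) := by
    intro s
    refine glue_subst_left D' D (fun _ _ => rfl) (fun _ _ => rfl) (fun x => ?_) fun x hx => ?_
    · by_cases h : x = (q, s) <;> simp [Letter.before, h, expand]
    · have : x ≠ (q, s) := fun h => hD x hx (by rw [h])
      simp [Letter.before, this]
  have h2 : ∀ s, glue K (D'.subst (Letter.after e (q, s))) D
      = substL (Letter.after e (q, s)) (glue K D' D) := by
    intro s
    refine glue_subst_left D' D (fun _ _ => rfl) (fun _ _ => rfl) (fun x => ?_) fun x hx => ?_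
    · by_cases h : x = (q, s) <;> simp [Letter.after, h, expand]
    · have : x ≠ (q, s) := fun h => hD x hx (by rw [h])
      simp [Letter.after, this]
  rw [h1, h1, h2, h2]
  exact clsL_fourT q e hne _

end lemmas4

section composition
variable (K : Type*) [Field K] {m m' n n' p : ℕ}

/-- Make all labels even. -/
def even : ℕ × Bool → ℕ × Bool := relabelEnd (fun k => 2 * k) fun _ => false

/-- Make all labels odd. -/
def odd : ℕ × Bool → ℕ × Bool := relabelEnd (fun k => 2 * k + 1) fun _ => false

/-- The composite of two diagrams; their chords are first given distinct labels. -/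
noncomputable def compWord (D' : Word n p) (D : Word m n) : A K m p :=
  clsL K (glue K (D'.mapEnds even) (D.mapEnds odd))

/-- Bilinear extension of the composition of diagrams. -/
noncomputable def compDiag : (Diag n p →₀ K) →ₗ[K] (Diag m n →₀ K) →ₗ[K] A K m p :=
  Finsupp.linearCombination K fun D' => Finsupp.linearCombination K fun D => compWord K D'.1 D.1

/-- Rename the beads. -/
def Letter.mapGen (f : Fin m → Fin m') : Letter m → Letter m'
  | .gen i s => .gen (f i) s
  | .cend e => .cend e

/-- Juxtaposition of diagrams. -/
def tensWord (D : Word m n) (D' : Word m' n') : Word (m + m') (n + n') :=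
  Fin.append (fun i => (D.mapEnds even i).map (Letter.mapGen (Fin.castAdd m')))
    (fun i => (D'.mapEnds odd i).map (Letter.mapGen (Fin.natAdd m)))

/-- Bilinear extension of juxtaposition. -/
noncomputable def tensDiag :
    (Diag m n →₀ K) →ₗ[K] (Diag m' n' →₀ K) →ₗ[K] A K (m + m') (n + n') :=
  Finsupp.linearCombination K fun D => Finsupp.linearCombination K fun D' =>
    cls K (tensWord D.1 D'.1)

variable {K}

theorem even_injective : Function.Injective even :=
  relabelEnd_injective (fun a b h => by simpa using h) _

theorem odd_injective : Function.Injective odd :=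
  relabelEnd_injective (fun a b h => by simpa using h) _

theorem even_mk (k : ℕ) (s : Bool) : even (k, s) = (2 * k, s) := by simp [even, relabelEnd]
theorem odd_mk (k : ℕ) (s : Bool) : odd (k, s) = (2 * k + 1, s) := by simp [odd, relabelEnd]

theorem even_ne (e : ℕ × Bool) (q : ℕ) : (even e).1 ≠ 2 * q + 1 := by
  simp only [even, relabelEnd]; omega
theorem odd_ne (e : ℕ × Bool) (q : ℕ) : (odd e).1 ≠ 2 * q := by
  simp only [odd, relabelEnd]; omega

theorem ends_even_ne (D : Word m n) (q : ℕ) : ∀ e ∈ (D.mapEnds even).ends, e.1 ≠ 2 * q + 1 := by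
  intro e h
  rw [ends_mapEnds] at h
  obtain ⟨e, _, rfl⟩ := Finset.mem_image.1 h
  exact even_ne e q

theorem ends_odd_ne (D : Word m n) (q : ℕ) : ∀ e ∈ (D.mapEnds odd).ends, e.1 ≠ 2 * q := by
  intro e h
  rw [ends_mapEnds] at h
  obtain ⟨e, _, rfl⟩ := Finset.mem_image.1 h
  exact odd_ne e q

/- relabelling the even, respectively odd, labels only -/

theorem exists_extend_even {σ : ℕ → ℕ} (hσ : Function.Injective σ) (f : ℕ → Bool) :
    ∃ (σ' : ℕ → ℕ) (f' : ℕ → Bool), Function.Injective σ' ∧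
      even ∘ relabelEnd σ f = relabelEnd σ' f' ∘ even ∧ odd = relabelEnd σ' f' ∘ odd := by
  refine ⟨fun x => if x % 2 = 0 then 2 * σ (x / 2) else x,
    fun x => if x % 2 = 0 then f (x / 2) else false, ?_, ?_, ?_⟩
  · intro a b h
    simp only at h
    split_ifs at h with h1 h2 h2
    · have := @hσ (a / 2) (b / 2) (by omega)
      omega
    · omega
    · omega
    · exact h
  · funext ⟨k, s⟩
    simp [relabelEnd, even]
  · funext ⟨k, s⟩
    have : (2 * k + 1) % 2 = 1 := by omega
    simp [relabelEnd, odd, this]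

theorem exists_extend_odd {σ : ℕ → ℕ} (hσ : Function.Injective σ) (f : ℕ → Bool) :
    ∃ (σ' : ℕ → ℕ) (f' : ℕ → Bool), Function.Injective σ' ∧
      odd ∘ relabelEnd σ f = relabelEnd σ' f' ∘ odd ∧ even = relabelEnd σ' f' ∘ even := by
  refine ⟨fun x => if x % 2 = 0 then x else 2 * σ (x / 2) + 1,
    fun x => if x % 2 = 0 then false else f (x / 2), ?_, ?_, ?_⟩
  · intro a b h
    simp only at h
    split_ifs at h with h1 h2 h2
    · exact h
    · omega
    · omega
    · have := @hσ (a / 2) (b / 2) (by omega)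
      omega
  · funext ⟨k, s⟩
    have : (2 * k + 1) % 2 = 1 := by omega
    have h2 : (2 * k + 1) / 2 = k := by omega
    simp [relabelEnd, odd, this, h2]
  · funext ⟨k, s⟩
    simp [relabelEnd, even]

theorem mapEnds_subst {τ : ℕ × Bool → ℕ × Bool} {f g : Letter m → List (Letter m)}
    (h : ∀ x, (f x).map (Letter.mapEnd τ) = g (x.mapEnd τ)) (w : Word m n) :
    (w.subst f).mapEnds τ = (w.mapEnds τ).subst g := by
  funext i
  simp only [Word.subst, Word.mapEnds, List.map_flatMap, List.flatMap_map, h]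

theorem mapEnd_around {σ : ℕ → ℕ} (hσ : Function.Injective σ) (f : ℕ → Bool) (q : ℕ) (j : Fin m)
    (s : Bool) (x : Letter m) : (Letter.around q j s x).map (Letter.mapEnd (relabelEnd σ f))
      = Letter.around (σ q) j s (x.mapEnd (relabelEnd σ f)) := by
  rcases x with _ | x
  · rfl
  · by_cases h : x.1 = q <;> simp [Letter.around, Letter.mapEnd, relabelEnd, h, hσ.eq_iff]

theorem mapEnd_before {τ : ℕ × Bool → ℕ × Bool} (hτ : Function.Injective τ) (e c : ℕ × Bool)
    (x : Letter m) : (Letter.before e c x).map (Letter.mapEnd τ)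
      = Letter.before (τ e) (τ c) (x.mapEnd τ) := by
  rcases x with _ | x
  · rfl
  · by_cases h : x = c <;> simp [Letter.before, Letter.mapEnd, h, hτ.eq_iff]

theorem mapEnd_after {τ : ℕ × Bool → ℕ × Bool} (hτ : Function.Injective τ) (e c : ℕ × Bool)
    (x : Letter m) : (Letter.after e c x).map (Letter.mapEnd τ)
      = Letter.after (τ e) (τ c) (x.mapEnd τ) := by
  rcases x with _ | x
  · rfl
  · by_cases h : x = c <;> simp [Letter.after, Letter.mapEnd, h, hτ.eq_iff]

theorem around_even (w : Word m n) (q : ℕ) (j : Fin m) (s : Bool) :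
    (w.subst (Letter.around q j s)).mapEnds even
      = (w.mapEnds even).subst (Letter.around (2 * q) j s) :=
  mapEnds_subst (mapEnd_around (σ := fun k => 2 * k) (fun a b h => by simpa using h) _ q j s) w

theorem around_odd (w : Word m n) (q : ℕ) (j : Fin m) (s : Bool) :
    (w.subst (Letter.around q j s)).mapEnds odd
      = (w.mapEnds odd).subst (Letter.around (2 * q + 1) j s) :=
  mapEnds_subst (mapEnd_around (σ := fun k => 2 * k + 1) (fun a b h => by simpa using h) _ q j s) w

theorem mapEnds_cancel {w w' : Word m n} {i : Fin n} {u v : List (Letter m)} {j : Fin m} {s : Bool}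
    (τ : ℕ × Bool → ℕ × Bool) (ha : w i = u ++ [Letter.gen j s, Letter.gen j (!s)] ++ v)
    (hb : w' = Function.update w i (u ++ v)) :
    w.mapEnds τ i = u.map (Letter.mapEnd τ) ++ [Letter.gen j s, Letter.gen j (!s)]
        ++ v.map (Letter.mapEnd τ) ∧
      w'.mapEnds τ = Function.update (w.mapEnds τ) i
        (u.map (Letter.mapEnd τ) ++ v.map (Letter.mapEnd τ)) := by
  constructor
  · simp [Word.mapEnds, ha, Letter.mapEnd]
  · subst hb
    funext k
    by_cases hk : k = i
    · subst hk; simp [Word.mapEnds]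
    · simp [Word.mapEnds, Function.update_of_ne hk]

theorem compWord_relabel_left {σ : ℕ → ℕ} (hσ : Function.Injective σ) (f : ℕ → Bool)
    (D' : Word n p) (D : Word m n) :
    compWord K (D'.mapEnds (relabelEnd σ f)) D = compWord K D' D := by
  obtain ⟨σ', f', h1, h2, h3⟩ := exists_extend_even hσ f
  rw [compWord, mapEnds_mapEnds, h2, ← mapEnds_mapEnds, h3, ← mapEnds_mapEnds,
    glue_mapEnds (relabelEnd_injective h1 f'), clsL_mapEndsL h1]
  rfl

theorem compWord_relabel_right {σ : ℕ → ℕ} (hσ : Function.Injective σ) (f : ℕ → Bool)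
    (D' : Word n p) (D : Word m n) :
    compWord K D' (D.mapEnds (relabelEnd σ f)) = compWord K D' D := by
  obtain ⟨σ', f', h1, h2, h3⟩ := exists_extend_odd hσ f
  rw [compWord, mapEnds_mapEnds, h2, ← mapEnds_mapEnds, h3, ← mapEnds_mapEnds,
    glue_mapEnds (relabelEnd_injective h1 f'), clsL_mapEndsL h1]
  rfl

theorem compDiag_rel_left (r : Diag n p →₀ K) (hr : ChordRel K r) :
    compDiag K r = (0 : (Diag m n →₀ K) →ₗ[K] _) := by
  ext D : 1
  ext1
  simp only [LinearMap.comp_apply, Finsupp.lsingle_apply, LinearMap.zero_apply]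
  cases hr with
  | relabel σ hσ f a b hb =>
    simp [compDiag, hb, compWord_relabel_left hσ]
  | cancel a b i u v j s ha hb =>
    obtain ⟨h1, h2⟩ := mapEnds_cancel even ha hb
    simp only [compDiag, map_sub, Finsupp.linearCombination_single, one_smul, LinearMap.sub_apply,
      compWord]
    rw [glue_cancel_left _ h1 h2, sub_self]
  | slide q j s a b hb =>
    simp only [compDiag, map_sub, Finsupp.linearCombination_single, one_smul, LinearMap.sub_apply,
      compWord]
    rw [hb, around_even, glue_slide_left _ _ _ _ _ _ (ends_odd_ne _ _), sub_self]
    intro t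
    rw [← even_mk, endCount_mapEnds even_injective]
    have := a.2 q
    cases t <;> omega
  | fourT w q e hq he a b c d ha hb hc hd =>
    simp only [compDiag, map_sub, map_add, Finsupp.linearCombination_single, one_smul,
      LinearMap.sub_apply, LinearMap.add_apply, compWord]
    rw [ha, hb, hc, hd, mapEnds_subst (mapEnd_before even_injective _ _),
      mapEnds_subst (mapEnd_after even_injective _ _),
      mapEnds_subst (mapEnd_before even_injective _ _),
      mapEnds_subst (mapEnd_after even_injective _ _), even_mk, even_mk]
    refine glue_fourT_left _ _ _ _ (fun h => ?_) (ends_odd_ne _ _)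
    have h : e.1 = q := by simpa [even, relabelEnd] using h
    have := hq e.2
    rw [← h] at this
    exact absurd (this.symm.trans he) one_ne_zero

theorem compDiag_rel_right (r : Diag m n →₀ K) (hr : ChordRel K r) :
    (compDiag K).flip r = (0 : (Diag n p →₀ K) →ₗ[K] _) := by
  ext D : 1
  ext1
  simp only [LinearMap.comp_apply, Finsupp.lsingle_apply, LinearMap.zero_apply,
    LinearMap.flip_apply, compDiag, Finsupp.linearCombination_single, one_smul]
  cases hr with
  | relabel σ hσ f a b hb =>
    simp [hb, compWord_relabel_right hσ]
  | cancel a b i u v j s ha hb =>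
    obtain ⟨h1, h2⟩ := mapEnds_cancel odd ha hb
    simp only [map_sub, Finsupp.linearCombination_single, one_smul, compWord]
    rw [glue_cancel_right _ h1 h2, sub_self]
  | slide q j s a b hb =>
    simp only [map_sub, Finsupp.linearCombination_single, one_smul, compWord]
    rw [hb, around_odd, glue_slide_right _ _ _ _ _ (ends_even_ne _ _), sub_self]
  | fourT w q e hq he a b c d ha hb hc hd =>
    simp only [map_sub, map_add, Finsupp.linearCombination_single, one_smul, compWord]
    rw [ha, hb, hc, hd, mapEnds_subst (mapEnd_before odd_injective _ _),
      mapEnds_subst (mapEnd_after odd_injective _ _),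
      mapEnds_subst (mapEnd_before odd_injective _ _),
      mapEnds_subst (mapEnd_after odd_injective _ _), odd_mk, odd_mk]
    refine glue_fourT_right _ _ _ _ (fun s => ?_) ?_ (ends_even_ne _ _)
    · rw [← odd_mk, endCount_mapEnds odd_injective, hq]
    · rw [← odd_mk, endCount_mapEnds odd_injective, he]

/-- Composition `A(n, p) × A(m, n) → A(m, p)`. -/
noncomputable def comp : A K n p →ₗ[K] A K m n →ₗ[K] A K m p :=
  (Submodule.liftQ _ (Submodule.liftQ _ (compDiag K)
    (Submodule.span_le.2 fun r hr => compDiag_rel_left r hr)).flip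
    (Submodule.span_le.2 fun r hr => by
      refine LinearMap.mem_ker.2 ?_
      ext D : 2
      exact congrArg (fun f => f ∘ₗ Finsupp.lsingle D) (compDiag_rel_right r hr))).flip

theorem compDiag_single (D' : Diag n p) (D : Diag m n) :
    compDiag K (Finsupp.single D' 1) (Finsupp.single D 1) = compWord K D'.1 D.1 := by
  simp [compDiag]

theorem comp_cls {D' : Word n p} {D : Word m n} (h' : D'.IsChordDiagram) (h : D.IsChordDiagram) :
    comp (cls K D') (cls K D) = compWord K D' D := by
  rw [cls, dif_pos h', cls, dif_pos h]
  exact compDiag_single ⟨D', h'⟩ ⟨D, h⟩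

/- tensor product -/

theorem mapGen_mapEnd (f : Fin m → Fin m') (τ : ℕ × Bool → ℕ × Bool) (x : Letter m) :
    (x.mapGen f).mapEnd τ = (x.mapEnd τ).mapGen f := by cases x <;> rfl

theorem append_mapEnds (τ : ℕ × Bool → ℕ × Bool) (w : Word m n) (w' : Word m n') :
    Word.mapEnds τ (Fin.append w w' : Word m (n + n'))
      = Fin.append (w.mapEnds τ) (w'.mapEnds τ) := by
  funext i
  refine Fin.addCases (fun i => ?_) (fun i => ?_) i <;> simp [Word.mapEnds]

theorem append_subst (f : Letter m → List (Letter m')) (w : Word m n) (w' : Word m n') :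
    Word.subst f (Fin.append w w' : Word m (n + n')) = Fin.append (w.subst f) (w'.subst f) := by
  funext i
  refine Fin.addCases (fun i => ?_) (fun i => ?_) i <;> simp [Word.subst]

/-- Rename the beads. -/
def Word.mapGens (f : Fin m → Fin m') (w : Word m n) : Word m' n :=
  fun i => (w i).map (Letter.mapGen f)

theorem tensWord_eq (D : Word m n) (D' : Word m' n') : tensWord D D' = Fin.append
    ((D.mapEnds even).mapGens (Fin.castAdd m')) ((D'.mapEnds odd).mapGens (Fin.natAdd m)) := rfl

theorem mapGens_mapEnds (f : Fin m → Fin m') (τ : ℕ × Bool → ℕ × Bool) (w : Word m n) :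
    (w.mapGens f).mapEnds τ = (w.mapEnds τ).mapGens f := by
  funext i
  simp [Word.mapGens, Word.mapEnds, Function.comp_def, mapGen_mapEnd]

theorem mapGens_subst {φ : Fin m → Fin m'} {f : Letter m → List (Letter m)}
    {g : Letter m' → List (Letter m')}
    (h : ∀ x, (f x).map (Letter.mapGen φ) = g (x.mapGen φ)) (w : Word m n) :
    (w.subst f).mapGens φ = (w.mapGens φ).subst g := by
  funext i
  simp only [Word.subst, Word.mapGens, List.map_flatMap, List.flatMap_map, h]

theorem around_mapGens (φ : Fin m → Fin m') (w : Word m n) (q : ℕ) (j : Fin m) (s : Bool) :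
    (w.subst (Letter.around q j s)).mapGens φ
      = (w.mapGens φ).subst (Letter.around q (φ j) s) := by
  refine mapGens_subst (fun x => ?_) w
  rcases x with _ | x
  · rfl
  · by_cases h : x.1 = q <;> simp [Letter.around, Letter.mapGen, h]

theorem before_mapGens (φ : Fin m → Fin m') (w : Word m n) (e c : ℕ × Bool) :
    (w.subst (Letter.before e c)).mapGens φ = (w.mapGens φ).subst (Letter.before e c) := by
  refine mapGens_subst (fun x => ?_) w
  rcases x with _ | x
  · rfl
  · by_cases h : x = c <;> simp [Letter.before, Letter.mapGen, h]

theorem after_mapGens (φ : Fin m → Fin m') (w : Word m n) (e c : ℕ × Bool) :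
    (w.subst (Letter.after e c)).mapGens φ = (w.mapGens φ).subst (Letter.after e c) := by
  refine mapGens_subst (fun x => ?_) w
  rcases x with _ | x
  · rfl
  · by_cases h : x = c <;> simp [Letter.after, Letter.mapGen, h]

theorem mem_mapGens {φ : Fin m → Fin m'} {w : Word m n} {i : Fin n} {e : ℕ × Bool} :
    Letter.cend e ∈ w.mapGens φ i ↔ Letter.cend e ∈ w i := by
  simp only [Word.mapGens, List.mem_map]
  constructor
  · rintro ⟨_ | x, h, hx⟩
    · simp [Letter.mapGen] at hx
    · simp only [Letter.mapGen, Letter.cend.injEq] at hx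
      exact hx ▸ h
  · exact fun h => ⟨_, h, rfl⟩

theorem ends_mapGens (φ : Fin m → Fin m') (w : Word m n) : (w.mapGens φ).ends = w.ends := by
  ext e
  simp only [mem_ends, mem_mapGens]

theorem subst_eq_self_of_ends {f : Letter m → List (Letter m)} {w : Word m n}
    (h1 : ∀ j s, f (.gen j s) = [.gen j s]) (h2 : ∀ e ∈ w.ends, f (.cend e) = [.cend e]) :
    w.subst f = w := by
  funext i
  refine flatMap_eq_self _ fun x hx => ?_
  rcases x with ⟨j, s⟩ | e
  · exact h1 j s
  · exact h2 e (mem_ends.2 ⟨i, hx⟩)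

theorem around_self {w : Word m n} {q : ℕ} (h : ∀ e ∈ w.ends, e.1 ≠ q) (j : Fin m) (s : Bool) :
    w.subst (Letter.around q j s) = w :=
  subst_eq_self_of_ends (fun _ _ => rfl) fun e he => by simp [Letter.around, h e he]

theorem before_self {w : Word m n} {c : ℕ × Bool} (h : ∀ e ∈ w.ends, e.1 ≠ c.1) (e : ℕ × Bool) :
    w.subst (Letter.before e c) = w :=
  subst_eq_self_of_ends (fun _ _ => rfl) fun d hd => before_eq _ fun h' => h d hd (by cases h'; rfl)

theorem after_self {w : Word m n} {c : ℕ × Bool} (h : ∀ e ∈ w.ends, e.1 ≠ c.1) (e : ℕ × Bool) :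
    w.subst (Letter.after e c) = w :=
  subst_eq_self_of_ends (fun _ _ => rfl) fun d hd => after_eq _ fun h' => h d hd (by cases h'; rfl)

theorem ends_gens_even (φ : Fin m → Fin m') (w : Word m n) (q : ℕ) :
    ∀ e ∈ ((w.mapEnds even).mapGens φ).ends, e.1 ≠ 2 * q + 1 := by
  rw [ends_mapGens]; exact ends_even_ne w q

theorem ends_gens_odd (φ : Fin m → Fin m') (w : Word m n) (q : ℕ) :
    ∀ e ∈ ((w.mapEnds odd).mapGens φ).ends, e.1 ≠ 2 * q := by
  rw [ends_mapGens]; exact ends_odd_ne w q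

theorem mapGens_cancel {w w' : Word m n} {i : Fin n} {u v : List (Letter m)} {j : Fin m} {s : Bool}
    (φ : Fin m → Fin m') (ha : w i = u ++ [Letter.gen j s, Letter.gen j (!s)] ++ v)
    (hb : w' = Function.update w i (u ++ v)) :
    w.mapGens φ i = u.map (Letter.mapGen φ) ++ [Letter.gen (φ j) s, Letter.gen (φ j) (!s)]
        ++ v.map (Letter.mapGen φ) ∧
      w'.mapGens φ = Function.update (w.mapGens φ) i
        (u.map (Letter.mapGen φ) ++ v.map (Letter.mapGen φ)) := by
  constructor
  · simp [Word.mapGens, ha, Letter.mapGen]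
  · subst hb
    funext k
    by_cases hk : k = i
    · subst hk; simp [Word.mapGens]
    · simp [Word.mapGens, Function.update_of_ne hk]

theorem cls_tensWord_cancel_left {w w₂ : Word m n} {i : Fin n} {u v : List (Letter m)} {j : Fin m}
    {s : Bool} (ha : w i = u ++ [Letter.gen j s, Letter.gen j (!s)] ++ v)
    (hb : w₂ = Function.update w i (u ++ v)) (w' : Word m' n') :
    cls K (tensWord w w') = cls K (tensWord w₂ w') := by
  obtain ⟨h1, h2⟩ := mapEnds_cancel even ha hb
  obtain ⟨h1, h2⟩ := mapGens_cancel (Fin.castAdd m') h1 h2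
  rw [tensWord_eq, tensWord_eq]
  refine cls_cancel (i := Fin.castAdd n' i) ((Fin.append_left _ _ _).trans h1) ?_
  rw [h2]
  funext k
  refine Fin.addCases (fun k => ?_) (fun k => ?_) k
  · rw [Fin.append_left]
    by_cases hk : k = i
    · subst hk; simp
    · rw [Function.update_of_ne hk, Function.update_of_ne (by simpa using hk), Fin.append_left]
  · rw [Fin.append_right, Function.update_of_ne, Fin.append_right]
    intro h
    have := congrArg Fin.val h
    have := i.2
    simp at *
    omega

theorem cls_tensWord_cancel_right {w w₂ : Word m' n'} {i : Fin n'} {u v : List (Letter m')}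
    {j : Fin m'} {s : Bool} (ha : w i = u ++ [Letter.gen j s, Letter.gen j (!s)] ++ v)
    (hb : w₂ = Function.update w i (u ++ v)) (w' : Word m n) :
    cls K (tensWord w' w) = cls K (tensWord w' w₂) := by
  obtain ⟨h1, h2⟩ := mapEnds_cancel odd ha hb
  obtain ⟨h1, h2⟩ := mapGens_cancel (Fin.natAdd m) h1 h2
  rw [tensWord_eq, tensWord_eq]
  refine cls_cancel (i := Fin.natAdd n i) ((Fin.append_right _ _ _).trans h1) ?_
  rw [h2]
  funext k
  refine Fin.addCases (fun k => ?_) (fun k => ?_) k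
  · rw [Fin.append_left, Function.update_of_ne, Fin.append_left]
    intro h
    have := congrArg Fin.val h
    have := k.2
    simp at *
    omega
  · rw [Fin.append_right]
    by_cases hk : k = i
    · subst hk; simp
    · rw [Function.update_of_ne hk, Function.update_of_ne (by simpa using hk), Fin.append_right]

theorem cls_tensWord_relabel_left {σ : ℕ → ℕ} (hσ : Function.Injective σ) (f : ℕ → Bool)
    (w : Word m n) (w' : Word m' n') :
    cls K (tensWord (w.mapEnds (relabelEnd σ f)) w') = cls K (tensWord w w') := by
  obtain ⟨σ', f', h1, h2, h3⟩ := exists_extend_even hσ f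
  have : tensWord (w.mapEnds (relabelEnd σ f)) w'
      = (tensWord w w').mapEnds (relabelEnd σ' f') := by
    rw [tensWord_eq, tensWord_eq, append_mapEnds, mapGens_mapEnds, mapGens_mapEnds,
      mapEnds_mapEnds, mapEnds_mapEnds, mapEnds_mapEnds, h2, ← h3]
  rw [this, cls_mapEnds h1]

theorem cls_tensWord_relabel_right {σ : ℕ → ℕ} (hσ : Function.Injective σ) (f : ℕ → Bool)
    (w : Word m n) (w' : Word m' n') :
    cls K (tensWord w (w'.mapEnds (relabelEnd σ f))) = cls K (tensWord w w') := by
  obtain ⟨σ', f', h1, h2, h3⟩ := exists_extend_odd hσ f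
  have : tensWord w (w'.mapEnds (relabelEnd σ f))
      = (tensWord w w').mapEnds (relabelEnd σ' f') := by
    rw [tensWord_eq, tensWord_eq, append_mapEnds, mapGens_mapEnds, mapGens_mapEnds,
      mapEnds_mapEnds, mapEnds_mapEnds, mapEnds_mapEnds, h2, ← h3]
  rw [this, cls_mapEnds h1]

theorem tensDiag_rel_left (r : Diag m n →₀ K) (hr : ChordRel K r) :
    tensDiag K r = (0 : (Diag m' n' →₀ K) →ₗ[K] _) := by
  ext D : 1
  ext1
  simp only [LinearMap.comp_apply, Finsupp.lsingle_apply, LinearMap.zero_apply]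
  cases hr with
  | relabel σ hσ f a b hb =>
    simp only [tensDiag, map_sub, Finsupp.linearCombination_single, one_smul, LinearMap.sub_apply]
    rw [hb, cls_tensWord_relabel_left hσ, sub_self]
  | cancel a b i u v j s ha hb =>
    simp only [tensDiag, map_sub, Finsupp.linearCombination_single, one_smul, LinearMap.sub_apply]
    rw [cls_tensWord_cancel_left ha hb, sub_self]
  | slide q j s a b hb =>
    simp only [tensDiag, map_sub, Finsupp.linearCombination_single, one_smul, LinearMap.sub_apply]
    have : tensWord b.1 D.1 = (tensWord a.1 D.1).subst
        (Letter.around (2 * q) (Fin.castAdd m' j) s) := by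
      rw [hb, tensWord_eq, tensWord_eq, append_subst, around_self (ends_gens_odd _ _ q),
        around_even, around_mapGens]
    rw [this, cls_around, sub_self]
  | fourT w q e hq he a b c d ha hb hc hd =>
    simp only [tensDiag, map_sub, map_add, Finsupp.linearCombination_single, one_smul,
      LinearMap.sub_apply, LinearMap.add_apply]
    have hne : (even e).1 ≠ 2 * q := fun h => by
      have h : e.1 = q := by simpa [even, relabelEnd] using h
      have := hq e.2
      rw [← h] at this
      exact absurd (this.symm.trans he) one_ne_zero
    have hB : ∀ s, tensWord (w.subst (Letter.before e (q, s))) D.1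
        = (tensWord w D.1).subst (Letter.before (even e) (2 * q, s)) := by
      intro s
      rw [tensWord_eq, tensWord_eq, mapEnds_subst (mapEnd_before even_injective _ _),
        before_mapGens, append_subst, even_mk q s,
        before_self (c := (2 * q, s)) (ends_gens_odd _ _ _)]
    have hA : ∀ s, tensWord (w.subst (Letter.after e (q, s))) D.1
        = (tensWord w D.1).subst (Letter.after (even e) (2 * q, s)) := by
      intro s
      rw [tensWord_eq, tensWord_eq, mapEnds_subst (mapEnd_after even_injective _ _),
        after_mapGens, append_subst, even_mk q s,
        after_self (c := (2 * q, s)) (ends_gens_odd _ _ _)]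
    rw [ha, hb, hc, hd, hB, hB, hA, hA]
    exact cls_fourT _ _ _ hne

theorem tensDiag_rel_right (r : Diag m' n' →₀ K) (hr : ChordRel K r) :
    (tensDiag K).flip r = (0 : (Diag m n →₀ K) →ₗ[K] _) := by
  ext D : 1
  ext1
  simp only [LinearMap.comp_apply, Finsupp.lsingle_apply, LinearMap.zero_apply,
    LinearMap.flip_apply, tensDiag, Finsupp.linearCombination_single, one_smul]
  cases hr with
  | relabel σ hσ f a b hb =>
    simp only [map_sub, Finsupp.linearCombination_single, one_smul]
    rw [hb, cls_tensWord_relabel_right hσ, sub_self]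
  | cancel a b i u v j s ha hb =>
    simp only [map_sub, Finsupp.linearCombination_single, one_smul]
    rw [cls_tensWord_cancel_right ha hb, sub_self]
  | slide q j s a b hb =>
    simp only [map_sub, Finsupp.linearCombination_single, one_smul]
    have : tensWord D.1 b.1 = (tensWord D.1 a.1).subst
        (Letter.around (2 * q + 1) (Fin.natAdd m j) s) := by
      rw [hb, tensWord_eq, tensWord_eq, append_subst, around_self (ends_gens_even _ _ q),
        around_odd, around_mapGens]
    rw [this, cls_around, sub_self]
  | fourT w q e hq he a b c d ha hb hc hd =>
    simp only [map_sub, map_add, Finsupp.linearCombination_single, one_smul]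
    have hne : (odd e).1 ≠ 2 * q + 1 := fun h => by
      have h : e.1 = q := by simpa [odd, relabelEnd] using h
      have := hq e.2
      rw [← h] at this
      exact absurd (this.symm.trans he) one_ne_zero
    have hB : ∀ s, tensWord D.1 (w.subst (Letter.before e (q, s)))
        = (tensWord D.1 w).subst (Letter.before (odd e) (2 * q + 1, s)) := by
      intro s
      rw [tensWord_eq, tensWord_eq, mapEnds_subst (mapEnd_before odd_injective _ _),
        before_mapGens, append_subst, odd_mk q s,
        before_self (c := (2 * q + 1, s)) (ends_gens_even _ _ _)]
    have hA : ∀ s, tensWord D.1 (w.subst (Letter.after e (q, s)))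
        = (tensWord D.1 w).subst (Letter.after (odd e) (2 * q + 1, s)) := by
      intro s
      rw [tensWord_eq, tensWord_eq, mapEnds_subst (mapEnd_after odd_injective _ _),
        after_mapGens, append_subst, odd_mk q s,
        after_self (c := (2 * q + 1, s)) (ends_gens_even _ _ _)]
    rw [ha, hb, hc, hd, hB, hB, hA, hA]
    exact cls_fourT _ _ _ hne

/-- Tensor product `A(m, n) × A(m', n') → A(m + m', n + n')`. -/
noncomputable def tens : A K m n →ₗ[K] A K m' n' →ₗ[K] A K (m + m') (n + n') :=
  (Submodule.liftQ _ (Submodule.liftQ _ (tensDiag K)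
    (Submodule.span_le.2 fun r hr => tensDiag_rel_left r hr)).flip
    (Submodule.span_le.2 fun r hr => by
      refine LinearMap.mem_ker.2 ?_
      ext D : 2
      exact congrArg (fun f => f ∘ₗ Finsupp.lsingle D) (tensDiag_rel_right r hr))).flip

theorem tensDiag_single (D : Diag m n) (D' : Diag m' n') :
    tensDiag K (Finsupp.single D 1) (Finsupp.single D' 1) = cls K (tensWord D.1 D'.1) := by
  simp [tensDiag]

theorem tens_cls {D : Word m n} {D' : Word m' n'} (h : D.IsChordDiagram) (h' : D'.IsChordDiagram) :
    tens (cls K D) (cls K D') = cls K (tensWord D D') := by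
  rw [cls, dif_pos h, cls, dif_pos h']
  exact tensDiag_single ⟨D, h⟩ ⟨D', h'⟩

end composition

section degree
variable {K : Type*} [Field K] {m m' n n' p : ℕ}

/-- The degree `k` part of `A(m, n)`, spanned by the diagrams with `k` chords. -/
noncomputable def degPart (K : Type*) [Field K] (m n k : ℕ) : Submodule K (A K m n) :=
  Submodule.span K (cls K '' {w : Word m n | w.ends.card = 2 * k})

theorem cls_mem_degPart {w : Word m n} {k : ℕ} (h : w.ends.card = 2 * k) :
    cls K w ∈ degPart K m n k := Submodule.subset_span ⟨w, h, rfl⟩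

/-- The ends of the outer diagram. -/
def keepEnds : List (Fin p × CabLetter m) → Finset (ℕ × Bool)
  | [] => ∅
  | (_, .keep (.cend e)) :: L => insert e (keepEnds L)
  | _ :: L => keepEnds L

theorem mem_keepEnds {L : List (Fin p × CabLetter m)} {e : ℕ × Bool} :
    e ∈ keepEnds L ↔ ∃ i, (i, CabLetter.keep (.cend e)) ∈ L := by
  induction L with
  | nil => simp [keepEnds]
  | cons x L ih =>
    obtain ⟨i, (_ | d) | _⟩ := x
    · simp [keepEnds, ih]
    · simp only [keepEnds, Finset.mem_insert, ih, List.mem_cons, Prod.mk.injEq,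
        CabLetter.keep.injEq, Letter.cend.injEq]
      constructor
      · rintro (rfl | ⟨i', h⟩)
        · exact ⟨i, .inl ⟨rfl, rfl⟩⟩
        · exact ⟨i', .inr h⟩
      · rintro ⟨i', ⟨-, h⟩ | h⟩
        · exact .inl h
        · exact .inr ⟨i', h⟩
    · simp [keepEnds, ih]

theorem mem_ends_prepend {w : Word m p} {i : Fin p} {l : Letter m} {e : ℕ × Bool} :
    e ∈ (w.prepend i [l]).ends ↔ l = .cend e ∨ e ∈ w.ends := by
  simp only [mem_ends, Word.prepend]
  constructor
  · rintro ⟨k, h⟩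
    by_cases hk : k = i
    · subst hk
      simp only [Function.update_self, List.singleton_append, List.mem_cons] at h
      rcases h with h | h
      · exact .inl h.symm
      · exact .inr ⟨_, h⟩
    · rw [Function.update_of_ne hk] at h
      exact .inr ⟨_, h⟩
  · rintro (h | ⟨k, h⟩)
    · exact ⟨i, by simp [h]⟩
    · refine ⟨k, ?_⟩
      by_cases hk : k = i
      · subst hk; simp [h]
      · rwa [Function.update_of_ne hk]

theorem pre_mem_supported {T T' : Finset (ℕ × Bool)} {i : Fin p} {l : Letter m}
    (h : ∀ e, e ∈ T' ↔ l = .cend e ∨ e ∈ T) {v : Word m p →₀ K}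
    (hv : v ∈ Finsupp.supported K K {w : Word m p | w.ends = T}) :
    pre K i [l] v ∈ Finsupp.supported K K {w : Word m p | w.ends = T'} := by
  refine Finsupp.supported_comap_lmapDomain K K (Word.prepend i [l]) _ (Finsupp.supported_mono ?_ hv)
  intro w (hw : w.ends = T)
  show (w.prepend i [l]).ends = T'
  ext e
  rw [mem_ends_prepend, h, hw]

theorem distribute_mem_supported (L : List (Fin p × CabLetter m)) (S : Finset (ℕ × Bool)) :
    distribute K S L ∈ Finsupp.supported K K {w : Word m p | w.ends = S ∪ keepEnds L} := by
  induction L generalizing S with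
  | nil =>
    rw [distribute]
    split_ifs with h
    · refine Finsupp.single_mem_supported _ _ ?_
      subst h
      ext e
      simp [mem_ends, keepEnds]
    · exact Submodule.zero_mem _
  | cons x L ih =>
    obtain ⟨i, l | ⟨d, t⟩⟩ := x
    · refine pre_mem_supported (fun e => ?_) (ih S)
      rcases l with _ | d
      · simp [keepEnds]
      · simp only [keepEnds, Finset.mem_union, Finset.mem_insert, Letter.cend.injEq]
        rw [eq_comm (a := e)]
        tauto
    · rw [distribute_copy_cons]
      refine Submodule.add_mem _ (ih S) ?_
      split_ifs with h
      · refine Submodule.smul_mem _ _ (pre_mem_supported (fun e => ?_) (ih (S.erase d)))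
        simp only [keepEnds, Finset.mem_union, Finset.mem_erase, Letter.cend.injEq]
        by_cases hd : d = e
        · subst hd; simp [h]
        · simp [hd, Ne.symm hd]
      · exact Submodule.zero_mem _

theorem glue_mem_supported (D' : Word n p) (D : Word m n) :
    glue K D' D ∈ Finsupp.supported K K {w : Word m p | w.ends = D.ends ∪ D'.ends} := by
  have h := distribute_mem_supported (K := K) (cable D' D) D.ends
  have : keepEnds (cable D' D) = D'.ends := by
    ext e
    rw [mem_keepEnds, mem_ends]
    refine exists_congr fun i => ⟨fun h => ?_, fun h => ?_⟩
    · obtain ⟨x, hx, h⟩ := mem_cable h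
      rwa [mem_expand_keep h] at hx
    · rw [cable_eq]
      simp only [List.mem_flatMap, List.mem_map]
      exact ⟨i, List.mem_finRange i, _, h, .keep (.cend e), by simp [expand], rfl⟩
  rwa [this] at h

theorem card_ends_union (D' : Word n p) (D : Word m m') :
    ((D.mapEnds odd).ends ∪ (D'.mapEnds even).ends).card = D'.ends.card + D.ends.card := by
  rw [Finset.card_union_of_disjoint, ends_mapEnds, ends_mapEnds,
    Finset.card_image_of_injective _ even_injective,
    Finset.card_image_of_injective _ odd_injective, add_comm]
  rw [Finset.disjoint_left]
  intro e h h'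
  rw [ends_mapEnds] at h
  obtain ⟨d, _, rfl⟩ := Finset.mem_image.1 h
  refine ends_even_ne D' d.1 _ h' ?_
  simp [odd, relabelEnd]

theorem compWord_mem_degPart {D' : Word n p} {D : Word m n} {k l : ℕ} (h' : D'.ends.card = 2 * k)
    (h : D.ends.card = 2 * l) : compWord K D' D ∈ degPart K m p (k + l) := by
  have := glue_mem_supported (K := K) (D'.mapEnds even) (D.mapEnds odd)
  rw [compWord, clsL, Finsupp.linearCombination_apply, Finsupp.sum]
  refine Submodule.sum_mem _ fun w hw => Submodule.smul_mem _ _ (cls_mem_degPart ?_)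
  rw [show w.ends = _ from (Finsupp.mem_supported _ _).1 this hw, card_ends_union, h, h', mul_add]

theorem comp_mem_degPart {x : A K n p} {y : A K m n} {k l : ℕ} (hx : x ∈ degPart K n p k)
    (hy : y ∈ degPart K m n l) : comp x y ∈ degPart K m p (k + l) := by
  have h := Submodule.apply_mem_map₂ comp hx hy
  rw [degPart, degPart, Submodule.map₂_span_span] at h
  refine Submodule.span_le.2 ?_ h
  rintro _ ⟨_, ⟨w', h', rfl⟩, _, ⟨w, h, rfl⟩, rfl⟩
  by_cases hc' : w'.IsChordDiagram
  · by_cases hc : w.IsChordDiagram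
    · show comp (cls K w') (cls K w) ∈ _
      rw [comp_cls hc' hc]
      exact compWord_mem_degPart h' h
    · show comp (cls K w') (cls K w) ∈ _; rw [cls_eq_zero hc, map_zero]; exact Submodule.zero_mem _
  · show comp (cls K w') (cls K w) ∈ _; rw [cls_eq_zero hc', map_zero, LinearMap.zero_apply]; exact Submodule.zero_mem _

theorem tens_mem_degPart {x : A K m n} {y : A K m' n'} {k l : ℕ} (hx : x ∈ degPart K m n k)
    (hy : y ∈ degPart K m' n' l) : tens x y ∈ degPart K (m + m') (n + n') (k + l) := by
  have h := Submodule.apply_mem_map₂ tens hx hy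
  rw [degPart, degPart, Submodule.map₂_span_span] at h
  refine Submodule.span_le.2 ?_ h
  rintro _ ⟨_, ⟨w, h, rfl⟩, _, ⟨w', h', rfl⟩, rfl⟩
  by_cases hc' : w'.IsChordDiagram
  · by_cases hc : w.IsChordDiagram
    · show tens (cls K w) (cls K w') ∈ _
      rw [tens_cls hc hc']
      refine cls_mem_degPart ?_
      have : (tensWord w w').ends = (w'.mapEnds odd).ends ∪ (w.mapEnds even).ends := by
        ext e
        rw [Finset.mem_union, mem_ends, tensWord_eq, mem_ends, mem_ends]
        constructor
        · rintro ⟨i, h⟩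
          revert h
          refine Fin.addCases (fun i h => ?_) (fun i h => ?_) i
          · rw [Fin.append_left] at h
            exact .inr ⟨i, mem_mapGens.1 h⟩
          · rw [Fin.append_right] at h
            exact .inl ⟨i, mem_mapGens.1 h⟩
        · rintro (⟨i, h⟩ | ⟨i, h⟩)
          · exact ⟨Fin.natAdd n i, by rw [Fin.append_right]; exact mem_mapGens.2 h⟩
          · exact ⟨Fin.castAdd n' i, by rw [Fin.append_left]; exact mem_mapGens.2 h⟩
      rw [this, card_ends_union]
      have h : w.ends.card = 2 * k := h
      have h' : w'.ends.card = 2 * l := h'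
      omega
    · show tens (cls K w) (cls K w') ∈ _; rw [cls_eq_zero hc, map_zero, LinearMap.zero_apply]; exact Submodule.zero_mem _
  · show tens (cls K w) (cls K w') ∈ _; rw [cls_eq_zero hc', map_zero]; exact Submodule.zero_mem _

end degree

section completion
variable {K : Type*} [Field K] {m m' n n' p : ℕ}

/-- Morphisms `m → n` of the degree completion `Â`: families of homogeneous elements, one in each
degree. -/
abbrev HatA (K : Type*) [Field K] (m n : ℕ) : Type _ :=
  ↥(Submodule.pi (R := K) (φ := fun _ : ℕ => A K m n) Set.univ fun k : ℕ => degPart K m n k)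

namespace HatA

theorem coe_mem (f : HatA K m n) (k : ℕ) : f.1 k ∈ degPart K m n k := f.2 k (Set.mem_univ k)

/-- Composition in `Â`. -/
noncomputable def comp (g : HatA K n p) (f : HatA K m n) : HatA K m p :=
  ⟨fun k => ∑ ij ∈ Finset.HasAntidiagonal.antidiagonal k, JacobiHB.comp (g.1 ij.1) (f.1 ij.2), fun _ _ =>
    Submodule.sum_mem _ fun ij h => Finset.HasAntidiagonal.mem_antidiagonal.1 h ▸
      comp_mem_degPart (g.coe_mem ij.1) (f.coe_mem ij.2)⟩

/-- Tensor product in `Â`. -/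
noncomputable def tens (f : HatA K m n) (g : HatA K m' n') : HatA K (m + m') (n + n') :=
  ⟨fun k => ∑ ij ∈ Finset.HasAntidiagonal.antidiagonal k, JacobiHB.tens (f.1 ij.1) (g.1 ij.2), fun _ _ =>
    Submodule.sum_mem _ fun ij h => Finset.HasAntidiagonal.mem_antidiagonal.1 h ▸
      tens_mem_degPart (f.coe_mem ij.1) (g.coe_mem ij.2)⟩

/-- The morphism of `Â` given by a single diagram. -/
noncomputable def diag (K : Type*) [Field K] (w : Word m n) : HatA K m n :=
  ⟨fun k => if w.ends.card = 2 * k then cls K w else 0, fun k _ => by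
    show (if w.ends.card = 2 * k then cls K w else 0) ∈ degPart K m n k
    split_ifs with h
    · exact cls_mem_degPart h
    · exact Submodule.zero_mem _⟩

/-- Transport along equalities of objects. -/
def cast {a b a' b' : ℕ} (ha : a = a') (hb : b = b') (f : HatA K a b) : HatA K a' b' :=
  ha ▸ hb ▸ f

end HatA

infixr:80 " ∘ₕ " => HatA.comp
infixr:85 " ⊗ₕ " => HatA.tens

variable (K)

/-- The identity of the object `n`. -/
noncomputable def idn (n : ℕ) : HatA K n n := HatA.diag K fun i => [.gen i true]

/-- The permutation morphism `P_σ`, which moves the factor `i` to the position `σ i`. -/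
noncomputable def perm {n : ℕ} (σ : Equiv.Perm (Fin n)) : HatA K n n :=
  HatA.diag K fun i => [.gen (σ.symm i) true]

/-- The symmetry `P_{m,n} : m ⊗ n → n ⊗ m`. -/
noncomputable def swap (m n : ℕ) : HatA K (m + n) (n + m) :=
  HatA.diag K fun i => [.gen (finAddFlip i) true]

/-- Multiplication of the Casimir Hopf algebra: one arc with colour `x_0 x_1`. -/
noncomputable def mu : HatA K 2 1 := HatA.diag K fun _ => [.gen 0 true, .gen 1 true]
/-- Unit: one arc without beads. -/
noncomputable def eta : HatA K 0 1 := HatA.diag K fun _ => []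
/-- Comultiplication: two arcs with colour `x_0`. -/
noncomputable def Delta : HatA K 1 2 := HatA.diag K fun _ => [.gen 0 true]
/-- Counit: no arc. -/
noncomputable def eps : HatA K 1 0 := HatA.diag K Fin.elim0
/-- Antipode: one arc with colour `x_0⁻¹`. -/
noncomputable def anti : HatA K 1 1 := HatA.diag K fun _ => [.gen 0 false]
/-- Casimir 2-tensor: two arcs joined by a chord. -/
noncomputable def cas : HatA K 0 2 := HatA.diag K ![[.cend (0, false)], [.cend (0, true)]]

end completion

section convolution
variable {K : Type*} [Field K]

/-- The multiplication `μ_n` of the `n`-th tensor power, for an algebra with multiplication `mul` on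
the object `1`. -/
noncomputable def mulN (mul : HatA K 2 1) : (n : ℕ) → HatA K (n + n) n
  | 0 => idn K 0
  | 1 => mul
  | n + 2 => (mulN mul (n + 1) ⊗ₕ mul : HatA K (n + 1 + (n + 1) + 2) (n + 1 + 1)) ∘ₕ
      HatA.cast (a' := n + 2 + (n + 2)) (b' := n + 1 + (n + 1) + 2) (by omega) (by omega)
        (idn K (n + 1) ⊗ₕ swap K 1 (n + 1) ⊗ₕ idn K 1)

/-- The unit of the `n`-th tensor power. -/
noncomputable def unitN (unit : HatA K 0 1) : (n : ℕ) → HatA K 0 n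
  | 0 => idn K 0
  | n + 1 => unitN unit n ⊗ₕ unit

/-- The iterated multiplication `μ^{[q]}`. -/
noncomputable def mulIter (mul : HatA K 2 1) (unit : HatA K 0 1) : (q : ℕ) → HatA K q 1
  | 0 => unit
  | 1 => idn K 1
  | q + 2 => mul ∘ₕ (mulIter mul unit (q + 1) ⊗ₕ idn K 1)

/-- The convolution `g * f = μ_n (g ⊗ f)`; one of `a` and `b` is `0` in all uses. -/
noncomputable def conv (mul : HatA K 2 1) {a b n : ℕ} (g : HatA K a n) (f : HatA K b n) :
    HatA K (a + b) n := mulN mul n ∘ₕ (g ⊗ₕ f)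

/-- The convolution product of morphisms `0 → n`. -/
noncomputable def conv0 (mul : HatA K 2 1) {n : ℕ} (g f : HatA K 0 n) : HatA K 0 n :=
  conv mul g f

/-- `y` is the convolution inverse of `x`. -/
def IsConvInv (mul : HatA K 2 1) (unit : HatA K 0 1) {n : ℕ} (x y : HatA K 0 n) : Prop :=
  conv0 mul x y = unitN unit n ∧ conv0 mul y x = unitN unit n

/-- Convolution product of a list of morphisms `0 → n`, from left to right. -/
noncomputable def convList (mul : HatA K 2 1) (unit : HatA K 0 1) {n : ℕ}
    (l : List (HatA K 0 n)) : HatA K 0 n := l.foldr (conv0 mul) (unitN unit n)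

end convolution

/-- Quasi-bialgebras in `Â` on the object `1`. The convolution inverse of the associator, which is
unique, is listed among the data in order to be able to refer to it. -/
structure QuasiBialgebra (K : Type*) [Field K] where
  mul : HatA K 2 1
  unit : HatA K 0 1
  mul_assoc : mul ∘ₕ (mul ⊗ₕ idn K 1) = mul ∘ₕ (idn K 1 ⊗ₕ mul)
  unit_mul : mul ∘ₕ (unit ⊗ₕ idn K 1) = idn K 1
  mul_unit : mul ∘ₕ (idn K 1 ⊗ₕ unit) = idn K 1
  comul : HatA K 1 2
  comul_mul : comul ∘ₕ mul = mulN mul 2 ∘ₕ (comul ⊗ₕ comul)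
  comul_unit : comul ∘ₕ unit = unit ⊗ₕ unit
  counit : HatA K 1 0
  counit_mul : counit ∘ₕ mul = counit ⊗ₕ counit
  counit_unit : counit ∘ₕ unit = idn K 0
  assoc : HatA K 0 3
  assocInv : HatA K 0 3
  assoc_inv : IsConvInv mul unit assoc assocInv
  counit_comul : (counit ⊗ₕ idn K 1) ∘ₕ comul = idn K 1
  comul_counit : (idn K 1 ⊗ₕ counit) ∘ₕ comul = idn K 1
  quasi_coassoc : (idn K 1 ⊗ₕ comul) ∘ₕ comul
    = conv mul (conv mul assoc ((comul ⊗ₕ idn K 1) ∘ₕ comul)) assocInv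
  pentagon :
    conv0 mul (conv0 mul (n := 4) (unit ⊗ₕ assoc)
        ((idn K 1 ⊗ₕ comul ⊗ₕ idn K 1 : HatA K 3 4) ∘ₕ assoc)) (assoc ⊗ₕ unit)
      = conv0 mul (n := 4) ((idn K 1 ⊗ₕ idn K 1 ⊗ₕ comul : HatA K 3 4) ∘ₕ assoc)
        ((comul ⊗ₕ idn K 1 ⊗ₕ idn K 1 : HatA K 3 4) ∘ₕ assoc)
  counit_assoc : (idn K 1 ⊗ₕ counit ⊗ₕ idn K 1 : HatA K 3 2) ∘ₕ assoc = unit ⊗ₕ unit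

/-- Quasi-Hopf algebras in `Â` on the object `1`; the antipode is an algebra anti-automorphism. -/
structure QuasiHopf (K : Type*) [Field K] extends QuasiBialgebra K where
  antipode : HatA K 1 1
  antipode_mul : antipode ∘ₕ mul = mul ∘ₕ swap K 1 1 ∘ₕ (antipode ⊗ₕ antipode)
  antipode_unit : antipode ∘ₕ unit = unit
  antipode_iso : ∃ T : HatA K 1 1, antipode ∘ₕ T = idn K 1 ∧ T ∘ₕ antipode = idn K 1
  alpha : HatA K 0 1
  alphaInv : HatA K 0 1
  alpha_inv : IsConvInv mul unit alpha alphaInv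
  beta : HatA K 0 1
  betaInv : HatA K 0 1
  beta_inv : IsConvInv mul unit beta betaInv
  antipode_alpha : mulIter mul unit 3 ∘ₕ (antipode ⊗ₕ alpha ⊗ₕ idn K 1 : HatA K 2 3) ∘ₕ comul
    = alpha ∘ₕ counit
  antipode_beta : mulIter mul unit 3 ∘ₕ (idn K 1 ⊗ₕ beta ⊗ₕ antipode : HatA K 2 3) ∘ₕ comul
    = beta ∘ₕ counit
  antipode_assoc : mulIter mul unit 5 ∘ₕ
    (idn K 1 ⊗ₕ beta ⊗ₕ antipode ⊗ₕ alpha ⊗ₕ idn K 1 : HatA K 3 5) ∘ₕ assoc = unit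
  antipode_assocInv : mulIter mul unit 5 ∘ₕ
    (antipode ⊗ₕ alpha ⊗ₕ idn K 1 ⊗ₕ beta ⊗ₕ antipode : HatA K 3 5) ∘ₕ assocInv = unit

/-- The permutation `1 ↦ 1, 2 ↦ 3, 3 ↦ 2`. -/
def perm132 : Equiv.Perm (Fin 3) := Equiv.swap 1 2
/-- The permutation `1 ↦ 2, 2 ↦ 1, 3 ↦ 3`. -/
def perm213 : Equiv.Perm (Fin 3) := Equiv.swap 0 1
/-- The permutation `1 ↦ 2, 2 ↦ 3, 3 ↦ 1`. -/
def perm231 : Equiv.Perm (Fin 3) := ⟨![1, 2, 0], ![2, 0, 1], by decide, by decide⟩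
/-- The permutation `1 ↦ 3, 2 ↦ 1, 3 ↦ 2`. -/
def perm312 : Equiv.Perm (Fin 3) := ⟨![2, 0, 1], ![1, 2, 0], by decide, by decide⟩

/-- Quasi-triangular quasi-Hopf algebras in `Â`, with the two hexagon axioms
`(Δ ⊗ id) R = φ_312 * R_13 * φ_132⁻¹ * R_23 * φ_123` and
`(id ⊗ Δ) R = φ_231⁻¹ * R_13 * φ_213 * R_12 * φ_123⁻¹`, where `φ_ijk` is `φ` with its first, second
and third factors moved to the positions `i`, `j` and `k`. -/
structure QuasiTriangularQuasiHopf (K : Type*) [Field K] extends QuasiHopf K where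
  R : HatA K 0 2
  RInv : HatA K 0 2
  R_inv : IsConvInv mul unit R RInv
  R_comul : conv mul (conv mul R comul) RInv = swap K 1 1 ∘ₕ comul
  comul_R_left : (comul ⊗ₕ idn K 1 : HatA K 2 3) ∘ₕ R = convList mul unit (n := 3)
    [perm K perm312 ∘ₕ assoc, (idn K 1 ⊗ₕ unit ⊗ₕ idn K 1 : HatA K 2 3) ∘ₕ R,
      perm K perm132 ∘ₕ assocInv, unit ⊗ₕ R, assoc]
  comul_R_right : (idn K 1 ⊗ₕ comul : HatA K 2 3) ∘ₕ R = convList mul unit (n := 3)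
    [perm K perm231 ∘ₕ assocInv, (idn K 1 ⊗ₕ unit ⊗ₕ idn K 1 : HatA K 2 3) ∘ₕ R,
      perm K perm213 ∘ₕ assoc, R ⊗ₕ unit, assocInv]

/-- Ribbon quasi-Hopf algebras in `Â`. -/
structure RibbonQuasiHopf (K : Type*) [Field K] extends QuasiTriangularQuasiHopf K where
  r : HatA K 0 1
  rInv : HatA K 0 1
  r_inv : IsConvInv mul unit r rInv
  antipode_r : antipode ∘ₕ r = r
  comul_r : comul ∘ₕ r = convList mul unit (n := 2) [swap K 1 1 ∘ₕ R, R, r ⊗ₕ r]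

/-- `R_21 = R` -/
def QuasiTriangularQuasiHopf.IsTriangular {K : Type*} [Field K] (H : QuasiTriangularQuasiHopf K) :
    Prop := swap K 1 1 ∘ₕ H.R = H.R

/-- `P Δ = Δ` -/
def QuasiBialgebra.IsCocommutative {K : Type*} [Field K] (H : QuasiBialgebra K) : Prop :=
  swap K 1 1 ∘ₕ H.comul = H.comul

/-- `μ (id ⊗ x) = μ (x ⊗ id)` for all `x : 0 → 1` -/
def QuasiBialgebra.IsSpecial {K : Type*} [Field K] (H : QuasiBialgebra K) : Prop :=
  ∀ x : HatA K 0 1, H.mul ∘ₕ (idn K 1 ⊗ₕ x) = H.mul ∘ₕ (x ⊗ₕ idn K 1 : HatA K 1 2)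

section kohnoDrinfeld

/-- The relations of the Kohno–Drinfeld Lie algebra. -/
def KDRel (K : Type*) [Field K] (n : ℕ) : Set (FreeLieAlgebra K {q : Fin n × Fin n // q.1 ≠ q.2}) :=
  {x | ∃ (i j : Fin n) (h : i ≠ j), x = .of K ⟨(i, j), h⟩ - .of K ⟨(j, i), h.symm⟩} ∪
  {x | ∃ (i j k : Fin n) (hij : i ≠ j) (hik : i ≠ k) (hjk : j ≠ k),
    x = ⁅FreeLieAlgebra.of K (⟨(i, j), hij⟩ : {q : Fin n × Fin n // q.1 ≠ q.2}),
      .of K ⟨(i, k), hik⟩ + .of K ⟨(j, k), hjk⟩⁆} ∪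
  {x | ∃ (i j k l : Fin n) (hij : i ≠ j) (hkl : k ≠ l), i ≠ k ∧ i ≠ l ∧ j ≠ k ∧ j ≠ l ∧
    x = ⁅FreeLieAlgebra.of K (⟨(i, j), hij⟩ : {q : Fin n × Fin n // q.1 ≠ q.2}),
      .of K ⟨(k, l), hkl⟩⁆}

/-- The Kohno–Drinfeld Lie algebra `t_n`. -/
abbrev KD (K : Type*) [Field K] (n : ℕ) : Type _ :=
  FreeLieAlgebra K {q : Fin n × Fin n // q.1 ≠ q.2} ⧸
    LieSubmodule.lieSpan K (FreeLieAlgebra K {q : Fin n × Fin n // q.1 ≠ q.2}) (KDRel K n)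

/-- The universal enveloping algebra `U(t_n)`. -/
abbrev UKD (K : Type*) [Field K] (n : ℕ) : Type _ := UniversalEnvelopingAlgebra K (KD K n)

variable (K : Type*) [Field K]

/-- The generator `t_{ij}`, with indices from `0` to `n - 1`. -/
noncomputable def tgen (n : ℕ) (i j : Fin n) (h : i ≠ j := by decide) : UKD K n :=
  UniversalEnvelopingAlgebra.ι K (LieSubmodule.Quotient.mk (FreeLieAlgebra.of K ⟨(i, j), h⟩) : KD K n)

variable {K} {B : Type*} [Ring B] [Algebra K B]

/-- A formal power series in two non-commuting variables `X`, `Y` is given by its coefficients, a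
function of words in the letters `0` (for `X`) and `1` (for `Y`). `subs φ a b` is `φ(h a, h b)`,
where `h` is a central variable. Since the relations of `t_n` are homogeneous, `t_{ij} ↦ h t_{ij}`
embeds the degree completion of `U(t_n)` into `U(t_n)[[h]]`, so that identities between series in
the completion may be stated there. -/
noncomputable def subs (φ : List (Fin 2) → K) (a b : B) : PowerSeries B :=
  PowerSeries.mk fun k => ∑ w : Fin k → Fin 2,
    φ (List.ofFn w) • ((List.ofFn w).map ![a, b]).prod

variable (K) in
/-- `exp(h a)` -/
noncomputable def expSeries (a : B) : PowerSeries B :=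
  PowerSeries.mk fun k => ((k.factorial : K)⁻¹) • a ^ k

/-- The terms of the coproduct of a word in the primitive variables `X`, `Y`. -/
def coprodWord : List (Fin 2) → List (List (Fin 2) × List (Fin 2))
  | [] => [([], [])]
  | x :: w => (coprodWord w).map (fun q => (x :: q.1, q.2)) ++
      (coprodWord w).map (fun q => (q.1, x :: q.2))

/-- `ε(φ) = 1` and `Δ(φ) = φ ⊗ φ`, where the latter compares the coefficients of `u ⊗ v`. -/
def IsGroupLike (φ : List (Fin 2) → K) : Prop :=
  φ [] = 1 ∧ ∀ u v : List (Fin 2), φ u * φ v =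
    ∑ w : Fin (u.length + v.length) → Fin 2,
      φ (List.ofFn w) * ((coprodWord (List.ofFn w)).count (u, v) : K)

/-- Drinfeld associators: group-like series that satisfy the pentagon and the two hexagon equations.
The inverses exist because the series have constant term `1`. -/
structure IsDrinfeldAssociator (φ : List (Fin 2) → K) : Prop where
  groupLike : IsGroupLike φ
  pentagon :
    subs φ (tgen K 4 0 1) (tgen K 4 1 2 + tgen K 4 1 3) * subs φ (tgen K 4 0 2 + tgen K 4 1 2) (tgen K 4 2 3)
      = subs φ (tgen K 4 1 2) (tgen K 4 2 3) *
        subs φ (tgen K 4 0 1 + tgen K 4 0 2) (tgen K 4 1 3 + tgen K 4 2 3) *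
        subs φ (tgen K 4 0 1) (tgen K 4 1 2)
  hexagon_left :
    expSeries K ((2⁻¹ : K) • (tgen K 3 0 2 + tgen K 3 1 2))
      = subs φ (tgen K 3 0 2) (tgen K 3 0 1) * expSeries K ((2⁻¹ : K) • tgen K 3 0 2) *
        Ring.inverse (subs φ (tgen K 3 0 2) (tgen K 3 1 2)) * expSeries K ((2⁻¹ : K) • tgen K 3 1 2) *
        subs φ (tgen K 3 0 1) (tgen K 3 1 2)
  hexagon_right :
    expSeries K ((2⁻¹ : K) • (tgen K 3 0 1 + tgen K 3 0 2))
      = Ring.inverse (subs φ (tgen K 3 1 2) (tgen K 3 0 2)) * expSeries K ((2⁻¹ : K) • tgen K 3 0 2) *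
        subs φ (tgen K 3 0 1) (tgen K 3 0 2) * expSeries K ((2⁻¹ : K) • tgen K 3 0 1) *
        Ring.inverse (subs φ (tgen K 3 0 1) (tgen K 3 1 2))

end kohnoDrinfeld

section theElements
variable {K : Type*} [Field K]

/-- `φ(a, b)` in the algebra of morphisms `0 → n` with the convolution product, for `a` and `b`
without part of degree `0`: only words of length at most `k` contribute in degree `k`. -/
noncomputable def evalSeries (φ : List (Fin 2) → K) {n : ℕ} (a b : HatA K 0 n) : HatA K 0 n :=
  ⟨fun k => ∑ j ∈ Finset.range (k + 1), ∑ w : Fin j → Fin 2,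
      φ (List.ofFn w) • (convList (mu K) (eta K) ((List.ofFn w).map ![a, b])).1 k,
    fun k _ => Submodule.sum_mem _ fun _ _ => Submodule.sum_mem _ fun _ _ =>
      Submodule.smul_mem _ _ (HatA.coe_mem _ k)⟩

/-- `exp_*(x)`, for `x` without part of degree `0`. -/
noncomputable def expConv {n : ℕ} (x : HatA K 0 n) : HatA K 0 n :=
  ⟨fun k => ∑ j ∈ Finset.range (k + 1),
      ((j.factorial : K)⁻¹) • (convList (mu K) (eta K) (List.replicate j x)).1 k,
    fun k _ => Submodule.sum_mem _ fun _ _ => Submodule.smul_mem _ _ (HatA.coe_mem _ k)⟩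

variable (K) in
/-- `c_12 = (id ⊗ id ⊗ η) c` -/
noncomputable def c12 : HatA K 0 3 := (idn K 1 ⊗ₕ idn K 1 ⊗ₕ eta K : HatA K 2 3) ∘ₕ cas K

variable (K) in
/-- `c_23 = (η ⊗ id ⊗ id) c` -/
noncomputable def c23 : HatA K 0 3 := (eta K ⊗ₕ idn K 1 ⊗ₕ idn K 1 : HatA K 2 3) ∘ₕ cas K

/-- `φ(c_12, c_23) : 0 → 3` -/
noncomputable def assocElt (φ : List (Fin 2) → K) : HatA K 0 3 := evalSeries φ (c12 K) (c23 K)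

/-- `ν : 0 → 1` is the convolution inverse of `μ^{[3]} (id ⊗ S ⊗ id) φ(c_12, c_23)`. -/
def IsNu (φ : List (Fin 2) → K) (ν : HatA K 0 1) : Prop :=
  IsConvInv (mu K) (eta K) ν (mulIter (mu K) (eta K) 3 ∘ₕ
    (idn K 1 ⊗ₕ anti K ⊗ₕ idn K 1 : HatA K 3 3) ∘ₕ assocElt φ)

end theElements

end JacobiHB

open JacobiHB

/-! The structure maps `mu`, `eta`, `Delta`, `eps`, `anti` are single diagrams without chords. They
compose by substituting words for beads, so the Hopf algebra axioms among them are equalities of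
words. The remaining data are morphisms `0 → n`, that is, series of chord diagrams without beads.
Under convolution the spaces `A K 0 n` are `K`-algebras (`instRingA`), and `toPS` embeds the
completed morphisms, graded by the number of chords, into power series over them.

Transport of the associator. Chords satisfy the Kohno–Drinfeld relations by 4T (`chord_fourT`),
which gives an algebra homomorphism `chordHom` from `U(t_n)` to `A K 0 n`. Inserting, deleting,
doubling and permuting strands is also an algebra homomorphism (`pull`), and it sends a chord to the
sum over all copies of its two ends (`pull_chord`). Hence the pentagon and the hexagons for `φ`
become the corresponding axioms, and deleting strands in the pentagon gives `φ(t, 0) = 1 = φ(0, t)`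
for a chord `t`.

Chords slide through beads. All chords of a subdiagram may be conjugated simultaneously by one bead.
If the same bead lies on every arc, the subdiagram passes through it. Therefore every `x : 0 → n`
commutes with the iterated coproduct (`comp_mu_bead`). As `Delta` is strictly coassociative and
cocommutative, this yields quasi-coassociativity and `R * Δ * R⁻¹ = PΔ`; for `n = 1` it is
specialness. On one arc a subdiagram with no chords to the outside passes all beads
(`cls_slide_beads`), so `A K 0 1` is commutative (`mul_comm_one`), axiom 3 reduces to cancellation
of beads, and `α`, `β` come out of axiom 4 as factors (`comp_prodWord_five`).

The two contractions. Let `M` be `φ` evaluated along `x₀ x₁⁻¹ x₂`, and `M'` be `φ⁻¹` evaluated along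
`x₀⁻¹ x₁ x₂⁻¹`. Axiom 4 then reads `β α M = 1` and `α β M' = 1`. With `α = ν β⁻¹` and `ν = M⁻¹` both
follow from commutativity and `M = M'`. The last equality is `act_zigzag`: move `φ ⊗ η` to the other
side of the pentagon and evaluate along `x₀⁻¹ x₁ x₂⁻¹ x₃`. In each of the three factors with a
doubled strand the two copies cancel, so that factor becomes `φ` with a strand deleted, which is
`1`. What remains is `M = M'`.

The ribbon element. Doubling the arc of an isolated chord gives the two isolated chords and twice
the chord between the arcs. These commute, again by 4T (`chord_self_commute`), so the exponential
factors.

Behind these computations lies the compatibility of composition with sums over placements of chord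
ends. Only chordless outer diagrams are needed for it: `comp_comp` and `comp_juxt_tens`. The former
rests on `cabL_dist`, which says that distributing chord ends over copies in two stages is the same
as doing it in one. -/

namespace JacobiHB

/-! ### Separating the labels of chords. -/

section relabelling
variable {K : Type*} [Field K] {m m' n n' p : ℕ}

/-- The chords of the two words have different labels. -/
def Disj (u : Word m n) (v : Word m' n') : Prop := ∀ e ∈ u.ends, ∀ d ∈ v.ends, e.1 ≠ d.1

theorem mapEnds_congr {τ τ' : ℕ × Bool → ℕ × Bool} {w : Word m n}
    (h : ∀ e ∈ w.ends, τ e = τ' e) : w.mapEnds τ = w.mapEnds τ' := by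
  funext i
  refine List.map_congr_left fun x hx => ?_
  rcases x with _ | e
  · rfl
  · simp [Letter.mapEnd, h e (mem_ends.2 ⟨i, hx⟩)]

theorem isChordDiagram_of_ends_eq_empty {w : Word m n} (h : w.ends = ∅) : w.IsChordDiagram := by
  have : ∀ e, w.endCount e = 0 := fun e => by
    by_contra h'
    have := mem_ends_iff.2 h'
    simp [h] at this
  intro p
  simp [this]

/-- The injection which separates the labels of a set from the others. -/
theorem exists_separate {u : Word m n} {v : Word m' n'} (h : Disj u v) :
    ∃ σ : ℕ → ℕ, Function.Injective σ ∧ u.mapEnds even = u.mapEnds (relabelEnd σ fun _ => false) ∧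
      v.mapEnds odd = v.mapEnds (relabelEnd σ fun _ => false) := by
  classical
  -- Parity tells the two branches apart, whence injectivity. Disjointness puts all labels of `v`
  -- into the odd branch, so `even` on `u` and `odd` on `v` are restrictions of one injection.
  refine ⟨fun x => if x ∈ u.ends.image Prod.fst then 2 * x else 2 * x + 1, ?_, ?_, ?_⟩
  · intro a b h
    simp only at h
    split_ifs at h <;> omega
  · refine mapEnds_congr fun e he => ?_
    have : e.1 ∈ u.ends.image Prod.fst := Finset.mem_image_of_mem _ he
    simp only [even, relabelEnd, this, if_true]
  · refine mapEnds_congr fun e he => ?_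
    have : e.1 ∉ u.ends.image Prod.fst := by
      intro h'
      obtain ⟨d, hd, hde⟩ := Finset.mem_image.1 h'
      exact h d hd e he hde
    simp only [odd, relabelEnd, this, if_false]

/-- The even/odd relabelling built into `compWord` only serves to separate labels. For disjoint
words it comes from a single injection applied to both, and classes do not see the names of chords.
-/
theorem compWord_of_disj {V : Word n p} {w : Word m n} (h : Disj V w) :
    compWord K V w = clsL K (glue K V w) := by
  obtain ⟨σ, hσ, h1, h2⟩ := exists_separate h
  rw [compWord, h1, h2, glue_mapEnds (relabelEnd_injective hσ _), clsL_mapEndsL hσ]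

theorem comp_cls_of_disj {V : Word n p} {w : Word m n} (hV : V.IsChordDiagram)
    (hw : w.IsChordDiagram) (h : Disj V w) : comp (cls K V) (cls K w) = clsL K (glue K V w) := by
  rw [comp_cls hV hw, compWord_of_disj h]

/-- Juxtaposition without change of the labels. -/
def juxt (u : Word m n) (v : Word m' n') : Word (m + m') (n + n') :=
  Fin.append (u.mapGens (Fin.castAdd m')) (v.mapGens (Fin.natAdd m))

theorem tens_cls_of_disj {u : Word m n} {v : Word m' n'} (hu : u.IsChordDiagram)
    (hv : v.IsChordDiagram) (h : Disj u v) : tens (cls K u) (cls K v) = cls K (juxt u v) := by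
  obtain ⟨σ, hσ, h1, h2⟩ := exists_separate h
  rw [tens_cls hu hv, tensWord_eq, h1, h2, ← mapGens_mapEnds, ← mapGens_mapEnds, ← append_mapEnds,
    cls_mapEnds hσ]
  rfl

theorem endCount_mapGens (φ : Fin m → Fin m') (w : Word m n) (e : ℕ × Bool) :
    (w.mapGens φ).endCount e = w.endCount e := by
  unfold Word.endCount Word.mapGens
  refine Finset.sum_congr rfl fun i _ => ?_
  induction w i with
  | nil => rfl
  | cons x l ih => cases x <;> simp [List.count_cons, ih, Letter.mapGen]

theorem endCount_juxt (u : Word m n) (v : Word m' n') (e : ℕ × Bool) :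
    (juxt u v).endCount e = u.endCount e + v.endCount e := by
  rw [← endCount_mapGens (Fin.castAdd m') u, ← endCount_mapGens (Fin.natAdd m) v]
  simp [Word.endCount, juxt, Fin.sum_univ_add]

theorem ends_juxt (u : Word m n) (v : Word m' n') : (juxt u v).ends = u.ends ∪ v.ends := by
  ext e
  simp only [Finset.mem_union, mem_ends_iff, endCount_juxt]
  omega

theorem isChordDiagram_juxt {u : Word m n} {v : Word m' n'} (hu : u.IsChordDiagram)
    (hv : v.IsChordDiagram) (h : Disj u v) : (juxt u v).IsChordDiagram := by
  intro p
  have h1 := hu p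
  have h2 := hv p
  simp only [endCount_juxt]
  by_cases hp : u.endCount (p, true) = 0
  · omega
  · have : v.endCount (p, true) = 0 := by
      by_contra h'
      exact h _ (mem_ends_iff.2 hp) _ (mem_ends_iff.2 h') rfl
    omega

theorem juxt_of_ends_eq_empty {u : Word m n} {v : Word m' n'} (hu : u.ends = ∅) (hv : v.ends = ∅) :
    (juxt u v).ends = ∅ := by rw [ends_juxt, hu, hv]; rfl

/-- Identities between multilinear operations are reduced with this to words that are genuine chord
diagrams, whose labels can then be chosen disjoint. -/
theorem A_induction {P : A K m n → Prop} (x : A K m n)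
    (hc : ∀ w : Word m n, w.IsChordDiagram → P (cls K w)) (h0 : P 0)
    (hadd : ∀ x y, P x → P y → P (x + y)) (hsmul : ∀ (c : K) x, P x → P (c • x)) : P x := by
  obtain ⟨v, rfl⟩ := Submodule.Quotient.mk_surjective _ x
  induction v using Finsupp.induction_linear with
  | zero => exact h0
  | add f g hf hg => rw [Submodule.Quotient.mk_add]; exact hadd _ _ hf hg
  | single w a =>
    have : (Finsupp.single w a : Diag m n →₀ K) = a • Finsupp.single w 1 := by simp
    rw [this, Submodule.Quotient.mk_smul]
    have h := hc w.1 w.2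
    rw [cls, dif_pos w.2] at h
    exact hsmul _ _ h

theorem A_hom_ext {M : Type*} [AddCommGroup M] [Module K M] {f g : A K m n →ₗ[K] M}
    (h : ∀ w : Word m n, w.IsChordDiagram → f (cls K w) = g (cls K w)) (x : A K m n) :
    f x = g x := by
  induction x using A_induction with
  | hc w hw => exact h w hw
  | h0 => simp
  | hadd x y hx hy => rw [map_add, map_add, hx, hy]
  | hsmul c x hx => rw [map_smul, map_smul, hx]

/-- Multiply the labels by `a` and add `b`. -/
def Word.affine (a b : ℕ) (w : Word m n) : Word m n :=
  w.mapEnds (relabelEnd (fun k => (a + 1) * k + b) fun _ => false)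

theorem affine_injective (a b : ℕ) : Function.Injective fun k : ℕ => (a + 1) * k + b :=
  fun x y h => by simpa using h

theorem cls_affine (a b : ℕ) (w : Word m n) : cls K (w.affine a b) = cls K w :=
  cls_mapEnds (affine_injective a b) _ w

theorem isChordDiagram_affine {a b : ℕ} {w : Word m n} (h : w.IsChordDiagram) :
    (w.affine a b).IsChordDiagram := (isChordDiagram_mapEnds (affine_injective a b) _ w).2 h

theorem mod_of_mem_ends_affine {a b : ℕ} {w : Word m n} {e : ℕ × Bool} (h : e ∈ (w.affine a b).ends) :
    e.1 % (a + 1) = b % (a + 1) := by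
  rw [Word.affine, ends_mapEnds] at h
  obtain ⟨d, -, rfl⟩ := Finset.mem_image.1 h
  simp [relabelEnd]

/-- Labels in different residue classes modulo `a + 1` differ, so `a + 1` words can be made pairwise
disjoint without changing their classes. -/
theorem disj_affine {a b c : ℕ} (u : Word m n) (v : Word m' n') (h : b % (a + 1) ≠ c % (a + 1)) :
    Disj (u.affine a b) (v.affine a c) := by
  intro e he d hd h'
  rw [← mod_of_mem_ends_affine he, ← mod_of_mem_ends_affine hd, h'] at h
  exact h rfl

theorem disj_of_ends_eq_empty_left {u : Word m n} (h : u.ends = ∅) (v : Word m' n') : Disj u v := by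
  simp [Disj, h]

theorem disj_of_ends_eq_empty_right {v : Word m' n'} (h : v.ends = ∅) (u : Word m n) :
    Disj u v := by
  simp [Disj, h]

end relabelling

/-! ### Composites in which no sum over placements occurs. -/

section substitution
variable {K : Type*} [Field K] {m m' n n' p : ℕ}

/-- Reversal of a bead. -/
def Letter.flip : Letter m → Letter m
  | .gen i s => .gen i (!s)
  | .cend e => .cend e

/-- What a letter is replaced with when the words `w` are substituted for the beads. -/
def Letter.fill (w : Word m n) : Letter n → List (Letter m)
  | .gen j true => w j
  | .gen j false => (w j).reverse.map Letter.flip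
  | .cend e => [.cend e]

/-- Substitution of the words `w` for the beads. -/
def Word.fill (V : Word n p) (w : Word m n) : Word m p := fun i => (V i).flatMap (Letter.fill w)

/-- The copied chord ends in a cabled diagram. -/
def copyEnds (L : List (Fin p × CabLetter m)) : List (ℕ × Bool) :=
  L.filterMap fun q => match q.2 with
    | .keep _ => none
    | .copy e _ => some e

/-- The copied chord ends are kept. -/
def CabLetter.resolve : CabLetter m → Letter m
  | .keep l => l
  | .copy e _ => .cend e

variable (K) in
/-- The sign of a letter. -/
def CabLetter.sign : CabLetter m → K
  | .keep _ => 1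
  | .copy _ s => sgn K s

/-- An end without any copy cannot be placed, so the sum over placements is empty. -/
theorem distribute_eq_zero {S : Finset (ℕ × Bool)} {e : ℕ × Bool} (he : e ∈ S)
    {L : List (Fin p × CabLetter m)} (hL : e ∉ copyEnds L) : distribute K S L = 0 := by
  induction L generalizing S with
  | nil => rw [distribute, if_neg (Finset.ne_empty_of_mem he)]
  | cons x L ih =>
    obtain ⟨i, l | ⟨d, s⟩⟩ := x
    · rw [distribute_keep_cons, ih he (by simpa [copyEnds] using hL), map_zero]
    · simp only [copyEnds, List.filterMap_cons, List.mem_cons, not_or] at hL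
      rw [distribute_copy_cons, ih he hL.2]
      split_ifs
      · rw [ih (Finset.mem_erase.2 ⟨hL.1, he⟩) hL.2]; simp
      · simp

/-- When every end has only one copy there is a single placement. In the inductive step the summand
that omits the copy vanishes by `distribute_eq_zero`. -/
theorem distribute_nodup (L : List (Fin p × CabLetter m)) (h : (copyEnds L).Nodup) :
    distribute K (copyEnds L).toFinset L = (L.map fun q => q.2.sign K).prod •
      Finsupp.single (preL (L.map fun q => (q.1, q.2.resolve)) fun _ => []) 1 := by
  induction L with
  | nil => simp [distribute, copyEnds, preL]
  | cons x L ih =>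
    obtain ⟨i, l | ⟨d, s⟩⟩ := x
    · have e1 : copyEnds ((i, .keep l) :: L) = copyEnds L := rfl
      rw [e1] at h ⊢
      rw [distribute_keep_cons, ih h, map_smul, pre_single]
      simp [CabLetter.sign, CabLetter.resolve, preL]
    · have e1 : copyEnds ((i, .copy d s) :: L) = d :: copyEnds L := rfl
      rw [e1] at h ⊢
      obtain ⟨h1, h2⟩ := List.nodup_cons.1 h
      have e2 : (List.toFinset (d :: copyEnds L)).erase d = (copyEnds L).toFinset := by
        rw [List.toFinset_cons, Finset.erase_insert (by simpa using h1)]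
      rw [distribute_copy_cons_of_mem _ _ _ (by simp), e2, ih h2,
        distribute_eq_zero (e := d) (by simp) h1, zero_add, map_smul, pre_single, smul_smul]
      simp [CabLetter.sign, CabLetter.resolve, preL]

theorem resolve_flip (x : CabLetter m) (hx : IsInner x) : x.flip.resolve = x.resolve.flip := by
  rcases x with (_ | _) | _
  · rfl
  · exact hx.elim
  · rfl

theorem resolve_ofLetter (x : Letter m) : (CabLetter.ofLetter x).resolve = x := by cases x <;> rfl

theorem map_resolve_expand (w : Word m n) (x : Letter n) :
    (expand w x).map CabLetter.resolve = x.fill w := by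
  rcases x with ⟨j, _ | _⟩ | e
  · simp only [expand, Letter.fill, List.map_map, ← List.map_reverse]
    refine List.map_congr_left fun x _ => ?_
    simp [resolve_flip _ (isInner_ofLetter x), resolve_ofLetter]
  · simp only [expand, Letter.fill, List.map_map]
    conv_rhs => rw [← List.map_id (w j)]
    exact List.map_congr_left fun x _ => resolve_ofLetter x
  · rfl

theorem filter_cable (V : Word n p) (w : Word m n) (i : Fin p) :
    (cable V w).filter (fun q => q.1 = i) = ((V i).flatMap (expand w)).map (Prod.mk i) := by
  rw [cable, List.filter_flatMap]
  have : ∀ j, List.filter (fun q : Fin p × CabLetter m => decide (q.1 = i))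
      (((V j).flatMap (expand w)).map (Prod.mk j))
      = if j = i then ((V j).flatMap (expand w)).map (Prod.mk j) else [] := by
    intro j
    split_ifs with h
    · rw [List.filter_eq_self]; simp; rintro _ _ _ _ _ _ rfl _; exact h
    · rw [List.filter_eq_nil_iff]; simp; rintro _ _ _ _ _ _ rfl _; exact h
  simp only [this]
  have key : ∀ l : List (Fin p), l.Nodup → i ∈ l → (l.flatMap fun j => if j = i then
      ((V j).flatMap (expand w)).map (Prod.mk j) else [])
      = ((V i).flatMap (expand w)).map (Prod.mk i) := by
    intro l hl hi
    induction l with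
    | nil => simp at hi
    | cons a l ih =>
      obtain ⟨h1, h2⟩ := List.nodup_cons.1 hl
      rw [List.flatMap_cons]
      by_cases h : a = i
      · subst h
        rw [if_pos rfl]
        have : (l.flatMap fun j => if j = a then
          ((V j).flatMap (expand w)).map (Prod.mk j) else []) = [] := by
          rw [List.flatMap_eq_nil_iff]
          intro j hj
          rw [if_neg]
          rintro rfl
          exact h1 hj
        rw [this, List.append_nil]
      · rw [if_neg h, List.nil_append]
        exact ih h2 ((List.mem_cons.1 hi).resolve_left (Ne.symm h))
  exact key _ (List.nodup_finRange p) (List.mem_finRange i)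

theorem preL_cable (V : Word n p) (w : Word m n) :
    preL ((cable V w).map fun q => (q.1, q.2.resolve)) (fun _ => []) = V.fill w := by
  funext i
  rw [preL_apply, List.append_nil, List.filter_map, List.map_map]
  have := filter_cable V w i
  simp only [Function.comp_def]
  rw [this, List.map_map, List.map_flatMap, Word.fill]
  simp only [List.flatMap_def]
  congr 1
  exact List.map_congr_left fun x _ => (by
    rw [← map_resolve_expand]; rfl)

/-- The ends on an arc. -/
def endList (l : List (Letter m)) : List (ℕ × Bool) := l.filterMap Letter.end?

theorem endList_gen_cons (j : Fin m) (s : Bool) (l : List (Letter m)) :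
    endList (.gen j s :: l) = endList l := rfl

theorem endList_cend_cons (e : ℕ × Bool) (l : List (Letter m)) :
    endList (.cend e :: l) = e :: endList l := rfl

/-- The beads of a word, with the orientations. -/
def Word.beads (V : Word n p) : List (Fin n × Bool) :=
  (List.finRange p).flatMap fun i => (V i).filterMap fun x => match x with
    | .gen j s => some (j, s)
    | .cend _ => none

theorem copyEnds_append (L L' : List (Fin p × CabLetter m)) :
    copyEnds (L ++ L') = copyEnds L ++ copyEnds L' := List.filterMap_append

theorem copyEnds_flatMap {α : Type*} (l : List α) (f : α → List (Fin p × CabLetter m)) :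
    copyEnds (l.flatMap f) = l.flatMap fun a => copyEnds (f a) := by
  induction l with
  | nil => rfl
  | cons a l ih => rw [List.flatMap_cons, List.flatMap_cons, copyEnds_append, ih]

theorem copyEnds_map_ofLetter (i : Fin p) (l : List (Letter m)) :
    copyEnds ((l.map CabLetter.ofLetter).map (Prod.mk i)) = endList l := by
  induction l with
  | nil => rfl
  | cons x l ih =>
    cases x with
    | gen => exact ih
    | cend => rw [endList_cend_cons, ← ih]; rfl

theorem copyEnds_map_flip (i : Fin p) (l : List (CabLetter m)) :
    copyEnds ((l.map CabLetter.flip).map (Prod.mk i)) = copyEnds (l.map (Prod.mk i)) := by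
  induction l with
  | nil => rfl
  | cons x l ih =>
    rcases x with (_ | _) | _ <;> simpa [copyEnds, CabLetter.flip] using ih

theorem copyEnds_expand_gen (w : Word m n) (i : Fin p) (j : Fin n) (s : Bool) :
    copyEnds ((expand w (.gen j s)).map (Prod.mk i))
      = if s then endList (w j) else (endList (w j)).reverse := by
  cases s
  · rw [expand, copyEnds_map_flip, ← List.map_reverse, copyEnds_map_ofLetter]
    simp [endList, List.filterMap_reverse]
  · rw [expand, copyEnds_map_ofLetter]; rfl

theorem copyEnds_cable (V : Word n p) (w : Word m n) : copyEnds (cable V w)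
    = V.beads.flatMap fun q => if q.2 then endList (w q.1) else (endList (w q.1)).reverse := by
  rw [cable_eq, copyEnds_flatMap, Word.beads, List.flatMap_assoc]
  congr 1; funext i
  rw [copyEnds_flatMap]
  induction V i with
  | nil => rfl
  | cons x l ih =>
    rw [List.flatMap_cons, ih]
    rcases x with ⟨j, s⟩ | e
    · rw [copyEnds_expand_gen]; rfl
    · rfl

theorem sign_expand_gen (w : Word m n) (i : Fin p) (j : Fin n) (s : Bool) :
    (((expand w (.gen j s)).map (Prod.mk i)).map fun q => q.2.sign K).prod
      = sgn K s ^ (endList (w j)).length := by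
  have h1 : ∀ l : List (Letter m),
      (((l.map CabLetter.ofLetter).map (Prod.mk i)).map fun q => q.2.sign K).prod = 1 := by
    intro l
    induction l with
    | nil => rfl
    | cons x l ih => cases x <;> simpa [CabLetter.sign, CabLetter.ofLetter, sgn] using ih
  have h2 : ∀ l : List (Letter m),
      ((((l.map CabLetter.ofLetter).map CabLetter.flip).map (Prod.mk i)).map
        fun q => q.2.sign K).prod = (-1) ^ (endList l).length := by
    intro l
    induction l with
    | nil => simp [endList]
    | cons x l ih =>
      cases x with
      | gen => simpa [CabLetter.sign, CabLetter.ofLetter, CabLetter.flip, endList_gen_cons] using ih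
      | cend =>
        rw [endList_cend_cons, List.length_cons, pow_succ', ← ih]
        simp [CabLetter.sign, CabLetter.ofLetter, CabLetter.flip, sgn]
  cases s
  · rw [expand, ← List.map_reverse, h2]
    simp [endList, List.filterMap_reverse, sgn]
  · rw [expand, h1]; simp [sgn]

theorem sign_cable (V : Word n p) (w : Word m n) : ((cable V w).map fun q => q.2.sign K).prod
    = (V.beads.map fun q => sgn K q.2 ^ (endList (w q.1)).length).prod := by
  rw [cable_eq, Word.beads]
  generalize List.finRange p = l
  induction l with
  | nil => rfl
  | cons i l ih =>
    rw [List.flatMap_cons, List.map_append, List.prod_append, ih, List.flatMap_cons,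
      List.map_append, List.prod_append]
    congr 1
    induction V i with
    | nil => rfl
    | cons x l ih =>
      rw [List.flatMap_cons, List.map_append, List.prod_append, ih]
      rcases x with ⟨j, s⟩ | e
      · rw [sign_expand_gen]; simp
      · simp [expand, CabLetter.sign]

theorem mem_endList {l : List (Letter m)} {e : ℕ × Bool} : e ∈ endList l ↔ .cend e ∈ l := by
  simp only [endList, List.mem_filterMap]
  constructor
  · rintro ⟨_ | d, h, h'⟩
    · simp [Letter.end?] at h'
    · simp only [Letter.end?, Option.some.injEq] at h'
      exact h' ▸ h
  · exact fun h => ⟨_, h, rfl⟩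

theorem endList_eq_nil {w : Word m n} (h : w.ends = ∅) (j : Fin n) : endList (w j) = [] := by
  rw [List.eq_nil_iff_forall_not_mem]
  intro e he
  have : e ∈ w.ends := mem_ends.2 ⟨j, mem_endList.1 he⟩
  simp [h] at this

/-- There are no ends to distribute, so cabling is plain substitution, however often the beads of
`V` are repeated. -/
theorem glue_of_inner_ends_eq_empty (V : Word n p) {w : Word m n} (h : w.ends = ∅) :
    glue K V w = Finsupp.single (V.fill w) 1 := by
  have h1 : copyEnds (cable V w) = [] := by
    rw [copyEnds_cable, List.flatMap_eq_nil_iff]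
    intro q _
    simp [endList_eq_nil h]
  have := distribute_nodup (K := K) (cable V w) (by simp [h1])
  rw [h1, List.toFinset_nil, sign_cable, preL_cable] at this
  rw [glue, h, this]
  simp [endList_eq_nil h]

theorem count_endList (l : List (Letter m)) (e : ℕ × Bool) :
    (endList l).count e = l.count (.cend e) := by
  induction l with
  | nil => rfl
  | cons x l ih =>
    cases x with
    | gen => simpa [endList_gen_cons] using ih
    | cend d =>
      rw [endList_cend_cons, List.count_cons, List.count_cons, ih]
      simp

/-- Each bead occurs exactly once, with the orientation given by `τ`. -/
def Word.IsLinear (V : Word n p) (τ : Fin n → Bool) : Prop :=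
  V.beads.Perm ((List.finRange n).map fun k => (k, τ k))

variable (K) in
/-- The sign of reversing the arcs `k` with `τ k = false`. -/
def revSign (τ : Fin n → Bool) (w : Word m n) : K :=
  ((List.finRange n).map fun k => sgn K (τ k) ^ (endList (w k)).length).prod

/-- Each arc of `w` is copied exactly once, hence so is each chord end, and `distribute_nodup`
applies. The sign counts the ends lying on reversed arcs. -/
theorem glue_of_isLinear {V : Word n p} {τ : Fin n → Bool} (hV : V.IsLinear τ) {w : Word m n}
    (hw : w.IsChordDiagram) :
    glue K V w = revSign K τ w • Finsupp.single (V.fill w) 1 := by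
  have h1 : (copyEnds (cable V w)).Perm ((List.finRange n).flatMap fun k =>
      if τ k then endList (w k) else (endList (w k)).reverse) := by
    rw [copyEnds_cable]
    refine (List.Perm.flatMap_right _ hV).trans ?_
    rw [List.flatMap_map]
  have hcount : ∀ e, (copyEnds (cable V w)).count e = w.endCount e := by
    intro e
    rw [h1.count_eq, List.count_flatMap, Word.endCount, ← List.ofFn_eq_map, List.sum_ofFn]
    refine Finset.sum_congr rfl fun k _ => ?_
    simp only [Function.comp]
    split_ifs
    · rw [count_endList]
    · rw [List.count_reverse, count_endList]
  have h2 : (copyEnds (cable V w)).Nodup := by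
    rw [List.nodup_iff_count_le_one]
    intro e
    rw [hcount]
    have := hw e.1
    rcases e with ⟨q, _ | _⟩ <;> simp only at this ⊢ <;> omega
  have h3 : (copyEnds (cable V w)).toFinset = w.ends := by
    ext e
    rw [List.mem_toFinset, mem_ends_iff, ← hcount, ← List.count_pos_iff]
    omega
  have := distribute_nodup (K := K) (cable V w) h2
  rw [h3, sign_cable, preL_cable, (hV.map _).prod_eq, List.map_map] at this
  exact this

theorem revSign_true (w : Word m n) : revSign K (fun _ => true) w = 1 := by
  simp [revSign, sgn]

theorem comp_cls_inner {V : Word n p} {w : Word m n} (hV : V.IsChordDiagram) (h : w.ends = ∅) :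
    comp (cls K V) (cls K w) = cls K (V.fill w) := by
  rw [comp_cls_of_disj hV (isChordDiagram_of_ends_eq_empty h) (disj_of_ends_eq_empty_right h V),
    glue_of_inner_ends_eq_empty V h, clsL_single]

theorem comp_cls_linear {V : Word n p} {τ : Fin n → Bool} (hV : V.IsLinear τ)
    (hV' : V.IsChordDiagram) {w : Word m n} (hw : w.IsChordDiagram) (h : Disj V w) :
    comp (cls K V) (cls K w) = revSign K τ w • cls K (V.fill w) := by
  rw [comp_cls_of_disj hV' hw h, glue_of_isLinear hV hw, map_smul, clsL_single]

theorem comp_cls_linear_pos {V : Word n p} (hV : V.IsLinear fun _ => true) (hV' : V.ends = ∅)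
    {w : Word m n} (hw : w.IsChordDiagram) : comp (cls K V) (cls K w) = cls K (V.fill w) := by
  rw [comp_cls_linear hV (isChordDiagram_of_ends_eq_empty hV') hw
    (disj_of_ends_eq_empty_left hV' w), revSign_true, one_smul]

end substitution
end JacobiHB

namespace JacobiHB

/-! ### Distribution of chord ends in stages; functoriality for chordless outer diagrams. -/

section distribution
variable {K : Type*} [Field K] {m n p q p' q' : ℕ}

/-- Lists of copies of chord ends, with arcs and signs. -/
abbrev CopyList (p : ℕ) : Type := List (Fin p × (ℕ × Bool) × Bool)

variable (K) in
/-- Distribution of chord ends for cabled diagrams without beads and without outer chords. -/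
noncomputable def dist (S : Finset (ℕ × Bool)) (L : CopyList p) : Word 0 p →₀ K :=
  distribute K S (L.map fun x => (x.1, .copy x.2.1 x.2.2))

theorem dist_nil (S : Finset (ℕ × Bool)) :
    dist K S ([] : CopyList p) = if S = ∅ then Finsupp.single (fun _ => []) 1 else 0 := rfl

theorem dist_cons_of_mem {S : Finset (ℕ × Bool)} (i : Fin p) {e : ℕ × Bool} (s : Bool)
    (L : CopyList p) (h : e ∈ S) : dist K S ((i, e, s) :: L)
      = dist K S L + sgn K s • pre K i [.cend e] (dist K (S.erase e) L) :=
  distribute_copy_cons_of_mem i s _ h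

theorem dist_cons_of_notMem {S : Finset (ℕ × Bool)} (i : Fin p) {e : ℕ × Bool} (s : Bool)
    (L : CopyList p) (h : e ∉ S) : dist K S ((i, e, s) :: L) = dist K S L :=
  distribute_copy_cons_of_notMem i s _ h

theorem dist_filter {P : ℕ × Bool → Bool} {S : Finset (ℕ × Bool)} (h : ∀ e ∈ S, P e = true)
    (L : CopyList p) : dist K S (L.filter fun x => P x.2.1) = dist K S L := by
  induction L generalizing S with
  | nil => rfl
  | cons x L ih =>
    obtain ⟨i, e, s⟩ := x
    have h' : ∀ d ∈ S.erase e, P d = true := fun d hd => h d (Finset.mem_of_mem_erase hd)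
    by_cases hP : P e = true
    · rw [List.filter_cons_of_pos (by simpa using hP)]
      by_cases he : e ∈ S
      · rw [dist_cons_of_mem _ _ _ he, dist_cons_of_mem _ _ _ he, ih h, ih h']
      · rw [dist_cons_of_notMem _ _ _ he, dist_cons_of_notMem _ _ _ he, ih h]
    · rw [List.filter_cons_of_neg (by simpa using hP),
        dist_cons_of_notMem _ _ _ (fun he => hP (h e he)), ih h]

theorem dist_eq_zero {S : Finset (ℕ × Bool)} {e : ℕ × Bool} (he : e ∈ S) {L : CopyList p}
    (hL : ∀ x ∈ L, x.2.1 ≠ e) : dist K S L = 0 := by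
  refine distribute_eq_zero he ?_
  intro h
  simp only [copyEnds, List.filterMap_map, List.mem_filterMap, Function.comp,
    Option.some.injEq] at h
  obtain ⟨x, hx, h⟩ := h
  exact hL x hx h

/-- Replace the label `b` by `a`. -/
def renameCopy (a b : ℕ × Bool) (x : Fin p × (ℕ × Bool) × Bool) : Fin p × (ℕ × Bool) × Bool :=
  (x.1, if x.2.1 = b then a else x.2.1, x.2.2)

/-- Each end is put on exactly one of its copies. Mark some copies of `a` by a new label `b`: either
`a` goes to an unmarked copy and the marked ones are dropped, or it goes to a marked copy and the
unmarked ones are dropped. -/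
theorem dist_split {S : Finset (ℕ × Bool)} {a b : ℕ × Bool} (ha : a ∈ S) (hb : b ∉ S)
    (L : CopyList p) : dist K S (L.map (renameCopy a b)) = dist K S (L.filter fun x => x.2.1 ≠ b)
      + dist K S ((L.filter fun x => x.2.1 ≠ a).map (renameCopy a b)) := by
  have hab : a ≠ b := fun h => hb (h ▸ ha)
  -- After `a` has been placed, copies labelled `a` or `b` no longer matter, so the three lists give
  -- the same result.
  have key : ∀ (T : Finset (ℕ × Bool)) (M : CopyList p), a ∉ T → b ∉ T →
      dist K T (M.map (renameCopy a b)) = dist K T (M.filter fun x => x.2.1 ≠ b) ∧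
      dist K T (M.map (renameCopy a b)) = dist K T ((M.filter fun x => x.2.1 ≠ a).map (renameCopy a b)) := by
    intro T M haT hbT
    induction M generalizing T with
    | nil => exact ⟨rfl, rfl⟩
    | cons x M ih =>
      obtain ⟨i, e, s⟩ := x
      obtain ⟨ih1, ih2⟩ := ih T haT hbT
      by_cases h1 : e = a
      · subst h1
        simp only [List.map_cons, renameCopy, hab, if_false, ne_eq, not_false_eq_true, decide_true,
          List.filter_cons_of_pos, not_true_eq_false, decide_false, Bool.false_eq_true,
          List.filter_cons_of_neg, dist_cons_of_notMem _ _ _ haT]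
        exact ⟨ih1, ih2⟩
      · by_cases h2 : e = b
        · subst h2
          simp only [List.map_cons, renameCopy, if_true, ne_eq, not_true_eq_false, decide_false,
            Bool.false_eq_true, not_false_eq_true, List.filter_cons_of_neg,
            dist_cons_of_notMem _ _ _ haT, h1, decide_true, List.filter_cons_of_pos]
          exact ⟨ih1, ih2⟩
        · have haT' : a ∉ T.erase e := fun h => haT (Finset.mem_of_mem_erase h)
          have hbT' : b ∉ T.erase e := fun h => hbT (Finset.mem_of_mem_erase h)
          obtain ⟨jh1, jh2⟩ := ih _ haT' hbT'
          have e1 : renameCopy a b (i, e, s) = (i, e, s) := by simp [renameCopy, h2]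
          rw [List.map_cons, e1, List.filter_cons_of_pos (by simpa using h2),
            List.filter_cons_of_pos (by simpa using h1), List.map_cons, e1]
          by_cases he : e ∈ T
          · simp only [dist_cons_of_mem _ _ _ he]
            rw [← ih1, ← jh1, ← ih2, ← jh2]; exact ⟨rfl, rfl⟩
          · simp only [dist_cons_of_notMem _ _ _ he]
            exact ⟨ih1, ih2⟩
  induction L generalizing S with
  | nil =>
    simp only [List.map_nil, List.filter_nil, dist_nil, if_neg (Finset.ne_empty_of_mem ha), add_zero]
  | cons x L ih =>
    obtain ⟨i, e, s⟩ := x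
    by_cases h1 : e = a
    · subst h1
      have e1 : renameCopy e b (i, e, s) = (i, e, s) := by simp [renameCopy, hab]
      rw [List.map_cons, e1, List.filter_cons_of_pos (by simpa using hab),
        List.filter_cons_of_neg (by simp), dist_cons_of_mem _ _ _ ha, dist_cons_of_mem _ _ _ ha,
        ih ha hb, (key (S.erase e) L (by simp) (fun h => hb (Finset.mem_of_mem_erase h))).1]
      abel
    · by_cases h2 : e = b
      · subst h2
        have e1 : renameCopy a e (i, e, s) = (i, a, s) := by simp [renameCopy]
        rw [List.map_cons, e1, List.filter_cons_of_neg (by simp),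
          List.filter_cons_of_pos (by simpa using h1), List.map_cons, e1,
          dist_cons_of_mem _ _ _ ha, dist_cons_of_mem _ _ _ ha, ih ha hb,
          (key (S.erase a) L (by simp) (fun h => hb (Finset.mem_of_mem_erase h))).2]
        abel
      · have e1 : renameCopy a b (i, e, s) = (i, e, s) := by simp [renameCopy, h2]
        rw [List.map_cons, e1, List.filter_cons_of_pos (by simpa using h2),
          List.filter_cons_of_pos (by simpa using h1), List.map_cons, e1]
        by_cases he : e ∈ S
        · simp only [dist_cons_of_mem _ _ _ he]
          rw [ih ha hb, ih (Finset.mem_erase.2 ⟨Ne.symm h1, ha⟩)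
            (fun h => hb (Finset.mem_of_mem_erase h)), map_add, smul_add]
          abel
        · simp only [dist_cons_of_notMem _ _ _ he]
          exact ih ha hb

/-- Reverse the copies of the ends `e` with `f e = true`. -/
def flipBy (f : ℕ × Bool → Bool) (x : Fin p × (ℕ × Bool) × Bool) : Fin p × (ℕ × Bool) × Bool :=
  (x.1, x.2.1, xor (f x.2.1) x.2.2)

/-- Every end of `S` is used exactly once in each placement, so reversing all copies of `e`
contributes one global factor `-1`. -/
theorem dist_flipBy (f : ℕ × Bool → Bool) (S : Finset (ℕ × Bool)) (L : CopyList p) :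
    dist K S (L.map (flipBy f)) = (∏ e ∈ S, sgn K (!f e)) • dist K S L := by
  induction L generalizing S with
  | nil =>
    by_cases h : S = ∅
    · simp [h]
    · simp [dist_nil, h]
  | cons x L ih =>
    obtain ⟨i, e, s⟩ := x
    rw [List.map_cons, flipBy]
    by_cases he : e ∈ S
    · rw [dist_cons_of_mem _ _ _ he, dist_cons_of_mem _ _ _ he, ih, ih, smul_add,
        ← Finset.mul_prod_erase _ _ he, map_smul, smul_smul, smul_smul]
      congr 2
      rw [mul_right_comm]
      congr 1
      cases f e <;> cases s <;> simp [sgn]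
    · rw [dist_cons_of_notMem _ _ _ he, dist_cons_of_notMem _ _ _ he, ih]

/-- Copies of arcs. -/
def cabLetter (L : CopyList q) (i : Fin p) : Letter q → CopyList p
  | .gen k true => (L.filter fun x => x.1 = k).map fun x => (i, x.2)
  | .gen k false => (L.filter fun x => x.1 = k).reverse.map fun x => (i, x.2.1, !x.2.2)
  | .cend _ => []

/-- Cabling for lists of copies. -/
def cab (W : Word q p) (L : CopyList q) : CopyList p :=
  (List.finRange p).flatMap fun i => (W i).flatMap (cabLetter L i)

theorem cab_congr (W : Word q p) {L L' : CopyList q}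
    (h : ∀ k, L.filter (fun x => x.1 = k) = L'.filter fun x => x.1 = k) : cab W L = cab W L' := by
  unfold cab
  congr 1; funext i
  congr 1; funext x
  rcases x with ⟨k, _ | _⟩ | _ <;> simp [cabLetter, h]

theorem cab_filter (W : Word q p) (P : ℕ × Bool → Bool) (L : CopyList q) :
    cab W (L.filter fun x => P x.2.1) = (cab W L).filter fun x => P x.2.1 := by
  unfold cab
  rw [List.filter_flatMap]
  congr 1; funext i
  rw [List.filter_flatMap]
  congr 1; funext x
  rcases x with ⟨k, _ | _⟩ | _
  · simp only [cabLetter, List.filter_map, List.filter_reverse, List.filter_filter,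
      Function.comp_def]
    congr 3
    funext x
    rw [Bool.and_comm]
  · simp only [cabLetter, List.filter_map, List.filter_filter, Function.comp_def]
    congr 2
    funext x
    rw [Bool.and_comm]
  · rfl

/-- Relabelling has to commute with reversal of orientation, because negative beads toggle the signs
of the copies. -/
theorem cab_map (W : Word q p) (r : (ℕ × Bool) × Bool → (ℕ × Bool) × Bool)
    (hr : ∀ e s, r (e, !s) = ((r (e, s)).1, !(r (e, s)).2)) (L : CopyList q) :
    cab W (L.map fun x => (x.1, r x.2)) = (cab W L).map fun x => (x.1, r x.2) := by
  unfold cab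
  rw [List.map_flatMap]
  congr 1; funext i
  rw [List.map_flatMap]
  congr 1; funext x
  rcases x with ⟨k, _ | _⟩ | _
  · simp only [cabLetter, List.filter_map, List.map_map, Function.comp_def, ← List.map_reverse]
    refine List.map_congr_left fun x _ => ?_
    rw [hr]
  · simp only [cabLetter, List.filter_map, List.map_map, Function.comp_def]
  · rfl

theorem mem_cab {W : Word q p} {L : CopyList q} {x : Fin p × (ℕ × Bool) × Bool}
    (h : x ∈ cab W L) : ∃ y ∈ L, y.2.1 = x.2.1 := by
  simp only [cab, List.mem_flatMap] at h
  obtain ⟨i, -, l, -, h⟩ := h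
  rcases l with ⟨k, _ | _⟩ | _
  · simp only [cabLetter, List.mem_map, List.mem_reverse, List.mem_filter] at h
    obtain ⟨y, ⟨hy, -⟩, rfl⟩ := h
    exact ⟨y, hy, rfl⟩
  · simp only [cabLetter, List.mem_map, List.mem_filter] at h
    obtain ⟨y, ⟨hy, -⟩, rfl⟩ := h
    exact ⟨y, hy, rfl⟩
  · simp [cabLetter] at h

/-- The ends of a diagram without beads. -/
def flat (v : Word 0 q) : CopyList q :=
  (List.finRange q).flatMap fun k => (endList (v k)).map fun e => (k, e, true)

theorem filter_finRange_flatMap {α : Type*} (f : Fin q → List α) (k : Fin q) :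
    ((List.finRange q).flatMap fun j => (f j).map (Prod.mk j)).filter (fun x => x.1 = k)
      = (f k).map (Prod.mk k) := by
  have h1 : ∀ j, ((f j).map (Prod.mk j)).filter (fun x => decide (x.1 = k))
      = if j = k then (f k).map (Prod.mk k) else [] := by
    intro j
    split_ifs with h
    · subst h
      rw [List.filter_eq_self]
      intro x hx
      obtain ⟨y, -, rfl⟩ := List.mem_map.1 hx
      simp
    · rw [List.filter_eq_nil_iff]
      intro x hx
      obtain ⟨y, -, rfl⟩ := List.mem_map.1 hx
      simpa using h
  rw [List.filter_flatMap]
  simp only [h1]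
  have key : ∀ l : List (Fin q), l.Nodup → k ∈ l → (l.flatMap fun j => if j = k then
      (f k).map (Prod.mk k) else []) = (f k).map (Prod.mk k) := by
    intro l hl hk
    induction l with
    | nil => simp at hk
    | cons a l ih =>
      obtain ⟨hal, hl'⟩ := List.nodup_cons.1 hl
      rw [List.flatMap_cons]
      by_cases h : a = k
      · subst h
        have : (l.flatMap fun j => if j = a then (f a).map (Prod.mk a) else []) = [] := by
          rw [List.flatMap_eq_nil_iff]
          intro j hj
          rw [if_neg]
          rintro rfl
          exact hal hj
        rw [if_pos rfl, this, List.append_nil]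
      · rw [if_neg h, List.nil_append]
        exact ih hl' ((List.mem_cons.1 hk).resolve_left (Ne.symm h))
  exact key _ (List.nodup_finRange q) (List.mem_finRange k)

theorem filter_flat (v : Word 0 q) (k : Fin q) :
    (flat v).filter (fun x => x.1 = k) = (endList (v k)).map fun e => (k, e, true) := by
  have := filter_finRange_flatMap (fun k => (endList (v k)).map fun e => (e, true)) k
  simp only [List.map_map, Function.comp_def] at this
  exact this

theorem mem_of_duplicate {α : Type*} {a : α} {l₁ l₂ : List α} (h : (l₁ ++ a :: l₂).Duplicate a) :
    a ∈ l₁ ++ l₂ := by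
  classical
  have h := List.duplicate_iff_two_le_count.1 h
  by_contra h'
  rw [List.mem_append, not_or] at h'
  rw [List.count_append, List.count_cons, List.count_eq_zero.2 h'.1, List.count_eq_zero.2 h'.2] at h
  simp at h

theorem dist_nodup (L : CopyList p) (h : (L.map fun x => x.2.1).Nodup)
    (hs : ∀ x ∈ L, x.2.2 = true) : dist K (L.map fun x => x.2.1).toFinset L
      = Finsupp.single (preL (L.map fun x => (x.1, .cend x.2.1)) fun _ => []) 1 := by
  have h1 : copyEnds (L.map fun x => (x.1, (CabLetter.copy x.2.1 x.2.2 : CabLetter 0)))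
      = L.map fun x => x.2.1 := by
    rw [copyEnds, List.filterMap_map, ← List.filterMap_eq_map]; rfl
  have := distribute_nodup (K := K) (L.map fun x => (x.1, (CabLetter.copy x.2.1 x.2.2 : CabLetter 0)))
    (h1 ▸ h)
  rw [h1, List.map_map, List.map_map] at this
  rw [dist, this]
  have h2 : (L.map ((fun q : Fin p × CabLetter 0 => q.2.sign K) ∘
      fun x => (x.1, CabLetter.copy x.2.1 x.2.2))).prod = 1 := by
    refine List.prod_eq_one fun a ha => ?_
    obtain ⟨x, hx, rfl⟩ := List.mem_map.1 ha
    simp [CabLetter.sign, hs x hx, sgn]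
  rw [h2, one_smul]
  rfl

variable (K) in
/-- Cabling of a diagram without beads, distributing the ends `S`. -/
noncomputable def cabL (S : Finset (ℕ × Bool)) (W : Word q p) :
    (Word 0 q →₀ K) →ₗ[K] (Word 0 p →₀ K) :=
  Finsupp.linearCombination K fun v => dist K S (cab W (flat v))

theorem cabL_single (S : Finset (ℕ × Bool)) (W : Word q p) (v : Word 0 q) :
    cabL K S W (Finsupp.single v 1) = dist K S (cab W (flat v)) := by
  simp [cabL]

/-- With one copy of each end, the first stage has a single placement, namely a signed diagram. Its
signs are collected in `f` and pulled out of both sides by `dist_flipBy`; afterwards `flat` recovers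
the list on each arc. -/
theorem cabL_dist_of_nodup (W : Word q p) (L : CopyList q) (h : (L.map fun x => x.2.1).Nodup) :
    cabL K (L.map fun x => x.2.1).toFinset W (dist K (L.map fun x => x.2.1).toFinset L)
      = dist K (L.map fun x => x.2.1).toFinset (cab W L) := by
  classical
  set f : ℕ × Bool → Bool := fun e => decide (∃ i, (i, e, false) ∈ L) with hf
  set M : CopyList q := L.map fun x => (x.1, x.2.1, true) with hM
  have hLM : L = M.map (flipBy f) := by
    conv_lhs => rw [← List.map_id L]
    rw [hM, List.map_map]
    refine List.map_congr_left fun x hx => ?_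
    obtain ⟨i, e, s⟩ := x
    have : f e = !s := by
      cases s
      · simpa [hf] using ⟨i, hx⟩
      · simp only [hf, Bool.not_true, decide_eq_false_iff_not, not_exists]
        intro j hj
        have := List.inj_on_of_nodup_map h hx hj rfl
        simp at this
    simp [flipBy, this]
  have hlab : (L.map fun x => x.2.1) = M.map fun x => x.2.1 := by simp [hM, Function.comp_def]
  have hMs : ∀ x ∈ M, x.2.2 = true := by
    intro x hx
    obtain ⟨y, -, rfl⟩ := List.mem_map.1 hx
    rfl
  have hcab : cab W L = (cab W M).map (flipBy f) := by
    conv_lhs => rw [hLM]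
    exact cab_map W (fun x => (x.1, xor (f x.1) x.2)) (fun e s => by simp) M
  rw [hcab]
  rw [hlab] at h ⊢
  conv_lhs => enter [2]; rw [hLM]
  rw [dist_flipBy, dist_flipBy, map_smul, dist_nodup M h hMs, cabL_single]
  congr 2
  refine cab_congr W fun k => ?_
  rw [filter_flat, preL_apply, List.append_nil]
  have : ∀ M : CopyList q, (∀ x ∈ M, x.2.2 = true) →
      (endList (((M.map fun x => (x.1, (Letter.cend x.2.1 : Letter 0))).filter
        fun x => decide (x.1 = k)).map Prod.snd)).map (fun e => (k, e, true))
      = M.filter fun x => decide (x.1 = k) := by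
    intro M hM
    induction M with
    | nil => rfl
    | cons x M ih =>
      have ih := ih fun y hy => hM y (List.mem_cons_of_mem _ hy)
      obtain ⟨i, e, s⟩ := x
      have hs : s = true := hM _ List.mem_cons_self
      subst hs
      rw [List.map_cons]
      by_cases h : i = k
      · subst h
        rw [List.filter_cons_of_pos (by simp), List.filter_cons_of_pos (by simp), List.map_cons,
          endList_cend_cons, List.map_cons, ih]
      · rw [List.filter_cons_of_neg (by simpa using h), List.filter_cons_of_neg (by simpa using h),
          ih]
  exact this M hMs

/-- Choosing a copy of an end and then a copy of that copy amounts to choosing a copy in the twice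
cabled diagram. The formal proof is by induction on the number of copies; the case where all copies
carry different ends is `cabL_dist_of_nodup`. -/
theorem cabL_dist (S : Finset (ℕ × Bool)) (W : Word q p) (L : CopyList q) :
    cabL K S W (dist K S L) = dist K S (cab W L) := by
  induction hN : L.length using Nat.strong_induction_on generalizing L with
  | _ N ih =>
  subst hN
  by_cases hS : ∀ x ∈ L, x.2.1 ∈ S
  swap
  -- Copies of ends outside `S` are never used, and discarding them shortens the list.
  · have hlt : (L.filter fun x => decide (x.2.1 ∈ S)).length < L.length := by
      push Not at hS
      obtain ⟨x, hx, hxS⟩ := hS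
      exact List.length_filter_lt_length_iff_exists.2 ⟨x, hx, by simpa using hxS⟩
    have := ih _ hlt (L.filter fun x => decide (x.2.1 ∈ S)) rfl
    rw [cab_filter W (fun e => decide (e ∈ S)), dist_filter (P := fun e => decide (e ∈ S)) (by simp),
      dist_filter (P := fun e => decide (e ∈ S)) (by simp)] at this
    exact this
  by_cases hnd : (L.map fun x => x.2.1).Nodup
  · by_cases hSL : ∀ e ∈ S, e ∈ L.map fun x => x.2.1
    · have : S = (L.map fun x => x.2.1).toFinset := by
        ext e
        rw [List.mem_toFinset]
        refine ⟨hSL e, fun h => ?_⟩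
        obtain ⟨x, hx, rfl⟩ := List.mem_map.1 h
        exact hS x hx
      rw [this]
      exact cabL_dist_of_nodup W L hnd
    · push Not at hSL
      obtain ⟨e, he, heL⟩ := hSL
      rw [dist_eq_zero he, dist_eq_zero he, map_zero]
      · intro x hx h
        obtain ⟨y, hy, hyx⟩ := mem_cab hx
        exact heL (List.mem_map.2 ⟨y, hy, hyx.trans h⟩)
      · intro x hx h
        exact heL (List.mem_map.2 ⟨x, hx, h⟩)
  -- Some end `a` has several copies; rename one of them to a fresh label `b`. By `dist_split` both
  -- sides become sums over two shorter lists: one lacks the renamed copy, the other lacks all the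
  -- remaining copies of `a`.
  · obtain ⟨a, ha⟩ := List.exists_duplicate_iff_not_nodup.2 hnd
    obtain ⟨x, hx, hxa⟩ := List.mem_map.1 ha.mem
    obtain ⟨L₁, L₂, rfl⟩ := List.append_of_mem hx
    obtain ⟨b, hb⟩ := Infinite.exists_notMem_finset
      (S ∪ ((L₁ ++ x :: L₂).map fun x => x.2.1).toFinset)
    simp only [Finset.mem_union, not_or, List.mem_toFinset] at hb
    obtain ⟨hbS, hbL⟩ := hb
    have haS : a ∈ S := hxa ▸ hS x hx
    have hbL' : ∀ y ∈ L₁ ++ x :: L₂, y.2.1 ≠ b := fun y hy h => hbL (List.mem_map.2 ⟨y, hy, h⟩)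
    have hab : a ≠ b := fun h => hbS (h ▸ haS)
    set M : CopyList q := L₁ ++ (x.1, b, x.2.2) :: L₂ with hM
    have hrel : ∀ l : CopyList q, (∀ y ∈ l, y.2.1 ≠ b) → l.map (renameCopy a b) = l := by
      intro l hl
      conv_rhs => rw [← List.map_id l]
      exact List.map_congr_left fun y hy => by simp [renameCopy, hl y hy]
    have h1 : ∀ y ∈ L₁, y.2.1 ≠ b := fun y hy => hbL' y (by simp [hy])
    have h2 : ∀ y ∈ L₂, y.2.1 ≠ b := fun y hy => hbL' y (by simp [hy])
    have e1 : M.map (renameCopy a b) = L₁ ++ x :: L₂ := by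
      rw [hM, List.map_append, List.map_cons, hrel _ h1, hrel _ h2]
      have : renameCopy a b (x.1, b, x.2.2) = x := by
        obtain ⟨i, e, s⟩ := x
        simp only at hxa
        simp [renameCopy, hxa]
      rw [this]
    have e2 : (M.filter fun y => y.2.1 ≠ b) = L₁ ++ L₂ := by
      rw [hM, List.filter_append, List.filter_cons_of_neg (by simp),
        List.filter_eq_self.2 (by simpa using h1), List.filter_eq_self.2 (by simpa using h2)]
    have e3 : (((M.filter fun y => y.2.1 ≠ a).map (renameCopy a b))).length < (L₁ ++ x :: L₂).length := by
      rw [List.length_map]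
      have : (L₁ ++ x :: L₂).length = M.length := by simp [hM]
      rw [this]
      refine List.length_filter_lt_length_iff_exists.2 ?_
      have : a ∈ (L₁ ++ L₂).map fun x => x.2.1 := by
        rw [List.map_append, List.map_cons, hxa] at ha
        rw [List.map_append]
        exact mem_of_duplicate ha
      obtain ⟨y, hy, hya⟩ := List.mem_map.1 this
      refine ⟨y, ?_, by simpa using hya⟩
      rw [hM]
      rcases List.mem_append.1 hy with h | h <;> simp [h]
    have c1 : ∀ l : CopyList q, cab W (l.map (renameCopy a b)) = (cab W l).map (renameCopy a b) :=
      cab_map W (fun x => (if x.1 = b then a else x.1, x.2)) (fun e s => rfl)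
    have c2 : ∀ (l : CopyList q) (d : ℕ × Bool), cab W (l.filter fun y => y.2.1 ≠ d)
        = (cab W l).filter fun y => y.2.1 ≠ d := fun l d => cab_filter W (fun e => e ≠ d) l
    have i1 := ih _ (by simp) (L₁ ++ L₂) rfl
    have i2 := ih _ e3 _ rfl
    rw [← e2, c2] at i1
    rw [c1, c2] at i2
    rw [← e1, c1, dist_split haS hbS M, dist_split haS hbS (cab W M), map_add, i1, i2]

/-- Copies of copies are copies along the substituted word. For a reversed bead the whole copied
list is reversed and every sign toggled, which is what `Letter.fill` does to the beads (`h3`). -/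
theorem cab_cab (W : Word q p) {V : Word n q} (L : CopyList n) (hW : W.ends = ∅) :
    cab W (cab V L) = cab (W.fill V) L := by
  have h1 : ∀ k, (cab V L).filter (fun x => decide (x.1 = k))
      = ((V k).flatMap (cabLetter L k)) := by
    intro k
    have h := filter_finRange_flatMap (fun k => ((V k).flatMap (cabLetter L k)).map Prod.snd) k
    have e : ∀ k : Fin q, (((V k).flatMap (cabLetter L k)).map Prod.snd).map (Prod.mk k)
        = (V k).flatMap (cabLetter L k) := by
      intro k
      rw [List.map_map, List.map_flatMap]
      congr 1; funext l
      rcases l with ⟨j, _ | _⟩ | _ <;> simp [cabLetter, Function.comp_def]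
    simp only [e] at h
    exact h
  have h2 : ∀ (i : Fin p) (k : Fin q) (l : List (Letter n)), (l.flatMap (cabLetter L k)).map (fun x => (i, x.2))
      = l.flatMap (cabLetter (p := p) L i) := by
    intro i k l
    rw [List.map_flatMap]
    congr 1; funext x
    rcases x with ⟨j, _ | _⟩ | _ <;> simp [cabLetter]
  have h3 : ∀ (i : Fin p) (k : Fin q) (l : List (Letter n)), (l.flatMap (cabLetter L k)).reverse.map
      (fun x : Fin q × (ℕ × Bool) × Bool => (i, x.2.1, !x.2.2)) = (l.reverse.map Letter.flip).flatMap
        (cabLetter (p := p) L i) := by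
    intro i k l
    induction l with
    | nil => rfl
    | cons x l ih =>
      rw [List.flatMap_cons, List.reverse_append, List.map_append, ih, List.reverse_cons,
        List.map_append, List.flatMap_append]
      congr 1
      rcases x with ⟨j, _ | _⟩ | _ <;> simp [cabLetter, Letter.flip, ← List.map_reverse]
  show (List.finRange p).flatMap _ = (List.finRange p).flatMap _
  congr 1; funext i
  rw [Word.fill, List.flatMap_assoc]
  simp only [List.flatMap_def]
  congr 1
  refine List.map_congr_left fun x hx => ?_
  rcases x with ⟨k, _ | _⟩ | e
  · rw [cabLetter, h1, h3, Letter.fill, List.flatMap_def]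
  · rw [cabLetter, h1, h2, Letter.fill, List.flatMap_def]
  · have : e ∈ W.ends := mem_ends.2 ⟨i, hx⟩
    simp [hW] at this

theorem glue_eq_dist {W : Word q p} (hW : W.ends = ∅) (v : Word 0 q) :
    glue K W v = dist K v.ends (cab W (flat v)) := by
  rw [glue, dist, cable_eq]
  congr 1
  rw [cab, List.map_flatMap]
  congr 1; funext i
  rw [List.map_flatMap]
  simp only [List.flatMap_def]
  congr 1
  refine List.map_congr_left fun x hx => ?_
  have key : ∀ l : List (Letter 0), l.map CabLetter.ofLetter
      = (endList l).map fun e => CabLetter.copy e true := by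
    intro l
    induction l with
    | nil => rfl
    | cons x l ih =>
      rcases x with ⟨j, _⟩ | e
      · exact j.elim0
      · rw [List.map_cons, ih]; rfl
  rcases x with ⟨k, _ | _⟩ | e
  · simp only [expand, cabLetter, filter_flat, key, List.map_map, ← List.map_reverse]
    rfl
  · simp only [expand, cabLetter, filter_flat, key, List.map_map]
    rfl
  · have : e ∈ W.ends := mem_ends.2 ⟨i, hx⟩
    simp [hW] at this

theorem endCount_prepend (w : Word m p) (i : Fin p) (l : List (Letter m)) (e : ℕ × Bool) :
    (w.prepend i l).endCount e = l.count (.cend e) + w.endCount e := by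
  unfold Word.endCount Word.prepend
  rw [← Finset.add_sum_erase _ _ (Finset.mem_univ i), ← Finset.add_sum_erase _ (fun k => (w k).count _)
    (Finset.mem_univ i), Function.update_self, List.count_append, add_assoc]
  congr 2
  refine Finset.sum_congr rfl fun k hk => ?_
  rw [Function.update_of_ne (Finset.ne_of_mem_erase hk)]

variable (K p) in
/-- Combinations of diagrams with the ends `S`, each occurring once. -/
noncomputable def endSupp (S : Finset (ℕ × Bool)) : Submodule K (Word 0 p →₀ K) :=
  Finsupp.supported K K {v : Word 0 p | ∀ e, v.endCount e = if e ∈ S then 1 else 0}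

theorem dist_mem_endSupp (S : Finset (ℕ × Bool)) (L : CopyList p) : dist K S L ∈ endSupp K p S := by
  induction L generalizing S with
  | nil =>
    rw [dist_nil]
    split_ifs with h
    · refine Finsupp.single_mem_supported _ _ ?_
      simp [h, Word.endCount]
    · exact Submodule.zero_mem _
  | cons x L ih =>
    obtain ⟨i, d, s⟩ := x
    by_cases hd : d ∈ S
    · rw [dist_cons_of_mem _ _ _ hd]
      refine Submodule.add_mem _ (ih S) (Submodule.smul_mem _ _ ?_)
      refine Finsupp.supported_comap_lmapDomain K K (Word.prepend i [Letter.cend d]) _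
        (Finsupp.supported_mono ?_ (ih (S.erase d)))
      intro w hw e
      rw [endCount_prepend, hw e]
      by_cases h : d = e
      · subst h; simp [hd]
      · simp [Ne.symm h, h]
    · rw [dist_cons_of_notMem _ _ _ hd]
      exact ih S

theorem isChordDiagram_of_endCount {w : Word m n} (hw : w.IsChordDiagram) {v : Word 0 p}
    (hv : ∀ e, v.endCount e = if e ∈ w.ends then 1 else 0) : v.IsChordDiagram := by
  intro r
  have h := hw r
  rw [hv, hv]
  simp only [mem_ends_iff]
  split_ifs <;> omega

theorem ends_eq_of_endCount {S : Finset (ℕ × Bool)} {v : Word 0 p}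
    (hv : ∀ e, v.endCount e = if e ∈ S then 1 else 0) : v.ends = S := by
  ext e
  rw [mem_ends_iff, hv]
  simp

theorem endSupp_induction {S : Finset (ℕ × Bool)} {P : (Word 0 p →₀ K) → Prop} {x : Word 0 p →₀ K}
    (hx : x ∈ endSupp K p S) (h0 : P 0) (hadd : ∀ x y, P x → P y → P (x + y))
    (hs : ∀ (c : K) x, P x → P (c • x))
    (h1 : ∀ v : Word 0 p, (∀ e, v.endCount e = if e ∈ S then 1 else 0) → P (Finsupp.single v 1)) :
    P x := by
  rw [endSupp, Finsupp.supported_eq_span_single] at hx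
  induction hx using Submodule.span_induction with
  | mem x h => obtain ⟨v, hv, rfl⟩ := h; exact h1 v hv
  | zero => exact h0
  | add x y _ _ hx hy => exact hadd x y hx hy
  | smul c x _ hx => exact hs c x hx

/-- All diagrams occurring in `x` carry precisely the ends of `w`, so one set of ends serves for the
entire linear combination. This allows a second composition after a first one has produced a sum. -/
theorem comp_clsL {W : Word q p} (hW : W.ends = ∅) {w : Word m n} (hw : w.IsChordDiagram)
    {x : Word 0 q →₀ K} (hx : x ∈ endSupp K q w.ends) :
    comp (cls K W) (clsL K x) = clsL K (cabL K w.ends W x) := by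
  refine endSupp_induction (P := fun x => comp (cls K W) (clsL K x) = clsL K (cabL K w.ends W x))
    hx ?_ (fun x y hx hy => ?_) (fun c x hx => ?_) fun v hv => ?_
  · simp
  · simp only [map_add, hx, hy]
  · simp only [map_smul, hx]
  · rw [clsL_single, comp_cls_of_disj (isChordDiagram_of_ends_eq_empty hW)
      (isChordDiagram_of_endCount hw hv) (disj_of_ends_eq_empty_left hW v), glue_eq_dist hW,
      cabL_single, ends_eq_of_endCount hv]

theorem comp_cls_eq_dist {W : Word q p} (hW : W.ends = ∅) {w : Word 0 q} (hw : w.IsChordDiagram) :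
    comp (cls K W) (cls K w) = clsL K (dist K w.ends (cab W (flat w))) := by
  rw [comp_cls_of_disj (isChordDiagram_of_ends_eq_empty hW) hw (disj_of_ends_eq_empty_left hW w),
    glue_eq_dist hW]

/-- Associativity of composition in the form used below. Both sides distribute the ends of the same
chord diagram over its twice cabled arcs, by `cabL_dist` and `cab_cab`. -/
theorem comp_comp {W : Word q p} {V : Word n q} (hW : W.ends = ∅) (hV : V.ends = ∅)
    (hWV : (W.fill V).ends = ∅) (x : A K 0 n) :
    comp (cls K W) (comp (cls K V) x) = comp (cls K (W.fill V)) x := by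
  refine A_hom_ext (f := comp (cls K W) ∘ₗ comp (cls K V)) (fun w hw => ?_) x
  rw [LinearMap.comp_apply, comp_cls_eq_dist hV hw, comp_cls_eq_dist hWV hw,
    comp_clsL hW hw (dist_mem_endSupp _ _), cabL_dist, cab_cab W _ hW]

/-- Linear extension of juxtaposition. -/
noncomputable def juxtL : (Word 0 p →₀ K) →ₗ[K] (Word 0 p' →₀ K) →ₗ[K] (Word 0 (p + p') →₀ K) :=
  Finsupp.linearCombination K fun u => Finsupp.linearCombination K fun v =>
    Finsupp.single (juxt u v : Word (0 + 0) (p + p')) 1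

theorem juxtL_single (u : Word 0 p) (v : Word 0 p') :
    juxtL (K := K) (Finsupp.single u 1) (Finsupp.single v 1)
      = Finsupp.single (juxt u v : Word (0 + 0) (p + p')) 1 := by
  simp [juxtL]

theorem juxt_castAdd (u : Word m n) (v : Word q p) (i : Fin n) :
    juxt u v (Fin.castAdd p i) = (u i).map (Letter.mapGen (Fin.castAdd q)) := Fin.append_left _ _ _

theorem juxt_natAdd (u : Word m n) (v : Word q p) (i : Fin p) :
    juxt u v (Fin.natAdd n i) = (v i).map (Letter.mapGen (Fin.natAdd m)) := Fin.append_right _ _ _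

theorem prepend_self (i : Fin n) (l : List (Letter m)) (w : Word m n) :
    w.prepend i l i = l ++ w i := Function.update_self _ _ _

theorem prepend_of_ne {i k : Fin n} (h : k ≠ i) (l : List (Letter m)) (w : Word m n) :
    w.prepend i l k = w k := Function.update_of_ne h _ _

theorem castAdd_ne_natAdd (i : Fin p) (j : Fin q) : Fin.castAdd q i ≠ Fin.natAdd p j := by
  intro h
  have h := congrArg Fin.val h
  have := i.2
  simp at h
  omega

theorem juxt_prepend_left (i : Fin p) (e : ℕ × Bool) (u : Word 0 p) (v : Word 0 p') :
    (juxt (u.prepend i [.cend e]) v : Word (0 + 0) (p + p'))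
      = (juxt u v : Word (0 + 0) (p + p')).prepend (Fin.castAdd p' i) [.cend e] := by
  funext k
  refine Fin.addCases (fun k => ?_) (fun k => ?_) k
  · rw [juxt_castAdd]
    by_cases h : k = i
    · subst h; rw [prepend_self, prepend_self, juxt_castAdd]; rfl
    · rw [prepend_of_ne h, prepend_of_ne (by simpa using h), juxt_castAdd]
  · rw [juxt_natAdd, prepend_of_ne (castAdd_ne_natAdd _ _).symm, juxt_natAdd]

theorem juxt_prepend_right (i : Fin p') (e : ℕ × Bool) (u : Word 0 p) (v : Word 0 p') :
    (juxt u (v.prepend i [.cend e]) : Word (0 + 0) (p + p'))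
      = (juxt u v : Word (0 + 0) (p + p')).prepend (Fin.natAdd p i) [.cend e] := by
  funext k
  refine Fin.addCases (fun k => ?_) (fun k => ?_) k
  · rw [juxt_castAdd, prepend_of_ne (castAdd_ne_natAdd _ _), juxt_castAdd]
  · rw [juxt_natAdd]
    by_cases h : k = i
    · subst h; rw [prepend_self, prepend_self, juxt_natAdd]; rfl
    · rw [prepend_of_ne h, prepend_of_ne (by simpa using h), juxt_natAdd]

theorem juxtL_pre_left (i : Fin p) (e : ℕ × Bool) (x : Word 0 p →₀ K) (y : Word 0 p' →₀ K) :
    juxtL (pre K i [.cend e] x) y = pre K (Fin.castAdd p' i) [.cend e] (juxtL x y) := by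
  induction x using Finsupp.induction_linear with
  | zero => simp
  | add x x' h h' => simp only [map_add, LinearMap.add_apply, h, h']
  | single u a =>
    induction y using Finsupp.induction_linear with
    | zero => simp
    | add x x' h h' => simp only [map_add, h, h']
    | single v b =>
      rw [pre_single, ← mul_one a, ← mul_one b, ← smul_eq_mul, ← smul_eq_mul, ← Finsupp.smul_single,
        ← Finsupp.smul_single, ← Finsupp.smul_single]
      simp only [map_smul, LinearMap.smul_apply, juxtL_single, pre_single, juxt_prepend_left]

theorem juxtL_pre_right (i : Fin p') (e : ℕ × Bool) (x : Word 0 p →₀ K) (y : Word 0 p' →₀ K) :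
    juxtL x (pre K i [.cend e] y) = pre K (Fin.natAdd p i) [.cend e] (juxtL x y) := by
  induction x using Finsupp.induction_linear with
  | zero => simp
  | add x x' h h' => simp only [map_add, LinearMap.add_apply, h, h']
  | single u a =>
    induction y using Finsupp.induction_linear with
    | zero => simp
    | add x x' h h' => simp only [map_add, h, h']
    | single v b =>
      rw [pre_single, ← mul_one a, ← mul_one b, ← smul_eq_mul, ← smul_eq_mul, ← Finsupp.smul_single,
        ← Finsupp.smul_single, ← Finsupp.smul_single]
      simp only [map_smul, LinearMap.smul_apply, juxtL_single, pre_single, juxt_prepend_right]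

/-- The two sets of ends have their copies on separate groups of arcs, so the placements are chosen
independently. -/
theorem dist_juxt {S S' : Finset (ℕ × Bool)} (L : CopyList p) (L' : CopyList p')
    (h : ∀ x ∈ L, x.2.1 ∉ S') (h' : ∀ x ∈ L', x.2.1 ∉ S) :
    dist K (S ∪ S') (L.map (fun x => (Fin.castAdd p' x.1, x.2)) ++
      L'.map fun x => (Fin.natAdd p x.1, x.2)) = juxtL (dist K S L) (dist K S' L') := by
  induction L generalizing S with
  | nil =>
    rw [List.map_nil, List.nil_append, dist_nil]
    split_ifs with hS
    · subst hS
      rw [Finset.empty_union]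
      clear h h'
      induction L' generalizing S' with
      | nil =>
        rw [List.map_nil, dist_nil, dist_nil]
        split_ifs
        · rw [juxtL_single]
          congr 1
          funext k
          refine Fin.addCases (fun k => ?_) (fun k => ?_) k <;> simp [juxt, Word.mapGens]
        · simp
      | cons x L' ih =>
        obtain ⟨i, e, s⟩ := x
        rw [List.map_cons]
        by_cases he : e ∈ S'
        · rw [dist_cons_of_mem _ _ _ he, dist_cons_of_mem _ _ _ he, ih, ih, map_add, map_smul,
            juxtL_pre_right]
        · rw [dist_cons_of_notMem _ _ _ he, dist_cons_of_notMem _ _ _ he, ih]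
    · obtain ⟨e, he⟩ := Finset.nonempty_iff_ne_empty.2 hS
      rw [map_zero, LinearMap.zero_apply, dist_eq_zero (e := e) (Finset.mem_union_left _ he)]
      intro x hx hxe
      obtain ⟨y, hy, rfl⟩ := List.mem_map.1 hx
      exact h' y hy (hxe ▸ he)
  | cons x L ih =>
    obtain ⟨i, e, s⟩ := x
    have h1 : e ∉ S' := h _ List.mem_cons_self
    have h2 : ∀ x ∈ L, x.2.1 ∉ S' := fun x hx => h x (List.mem_cons_of_mem _ hx)
    rw [List.map_cons, List.cons_append]
    by_cases he : e ∈ S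
    · rw [dist_cons_of_mem _ _ _ (Finset.mem_union_left _ he), dist_cons_of_mem _ _ _ he,
        Finset.erase_union_distrib, Finset.erase_eq_of_notMem h1, ih h2 h',
        ih h2 fun x hx hxe => h' x hx (Finset.mem_of_mem_erase hxe), map_add, LinearMap.add_apply,
        map_smul, LinearMap.smul_apply, juxtL_pre_left]
    · rw [dist_cons_of_notMem _ _ _ (by simp [he, h1]), dist_cons_of_notMem _ _ _ he, ih h2 h']

theorem endList_map_mapGen (φ : Fin m → Fin n) (l : List (Letter m)) :
    endList (l.map (Letter.mapGen φ)) = endList l := by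
  induction l with
  | nil => rfl
  | cons x l ih =>
    cases x with
    | gen => exact ih
    | cend e => rw [List.map_cons, endList_cend_cons, ← ih]; rfl

theorem finRange_flatMap_add {α : Type*} (f : Fin (p + p') → List α) :
    (List.finRange (p + p')).flatMap f = ((List.finRange p).flatMap fun i => f (Fin.castAdd p' i))
      ++ (List.finRange p').flatMap fun i => f (Fin.natAdd p i) := by
  have : List.finRange (p + p') = (List.finRange p).map (Fin.castAdd p')
      ++ (List.finRange p').map (Fin.natAdd p) := by
    rw [← List.ofFn_id, List.ofFn_add, ← List.ofFn_eq_map, ← List.ofFn_eq_map]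
    rfl
  rw [this, List.flatMap_append, List.flatMap_map, List.flatMap_map]

theorem cab_juxt (V : Word q p) (V' : Word q' p') (w : Word 0 q) (w' : Word 0 q') :
    cab (juxt V V') (flat (juxt w w' : Word (0 + 0) (q + q')))
      = (cab V (flat w)).map (fun x => (Fin.castAdd p' x.1, x.2)) ++
        (cab V' (flat w')).map fun x => (Fin.natAdd p x.1, x.2) := by
  rw [cab, finRange_flatMap_add, cab, cab, List.map_flatMap, List.map_flatMap]
  congr 1
  · congr 1; funext i
    rw [juxt_castAdd, List.flatMap_map, List.map_flatMap]
    congr 1; funext x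
    have h : ∀ k, endList ((juxt w w' : Word (0 + 0) (q + q')) (Fin.castAdd q' k)) = endList (w k) := by
      intro k
      rw [juxt_castAdd, endList_map_mapGen]
    rcases x with ⟨k, _ | _⟩ | _
    · simp only [Letter.mapGen, cabLetter]
      rw [filter_flat, filter_flat, h]
      simp [Function.comp_def, ← List.map_reverse]
    · simp only [Letter.mapGen, cabLetter]
      rw [filter_flat, filter_flat, h]
      simp [Function.comp_def]
    · rfl
  · congr 1; funext i
    rw [juxt_natAdd, List.flatMap_map, List.map_flatMap]
    congr 1; funext x
    have h : ∀ k, endList ((juxt w w' : Word (0 + 0) (q + q')) (Fin.natAdd q k)) = endList (w' k) := by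
      intro k
      rw [juxt_natAdd, endList_map_mapGen]
    rcases x with ⟨k, _ | _⟩ | _
    · simp only [Letter.mapGen, cabLetter]
      rw [filter_flat, filter_flat, h]
      simp [Function.comp_def, ← List.map_reverse]
    · simp only [Letter.mapGen, cabLetter]
      rw [filter_flat, filter_flat, h]
      simp [Function.comp_def]
    · rfl

theorem tens_clsL {w : Word 0 q} {w' : Word 0 q'} (hw : w.IsChordDiagram) (hw' : w'.IsChordDiagram)
    (h : Disj w w') {x : Word 0 p →₀ K} (hx : x ∈ endSupp K p w.ends) {y : Word 0 p' →₀ K}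
    (hy : y ∈ endSupp K p' w'.ends) :
    tens (clsL K x) (clsL K y) = (clsL K (juxtL x y) : A K 0 (p + p')) := by
  refine endSupp_induction (P := fun x => tens (clsL K x) (clsL K y)
    = (clsL K (juxtL x y) : A K 0 (p + p'))) hx ?_ (fun x y hx hy => ?_) (fun c x hx => ?_) fun u hu => ?_
  · simp
  · simp only [map_add, LinearMap.add_apply, hx, hy]
  · simp only [map_smul, LinearMap.smul_apply, hx]
  · refine endSupp_induction (P := fun y => tens (clsL K (Finsupp.single u 1)) (clsL K y)
      = (clsL K (juxtL (Finsupp.single u 1) y) : A K 0 (p + p')))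
      hy ?_ (fun x y hx hy => ?_) (fun c x hx => ?_) fun v hv => ?_
    · simp
    · simp only [map_add, hx, hy]
    · simp only [map_smul, hx]
    · rw [clsL_single, clsL_single, juxtL_single, clsL_single]
      refine tens_cls_of_disj (isChordDiagram_of_endCount hw hu) (isChordDiagram_of_endCount hw' hv) ?_
      intro e he d hd
      rw [ends_eq_of_endCount hu] at he
      rw [ends_eq_of_endCount hv] at hd
      exact h e he d hd

theorem exists_disj (u : Word m n) (v : Word p q) : ∃ (u' : Word m n) (v' : Word p q),
    cls K u' = cls K u ∧ cls K v' = cls K v ∧ (u.IsChordDiagram → u'.IsChordDiagram) ∧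
      (v.IsChordDiagram → v'.IsChordDiagram) ∧ Disj u' v' :=
  ⟨_, _, cls_affine 1 0 u, cls_affine 1 1 v, isChordDiagram_affine, isChordDiagram_affine,
    disj_affine u v (by decide)⟩

/-- The interchange law for chordless diagrams acting on bead-free ones. After disjoint labels have
been chosen, the cabled list of a juxtaposition is the concatenation of the two cabled lists, and
`dist_juxt` separates the sums. -/
theorem comp_juxt_tens {V : Word q p} {V' : Word q' p'} (hV : V.ends = ∅) (hV' : V'.ends = ∅)
    (x : A K 0 q) (y : A K 0 q') : comp (cls K (juxt V V')) (tens x y : A K 0 (q + q'))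
      = (tens (comp (cls K V) x) (comp (cls K V') y) : A K 0 (p + p')) := by
  induction x using A_induction with
  | h0 => simp
  | hadd x y hx hy => simp only [map_add, LinearMap.add_apply, hx, hy]
  | hsmul c x hx => simp only [map_smul, LinearMap.smul_apply, hx]
  | hc u hu =>
    induction y using A_induction with
    | h0 => simp
    | hadd x y hx hy => simp only [map_add, hx, hy]
    | hsmul c x hx => simp only [map_smul, hx]
    | hc v hv =>
      obtain ⟨u', v', h1, h2, h3, h4, h5⟩ := exists_disj (K := K) u v
      rw [← h1, ← h2]
      have hu' := h3 hu
      have hv' := h4 hv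
      have e1 : (tens (cls K u') (cls K v') : A K 0 (q + q'))
          = cls K (juxt u' v' : Word (0 + 0) (q + q')) := tens_cls_of_disj hu' hv' h5
      rw [e1]
      have e2 := comp_cls_eq_dist (K := K) (juxt_of_ends_eq_empty hV hV')
        (w := (juxt u' v' : Word (0 + 0) (q + q'))) (isChordDiagram_juxt hu' hv' h5)
      rw [ends_juxt, cab_juxt, dist_juxt] at e2
      · rw [comp_cls_eq_dist hV hu', comp_cls_eq_dist hV' hv',
          tens_clsL hu' hv' h5 (dist_mem_endSupp _ _) (dist_mem_endSupp _ _)]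
        exact e2
      · intro x hx hx'
        obtain ⟨y, hy, hyx⟩ := mem_cab hx
        simp only [flat, List.mem_flatMap, List.mem_map] at hy
        obtain ⟨k, -, e, he, rfl⟩ := hy
        exact h5 e (mem_ends.2 ⟨k, mem_endList.1 he⟩) _ hx' (by rw [← hyx])
      · intro x hx hx'
        obtain ⟨y, hy, hyx⟩ := mem_cab hx
        simp only [flat, List.mem_flatMap, List.mem_map] at hy
        obtain ⟨k, -, e, he, rfl⟩ := hy
        exact h5 _ hx' e (mem_ends.2 ⟨k, mem_endList.1 he⟩) (by rw [← hyx])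

end distribution
end JacobiHB

namespace JacobiHB

/-! ### The convolution algebras `A K 0 n` and their strand operations. -/

section algebra
variable {K : Type*} [Field K] {m m' n p q : ℕ}

theorem ends_eq_empty_iff {w : Word m n} : w.ends = ∅ ↔ ∀ i e, Letter.cend e ∉ w i := by
  rw [Finset.eq_empty_iff_forall_notMem]
  simp only [mem_ends, not_exists]
  exact forall_comm

theorem ends_fill {V : Word n p} {w : Word m n} (hV : V.ends = ∅) (hw : w.ends = ∅) :
    (V.fill w).ends = ∅ := by
  rw [ends_eq_empty_iff] at *
  intro i e h
  obtain ⟨x, hx, h⟩ := List.mem_flatMap.1 h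
  rcases x with ⟨j, _ | _⟩ | d
  · obtain ⟨y, hy, h⟩ := List.mem_map.1 h
    rcases y with _ | y
    · simp [Letter.flip] at h
    · exact hw j y (List.mem_reverse.1 hy)
  · exact hw j e h
  · exact hV i d hx

theorem comp_comp' {W : Word q p} {V : Word n q} (hW : W.ends = ∅) (hV : V.ends = ∅)
    (x : A K 0 n) : comp (cls K W) (comp (cls K V) x) = comp (cls K (W.fill V)) x :=
  comp_comp hW hV (ends_fill hW hV) x

theorem count_beads (V : Word n p) (k : Fin n) (s : Bool) :
    V.beads.count (k, s) = ∑ i, (V i).count (.gen k s) := by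
  rw [Word.beads, List.count_flatMap, ← List.ofFn_eq_map, List.sum_ofFn]
  refine Finset.sum_congr rfl fun i _ => ?_
  simp only [Function.comp]
  induction V i with
  | nil => rfl
  | cons x l ih =>
    rcases x with ⟨j, t⟩ | e
    · simp [List.count_cons, ih]
    · simp [ih]

theorem isLinear_iff {V : Word n p} {τ : Fin n → Bool} : V.IsLinear τ ↔
    ∀ k s, ∑ i, (V i).count (.gen k s) = if s = τ k then 1 else 0 := by
  have h2 : ∀ k s, ((List.finRange n).map fun k => (k, τ k)).count (k, s)
      = if s = τ k then 1 else 0 := by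
    intro k s
    by_cases h : s = τ k
    · subst h
      rw [if_pos rfl, List.count_map_of_injective _ (fun k => (k, τ k)) (fun a b h => (Prod.mk.inj h).1)]
      exact List.count_eq_one_of_mem (List.nodup_finRange n) (List.mem_finRange k)
    · rw [if_neg h, List.count_eq_zero]
      intro h'
      obtain ⟨j, -, h'⟩ := List.mem_map.1 h'
      obtain ⟨rfl, rfl⟩ := Prod.mk.inj h'
      exact h rfl
  rw [Word.IsLinear, List.perm_iff_count, Prod.forall]
  simp only [h2, count_beads]

/-- The word of the multiplication of the `n`-th tensor power. -/
def muWord (n : ℕ) : Word (n + n) n :=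
  fun i => [.gen (Fin.castAdd n i) true, .gen (Fin.natAdd n i) true]

theorem ends_muWord (n : ℕ) : (muWord n).ends = ∅ := by
  rw [ends_eq_empty_iff]; simp [muWord]

theorem isLinear_muWord (n : ℕ) : (muWord n).IsLinear fun _ => true := by
  rw [isLinear_iff]
  intro k s
  cases s
  · simp [muWord]
  · rw [if_pos rfl]
    refine Fin.addCases (fun k => ?_) (fun k => ?_) k
    · rw [Finset.sum_eq_single k]
      · simp [muWord, (castAdd_ne_natAdd k k).symm, -Fin.natAdd_eq_addNat]
      · intro j _ hj
        simp [muWord, hj, (castAdd_ne_natAdd _ _).symm, -Fin.natAdd_eq_addNat]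
      · simp
    · rw [Finset.sum_eq_single k]
      · simp [muWord, castAdd_ne_natAdd k k, -Fin.natAdd_eq_addNat]
      · intro j _ hj
        simp [muWord, hj, castAdd_ne_natAdd, -Fin.natAdd_eq_addNat]
      · simp

/-- Concatenation along each arc. -/
def Word.cat (u v : Word m n) : Word m n := fun i => u i ++ v i

theorem endCount_cat (u v : Word m n) (e : ℕ × Bool) :
    (u.cat v).endCount e = u.endCount e + v.endCount e := by
  simp [Word.endCount, Word.cat, Finset.sum_add_distrib]

theorem ends_cat (u v : Word m n) : (u.cat v).ends = u.ends ∪ v.ends := by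
  ext e
  simp only [Finset.mem_union, mem_ends_iff, endCount_cat]
  omega

theorem isChordDiagram_cat {u v : Word m n} (hu : u.IsChordDiagram) (hv : v.IsChordDiagram)
    (h : Disj u v) : (u.cat v).IsChordDiagram :=
  fun p => by
    simp only [endCount_cat, ← endCount_juxt]
    exact isChordDiagram_juxt hu hv h p

theorem fill_muWord (w : Word m (n + n)) :
    (muWord n).fill w = fun i => w (Fin.castAdd n i) ++ w (Fin.natAdd n i) := by
  funext i
  simp [Word.fill, muWord, Letter.fill]

theorem comp_muWord_tens {u : Word m n} {v : Word m' n} (hu : u.IsChordDiagram)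
    (hv : v.IsChordDiagram) (h : Disj u v) : comp (cls K (muWord n)) (tens (cls K u) (cls K v))
      = cls K ((u.mapGens (Fin.castAdd m')).cat (v.mapGens (Fin.natAdd m))) := by
  rw [tens_cls_of_disj hu hv h, comp_cls_linear_pos (isLinear_muWord n) (ends_muWord n)
    (isChordDiagram_juxt hu hv h), fill_muWord]
  congr 1
  funext i
  rw [juxt_castAdd, juxt_natAdd]
  rfl

theorem map_mapGen_zero (φ : Fin 0 → Fin 0) (l : List (Letter 0)) :
    l.map (Letter.mapGen φ) = l := by
  conv_rhs => rw [← List.map_id l]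
  refine List.map_congr_left fun x _ => ?_
  rcases x with ⟨j, _⟩ | _
  · exact j.elim0
  · rfl

noncomputable instance instMulA : Mul (A K 0 n) :=
  ⟨fun x y => (comp (cls K (muWord n)) (tens x y) : A K (0 + 0) n)⟩

theorem mul_eq (x y : A K 0 n) :
    x * y = (comp (cls K (muWord n)) (tens x y : A K 0 (n + n)) : A K 0 n) := rfl

theorem cls_mul_cls {u v : Word 0 n} (hu : u.IsChordDiagram) (hv : v.IsChordDiagram)
    (h : Disj u v) : cls K u * cls K v = cls K (u.cat v) := by
  have := comp_muWord_tens (K := K) hu hv h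
  refine this.trans ?_
  have h1 : (u.mapGens (Fin.castAdd 0)).cat (v.mapGens (Fin.natAdd 0)) = u.cat v := by
    funext i
    simp only [Word.cat, Word.mapGens]
    congr 1
    · exact map_mapGen_zero _ _
    · exact map_mapGen_zero _ _
  rw [h1]

/-- The diagram without chords and beads. -/
def emptyWord (m n : ℕ) : Word m n := fun _ => []

theorem ends_emptyWord : (emptyWord m n).ends = ∅ := by
  rw [ends_eq_empty_iff]; simp [emptyWord]

theorem isChordDiagram_emptyWord : (emptyWord m n).IsChordDiagram :=
  isChordDiagram_of_ends_eq_empty ends_emptyWord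

noncomputable instance instOneA : One (A K 0 n) := ⟨cls K (emptyWord 0 n)⟩

theorem one_eq : (1 : A K 0 n) = cls K (emptyWord 0 n) := rfl

theorem A_mul_add (x y z : A K 0 n) : x * (y + z) = x * y + x * z := by
  simp only [mul_eq, map_add]

theorem A_add_mul (x y z : A K 0 n) : (x + y) * z = x * z + y * z := by
  simp only [mul_eq, map_add, LinearMap.add_apply]

theorem A_smul_mul (c : K) (x y : A K 0 n) : (c • x) * y = c • (x * y) := by
  simp only [mul_eq, map_smul, LinearMap.smul_apply]

theorem A_mul_smul (c : K) (x y : A K 0 n) : x * (c • y) = c • (x * y) := by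
  simp only [mul_eq, map_smul]

theorem A_zero_mul (x : A K 0 n) : 0 * x = 0 := by
  simp only [mul_eq, map_zero, LinearMap.zero_apply]

theorem A_mul_zero (x : A K 0 n) : x * 0 = 0 := by
  simp only [mul_eq, map_zero]

theorem disj_cat_left {u v : Word m n} {w : Word m' p} (h : Disj u w) (h' : Disj v w) :
    Disj (u.cat v) w := by
  intro e he
  rw [ends_cat, Finset.mem_union] at he
  exact he.elim (h e) (h' e)

theorem disj_cat_right {u v : Word m n} {w : Word m' p} (h : Disj w u) (h' : Disj w v) :
    Disj w (u.cat v) := by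
  intro e he d hd
  rw [ends_cat, Finset.mem_union] at hd
  exact hd.elim (h e he d) (h' e he d)

theorem A_mul_assoc (x y z : A K 0 n) : x * y * z = x * (y * z) := by
  induction x using A_induction with
  | h0 => simp only [A_zero_mul]
  | hadd x x' h h' => simp only [A_add_mul, h, h']
  | hsmul c x h => simp only [A_smul_mul, h]
  | hc u hu =>
    induction y using A_induction with
    | h0 => simp only [A_zero_mul, A_mul_zero]
    | hadd x x' h h' => simp only [A_add_mul, A_mul_add, h, h']
    | hsmul c x h => simp only [A_smul_mul, A_mul_smul, h]
    | hc v hv =>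
      induction z using A_induction with
      | h0 => simp only [A_mul_zero]
      | hadd x x' h h' => simp only [A_mul_add, h, h']
      | hsmul c x h => simp only [A_mul_smul, h]
      | hc w hw =>
        -- Three residue classes modulo 3 make the labels pairwise disjoint; associativity then
        -- becomes that of concatenation on each arc.
        rw [← cls_affine 2 0 u, ← cls_affine 2 1 v, ← cls_affine 2 2 w]
        have huv : Disj (u.affine 2 0) (v.affine 2 1) := disj_affine u v (by decide)
        have huw : Disj (u.affine 2 0) (w.affine 2 2) := disj_affine u w (by decide)
        have hvw : Disj (v.affine 2 1) (w.affine 2 2) := disj_affine v w (by decide)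
        have hu := isChordDiagram_affine (a := 2) (b := 0) hu
        have hv := isChordDiagram_affine (a := 2) (b := 1) hv
        have hw := isChordDiagram_affine (a := 2) (b := 2) hw
        rw [cls_mul_cls hu hv huv, cls_mul_cls hv hw hvw,
          cls_mul_cls (isChordDiagram_cat hu hv huv) hw (disj_cat_left huw hvw),
          cls_mul_cls hu (isChordDiagram_cat hv hw hvw) (disj_cat_right huv huw)]
        congr 1
        funext i
        exact List.append_assoc _ _ _

theorem A_one_mul (x : A K 0 n) : 1 * x = x := by
  induction x using A_induction with
  | h0 => rw [A_mul_zero]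
  | hadd x x' h h' => rw [A_mul_add, h, h']
  | hsmul c x h => rw [A_mul_smul, h]
  | hc u hu =>
    rw [one_eq, cls_mul_cls isChordDiagram_emptyWord hu (disj_of_ends_eq_empty_left ends_emptyWord u)]
    rfl

theorem A_mul_one (x : A K 0 n) : x * 1 = x := by
  induction x using A_induction with
  | h0 => rw [A_zero_mul]
  | hadd x x' h h' => rw [A_add_mul, h, h']
  | hsmul c x h => rw [A_smul_mul, h]
  | hc u hu =>
    rw [one_eq, cls_mul_cls hu isChordDiagram_emptyWord (disj_of_ends_eq_empty_right ends_emptyWord u)]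
    congr 1
    funext i
    exact List.append_nil _

/-- The convolution algebra of the morphisms `0 → n`. -/
noncomputable instance instRingA : Ring (A K 0 n) where
  __ := (inferInstance : AddCommGroup (A K 0 n))
  __ := instMulA
  __ := instOneA
  left_distrib := A_mul_add
  right_distrib := A_add_mul
  zero_mul := A_zero_mul
  mul_zero := A_mul_zero
  mul_assoc := A_mul_assoc
  one_mul := A_one_mul
  mul_one := A_mul_one

noncomputable instance instAlgebraA : Algebra K (A K 0 n) :=
  Algebra.ofModule A_smul_mul A_mul_smul

theorem comp_one {V : Word n p} (hV : V.ends = ∅) : comp (cls K V) (1 : A K 0 n) = 1 := by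
  rw [one_eq, comp_cls_inner (isChordDiagram_of_ends_eq_empty hV) ends_emptyWord, one_eq]
  congr 1
  funext i
  rw [Word.fill, emptyWord, List.flatMap_eq_nil_iff]
  intro x hx
  rcases x with ⟨j, _ | _⟩ | e
  · rfl
  · rfl
  · exact absurd hx (ends_eq_empty_iff.1 hV i e)

/-- The word with at most one positive bead on each arc given by a partial map. -/
def pullWord (f : Fin p → Option (Fin q)) : Word q p :=
  fun i => (f i).elim [] fun k => [.gen k true]

theorem ends_pullWord (f : Fin p → Option (Fin q)) : (pullWord f).ends = ∅ := by
  rw [ends_eq_empty_iff]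
  intro i e
  rw [pullWord]
  cases f i <;> simp

theorem fill_juxt_muWord (V : Word q p) : (muWord p).fill (juxt V V)
    = fun i => (V i).map (Letter.mapGen (Fin.castAdd q)) ++ (V i).map (Letter.mapGen (Fin.natAdd q)) := by
  rw [fill_muWord]
  funext i
  rw [juxt_castAdd, juxt_natAdd]

/-- A product of two images is a single chordless diagram applied to a tensor. Identities between
such products can therefore be verified on words. -/
theorem comp_mul_comp {U : Word q n} {V : Word p n} (hU : U.ends = ∅) (hV : V.ends = ∅)
    (x : A K 0 q) (y : A K 0 p) : comp (cls K U) x * comp (cls K V) y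
      = comp (cls K ((muWord n).fill (juxt U V))) (tens x y : A K 0 (q + p)) := by
  rw [mul_eq, ← comp_juxt_tens hU hV, comp_comp' (ends_muWord n) (juxt_of_ends_eq_empty hU hV)]

theorem comp_mul {W : Word n p} (hW : W.ends = ∅) (x y : A K 0 n) :
    comp (cls K W) (x * y) = comp (cls K (W.fill (muWord n))) (tens x y : A K 0 (n + n)) := by
  rw [mul_eq, comp_comp' hW (ends_muWord n)]

/-- With at most one bead on each arc and all beads positive, multiplying before or after the
operation produces literally the same word on each arc. Longer or negative words would interleave or
reverse the two factors. -/
theorem comp_pullWord_mul (f : Fin p → Option (Fin q)) (x y : A K 0 q) :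
    comp (cls K (pullWord f)) (x * y)
      = comp (cls K (pullWord f)) x * comp (cls K (pullWord f)) y := by
  rw [comp_mul (ends_pullWord f), comp_mul_comp (ends_pullWord f) (ends_pullWord f),
    fill_juxt_muWord]
  congr 3
  funext i
  rw [Word.fill, pullWord]
  cases f i <;> rfl

variable (K) in
/-- Insertion of strands, deletion of strands and their parallels, as an algebra homomorphism. -/
noncomputable def pull (f : Fin p → Option (Fin q)) : A K 0 q →ₐ[K] A K 0 p :=
  AlgHom.ofLinearMap (comp (cls K (pullWord f))) (comp_one (ends_pullWord f)) (comp_pullWord_mul f)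

theorem pull_apply (f : Fin p → Option (Fin q)) (x : A K 0 q) :
    pull K f x = comp (cls K (pullWord f)) x := rfl

/-- The inclusion of the first strands. -/
def inclLeft (p q : ℕ) : Fin (p + q) → Option (Fin p) := Fin.append some fun _ => none

/-- The inclusion of the last strands. -/
def inclRight (p q : ℕ) : Fin (p + q) → Option (Fin q) := Fin.append (fun _ => none) some

/-- The two factors occupy different arcs, so superposing them arc by arc just reassembles the
tensor product: the combined word is the identity. This turns `⊗` into products of images under
`pull`. -/
theorem tens_eq_mul (x : A K 0 p) (y : A K 0 q) : (tens x y : A K 0 (p + q))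
    = pull K (inclLeft p q) x * pull K (inclRight p q) y := by
  rw [pull_apply, pull_apply, comp_mul_comp (ends_pullWord _) (ends_pullWord _)]
  have : (muWord (p + q)).fill (juxt (pullWord (inclLeft p q)) (pullWord (inclRight p q)))
      = fun i => [.gen i true] := by
    rw [fill_muWord]
    funext i
    rw [juxt_castAdd, juxt_natAdd]
    refine Fin.addCases (fun i => ?_) (fun i => ?_) i <;>
      simp [pullWord, inclLeft, inclRight, Letter.mapGen]
  rw [this]
  have hl : ∀ n, Word.IsLinear (fun i => [.gen i true] : Word n n) fun _ => true := by
    intro n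
    rw [isLinear_iff]
    intro k s
    cases s <;> simp [List.count_cons]
  refine (A_hom_ext (g := LinearMap.id) (fun w hw => ?_) (tens x y : A K 0 (p + q))).symm
  rw [comp_cls_linear_pos (hl _) (by rw [ends_eq_empty_iff]; simp) hw, LinearMap.id_apply]
  congr 1
  funext i
  simp [Word.fill, Letter.fill]

end algebra
end JacobiHB

namespace JacobiHB

/-! ### Single chords, the infinitesimal braid relations, and parallels of a chord. -/

section chords
variable {K : Type*} [Field K] {m n p q : ℕ}

/-- The diagram whose only chord, with label `c`, joins the arcs `i` and `j`. -/
def chordWord (c : ℕ) (i j : Fin n) : Word m n := fun a =>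
  (if a = i then [.cend (c, false)] else []) ++ (if a = j then [.cend (c, true)] else [])

theorem endCount_chordWord (c : ℕ) (i j : Fin n) (e : ℕ × Bool) :
    (chordWord c i j : Word m n).endCount e = if e.1 = c then 1 else 0 := by
  have h : ∀ a, ((chordWord c i j : Word m n) a).count (.cend e)
      = (if a = i then (if e = (c, false) then 1 else 0) else 0)
        + (if a = j then (if e = (c, true) then 1 else 0) else 0) := by
    intro a
    rw [chordWord, List.count_append]
    congr 1
    all_goals split_ifs <;> simp_all [eq_comm]
  rw [Word.endCount, Finset.sum_congr rfl fun a _ => h a, Finset.sum_add_distrib,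
    Finset.sum_ite_eq' Finset.univ i, Finset.sum_ite_eq' Finset.univ j]
  obtain ⟨k, b⟩ := e
  cases b <;> simp

theorem isChordDiagram_chordWord (c : ℕ) (i j : Fin n) :
    (chordWord c i j : Word m n).IsChordDiagram := by
  intro k
  rw [endCount_chordWord, endCount_chordWord]
  split_ifs <;> simp

theorem ends_chordWord (c : ℕ) (i j : Fin n) :
    (chordWord c i j : Word m n).ends = {(c, false), (c, true)} := by
  ext ⟨k, b⟩
  rw [mem_ends_iff, endCount_chordWord]
  cases b <;> simp

theorem disj_chordWord {c d : ℕ} (h : c ≠ d) (i j k l : Fin n) :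
    Disj (chordWord c i j : Word m n) (chordWord d k l : Word m n) := by
  simp [Disj, ends_chordWord, h]

variable (K) in
/-- The chord between the arcs `i` and `j`. -/
noncomputable def chord (i j : Fin n) : A K 0 n := cls K (chordWord 0 i j)

theorem cls_chordWord (c : ℕ) (i j : Fin n) : cls K (chordWord c i j) = chord K i j := by
  rw [chord, ← cls_mapEnds (K := K) (add_left_injective c) (fun _ => false) (chordWord 0 i j)]
  congr 1
  funext a
  simp only [chordWord, Word.mapEnds, List.map_append]
  split_ifs <;> simp [Letter.mapEnd, relabelEnd]

/-- The two ends of a chord are unnamed. -/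
theorem chord_comm (i j : Fin n) : chord K i j = chord K j i := by
  rcases eq_or_ne i j with rfl | h
  · rfl
  rw [chord, ← cls_mapEnds (K := K) Function.injective_id (fun _ => true) (chordWord 0 i j), chord]
  congr 1
  funext a
  simp only [chordWord, Word.mapEnds, List.map_append]
  split_ifs with h1 h2 <;> first | (exfalso; exact h (h1.symm.trans h2)) | simp [Letter.mapEnd, relabelEnd]

theorem chord_mul_chord (i j k l : Fin n) :
    chord K i j * chord K k l = cls K ((chordWord 0 i j).cat (chordWord 1 k l)) := by
  rw [← cls_chordWord 1 k l, chord, cls_mul_cls (isChordDiagram_chordWord _ _ _)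
    (isChordDiagram_chordWord _ _ _) (disj_chordWord (by decide) _ _ _ _)]

/-- The companion of `chord_mul_chord` with the two labels exchanged. Having both allows products in
either order to match the words of a 4T relation literally. -/
theorem chord_mul_chord' (i j k l : Fin n) :
    chord K i j * chord K k l = cls K ((chordWord 1 i j).cat (chordWord 0 k l)) := by
  rw [← cls_chordWord 1 i j, chord, cls_mul_cls (isChordDiagram_chordWord _ _ _)
    (isChordDiagram_chordWord _ _ _) (disj_chordWord (by decide) _ _ _ _)]

theorem chord_commute (i j k l : Fin n) (h1 : i ≠ k) (h2 : i ≠ l) (h3 : j ≠ k) (h4 : j ≠ l) :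
    Commute (chord K i j) (chord K k l) := by
  rw [Commute, SemiconjBy, chord_mul_chord, chord_mul_chord']
  congr 1
  funext a
  simp only [Word.cat, chordWord]
  by_cases hi : a = i
  · subst hi; simp [h1, h2]
  by_cases hj : a = j
  · subst hj; simp [hi, h3, h4]
  · simp [hi, hj]

/-- This is 4T for a chord joining `i` and `j` and a moving end whose partner stays on `k`. On
different arcs, being before or after an end of the first chord is the order of the two factors. -/
theorem chord_fourT (i j k : Fin n) (hij : i ≠ j) (hik : i ≠ k) (hjk : j ≠ k) :
    chord K i j * (chord K i k + chord K j k) = (chord K i k + chord K j k) * chord K i j := by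
  -- Chord `0` is the fixed chord; `(1, false)` is the moving end and `(1, true)` its partner on the
  -- arc `k`.
  have h := cls_fourT (K := K) (fun a => chordWord 0 i j a ++ if a = k then [.cend (1, true)] else []
    : Word 0 n) 0 (1, false) (by decide)
  have e1 : Word.subst (Letter.before (1, false) (0, false)) (fun a => chordWord 0 i j a ++
      if a = k then [.cend (1, true)] else [] : Word 0 n) = (chordWord 1 i k).cat (chordWord 0 i j) := by
    funext a
    simp only [Word.cat, chordWord, Word.subst, List.flatMap_append]
    rcases eq_or_ne a i with rfl | hi
    · simp [hij, hik, Letter.before]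
    rcases eq_or_ne a j with rfl | hj
    · simp [hi, hjk, Letter.before]
    · split_ifs <;> simp_all [Letter.before]
  have e2 : Word.subst (Letter.after (1, false) (0, false)) (fun a => chordWord 0 i j a ++
      if a = k then [.cend (1, true)] else [] : Word 0 n) = (chordWord 0 i j).cat (chordWord 1 i k) := by
    funext a
    simp only [Word.cat, chordWord, Word.subst, List.flatMap_append]
    rcases eq_or_ne a i with rfl | hi
    · simp [hij, hik, Letter.after]
    rcases eq_or_ne a j with rfl | hj
    · simp [hi, hjk, Letter.after]
    · split_ifs <;> simp_all [Letter.after]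
  have e3 : Word.subst (Letter.before (1, false) (0, true)) (fun a => chordWord 0 i j a ++
      if a = k then [.cend (1, true)] else [] : Word 0 n) = (chordWord 1 j k).cat (chordWord 0 i j) := by
    funext a
    simp only [Word.cat, chordWord, Word.subst, List.flatMap_append]
    rcases eq_or_ne a i with rfl | hi
    · simp [hij, hik, Letter.before]
    rcases eq_or_ne a j with rfl | hj
    · simp [hi, hjk, Letter.before]
    · split_ifs <;> simp_all [Letter.before]
  have e4 : Word.subst (Letter.after (1, false) (0, true)) (fun a => chordWord 0 i j a ++
      if a = k then [.cend (1, true)] else [] : Word 0 n) = (chordWord 0 i j).cat (chordWord 1 j k) := by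
    funext a
    simp only [Word.cat, chordWord, Word.subst, List.flatMap_append]
    rcases eq_or_ne a i with rfl | hi
    · simp [hij, hik, Letter.after]
    rcases eq_or_ne a j with rfl | hj
    · simp [hi, hjk, Letter.after]
    · split_ifs <;> simp_all [Letter.after]
  rw [e1, e2, e3, e4, ← chord_mul_chord', ← chord_mul_chord', ← chord_mul_chord,
    ← chord_mul_chord] at h
  rw [mul_add, add_mul, ← sub_eq_zero, ← neg_eq_zero, ← h]
  abel

/-- An isolated chord commutes with a chord ending on its arc. It is 4T with both ends of the fixed
chord on the same arc, and it is what makes the ribbon element compatible with the coproduct. -/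
theorem chord_self_commute (i j : Fin n) (hij : i ≠ j) :
    Commute (chord K i i) (chord K i j) := by
  have h := cls_fourT (K := K) (fun a => chordWord 0 i i a ++ if a = j then [.cend (1, true)] else []
    : Word 0 n) 0 (1, false) (by decide)
  have e1 : Word.subst (Letter.before (1, false) (0, false)) (fun a => chordWord 0 i i a ++
      if a = j then [.cend (1, true)] else [] : Word 0 n) = (chordWord 1 i j).cat (chordWord 0 i i) := by
    funext a
    simp only [Word.cat, chordWord, Word.subst, List.flatMap_append]
    rcases eq_or_ne a i with rfl | hi
    · simp [hij, Letter.before]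
    · split_ifs <;> simp_all [Letter.before]
  have e4 : Word.subst (Letter.after (1, false) (0, true)) (fun a => chordWord 0 i i a ++
      if a = j then [.cend (1, true)] else [] : Word 0 n) = (chordWord 0 i i).cat (chordWord 1 i j) := by
    funext a
    simp only [Word.cat, chordWord, Word.subst, List.flatMap_append]
    rcases eq_or_ne a i with rfl | hi
    · simp [hij, Letter.after]
    · split_ifs <;> simp_all [Letter.after]
  -- The two ends of the fixed chord are adjacent, so just after the first is just before the
  -- second, and the middle terms of 4T cancel.
  have e2 : Word.subst (Letter.after (1, false) (0, false)) (fun a => chordWord 0 i i a ++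
      if a = j then [.cend (1, true)] else [] : Word 0 n)
      = Word.subst (Letter.before (1, false) (0, true)) (fun a => chordWord 0 i i a ++
      if a = j then [.cend (1, true)] else [] : Word 0 n) := by
    funext a
    simp only [chordWord, Word.subst, List.flatMap_append]
    rcases eq_or_ne a i with rfl | hi
    · simp [hij, Letter.after, Letter.before]
    · split_ifs <;> simp_all [Letter.after, Letter.before]
  rw [e1, e2, e4, ← chord_mul_chord', ← chord_mul_chord, sub_add_cancel, sub_eq_zero] at h
  exact h.symm

/-- Copies of two chord ends on the arcs that satisfy `P` and `Q`. -/
def twoEnds (e d : ℕ × Bool) (P Q : Fin p → Prop) [DecidablePred P] [DecidablePred Q]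
    (l : List (Fin p)) : CopyList p :=
  l.flatMap fun a => (if P a then [(a, e, true)] else []) ++ (if Q a then [(a, d, true)] else [])

section twoEnds
variable {e d : ℕ × Bool} (P Q : Fin p → Prop) [DecidablePred P] [DecidablePred Q]

theorem dist_empty (L : CopyList p) : dist K ∅ L = Finsupp.single (fun _ => []) 1 := by
  induction L with
  | nil => rfl
  | cons x L ih =>
    obtain ⟨i, e, s⟩ := x
    rw [dist_cons_of_notMem _ _ _ (Finset.notMem_empty e), ih]

theorem dist_twoEnds_left (hed : e ≠ d) (l : List (Fin p)) :
    dist K {e} (twoEnds e d P Q l) = (l.map fun a => if P a then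
      Finsupp.single (fun k => if k = a then [Letter.cend e] else []) 1 else 0).sum := by
  have hd : d ∉ ({e} : Finset (ℕ × Bool)) := by simpa using hed.symm
  induction l with
  | nil => rfl
  | cons a l ih =>
    have h1 : dist K {e} (twoEnds e d P Q (a :: l)) = dist K {e} (twoEnds e d P Q l)
        + if P a then Finsupp.single (fun k => if k = a then [Letter.cend e] else []) 1 else 0 := by
      have hw : (Word.prepend a [Letter.cend e] fun _ => [] : Word 0 p)
          = fun k => if k = a then [Letter.cend e] else [] := by
        funext k
        by_cases h : k = a
        · subst h; simp [prepend_self]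
        · simp [prepend_of_ne h, h]
      by_cases hP : P a <;> by_cases hQ : Q a <;>
        simp [twoEnds, hP, hQ, dist_cons_of_mem, dist_cons_of_notMem, hd, dist_empty, sgn, pre_single,
          hw]
    rw [h1, ih, List.map_cons, List.sum_cons, add_comm]

theorem dist_twoEnds_right (hed : e ≠ d) (l : List (Fin p)) :
    dist K {d} (twoEnds e d P Q l) = (l.map fun a => if Q a then
      Finsupp.single (fun k => if k = a then [Letter.cend d] else []) 1 else 0).sum := by
  have hd : e ∉ ({d} : Finset (ℕ × Bool)) := by simpa using hed
  induction l with
  | nil => rfl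
  | cons a l ih =>
    have h1 : dist K {d} (twoEnds e d P Q (a :: l)) = dist K {d} (twoEnds e d P Q l)
        + if Q a then Finsupp.single (fun k => if k = a then [Letter.cend d] else []) 1 else 0 := by
      have hw : (Word.prepend a [Letter.cend d] fun _ => [] : Word 0 p)
          = fun k => if k = a then [Letter.cend d] else [] := by
        funext k
        by_cases h : k = a
        · subst h; simp [prepend_self]
        · simp [prepend_of_ne h, h]
      by_cases hP : P a <;> by_cases hQ : Q a <;>
        simp [twoEnds, hP, hQ, dist_cons_of_mem, dist_cons_of_notMem, hd, dist_empty, sgn, pre_single,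
          hw]
    rw [h1, ih, List.map_cons, List.sum_cons, add_comm]

/-- The two ends choose their arcs independently. On a common arc `e` stays before `d`, since that
is their order in the list. -/
theorem dist_twoEnds (hed : e ≠ d) (l : List (Fin p)) (hl : l.Nodup) :
    dist K {e, d} (twoEnds e d P Q l) = (l.map fun a => (l.map fun b => if P a ∧ Q b then
      Finsupp.single (fun k => (if k = a then [Letter.cend e] else []) ++
        (if k = b then [Letter.cend d] else [])) 1 else 0).sum).sum := by
  set w : Fin p → Fin p → Word 0 p := fun a b k => (if k = a then [Letter.cend e] else []) ++
        (if k = b then [Letter.cend d] else []) with hw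
  have her : ({e, d} : Finset (ℕ × Bool)).erase e = {d} := by
    rw [Finset.erase_insert]; simpa using hed
  have hdr : ({e, d} : Finset (ℕ × Bool)).erase d = {e} := by
    rw [Finset.pair_comm, Finset.erase_insert]; simpa using hed.symm
  induction l with
  | nil =>
    rw [twoEnds, List.flatMap_nil, dist_nil, if_neg (Finset.insert_ne_empty _ _)]
    rfl
  | cons a l ih =>
    obtain ⟨ha, hl⟩ := List.nodup_cons.1 hl
    -- Four cases for the arc `a`: it receives neither end, only `d`, only `e`, or both.
    have h1 : dist K {e, d} (twoEnds e d P Q (a :: l)) = dist K {e, d} (twoEnds e d P Q l)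
        + (if Q a then pre K a [.cend d] (dist K {e} (twoEnds e d P Q l)) else 0)
        + (if P a then pre K a [.cend e] (dist K {d} (twoEnds e d P Q l)) else 0)
        + if P a ∧ Q a then Finsupp.single (w a a) 1 else 0 := by
      have h2 : (Word.prepend a [Letter.cend e] (Word.prepend a [Letter.cend d] fun _ => []) : Word 0 p)
          = w a a := by
        funext k
        by_cases h : k = a
        · subst h; simp [prepend_self, hw]
        · simp [prepend_of_ne h, h, hw]
      by_cases hP : P a <;> by_cases hQ : Q a
      · simp only [twoEnds, List.flatMap_cons, hP, hQ, if_true, List.cons_append, List.nil_append,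
          and_self]
        rw [dist_cons_of_mem _ _ _ (by simp), her, dist_cons_of_mem _ _ _ (by simp), hdr,
          dist_cons_of_mem _ _ _ (by simp), Finset.erase_singleton, dist_empty, map_add, map_smul,
          pre_single, pre_single, h2]
        simp only [sgn, if_true, one_smul]
        abel
      · simp [twoEnds, hP, hQ, dist_cons_of_mem, her, sgn]
      · simp [twoEnds, hP, hQ, dist_cons_of_mem, hdr, sgn]
      · simp [twoEnds, hP, hQ]
    have h3 : (if Q a then pre K a [.cend d] (dist K {e} (twoEnds e d P Q l)) else 0)
        = (l.map fun x => if P x ∧ Q a then Finsupp.single (w x a) (1 : K) else 0).sum := by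
      by_cases hQ : Q a
      · rw [if_pos hQ, dist_twoEnds_left P Q hed, map_list_sum, List.map_map]
        congr 1
        refine List.map_congr_left fun x hx => ?_
        have hne : x ≠ a := fun h => ha (h ▸ hx)
        simp only [Function.comp, hQ, and_true]
        split_ifs
        · rw [pre_single]
          congr 1
          funext k
          by_cases h : k = a
          · subst h; simp [prepend_self, hw, hne.symm]
          · simp [prepend_of_ne h, h, hw]
        · rw [map_zero]
      · simp [hQ]
    have h4 : (if P a then pre K a [.cend e] (dist K {d} (twoEnds e d P Q l)) else 0)
        = (l.map fun x => if P a ∧ Q x then Finsupp.single (w a x) (1 : K) else 0).sum := by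
      by_cases hP : P a
      · rw [if_pos hP, dist_twoEnds_right P Q hed, map_list_sum, List.map_map]
        congr 1
        refine List.map_congr_left fun x hx => ?_
        simp only [Function.comp, hP, true_and]
        split_ifs
        · rw [pre_single]
          congr 1
          funext k
          by_cases h : k = a
          · subst h; simp [prepend_self, hw]
          · simp [prepend_of_ne h, h, hw]
        · rw [map_zero]
      · simp [hP]
    rw [h1, h3, h4, ih hl]
    simp only [List.map_cons, List.sum_cons, List.sum_map_add]
    abel

end twoEnds

theorem cab_pullWord (f : Fin p → Option (Fin q)) (v : Word 0 q) : cab (pullWord f) (flat v)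
    = (List.finRange p).flatMap fun a =>
      (f a).elim [] fun k => (endList (v k)).map fun e => (a, e, true) := by
  unfold cab
  congr 1; funext a
  rw [pullWord]
  cases f a with
  | none => rfl
  | some k => simp [cabLetter, filter_flat]

/-- Each end of the chord is distributed over the copies of its arc, all with sign `+1` because only
positive beads occur. Deleted arcs have no copies, so their chords vanish. -/
theorem pull_chord (f : Fin p → Option (Fin q)) (i j : Fin q) : pull K f (chord K i j)
    = ∑ a, ∑ b, if f a = some i ∧ f b = some j then chord K a b else 0 := by
  have h1 : cab (pullWord f) (flat (chordWord 0 i j)) = twoEnds (0, false) (0, true)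
      (fun a => f a = some i) (fun a => f a = some j) (List.finRange p) := by
    rw [cab_pullWord, twoEnds]
    congr 1; funext a
    cases f a with
    | none => simp
    | some k =>
      simp only [Option.elim_some, Option.some.injEq, chordWord, endList, List.filterMap_append,
        List.map_append]
      congr 1 <;> split_ifs <;> rfl
  rw [pull_apply, chord, comp_cls_eq_dist (ends_pullWord f) (isChordDiagram_chordWord 0 i j), h1,
    ends_chordWord, dist_twoEnds _ _ (by decide) _ (List.nodup_finRange p), map_list_sum,
    List.map_map, ← List.ofFn_eq_map, List.sum_ofFn]
  refine Finset.sum_congr rfl fun a _ => ?_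
  rw [Function.comp, map_list_sum, List.map_map, ← List.ofFn_eq_map, List.sum_ofFn]
  refine Finset.sum_congr rfl fun b _ => ?_
  rw [Function.comp]
  split_ifs
  · rw [clsL_single]; rfl
  · exact map_zero _

end chords
end JacobiHB

namespace JacobiHB

/-! ### Free reduction of beads and sliding of chords through them. -/

section sliding
variable {K : Type*} [Field K] {m n p q : ℕ}

/-- Equality up to free reduction of the beads. -/
inductive BeadEq : List (Letter m) → List (Letter m) → Prop
  | refl (l : List (Letter m)) : BeadEq l l
  | symm {l l' : List (Letter m)} : BeadEq l l' → BeadEq l' l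
  | trans {l l' l'' : List (Letter m)} : BeadEq l l' → BeadEq l' l'' → BeadEq l l''
  | append {a b c d : List (Letter m)} : BeadEq a b → BeadEq c d → BeadEq (a ++ c) (b ++ d)
  | cancel (j : Fin m) (s : Bool) : BeadEq [.gen j s, .gen j (!s)] []

theorem BeadEq.cons {l l' : List (Letter m)} (x : Letter m) (h : BeadEq l l') :
    BeadEq (x :: l) (x :: l') := (BeadEq.refl [x]).append h

theorem BeadEq.cancel_cons (j : Fin m) (s : Bool) (l : List (Letter m)) :
    BeadEq (.gen j s :: .gen j (!s) :: l) l := (BeadEq.cancel j s).append (.refl l)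

/-- Induction on the derivation, with an arbitrary context `u`, `v` on the arc; the context absorbs
the other factor in the case of a concatenation. -/
theorem cls_update_of_beadEq {l l' : List (Letter m)} (h : BeadEq l l') :
    ∀ (w : Word m n) (i : Fin n) (u v : List (Letter m)), w i = u ++ l ++ v →
      cls K w = cls K (Function.update w i (u ++ l' ++ v)) := by
  induction h with
  | refl l => intro w i u v h; rw [← h, Function.update_eq_self]
  | symm _ ih =>
    intro w i u v h
    have := ih (Function.update w i (u ++ _ ++ v)) i u v (Function.update_self _ _ _)
    rw [Function.update_idem, ← h, Function.update_eq_self] at this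
    exact this.symm
  | trans _ _ ih ih' =>
    intro w i u v h
    rw [ih w i u v h, ih' _ i u v (Function.update_self _ _ _), Function.update_idem]
  | @append a b c d _ _ ih ih' =>
    intro w i u v h
    rw [ih w i u (c ++ v) (by rw [h]; simp),
      ih' _ i (u ++ b) v (by rw [Function.update_self]; simp), Function.update_idem]
    simp
  | cancel j s =>
    intro w i u v h
    rw [cls_cancel h rfl, List.append_nil]

/-- The arcs are replaced one after another. -/
theorem cls_eq_of_beadEq {w w' : Word m n} (h : ∀ i, BeadEq (w i) (w' i)) : cls K w = cls K w' := by
  have key : ∀ s : Finset (Fin n), cls K w = cls K fun i => if i ∈ s then w' i else w i := by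
    intro s
    induction s using Finset.induction_on with
    | empty => simp
    | insert a s ha ih =>
      rw [ih, cls_update_of_beadEq (h a) _ a [] [] (by simp [ha])]
      congr 1
      funext i
      rcases eq_or_ne i a with rfl | hi
      · simp
      · simp [hi]
  simpa using key Finset.univ

/-- Put a letter in front of a reduced word. -/
def consReduce (x : Letter m) (l : List (Letter m)) : List (Letter m) :=
  match x, l with
  | .gen j s, .gen k t :: l => if k = j ∧ t = !s then l else .gen j s :: .gen k t :: l
  | x, l => x :: l

/-- Free reduction. -/
def freeReduce (l : List (Letter m)) : List (Letter m) := l.foldr consReduce []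

theorem beadEq_consReduce (x : Letter m) (l : List (Letter m)) :
    BeadEq (x :: l) (consReduce x l) := by
  unfold consReduce
  split
  · split_ifs with h
    · obtain ⟨rfl, rfl⟩ := h
      exact .cancel_cons _ _ _
    · exact .refl _
  · exact .refl _

theorem beadEq_freeReduce (l : List (Letter m)) : BeadEq l (freeReduce l) := by
  induction l with
  | nil => exact .refl _
  | cons x l ih => exact (ih.cons x).trans (beadEq_consReduce x _)

/-- Makes equality up to free reduction checkable by evaluation on concrete words. -/
theorem cls_eq_of_freeReduce {w w' : Word m n} (h : ∀ i, freeReduce (w i) = freeReduce (w' i)) :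
    cls K w = cls K w' :=
  cls_eq_of_beadEq fun i => (beadEq_freeReduce _).trans (h i ▸ (beadEq_freeReduce _).symm)

/-- Conjugation of all the ends of the chords with labels in `P`. -/
def Letter.aroundAll (P : Finset ℕ) (j : Fin m) (s : Bool) : Letter m → List (Letter m)
  | .gen i t => [.gen i t]
  | .cend e => if e.1 ∈ P then [.gen j s, .cend e, .gen j (!s)] else [.cend e]

theorem cls_aroundAll (P : Finset ℕ) (j : Fin m) (s : Bool) (w : Word m n) :
    cls K (w.subst (Letter.aroundAll P j s)) = cls K w := by
  induction P using Finset.induction_on with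
  | empty =>
    congr 1
    funext i
    have : Letter.aroundAll ∅ j s = fun x : Letter m => [x] := by
      funext x; cases x <;> simp [Letter.aroundAll]
    simp [Word.subst, this]
  | insert a P ha ih =>
    rw [← ih, ← cls_around (K := K) a j s (w.subst (Letter.aroundAll P j s))]
    congr 1
    funext i
    simp only [Word.subst, List.flatMap_assoc]
    congr 1
    funext x
    rcases x with _ | e
    · rfl
    · by_cases h1 : e.1 = a
      · simp [Letter.aroundAll, Letter.around, h1, ha]
      · by_cases h2 : e.1 ∈ P <;> simp [Letter.aroundAll, Letter.around, h1, h2]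

theorem flatMap_aroundAll_of_disj {P : Finset ℕ} {l : List (Letter m)}
    (h : ∀ e, .cend e ∈ l → e.1 ∉ P) (j : Fin m) (s : Bool) :
    l.flatMap (Letter.aroundAll P j s) = l := by
  induction l with
  | nil => rfl
  | cons x l ih =>
    rw [List.flatMap_cons, ih fun e he => h e (List.mem_cons_of_mem _ he)]
    rcases x with _ | e
    · rfl
    · simp [Letter.aroundAll, h e List.mem_cons_self]

/-- Conjugating each end of a bead-free stretch telescopes: the inner pairs `x⁻¹ x` cancel and only
the outermost beads remain. -/
theorem beadEq_flatMap_aroundAll {P : Finset ℕ} {l : List (Letter m)}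
    (h : ∀ x ∈ l, ∃ e : ℕ × Bool, x = .cend e ∧ e.1 ∈ P) (j : Fin m) (s : Bool) :
    BeadEq (l.flatMap (Letter.aroundAll P j s)) (.gen j s :: (l ++ [.gen j (!s)])) := by
  induction l with
  | nil => exact (BeadEq.cancel j s).symm
  | cons x l ih =>
    obtain ⟨e, rfl, he⟩ := h x List.mem_cons_self
    have h1 : Letter.aroundAll P j s (.cend e) = [.gen j s, .cend e, .gen j (!s)] := by
      simp [Letter.aroundAll, he]
    rw [List.flatMap_cons, h1]
    refine ((BeadEq.refl _).append (ih fun x hx => h x (List.mem_cons_of_mem _ hx))).trans ?_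
    have := BeadEq.cancel_cons j (!s) (l ++ [.gen j (!s)])
    rw [Bool.not_not] at this
    exact (this.cons _).cons _

/-- A list of chord ends. -/
def IsBare (l : List (Letter m)) : Prop := ∀ x ∈ l, ∃ e : ℕ × Bool, x = .cend e

/-- A family of chords may be conjugated with a bead. -/
theorem cls_conj {a b c : Word m n} (hb : ∀ i, IsBare (b i)) (hba : Disj b a) (hbc : Disj b c)
    (j : Fin m) (s : Bool) : cls K ((a.cat b).cat c)
      = cls K fun i => a i ++ .gen j s :: b i ++ .gen j (!s) :: c i := by
  rw [← cls_aroundAll (b.ends.image Prod.fst) j s]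
  refine cls_eq_of_beadEq fun i => ?_
  have h1 : ∀ {d : Word m n}, Disj b d → ∀ e, .cend e ∈ d i → e.1 ∉ b.ends.image Prod.fst := by
    intro d hd e he h
    obtain ⟨e', he', h⟩ := Finset.mem_image.1 h
    exact hd e' he' e (mem_ends.2 ⟨i, he⟩) h
  have h2 : ∀ x ∈ b i, ∃ e : ℕ × Bool, x = .cend e ∧ e.1 ∈ b.ends.image Prod.fst := by
    intro x hx
    obtain ⟨e, rfl⟩ := hb i x hx
    exact ⟨e, rfl, Finset.mem_image_of_mem _ (mem_ends.2 ⟨i, hx⟩)⟩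
  simp only [Word.subst, Word.cat, List.flatMap_append, flatMap_aroundAll_of_disj (h1 hba),
    flatMap_aroundAll_of_disj (h1 hbc)]
  have := ((BeadEq.refl (a i)).append (beadEq_flatMap_aroundAll h2 j s)).append (.refl (c i))
  simpa using this

theorem isBare_map (φ : Fin 0 → Fin m) (l : List (Letter 0)) : IsBare (l.map (Letter.mapGen φ)) := by
  intro x hx
  obtain ⟨y, -, rfl⟩ := List.mem_map.1 hx
  rcases y with ⟨j, _⟩ | e
  · exact j.elim0
  · exact ⟨e, rfl⟩

/-- Chord diagrams without beads, considered with more beads. -/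
def Word.bare (m : ℕ) (u : Word 0 n) : Word m n := u.mapGens Fin.elim0

theorem isChordDiagram_mapGens {φ : Fin m → Fin p} {w : Word m n} (h : w.IsChordDiagram) :
    (w.mapGens φ).IsChordDiagram := (isChordDiagram_congr (endCount_mapGens φ w)).2 h

theorem isBare_bare (u : Word 0 n) (i : Fin n) : IsBare (u.bare m i) := isBare_map _ _

/-- One bead on every arc. -/
def beadWord (n : ℕ) : Word 1 n := fun _ => [.gen 0 true]

theorem ends_beadWord : (beadWord n).ends = ∅ := by
  rw [ends_eq_empty_iff]; simp [beadWord]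

/-- Conjugate all chords of `u` by the bead: `u x v` becomes `x u x⁻¹ x v`, and the last two beads
cancel. It is essential that the same bead lies on every arc at the same height. -/
theorem cls_bead_cat {u v : Word 0 n} (h : Disj u v) :
    cls K (((u.bare 1).cat (beadWord n)).cat (v.bare 1))
      = cls K ((beadWord n).cat ((u.cat v).bare 1)) := by
  have h1 := cls_conj (K := K) (a := emptyWord 1 n) (b := u.bare 1)
    (c := (beadWord n).cat (v.bare 1)) (isBare_bare u)
    (disj_of_ends_eq_empty_right ends_emptyWord _)
    (disj_cat_right (disj_of_ends_eq_empty_right ends_beadWord _) (by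
      rw [Disj, Word.bare, Word.bare, ends_mapGens, ends_mapGens]; exact h)) 0 true
  have h2 : ((emptyWord 1 n).cat (u.bare 1)).cat ((beadWord n).cat (v.bare 1))
      = ((u.bare 1).cat (beadWord n)).cat (v.bare 1) := by
    funext i; simp [Word.cat, emptyWord]
  rw [← h2, h1]
  refine cls_eq_of_beadEq fun i => ?_
  have h3 := (BeadEq.refl (.gen 0 true :: u.bare 1 i)).append
    (BeadEq.cancel_cons 0 false (v.bare 1 i))
  simpa [Word.cat, emptyWord, beadWord, Word.bare, Word.mapGens] using h3

/-- The word with one bead `x₀` on every arc is the iterated coproduct, so this says that it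
commutes with every `x : 0 → n`. Quasi-coassociativity and the conjugation axiom for `R` come from
here. Since `x` and `y` have no beads, the substance is `cls_bead_cat`; the rest is bookkeeping of
bead names. -/
theorem comp_mu_bead (x y : A K 0 n) :
    (comp (cls K (muWord n)) (tens (comp (cls K (muWord n)) (tens x (cls K (beadWord n)))) y
      : A K 1 (n + n)) : A K 1 n)
      = (comp (cls K (muWord n)) (tens (cls K (beadWord n)) (x * y) : A K 1 (n + n)) : A K 1 n) := by
  induction x using A_induction with
  | h0 => simp
  | hadd x x' h h' => simp only [map_add, add_mul, LinearMap.add_apply] at *; rw [h, h']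
  | hsmul c x h => simp only [map_smul, smul_mul_assoc, LinearMap.smul_apply] at *; rw [h]
  | hc u hu =>
    induction y using A_induction with
    | h0 => simp
    | hadd y y' h h' => simp only [map_add, mul_add] at *; rw [h, h']
    | hsmul c y h => simp only [map_smul, mul_smul_comm] at *; rw [h]
    | hc v hv =>
      obtain ⟨u', v', h1, h2, hu', hv', hd⟩ := exists_disj (K := K) u v
      rw [← h1, ← h2]
      have hu := hu' hu
      have hv := hv' hv
      have hb := isChordDiagram_of_ends_eq_empty (ends_beadWord (n := n))
      have hc := isChordDiagram_cat (isChordDiagram_mapGens (φ := Fin.castAdd 1) hu)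
        (isChordDiagram_mapGens (φ := Fin.natAdd 0) hb)
        (disj_of_ends_eq_empty_right (by rw [ends_mapGens, ends_beadWord]) _)
      rw [cls_mul_cls hu hv hd, comp_muWord_tens hu hb (disj_of_ends_eq_empty_right ends_beadWord _)]
      have h3 := comp_muWord_tens (K := K) hc hv (disj_cat_left
        (by rw [Disj, ends_mapGens]; exact hd)
        (disj_of_ends_eq_empty_left (by rw [ends_mapGens, ends_beadWord]) _))
      have h4 := comp_muWord_tens (K := K) hb (isChordDiagram_cat hu hv hd)
        (disj_of_ends_eq_empty_left ends_beadWord _)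
      refine h3.trans (Eq.trans ?_ h4.symm)
      refine Eq.trans ?_ ((cls_bead_cat hd).trans ?_)
      · congr 1
        funext i
        simp only [Word.cat, Word.mapGens, Word.bare, List.map_append, List.map_map]
        congr 1
        · congr 1
          refine List.map_congr_left fun x _ => ?_
          rcases x with ⟨j, _⟩ | e
          · exact j.elim0
          · rfl
        · refine List.map_congr_left fun x _ => ?_
          rcases x with ⟨j, _⟩ | e
          · exact j.elim0
          · rfl
      · congr 1
        funext i
        simp only [Word.cat, Word.mapGens, Word.bare, List.map_append]
        congr 1
        congr 1 <;>
        · refine List.map_congr_left fun x _ => ?_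
          rcases x with ⟨j, _⟩ | e
          · exact j.elim0
          · rfl

end sliding
end JacobiHB

namespace JacobiHB

/-! ### Diagrams on one arc: centrality and commutativity. -/

section oneArc
variable {K : Type*} [Field K] {m n p q : ℕ}

theorem comp_mu_one (z : A K m n) :
    (comp (cls K (muWord n)) (tens z (1 : A K 0 n) : A K m (n + n)) : A K m n) = z := by
  induction z using A_induction with
  | h0 => simp
  | hadd x x' h h' => simp only [map_add, LinearMap.add_apply] at *; rw [h, h']
  | hsmul c x h => simp only [map_smul, LinearMap.smul_apply] at *; rw [h]
  | hc w hw =>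
    refine (comp_muWord_tens hw isChordDiagram_emptyWord
      (disj_of_ends_eq_empty_right ends_emptyWord w)).trans ?_
    congr 1
    funext i
    refine (List.append_nil _).trans ?_
    have : (Letter.mapGen (Fin.castAdd 0) : Letter m → Letter m) = id := by
      funext x; cases x <;> rfl
    exact (congrArg (fun f => (w i).map f) this).trans (List.map_id _)

/-- The case `y = 1` of `comp_mu_bead`; for one arc it is the special property. -/
theorem comp_mu_bead_comm (x : A K 0 n) :
    (comp (cls K (muWord n)) (tens x (cls K (beadWord n)) : A K 1 (n + n)) : A K 1 n)
      = (comp (cls K (muWord n)) (tens (cls K (beadWord n)) x : A K 1 (n + n)) : A K 1 n) := by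
  have := comp_mu_bead x 1
  rw [mul_one] at this
  rw [← this]
  exact (comp_mu_one _).symm

/-- Chords may be moved across beads on a single arc. -/
theorem cls_slide_beads (d l c : List (Letter m)) (g : List (Fin m × Bool)) (hl : IsBare l)
    (hd : ∀ e e', .cend e ∈ l → .cend e' ∈ d → e.1 ≠ e'.1)
    (hc : ∀ e e', .cend e ∈ l → .cend e' ∈ c → e.1 ≠ e'.1) :
    cls K (fun _ => d ++ (g.map fun x => .gen x.1 x.2) ++ l ++ c : Word m 1)
      = cls K (fun _ => d ++ l ++ (g.map fun x => .gen x.1 x.2) ++ c : Word m 1) := by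
  induction g using List.reverseRecOn generalizing c with
  | nil => simp
  | append_singleton g x ih =>
    -- Move the last bead `x` first: conjugating `l` by `x⁻¹` gives `x x⁻¹ l x`, hence `l x`. The
    -- remaining beads are moved by induction with `x` joined to `c`.
    have h1 := ih (.gen x.1 x.2 :: c) fun e e' he he' => hc e e' he (by simpa using he')
    have h2 := cls_conj (K := K)
      (a := (fun _ => d ++ ((g ++ [x]).map fun x => .gen x.1 x.2) : Word m 1))
      (b := fun _ => l) (c := fun _ => c) (fun _ => hl) (by
        intro e he e' he'
        obtain ⟨_, he⟩ := mem_ends.1 he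
        obtain ⟨_, he'⟩ := mem_ends.1 he'
        refine hd e e' he ?_
        rcases List.mem_append.1 he' with h | h
        · exact h
        · simp at h) (by
        intro e he e' he'
        obtain ⟨_, he⟩ := mem_ends.1 he
        obtain ⟨_, he'⟩ := mem_ends.1 he'
        exact hc e e' he he') x.1 (!x.2)
    rw [Bool.not_not] at h2
    refine Eq.trans ?_ (Eq.trans h1 ?_)
    · refine h2.trans ?_
      refine cls_eq_of_beadEq fun i => ?_
      have := (BeadEq.refl (d ++ g.map fun x => .gen x.1 x.2)).append
        (BeadEq.cancel_cons x.1 x.2 (l ++ .gen x.1 x.2 :: c))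
      simpa using this
    · congr 1
      funext i
      simp

theorem disj_one {u : Word 0 1} {v : Word m 1} (h : Disj u v) (φ : Fin 0 → Fin n) :
    ∀ e e', .cend e ∈ (u 0).map (Letter.mapGen φ) → .cend e' ∈ v 0 → e.1 ≠ e'.1 := by
  intro e e' he he'
  refine h e ?_ e' (mem_ends.2 ⟨0, he'⟩)
  rw [← ends_mapGens φ]
  exact mem_ends.2 ⟨0, he⟩

theorem count_gen_of_isBare {l : List (Letter m)} (h : IsBare l) (k : Fin m) (s : Bool) :
    l.count (.gen k s) = 0 := by
  rw [List.count_eq_zero]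
  intro h'
  obtain ⟨e, he⟩ := h _ h'
  cases he

theorem flatMap_fill_bare (w : Word m n) (u : List (Letter 0)) (φ : Fin 0 → Fin n) :
    (u.map (Letter.mapGen φ)).flatMap (Letter.fill w) = u.map (Letter.mapGen Fin.elim0) := by
  induction u with
  | nil => rfl
  | cons x u ih =>
    rcases x with ⟨j, _⟩ | e
    · exact j.elim0
    · rw [List.map_cons, List.flatMap_cons, ih]; rfl

theorem map_mapGen_elim0 (l : List (Letter 0)) : l.map (Letter.mapGen Fin.elim0) = l :=
  map_mapGen_zero _ _

/-- Without beads, diagrams on one arc commute. -/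
theorem mul_comm_one (x y : A K 0 1) : x * y = y * x := by
  induction x using A_induction with
  | h0 => simp
  | hadd x x' h h' => rw [add_mul, mul_add, h, h']
  | hsmul c x h => rw [smul_mul_assoc, mul_smul_comm, h]
  | hc u hu =>
    induction y using A_induction with
    | h0 => simp
    | hadd x x' h h' => rw [add_mul, mul_add, h, h']
    | hsmul c x h => rw [smul_mul_assoc, mul_smul_comm, h]
    | hc v hv =>
      obtain ⟨u', v', h1, h2, hu', hv', hd⟩ := exists_disj (K := K) u v
      rw [← h1, ← h2]
      have hu := hu' hu
      have hv := hv' hv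
      have hd' : Disj v' u' := fun e he d hd'' => (hd d hd'' e he).symm
      rw [cls_mul_cls hu hv hd, cls_mul_cls hv hu hd']
      -- On one arc `x u = u x` for a bead `x`. Composing with `v`, that is, substituting `v` for
      -- `x`, turns this into `v u = u v`.
      have h := cls_slide_beads (K := K) [] (u'.bare 1 0) [] [(0, true)] (isBare_bare u' 0)
        (by simp) (by simp)
      have hE : ∀ a b : List (Letter 1), IsBare a → IsBare b → a ++ b = u'.bare 1 0 →
          comp (cls K (fun _ => a ++ .gen 0 true :: b : Word 1 1)) (cls K v')
            = cls K (Word.fill (fun _ => a ++ .gen 0 true :: b : Word 1 1) v') := by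
        intro a b ha hb hab
        have hend : ∀ e, (Word.endCount (fun _ => a ++ .gen 0 true :: b : Word 1 1) e)
            = u'.endCount e := by
          intro e
          have := endCount_mapGens (Fin.elim0 : Fin 0 → Fin 1) u' e
          rw [← this]
          change _ = Word.endCount (u'.bare 1) e
          simp only [Word.endCount, Fin.sum_univ_one, ← hab]
          simp
        have hends : Word.ends (fun _ => a ++ .gen 0 true :: b : Word 1 1) = u'.ends := by
          ext e; rw [mem_ends_iff, mem_ends_iff, hend]
        rw [comp_cls_linear (τ := fun _ => true) _ _ hv, revSign_true, one_smul]
        · rw [Disj, hends]; exact hd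
        · rw [isLinear_iff]
          intro k s
          obtain rfl := Subsingleton.elim k 0
          cases s <;> simp [count_gen_of_isBare, ha, hb]
        · intro k
          rw [hend, hend]
          exact hu k
      have e1 := hE [] _ (by simp [IsBare]) (isBare_bare u' 0) rfl
      have e2 := hE _ [] (isBare_bare u' 0) (by simp [IsBare]) (List.append_nil _)
      have e3 : cls K (fun _ => [] ++ .gen 0 true :: u'.bare 1 0 : Word 1 1)
          = cls K (fun _ => u'.bare 1 0 ++ [.gen 0 true] : Word 1 1) := by simpa using h
      rw [e3] at e1
      rw [e1] at e2
      have w1 : Word.fill (fun _ => [] ++ .gen 0 true :: u'.bare 1 0 : Word 1 1) v' = v'.cat u' := by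
        funext i
        obtain rfl := Subsingleton.elim i 0
        simp only [Word.fill, List.nil_append, List.flatMap_cons, Word.bare, Word.mapGens,
          flatMap_fill_bare, map_mapGen_elim0]
        rfl
      have w2 : Word.fill (fun _ => u'.bare 1 0 ++ [.gen 0 true] : Word 1 1) v' = u'.cat v' := by
        funext i
        obtain rfl := Subsingleton.elim i 0
        simp only [Word.fill, List.flatMap_append, List.flatMap_cons, Word.bare, Word.mapGens,
          flatMap_fill_bare, map_mapGen_elim0, List.flatMap_nil, List.append_nil]
        rfl
      rw [w1, w2] at e2
      exact e2.symm

end oneArc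
end JacobiHB

namespace JacobiHB

/-! ### Contractions with the antipode on one arc. -/

section antipode
variable {K : Type*} [Field K] {m n p q : ℕ}

/-- The identity or the antipode. -/
def signWord (s : Bool) : Word 1 1 := fun _ => [.gen 0 s]

theorem ends_signWord (s : Bool) : (signWord s).ends = ∅ := by
  rw [ends_eq_empty_iff]; simp [signWord]

theorem isChordDiagram_signWord (s : Bool) : (signWord s).IsChordDiagram :=
  isChordDiagram_of_ends_eq_empty (ends_signWord s)

/-- The word of the product of the generators, on one arc. -/
def prodWord (n : ℕ) : Word n 1 := fun _ => (List.finRange n).map fun k => .gen k true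

theorem ends_prodWord (n : ℕ) : (prodWord n).ends = ∅ := by
  rw [ends_eq_empty_iff]; simp [prodWord]

theorem isLinear_prodWord (n : ℕ) : (prodWord n).IsLinear fun _ => true := by
  rw [isLinear_iff]
  intro k s
  rw [Fin.sum_univ_one, prodWord]
  cases s
  · simp [List.count_eq_zero]
  · rw [if_pos rfl, List.count_map_of_injective _ (fun k : Fin n => Letter.gen k true)
      (fun a b h => (Letter.gen.inj h).1)]
    exact List.count_eq_one_of_mem (List.nodup_finRange n) (List.mem_finRange k)

theorem count_cend_bare (u : Word 0 1) (φ : Fin 0 → Fin m) (e : ℕ × Bool) :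
    ((u 0).map (Letter.mapGen φ)).count (.cend e) = u.endCount e := by
  rw [← endCount_mapGens φ u, Word.endCount, Fin.sum_univ_one]; rfl

theorem map_mapGen_bare (φ : Fin 0 → Fin m) (ψ : Fin m → Fin n) (l : List (Letter 0)) :
    (l.map (Letter.mapGen φ)).map (Letter.mapGen ψ) = l.map (Letter.mapGen Fin.elim0) := by
  rw [List.map_map]
  refine List.map_congr_left fun x _ => ?_
  rcases x with ⟨j, _⟩ | e
  · exact j.elim0
  · rfl

theorem map_mapGen_eq_elim0 (φ : Fin 0 → Fin m) (l : List (Letter 0)) :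
    l.map (Letter.mapGen φ) = l.map (Letter.mapGen Fin.elim0) := by
  rw [Subsingleton.elim φ Fin.elim0]

theorem juxt_sign_sign (s t : Bool) (u : Word 0 1) :
    (juxt (signWord s) (juxt u (signWord t)) : Word 2 3)
      = ![[.gen 0 s], u.bare 2 0, [.gen 1 t]] := by
  funext i
  fin_cases i
  · rfl
  · exact map_mapGen_bare _ _ (u 0)
  · rfl

/-- The word of the counit. -/
def counitWord : Word 1 0 := Fin.elim0

/-- The composite is the word `x₀^{∓1} x x₀^{±1}` on one arc; sliding `x` past the first bead makes
the beads cancel. The two values of `s` are the axioms for `alpha` and `beta`. -/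
theorem antipode_convolution_aux (s : Bool) (x : A K 0 1) :
    (comp (cls K (prodWord 3)) (comp (tens (cls K (signWord s)) (tens x (cls K (signWord (!s)))) :
      A K 2 3) (cls K (beadWord 2))) : A K 1 1) = comp x (cls K counitWord) := by
  induction x using A_induction with
  | h0 => simp
  | hadd x x' h h' => simp only [map_add, LinearMap.add_apply] at *; rw [h, h']
  | hsmul c x h => simp only [map_smul, LinearMap.smul_apply] at *; rw [h]
  | hc u hu =>
    have hd := disj_of_ends_eq_empty_right (ends_signWord (!s)) u
    have hd' := disj_of_ends_eq_empty_left (ends_signWord s) (juxt u (signWord (!s)))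
    have hY := isChordDiagram_juxt hu (isChordDiagram_signWord (!s)) hd
    have hY' := isChordDiagram_juxt (isChordDiagram_signWord s) hY hd'
    have h1 : (tens (cls K (signWord s)) (tens (cls K u) (cls K (signWord (!s)))) : A K 2 3)
        = cls K (![[.gen 0 s], u.bare 2 0, [.gen 1 (!s)]] : Word 2 3) := by
      rw [tens_cls_of_disj hu (isChordDiagram_signWord (!s)) hd]
      refine (tens_cls_of_disj (isChordDiagram_signWord s) hY hd').trans ?_
      exact congrArg _ (juxt_sign_sign s (!s) u)
    have hY'' : Word.IsChordDiagram (![[.gen 0 s], u.bare 2 0, [.gen 1 (!s)]] : Word 2 3) := by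
      rw [← juxt_sign_sign]; exact hY'
    have h2 : Word.fill (![[.gen 0 s], u.bare 2 0, [.gen 1 (!s)]] : Word 2 3) (beadWord 2)
        = ![[.gen 0 s], u.bare 1 0, [.gen 0 (!s)]] := by
      funext i
      fin_cases i
      · cases s <;> rfl
      · exact flatMap_fill_bare (beadWord 2) (u 0) _
      · cases s <;> rfl
    have h3 : Word.IsChordDiagram (![[.gen 0 s], u.bare 1 0, [.gen 0 (!s)]] : Word 1 3) := by
      intro k
      have := hu k
      simp only [Word.endCount, Fin.sum_univ_three, Word.bare, Word.mapGens] at *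
      simpa [count_cend_bare, Word.endCount] using this
    have hε : counitWord.ends = ∅ := by
      rw [ends_eq_empty_iff]; exact fun i => i.elim0
    rw [h1, comp_cls_inner hY'' ends_beadWord, h2,
      comp_cls_linear_pos (isLinear_prodWord 3) (ends_prodWord 3) h3, comp_cls_inner hu hε]
    have h4 := cls_slide_beads (K := K) [] (u.bare 1 0) [.gen 0 (!s)] [(0, s)] (isBare_bare u 0)
      (by simp) (by simp)
    have h5 : Word.fill (prodWord 3) (![[.gen 0 s], u.bare 1 0, [.gen 0 (!s)]] : Word 1 3)
        = fun _ => [] ++ [(0, s)].map (fun x => Letter.gen x.1 x.2) ++ u.bare 1 0 ++ [.gen 0 (!s)] := by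
      funext i
      simp [Word.fill, prodWord, List.finRange_succ, Letter.fill]
    rw [h5, h4]
    refine cls_eq_of_beadEq fun i => ?_
    obtain rfl := Subsingleton.elim i 0
    have h6 : Word.fill u counitWord 0 = u.bare 1 0 := by
      have := flatMap_fill_bare counitWord (u 0) id
      rw [map_mapGen_zero] at this
      exact this
    rw [h6]
    have := (BeadEq.refl (u.bare 1 0)).append (BeadEq.cancel 0 s)
    simpa using this

theorem juxt_sign_sign_sign (s t r : Bool) (u v : Word 0 1) :
    (juxt (signWord s) (juxt u (juxt (signWord t) (juxt v (signWord r)))) : Word 3 5)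
      = ![[.gen 0 s], u.bare 3 0, [.gen 1 t], v.bare 3 0, [.gen 2 r]] := by
  funext i
  fin_cases i
  · rfl
  · exact map_mapGen_bare _ _ (u 0)
  · rfl
  · refine Eq.trans ?_ (map_mapGen_bare (Fin.elim0 : Fin 0 → Fin 1) (Fin.natAdd 2) (v 0))
    refine (congrArg _ (congrArg _ (congrArg _ (map_mapGen_eq_elim0 _ _)))).trans ?_
    simp only [map_mapGen_bare]
    rfl
  · rfl

theorem count_cend_fill_gen (w : Word m n) (j : Fin n) (s : Bool) (e : ℕ × Bool) :
    (Letter.fill w (.gen j s)).count (.cend e) = (w j).count (.cend e) := by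
  cases s
  · have h : Function.Injective (Letter.flip : Letter m → Letter m) := by
      rintro (_ | _) (_ | _) h <;> simp_all [Letter.flip]
    exact (List.count_map_of_injective _ _ h (.cend e)).trans (List.count_reverse)
  · rfl

/-- On the output arc, `b` and `a` sit between the beads into which the legs of `f` are to be
substituted. They slide past these beads to the front and become factors, leaving the contraction of
`f` alone. -/
theorem comp_prodWord_five (s t r : Bool) (b a : A K 0 1) (f : A K 0 3) :
    (comp (cls K (prodWord 5)) (comp (tens (cls K (signWord s)) (tens b (tens (cls K (signWord t))
      (tens a (cls K (signWord r))))) : A K 3 5) f) : A K 0 1)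
      = b * a * comp (cls K (fun _ => [.gen 0 s, .gen 1 t, .gen 2 r] : Word 3 1)) f := by
  induction b using A_induction with
  | h0 => simp
  | hadd x x' h h' => simp only [map_add, LinearMap.add_apply, add_mul] at *; rw [h, h']
  | hsmul c x h => simp only [map_smul, LinearMap.smul_apply, smul_mul_assoc] at *; rw [h]
  | hc u hu =>
  induction a using A_induction with
  | h0 => simp
  | hadd x x' h h' => simp only [map_add, LinearMap.add_apply, add_mul, mul_add] at *; rw [h, h']
  | hsmul c x h =>
    simp only [map_smul, LinearMap.smul_apply, smul_mul_assoc, mul_smul_comm] at *; rw [h]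
  | hc v hv =>
  induction f using A_induction with
  | h0 => simp
  | hadd x x' h h' => simp only [map_add, mul_add] at *; rw [h, h']
  | hsmul c x h => simp only [map_smul, mul_smul_comm] at *; rw [h]
  | hc w hw =>
    rw [← cls_affine 2 0 u, ← cls_affine 2 1 v, ← cls_affine 2 2 w]
    have huv : Disj (u.affine 2 0) (v.affine 2 1) := disj_affine u v (by decide)
    have huw : Disj (u.affine 2 0) (w.affine 2 2) := disj_affine u w (by decide)
    have hvw : Disj (v.affine 2 1) (w.affine 2 2) := disj_affine v w (by decide)
    have hu := isChordDiagram_affine (a := 2) (b := 0) hu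
    have hv := isChordDiagram_affine (a := 2) (b := 1) hv
    have hw := isChordDiagram_affine (a := 2) (b := 2) hw
    generalize u.affine 2 0 = u at *
    generalize v.affine 2 1 = v at *
    generalize w.affine 2 2 = w at *
    have hvr := disj_of_ends_eq_empty_right (ends_signWord r) v
    have h1 := isChordDiagram_juxt hv (isChordDiagram_signWord r) hvr
    have h2 := isChordDiagram_juxt (isChordDiagram_signWord t) h1
      (disj_of_ends_eq_empty_left (ends_signWord t) _)
    have hu2 : Disj u (juxt (signWord t) (juxt v (signWord r))) := by
      simpa [Disj, ends_juxt, ends_signWord] using huv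
    have h3 := isChordDiagram_juxt hu h2 hu2
    have h4 := isChordDiagram_juxt (isChordDiagram_signWord s) h3
      (disj_of_ends_eq_empty_left (ends_signWord s) _)
    have hYe : (juxt (signWord s) (juxt u (juxt (signWord t) (juxt v (signWord r)))) :
        Word 3 5).ends = u.ends ∪ v.ends := by
      simp only [ends_juxt, ends_signWord, Finset.union_empty, Finset.empty_union]
    set Y : Word 3 5 := ![[.gen 0 s], u.bare 3 0, [.gen 1 t], v.bare 3 0, [.gen 2 r]] with hY
    have hYj := juxt_sign_sign_sign s t r u v
    rw [hYj] at hYe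
    have hYcd : Y.IsChordDiagram := by
      have := h4
      rw [hYj] at this
      exact this
    have e1 : (tens (cls K (signWord s)) (tens (cls K u) (tens (cls K (signWord t))
        (tens (cls K v) (cls K (signWord r))))) : A K 3 5) = cls K Y := by
      rw [tens_cls_of_disj hv (isChordDiagram_signWord r) hvr,
        tens_cls_of_disj (isChordDiagram_signWord t) h1 (disj_of_ends_eq_empty_left (ends_signWord t) _),
        tens_cls_of_disj hu h2 hu2]
      exact (tens_cls_of_disj (isChordDiagram_signWord s) h3
        (disj_of_ends_eq_empty_left (ends_signWord s) _)).trans (congrArg _ hYj)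
    have hYw : Disj Y w := by
      rw [Disj, hYe]
      intro e he
      exact (Finset.mem_union.1 he).elim (huw e) (hvw e)
    have hlin : Y.IsLinear ![s, t, r] := by
      rw [isLinear_iff]
      intro k x
      fin_cases k <;> cases s <;> cases t <;> cases r <;> cases x <;>
        simp [Fin.sum_univ_five, hY, count_gen_of_isBare _ _ _, isBare_bare]
    have hbu : ∀ l : List (Letter 0), (l.map (Letter.mapGen Fin.elim0)).flatMap (Letter.fill w) = l :=
      fun l => (flatMap_fill_bare w l Fin.elim0).trans (map_mapGen_elim0 l)
    have hYfill : Y.fill w = ![Letter.fill w (.gen 0 s), u 0, Letter.fill w (.gen 1 t), v 0,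
        Letter.fill w (.gen 2 r)] := by
      funext i
      fin_cases i
      · exact List.append_nil _
      · exact hbu (u 0)
      · exact List.append_nil _
      · exact hbu (v 0)
      · exact List.append_nil _
    have huvw : (juxt (juxt u v) w).IsChordDiagram :=
      isChordDiagram_juxt (isChordDiagram_juxt hu hv huv) hw (by
        rw [Disj, ends_juxt]
        intro e he
        exact (Finset.mem_union.1 he).elim (huw e) (hvw e))
    have hYfcd : (Y.fill w).IsChordDiagram := by
      have h : ∀ e, (Y.fill w).endCount e = (juxt (juxt u v) w).endCount e := by
        intro e
        rw [endCount_juxt, endCount_juxt, hYfill]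
        simp [Word.endCount, Fin.sum_univ_five, Fin.sum_univ_three, count_cend_fill_gen]
        ring
      intro k
      rw [h, h]
      exact huvw k
    -- Used twice: for the word with `u`, `v` between the beads, and for the word with `u`, `v` in
    -- front. Both have the same linear beads, so the same sign appears and can be factored out.
    have hV : ∀ V : Word 3 1, (∀ e, V.endCount e = u.endCount e + v.endCount e) →
        (∀ k x, (V 0).count (.gen k x) = ∑ i, (Y i).count (.gen k x)) →
        comp (cls K V) (cls K w) = revSign K ![s, t, r] w • cls K (V.fill w) := by
      intro V hV hV'
      refine comp_cls_linear ?_ ?_ hw ?_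
      · rw [isLinear_iff] at *
        intro k x
        rw [Fin.sum_univ_one, hV', hlin]
      · intro k
        simp only [hV, ← endCount_juxt]
        exact isChordDiagram_juxt hu hv huv k
      · have : V.ends = u.ends ∪ v.ends := by
          ext e; rw [mem_ends_iff, hV, Finset.mem_union, mem_ends_iff, mem_ends_iff]; omega
        rw [Disj, this]
        intro e he
        exact (Finset.mem_union.1 he).elim (huw e) (hvw e)
    have c1 : ∀ k x, (u.bare 3 0).count (.gen k x) = 0 := fun k x =>
      count_gen_of_isBare (isBare_bare u 0) k x
    have c2 : ∀ k x, (v.bare 3 0).count (.gen k x) = 0 := fun k x =>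
      count_gen_of_isBare (isBare_bare v 0) k x
    have d1 : ∀ e, (u.bare 3 0).count (.cend e) = u.endCount e := count_cend_bare u _
    have d2 : ∀ e, (v.bare 3 0).count (.cend e) = v.endCount e := count_cend_bare v _
    have hV1 := hV (fun _ => [.gen 0 s] ++ u.bare 3 0 ++ [.gen 1 t] ++ v.bare 3 0 ++ [.gen 2 r])
      (fun e => by simp [Word.endCount, d1, d2])
      (fun k x => by
        simp [Fin.sum_univ_five, hY, c1, c2, List.count_cons]
        ring)
    have hV2 := hV (fun _ => u.bare 3 0 ++ v.bare 3 0 ++ [.gen 0 s, .gen 1 t, .gen 2 r])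
      (fun e => by simp [Word.endCount, d1, d2])
      (fun k x => by
        simp [Fin.sum_univ_five, hY, c1, c2, List.count_cons]
        ring)
    -- The sliding takes place before `w` is inserted, when `u` and `v` have only beads to cross,
    -- apart from each other's unchanged order.
    have hslide : cls K (fun _ => [.gen 0 s] ++ u.bare 3 0 ++ [.gen 1 t] ++ v.bare 3 0 ++ [.gen 2 r]
        : Word 3 1) = cls K fun _ => u.bare 3 0 ++ v.bare 3 0 ++ [.gen 0 s, .gen 1 t, .gen 2 r] := by
      have huv' : ∀ e e', .cend e ∈ u.bare 3 0 → .cend e' ∈ v.bare 3 0 → e.1 ≠ e'.1 :=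
        disj_one (v := v.bare 3) (by rw [Disj, Word.bare, ends_mapGens]; exact huv) _
      have s1 := cls_slide_beads (K := K) [] (u.bare 3 0) ([.gen 1 t] ++ v.bare 3 0 ++ [.gen 2 r])
        [(0, s)] (isBare_bare u 0) (by simp) (fun e e' he he' => huv' e e' he (by simpa using he'))
      have s2 := cls_slide_beads (K := K) (u.bare 3 0) (v.bare 3 0) [.gen 2 r]
        [(0, s), (1, t)] (isBare_bare v 0) (fun e e' he he' => (huv' e' e he' he).symm) (by simp)
      simp only [List.nil_append, List.map_cons, List.map_nil, List.append_assoc,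
        List.cons_append] at s1 s2 ⊢
      rw [s1, s2]
    have hM := comp_cls_linear (K := K) (V := (fun _ => [.gen 0 s, .gen 1 t, .gen 2 r] : Word 3 1))
      (τ := ![s, t, r]) (w := w) (by
        rw [isLinear_iff]
        intro k x
        rw [← isLinear_iff.1 hlin]
        simp [Fin.sum_univ_five, hY, c1, c2, List.count_cons]
        ring) (isChordDiagram_of_ends_eq_empty (by rw [ends_eq_empty_iff]; simp)) hw
      (disj_of_ends_eq_empty_left (by rw [ends_eq_empty_iff]; simp) w)
    have hMe : ∀ e, (Word.fill (fun _ => [.gen 0 s, .gen 1 t, .gen 2 r] : Word 3 1) w).endCount e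
        = w.endCount e := by
      intro e
      simp [Word.endCount, Word.fill, count_cend_fill_gen, Fin.sum_univ_three]
      ring
    have hMcd : (Word.fill (fun _ => [.gen 0 s, .gen 1 t, .gen 2 r] : Word 3 1) w).IsChordDiagram := by
      intro k
      rw [hMe, hMe]
      exact hw k
    have hMd : Disj (u.cat v) (Word.fill (fun _ => [.gen 0 s, .gen 1 t, .gen 2 r] : Word 3 1) w) := by
      have : (Word.fill (fun _ => [.gen 0 s, .gen 1 t, .gen 2 r] : Word 3 1) w).ends = w.ends := by
        ext e; rw [mem_ends_iff, mem_ends_iff, hMe]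
      rw [Disj, this]
      exact disj_cat_left huw hvw
    rw [e1, comp_cls_linear hlin hYcd hw hYw, hM, map_smul, mul_smul_comm,
      comp_cls_linear_pos (isLinear_prodWord 5) (ends_prodWord 5) hYfcd, cls_mul_cls hu hv huv,
      cls_mul_cls (isChordDiagram_cat hu hv huv) hMcd hMd]
    refine Eq.trans ?_ ((hV1.symm.trans (by rw [hslide])).trans (hV2.trans ?_))
    · congr 2
      funext i
      simp only [Word.fill, prodWord, List.finRange_succ, List.flatMap_append]
      rw [← Word.fill, hYfill]
      simp [Letter.fill, hbu, Word.bare, Word.mapGens]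
      exact (hbu (u 0)).symm
    · congr 2
      funext i
      obtain rfl := Subsingleton.elim i 0
      simp [Word.fill, Word.cat, hbu, Word.bare, Word.mapGens]

end antipode
end JacobiHB

namespace JacobiHB

/-! ### From the Kohno–Drinfeld Lie algebra to chord diagrams. -/

section kohnoDrinfeldHom
attribute [local instance] LieRing.ofAssociativeRing

variable (K : Type*) [Field K] (n : ℕ)

/-- The chords, as a homomorphism from the free Lie algebra. -/
noncomputable def chordFreeHom :
    FreeLieAlgebra K {q : Fin n × Fin n // q.1 ≠ q.2} →ₗ⁅K⁆ A K 0 n :=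
  FreeLieAlgebra.lift K fun q => chord K q.1.1 q.1.2

variable {n} in
theorem chordFreeHom_of (q : {q : Fin n × Fin n // q.1 ≠ q.2}) :
    chordFreeHom K n (FreeLieAlgebra.of K q) = chord K q.1.1 q.1.2 :=
  FreeLieAlgebra.lift_of_apply _ _

/-- The three families of relations are the symmetry of chords, 4T, and commutation of chords on
disjoint arcs. -/
theorem lieSpan_KDRel_le_ker : (LieSubmodule.lieSpan K
    (FreeLieAlgebra K {q : Fin n × Fin n // q.1 ≠ q.2}) (KDRel K n)) ≤ (chordFreeHom K n).ker := by
  rw [LieSubmodule.lieSpan_le]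
  rintro x ((⟨i, j, h, rfl⟩ | ⟨i, j, k, hij, hik, hjk, rfl⟩) | ⟨i, j, k, l, hij, hkl, h1, h2, h3, h4, rfl⟩)
  · refine LieHom.mem_ker.2 ?_
    rw [map_sub, chordFreeHom_of, chordFreeHom_of, chord_comm, sub_self]
  · refine LieHom.mem_ker.2 ?_
    rw [LieHom.map_lie, map_add, chordFreeHom_of, chordFreeHom_of, chordFreeHom_of,
      LieRing.of_associative_ring_bracket, chord_fourT i j k hij hik hjk, sub_self]
  · refine LieHom.mem_ker.2 ?_
    rw [LieHom.map_lie, chordFreeHom_of, chordFreeHom_of, LieRing.of_associative_ring_bracket,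
      sub_eq_zero]
    exact chord_commute i j k l h1 h2 h3 h4

/-- The chords satisfy the relations of the Kohno–Drinfeld Lie algebra. -/
noncomputable def chordLieHom : KD K n →ₗ⁅K⁆ A K 0 n :=
  { Submodule.liftQ _ (chordFreeHom K n : _ →ₗ[K] A K 0 n) (fun x hx =>
      LinearMap.mem_ker.2 (LieHom.mem_ker.1 (lieSpan_KDRel_le_ker K n hx))) with
    map_lie' := by
      intro x y
      obtain ⟨x, rfl⟩ := Submodule.Quotient.mk_surjective _ x
      obtain ⟨y, rfl⟩ := Submodule.Quotient.mk_surjective _ y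
      exact LieHom.map_lie (chordFreeHom K n) x y }

/-- The homomorphism from the enveloping algebra to the algebra of chord diagrams. -/
noncomputable def chordHom : UKD K n →ₐ[K] A K 0 n :=
  UniversalEnvelopingAlgebra.lift K (chordLieHom K n)

variable {n} in
theorem chordHom_tgen (i j : Fin n) (h : i ≠ j) : chordHom K n (tgen K n i j h) = chord K i j := by
  rw [chordHom, tgen, UniversalEnvelopingAlgebra.lift_ι_apply]
  exact chordFreeHom_of K ⟨(i, j), h⟩

end kohnoDrinfeldHom

/-! ### The antipode on one arc, and products read off from freely reduced words. -/

section antipodeOne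
variable {K : Type*} [Field K] {m n p q q' : ℕ}

theorem revSign_false (w : Word m 1) :
    revSign K (fun _ => false) w = (-1) ^ (endList (w 0)).length := by
  simp [revSign, sgn, List.finRange_succ]

theorem isLinear_signWord (s : Bool) : (signWord s).IsLinear fun _ => s := by
  rw [isLinear_iff]
  intro k t
  obtain rfl := Subsingleton.elim k 0
  cases s <;> cases t <;> simp [signWord]

theorem comp_antipode_cls {w : Word 0 1} (hw : w.IsChordDiagram) :
    comp (cls K (signWord false)) (cls K w)
      = (-1 : K) ^ (endList (w 0)).length • cls K fun _ => ((w 0).reverse.map Letter.flip) := by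
  rw [comp_cls_linear (isLinear_signWord false) (isChordDiagram_signWord false) hw
    (disj_of_ends_eq_empty_left (ends_signWord _) w), revSign_false]
  congr 2
  funext i
  exact List.append_nil _

theorem endCount_reverse_flip (w : Word m 1) (e : ℕ × Bool) :
    Word.endCount (fun _ => (w 0).reverse.map Letter.flip : Word m 1) e = w.endCount e := by
  rw [Word.endCount, Word.endCount, Fin.sum_univ_one, Fin.sum_univ_one]
  have h : Function.Injective (Letter.flip : Letter m → Letter m) := by
    rintro (_ | _) (_ | _) h <;> simp_all [Letter.flip]
  exact (List.count_map_of_injective _ _ h (.cend e)).trans List.count_reverse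

/-- Reversing an arc reverses concatenation, and the sign `-1` per chord end is multiplicative. -/
theorem comp_antipode_mul (x y : A K 0 1) : comp (cls K (signWord false)) (x * y)
    = comp (cls K (signWord false)) y * comp (cls K (signWord false)) x := by
  induction x using A_induction with
  | h0 => simp
  | hadd x x' h h' => rw [add_mul, map_add, map_add, mul_add, h, h']
  | hsmul c x h => rw [smul_mul_assoc, map_smul, map_smul, mul_smul_comm, h]
  | hc u hu =>
  induction y using A_induction with
  | h0 => simp
  | hadd x x' h h' => rw [mul_add, map_add, map_add, add_mul, h, h']
  | hsmul c x h => rw [mul_smul_comm, map_smul, map_smul, smul_mul_assoc, h]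
  | hc v hv =>
    obtain ⟨u', v', h1, h2, hu', hv', hd⟩ := exists_disj (K := K) u v
    rw [← h1, ← h2]
    have hu := hu' hu
    have hv := hv' hv
    have hcd : ∀ {w : Word 0 1}, w.IsChordDiagram →
        Word.IsChordDiagram (fun _ => (w 0).reverse.map Letter.flip : Word 0 1) := fun {w} hw =>
      (isChordDiagram_congr (endCount_reverse_flip w)).2 hw
    have he : ∀ w : Word 0 1, Word.ends (fun _ => (w 0).reverse.map Letter.flip : Word 0 1) = w.ends := by
      intro w; ext e; rw [mem_ends_iff, mem_ends_iff, endCount_reverse_flip]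
    rw [cls_mul_cls hu hv hd, comp_antipode_cls hu, comp_antipode_cls hv,
      comp_antipode_cls (isChordDiagram_cat hu hv hd), smul_mul_smul_comm, cls_mul_cls (hcd hv) (hcd hu)
        (by rw [Disj, he, he]; exact fun e he d hd' => (hd d hd' e he).symm)]
    congr 1
    · rw [← pow_add, add_comm]
      congr 1
      simp [Word.cat, endList]
    · congr 1
      funext i
      simp [Word.cat]

/-- Two ends give two signs, and the reversal merely exchanges the unnamed ends. -/
theorem comp_antipode_chord : comp (cls K (signWord false)) (chord K 0 0) = chord K (0 : Fin 1) 0 := by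
  rw [chord, comp_antipode_cls (isChordDiagram_chordWord _ _ _),
    ← cls_mapEnds (K := K) Function.injective_id (fun _ => true) (chordWord 0 0 0)]
  have : (endList ((chordWord 0 0 0 : Word 0 1) 0)).length = 2 := rfl
  rw [this, neg_one_sq, one_smul]
  congr 1
  funext i
  obtain rfl := Subsingleton.elim i 0
  rfl

theorem comp_antipode_chord_pow (k : ℕ) :
    comp (cls K (signWord false)) (chord K 0 0 ^ k) = chord K (0 : Fin 1) 0 ^ k := by
  induction k with
  | zero => rw [pow_zero]; exact comp_one (ends_signWord false)
  | succ k ih => rw [pow_succ, comp_antipode_mul, ih, comp_antipode_chord, ← pow_succ', pow_succ]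

theorem comp_mu_chord : (comp (cls K (muWord 1)) (chord K (0 : Fin 2) 1 : A K 0 2) : A K 0 1)
    = chord K 0 0 := by
  refine (comp_cls_linear_pos (isLinear_muWord 1) (ends_muWord 1)
    (isChordDiagram_chordWord 0 _ _)).trans ?_
  rw [chord]
  congr 1
  funext i
  obtain rfl := Subsingleton.elim i 0
  rfl

/-- A contraction of a product depends only on the freely reduced word obtained by substitution.
Thus strands that cancel in the contraction may be deleted from the factors, which is the mechanism
of `act_zigzag`. -/
theorem comp_eq_of_freeReduce {W : Word q' p} {U U' : Word n q'} {V V' : Word m q'} (hU : U.ends = ∅)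
    (hV : V.ends = ∅) (hU' : U'.ends = ∅) (hV' : V'.ends = ∅) (hW : W.ends = ∅)
    (h : ∀ i, freeReduce (W.fill ((muWord q').fill (juxt U V)) i)
      = freeReduce (W.fill ((muWord q').fill (juxt U' V')) i)) (x : A K 0 n) (y : A K 0 m) :
    comp (cls K W) (comp (cls K U) x * comp (cls K V) y)
      = comp (cls K W) (comp (cls K U') x * comp (cls K V') y) := by
  have hμ := fun {U : Word n q'} {V : Word m q'} (hU : U.ends = ∅) (hV : V.ends = ∅) =>
    ends_fill (ends_muWord q') (juxt_of_ends_eq_empty hU hV)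
  rw [comp_mul_comp hU hV, comp_mul_comp hU' hV', comp_comp' hW (hμ hU hV),
    comp_comp' hW (hμ hU' hV'), cls_eq_of_freeReduce h]

end antipodeOne
end JacobiHB

namespace JacobiHB

/-! ### Chordless diagrams in the completed category. -/

section completed
variable {K : Type*} [Field K] {m m' n n' p q : ℕ}

theorem HatA.ext {x y : HatA K m n} (h : ∀ k, x.1 k = y.1 k) : x = y := Subtype.ext (funext h)

theorem diag_apply {W : Word m n} (hW : W.ends = ∅) (k : ℕ) :
    (HatA.diag K W).1 k = if k = 0 then cls K W else 0 := by
  refine if_congr ?_ rfl rfl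
  rw [hW, Finset.card_empty]
  omega

/-- A chordless diagram lives in degree `0`, so only one term of the sum over degrees survives. The
three lemmas after it are the variants for the other side and for `⊗`. -/
theorem diag_comp_apply {W : Word n p} (hW : W.ends = ∅) (x : HatA K m n) (k : ℕ) :
    (HatA.diag K W ∘ₕ x).1 k = comp (cls K W) (x.1 k) := by
  refine (Finset.sum_eq_single (0, k) ?_ fun h =>
    absurd (Finset.HasAntidiagonal.mem_antidiagonal.2 (zero_add k)) h).trans ?_
  · rintro ⟨i, j⟩ h hne
    have hi : i ≠ 0 := by
      rintro rfl
      simp_all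
    rw [diag_apply hW, if_neg hi, map_zero, LinearMap.zero_apply]
  · rw [diag_apply hW, if_pos rfl]

theorem comp_diag_apply {W : Word m n} (hW : W.ends = ∅) (x : HatA K n p) (k : ℕ) :
    (x ∘ₕ HatA.diag K W).1 k = comp (x.1 k) (cls K W) := by
  refine (Finset.sum_eq_single (k, 0) ?_ fun h =>
    absurd (Finset.HasAntidiagonal.mem_antidiagonal.2 (add_zero k)) h).trans ?_
  · rintro ⟨i, j⟩ h hne
    have hj : j ≠ 0 := by
      rintro rfl
      simp_all
    rw [diag_apply hW, if_neg hj, map_zero]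
  · rw [diag_apply hW, if_pos rfl]

theorem diag_tens_apply {W : Word m n} (hW : W.ends = ∅) (x : HatA K m' n') (k : ℕ) :
    (HatA.diag K W ⊗ₕ x).1 k = tens (cls K W) (x.1 k) := by
  refine (Finset.sum_eq_single (0, k) ?_ fun h =>
    absurd (Finset.HasAntidiagonal.mem_antidiagonal.2 (zero_add k)) h).trans ?_
  · rintro ⟨i, j⟩ h hne
    have hi : i ≠ 0 := by
      rintro rfl
      simp_all
    rw [diag_apply hW, if_neg hi, map_zero, LinearMap.zero_apply]
  · rw [diag_apply hW, if_pos rfl]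

theorem tens_diag_apply {W : Word m n} (hW : W.ends = ∅) (x : HatA K m' n') (k : ℕ) :
    (x ⊗ₕ HatA.diag K W).1 k = tens (x.1 k) (cls K W) := by
  refine (Finset.sum_eq_single (k, 0) ?_ fun h =>
    absurd (Finset.HasAntidiagonal.mem_antidiagonal.2 (add_zero k)) h).trans ?_
  · rintro ⟨i, j⟩ h hne
    have hj : j ≠ 0 := by
      rintro rfl
      simp_all
    rw [diag_apply hW, if_neg hj, map_zero]
  · rw [diag_apply hW, if_pos rfl]

theorem diag_comp_diag {W : Word n p} {V : Word m n} (hW : W.ends = ∅) (hV : V.ends = ∅) :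
    HatA.diag K W ∘ₕ HatA.diag K V = HatA.diag K (W.fill V) := by
  refine HatA.ext fun k => ?_
  rw [diag_comp_apply hW, diag_apply hV, diag_apply (ends_fill hW hV)]
  split_ifs
  · rw [comp_cls_inner (isChordDiagram_of_ends_eq_empty hW) hV]
  · rw [map_zero]

theorem diag_tens_diag {W : Word m n} {V : Word m' n'} (hW : W.ends = ∅) (hV : V.ends = ∅) :
    HatA.diag K W ⊗ₕ HatA.diag K V = HatA.diag K (juxt W V) := by
  refine HatA.ext fun k => ?_
  rw [diag_tens_apply hW, diag_apply hV, diag_apply (juxt_of_ends_eq_empty hW hV)]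
  split_ifs
  · rw [tens_cls_of_disj (isChordDiagram_of_ends_eq_empty hW) (isChordDiagram_of_ends_eq_empty hV)
      (disj_of_ends_eq_empty_left hW V)]
  · rw [map_zero]

theorem cast_diag {a b a' b' : ℕ} (ha : a = a') (hb : b = b') (w : Word a b) :
    HatA.cast ha hb (HatA.diag K w)
      = HatA.diag K fun i => (w (Fin.cast hb.symm i)).map (Letter.mapGen (Fin.cast ha)) := by
  subst ha hb
  have : (Letter.mapGen (Fin.cast rfl) : Letter a → Letter a) = id := by
    funext x; cases x <;> rfl
  show HatA.diag K w = _
  congr 1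
  funext i
  rw [this, List.map_id]
  rfl

/-- The word of the identity. -/
def idWord (n : ℕ) : Word n n := fun i => [.gen i true]

theorem ends_idWord (n : ℕ) : (idWord n).ends = ∅ := by
  rw [ends_eq_empty_iff]; simp [idWord]

theorem idn_eq (n : ℕ) : idn K n = HatA.diag K (idWord n) := rfl

theorem mu_eq : mu K = HatA.diag K (muWord 1) := by
  refine congrArg (HatA.diag K (m := 2) (n := 1)) ?_
  funext i
  obtain rfl := Subsingleton.elim i 0
  rfl

theorem eta_eq : eta K = HatA.diag K (emptyWord 0 1) := rfl

theorem ends_swapWord (m n : ℕ) :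
    Word.ends (fun i => [.gen (finAddFlip i) true] : Word (m + n) (n + m)) = ∅ := by
  rw [ends_eq_empty_iff]; simp

theorem mulN_succ_succ (h : mulN (mu K) (n + 1) = HatA.diag K (muWord (n + 1))) :
    mulN (mu K) (n + 2) = HatA.diag K (Word.fill
      (juxt (muWord (n + 1)) (muWord 1) : Word (n + 1 + (n + 1) + 2) (n + 1 + 1))
      (fun i => (juxt (idWord (n + 1)) (juxt (fun i => [.gen (finAddFlip i) true] :
          Word (1 + (n + 1)) (n + 1 + 1)) (idWord 1)) (Fin.cast (by omega) i)).map
        (Letter.mapGen (Fin.cast (by omega))) : Word (n + 2 + (n + 2)) (n + 1 + (n + 1) + 2))) := by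
  rw [mulN, h, mu_eq]
  have h1 : (idn K (n + 1) ⊗ₕ swap K 1 (n + 1) ⊗ₕ idn K 1) = HatA.diag K (juxt (idWord (n + 1))
      (juxt (fun i => [.gen (finAddFlip i) true] : Word (1 + (n + 1)) (n + 1 + 1)) (idWord 1))) := by
    rw [swap, idn_eq, idn_eq, diag_tens_diag (ends_swapWord _ _) (ends_idWord 1),
      diag_tens_diag (ends_idWord _) (juxt_of_ends_eq_empty (ends_swapWord _ _) (ends_idWord 1))]
  rw [h1, cast_diag]
  refine (congrArg (fun x => HatA.comp x _) (diag_tens_diag (ends_muWord _) (ends_muWord 1))).trans ?_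
  refine diag_comp_diag (juxt_of_ends_eq_empty (ends_muWord _) (ends_muWord 1)) ?_
  have h2 := ends_eq_empty_iff.1 (juxt_of_ends_eq_empty (ends_idWord (n + 1))
    (juxt_of_ends_eq_empty (ends_swapWord 1 (n + 1)) (ends_idWord 1)))
  rw [ends_eq_empty_iff]
  intro i e h
  obtain ⟨x, hx, h⟩ := List.mem_map.1 h
  cases x with
  | gen => cases h
  | cend d => exact h2 _ _ hx

/-- The recursively defined multiplication has the expected word, with one bead from each factor on
every arc. This is verified by evaluation for the sizes needed; the pentagon requires `n = 4`. -/
theorem mulN_mu : ∀ {n : ℕ}, n ≤ 4 → mulN (mu K) n = HatA.diag K (muWord n)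
  | 0, _ => by
    rw [mulN, idn_eq]
    congr 1
    funext i
    exact i.elim0
  | 1, _ => mu_eq
  | 2, h => by
    rw [mulN_succ_succ (mulN_mu (by omega))]
    congr 1
    decide
  | 3, h => by
    rw [mulN_succ_succ (mulN_mu (by omega))]
    congr 1
    decide
  | 4, h => by
    rw [mulN_succ_succ (mulN_mu (by omega))]
    congr 1
    decide
  | n + 5, h => absurd h (by omega)

theorem unitN_eta : ∀ n : ℕ, unitN (eta K) n = HatA.diag K (emptyWord 0 n)
  | 0 => by
    rw [unitN, idn_eq]
    congr 1
    funext i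
    exact i.elim0
  | n + 1 => by
    rw [unitN, unitN_eta n, eta_eq]
    refine (diag_tens_diag ends_emptyWord ends_emptyWord).trans ?_
    congr 1
    funext i
    refine Fin.addCases (fun i => ?_) (fun i => ?_) i
    · exact juxt_castAdd _ _ i
    · exact juxt_natAdd _ _ i

end completed
end JacobiHB

namespace JacobiHB

/-! ### The completed morphisms `0 → n` as power series. -/

section powerSeries
variable {K : Type*} [Field K] {m n p q : ℕ}
open PowerSeries

/-- A morphism `0 → n` of the completed category, as a power series. -/
noncomputable def toPS (x : HatA K 0 n) : PowerSeries (A K 0 n) := PowerSeries.mk x.1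

theorem coeff_toPS (x : HatA K 0 n) (k : ℕ) : coeff k (toPS x) = x.1 k := coeff_mk k x.1

theorem toPS_injective : Function.Injective (toPS : HatA K 0 n → PowerSeries (A K 0 n)) := by
  intro x y h
  refine HatA.ext fun k => ?_
  rw [← coeff_toPS, h, coeff_toPS]

theorem conv0_apply (hn : n ≤ 4) (x y : HatA K 0 n) (k : ℕ) : (conv0 (mu K) x y).1 k
    = ∑ ij ∈ Finset.HasAntidiagonal.antidiagonal k, x.1 ij.1 * y.1 ij.2 := by
  rw [conv0, conv, mulN_mu hn]
  refine (diag_comp_apply (ends_muWord n) (x ⊗ₕ y) k).trans ?_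
  exact map_sum (comp (cls K (muWord n)) : A K 0 (n + n) →ₗ[K] A K 0 n)
    (fun ij : ℕ × ℕ => (tens (x.1 ij.1) (y.1 ij.2) : A K 0 (n + n)))
    (Finset.HasAntidiagonal.antidiagonal k)

/-- With the number of chords as exponent, convolution is the Cauchy product. Together with
injectivity of `toPS`, it moves the axioms about morphisms `0 → n` into rings of power series. -/
theorem toPS_conv0 (hn : n ≤ 4) (x y : HatA K 0 n) :
    toPS (conv0 (mu K) x y) = toPS x * toPS y := by
  ext k
  rw [coeff_toPS, conv0_apply hn, coeff_mul]
  simp only [coeff_toPS]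

theorem toPS_unitN : toPS (unitN (eta K) n) = 1 := by
  ext k
  rw [coeff_toPS, unitN_eta, diag_apply ends_emptyWord, coeff_one]
  rfl

theorem toPS_eta : toPS (eta K) = 1 := by
  ext k
  rw [coeff_toPS, eta_eq, diag_apply ends_emptyWord, coeff_one]
  rfl

theorem isConvInv_iff (hn : n ≤ 4) (x y : HatA K 0 n) : IsConvInv (mu K) (eta K) x y ↔
    toPS x * toPS y = 1 ∧ toPS y * toPS x = 1 := by
  rw [IsConvInv, ← toPS_injective.eq_iff, ← toPS_injective.eq_iff (a := conv0 _ y x),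
    toPS_conv0 hn, toPS_conv0 hn, toPS_unitN]

theorem toPS_convList (hn : n ≤ 4) (l : List (HatA K 0 n)) :
    toPS (convList (mu K) (eta K) l) = (l.map toPS).prod := by
  induction l with
  | nil => exact toPS_unitN
  | cons x l ih =>
    rw [List.map_cons, List.prod_cons, ← ih, ← toPS_conv0 hn]; rfl

theorem prod_map_monomial {R : Type*} [Ring R] {α : Type*} (f : α → R) (l : List α) :
    (l.map fun i => monomial 1 (f i)).prod = monomial l.length (l.map f).prod := by
  induction l with
  | nil => simp
  | cons i l ih =>
    rw [List.map_cons, List.prod_cons, ih, monomial_mul_monomial, List.map_cons, List.prod_cons,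
      List.length_cons, add_comm]

/-- As `a` and `b` are homogeneous of degree `1`, a word of length `j` contributes in degree `j`
only. The truncated sum of `evalSeries` is thus exactly the coefficient of `subs`. -/
theorem toPS_evalSeries (hn : n ≤ 4) (φ : List (Fin 2) → K) {a b : HatA K 0 n} {x y : A K 0 n}
    (ha : toPS a = monomial 1 x) (hb : toPS b = monomial 1 y) :
    toPS (evalSeries φ a b) = subs φ x y := by
  have h1 : ∀ (l : List (Fin 2)) k, (convList (mu K) (eta K) (l.map ![a, b])).1 k
      = if k = l.length then (l.map ![x, y]).prod else 0 := by
    intro l k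
    have h2 : toPS ∘ ![a, b] = fun i => monomial 1 (![x, y] i) := by
      funext i; fin_cases i; exacts [ha, hb]
    rw [← coeff_toPS, toPS_convList hn, List.map_map, h2, prod_map_monomial, coeff_monomial]
  ext k
  rw [coeff_toPS, subs, coeff_mk]
  simp only [evalSeries, h1, List.length_ofFn]
  rw [Finset.sum_eq_single k]
  · simp
  · intro j _ hj
    simp [hj.symm]
  · simp

theorem toPS_expConv (hn : n ≤ 4) {a : HatA K 0 n} {x : A K 0 n} (ha : toPS a = monomial 1 x) :
    toPS (expConv a) = expSeries K x := by
  ext k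
  rw [coeff_toPS, expSeries, coeff_mk]
  have h1 : ∀ j k, (convList (mu K) (eta K) (List.replicate j a)).1 k = if k = j then x ^ j else 0 := by
    intro j k
    have : (List.replicate j a).map toPS = (List.replicate j 0).map fun _ => monomial 1 x := by
      simp [ha]
    rw [← coeff_toPS, toPS_convList hn, this, prod_map_monomial, coeff_monomial]
    simp
  simp only [expConv, h1]
  rw [Finset.sum_eq_single k]
  · simp
  · intro j _ hj
    simp [hj.symm]
  · simp

theorem map_subs {B C : Type*} [Ring B] [Algebra K B] [Ring C] [Algebra K C] (g : B →ₐ[K] C)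
    (φ : List (Fin 2) → K) (a b : B) :
    PowerSeries.map (g : B →+* C) (subs φ a b) = subs φ (g a) (g b) := by
  ext k
  rw [coeff_map, subs, subs, coeff_mk, coeff_mk, map_sum]
  refine Finset.sum_congr rfl fun w _ => ?_
  have h : (g ∘ ![a, b]) = ![g a, g b] := by funext i; fin_cases i <;> rfl
  rw [← h, ← List.map_map, ← map_list_prod]
  exact map_smul g _ _

theorem map_expSeries {B C : Type*} [Ring B] [Algebra K B] [Ring C] [Algebra K C] (g : B →ₐ[K] C)
    (a : B) : PowerSeries.map (g : B →+* C) (expSeries K a) = expSeries K (g a) := by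
  ext k
  rw [coeff_map, expSeries, expSeries, coeff_mk, coeff_mk, ← map_pow]
  exact map_smul g _ _

theorem constantCoeff_subs {B : Type*} [Ring B] [Algebra K B] {φ : List (Fin 2) → K} (h : φ [] = 1)
    (a b : B) : constantCoeff (subs φ a b) = 1 := by
  rw [← coeff_zero_eq_constantCoeff_apply, subs, coeff_mk]
  simp [h]

theorem constantCoeff_expSeries {B : Type*} [Ring B] [Algebra K B] (a : B) :
    constantCoeff (expSeries K a) = 1 := by
  rw [← coeff_zero_eq_constantCoeff_apply, expSeries, coeff_mk]
  simp

theorem isUnit_subs {B : Type*} [Ring B] [Algebra K B] {φ : List (Fin 2) → K} (h : φ [] = 1)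
    (a b : B) : IsUnit (subs φ a b) := by
  rw [PowerSeries.isUnit_iff_constantCoeff, constantCoeff_subs h]
  exact isUnit_one

theorem ringInverse_eq {R : Type*} [Semiring R] {x y : R} (h : x * y = 1) (h' : y * x = 1) :
    Ring.inverse x = y := Ring.inverse_unit ⟨x, y, h, h'⟩

theorem map_ringInverse {R S : Type*} [Semiring R] [Semiring S] (g : R →+* S) {x : R} (h : IsUnit x) :
    g (Ring.inverse x) = Ring.inverse (g x) := by
  refine (ringInverse_eq ?_ ?_).symm
  · rw [← map_mul, Ring.mul_inverse_cancel x h, map_one]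
  · rw [← map_mul, Ring.inverse_mul_cancel x h, map_one]

theorem mul_mem_degPart {x y : A K 0 n} {k l : ℕ} (hx : x ∈ degPart K 0 n k)
    (hy : y ∈ degPart K 0 n l) : x * y ∈ degPart K 0 n (k + l) := by
  have h : cls K (muWord n) ∈ degPart K (n + n) n 0 := cls_mem_degPart (by rw [ends_muWord]; rfl)
  exact zero_add (k + l) ▸ comp_mem_degPart h (tens_mem_degPart hx hy)

/-- A power series with constant term `1` is invertible. What needs an argument is that the inverse
is again a family of homogeneous elements, so that it comes from the completed category. -/
theorem exists_inverse (x : HatA K 0 n) (h : x.1 0 = 1) :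
    ∃ y : HatA K 0 n, toPS x * toPS y = 1 ∧ toPS y * toPS x = 1 := by
  have hc : constantCoeff (toPS x) = ((1 : (A K 0 n)ˣ) : A K 0 n) := by
    rw [← coeff_zero_eq_constantCoeff_apply, coeff_toPS, h]; rfl
  set y := invOfUnit (toPS x) 1 with hy
  -- The recursion for the coefficients of the inverse involves only products of total degree `k`.
  have hmem : ∀ k, coeff k y ∈ degPart K 0 n k := by
    intro k
    induction k using Nat.strong_induction_on with
    | _ k ih =>
      rw [hy, coeff_invOfUnit]
      split_ifs with hk
      · subst hk
        rw [inv_one, Units.val_one, one_eq]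
        exact cls_mem_degPart (by rw [ends_emptyWord]; rfl)
      · rw [inv_one, Units.val_one, neg_one_mul]
        refine Submodule.neg_mem _ (Submodule.sum_mem _ fun ij hij => ?_)
        split_ifs with hlt
        · rw [← Finset.HasAntidiagonal.mem_antidiagonal.1 hij]
          refine mul_mem_degPart ?_ (ih _ hlt)
          rw [coeff_toPS]
          exact x.coe_mem _
        · exact Submodule.zero_mem _
  refine ⟨⟨fun k => coeff k y, fun k _ => hmem k⟩, ?_⟩
  have : toPS (⟨fun k => coeff k y, fun k _ => hmem k⟩ : HatA K 0 n) = y := by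
    ext k
    rw [coeff_toPS]
  rw [this]
  exact ⟨mul_invOfUnit _ _ hc, invOfUnit_mul _ _ hc⟩

/-- Post-composition with a diagram without chords, coefficientwise. -/
noncomputable def act (W : Word n p) (f : PowerSeries (A K 0 n)) : PowerSeries (A K 0 p) :=
  PowerSeries.mk fun k => comp (cls K W) (coeff k f)

theorem coeff_act (W : Word n p) (f : PowerSeries (A K 0 n)) (k : ℕ) :
    coeff k (act W f) = comp (cls K W) (coeff k f) := coeff_mk _ _

theorem toPS_diag_comp {W : Word n p} (hW : W.ends = ∅) (x : HatA K 0 n) :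
    toPS (HatA.diag K W ∘ₕ x) = act W (toPS x) := by
  ext k
  rw [coeff_toPS, diag_comp_apply hW, coeff_act, coeff_toPS]

theorem act_pullWord (f : Fin p → Option (Fin q)) (x : PowerSeries (A K 0 q)) :
    act (pullWord f) x = PowerSeries.map (pull K f : A K 0 q →+* A K 0 p) x := by
  ext k
  rw [coeff_act, coeff_map]
  rfl

theorem act_monomial (W : Word n p) (k : ℕ) (x : A K 0 n) :
    act W (monomial k x) = monomial k (comp (cls K W) x) := by
  ext j
  rw [coeff_act, coeff_monomial, coeff_monomial]
  split_ifs
  · rfl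
  · exact map_zero _

/-- The degreewise identity, which holds for all pairs of elements, passes to all Cauchy products.
-/
theorem act_mul_eq {W : Word q p} {U U' : Word n q} {V V' : Word m q}
    (h : ∀ (x : A K 0 n) (y : A K 0 m), comp (cls K W) (comp (cls K U) x * comp (cls K V) y)
      = comp (cls K W) (comp (cls K U') x * comp (cls K V') y)) (x : PowerSeries (A K 0 n))
    (y : PowerSeries (A K 0 m)) : act W (act U x * act V y) = act W (act U' x * act V' y) := by
  ext k
  simp only [coeff_act, coeff_mul, map_sum, h]

end powerSeries
end JacobiHB

namespace JacobiHB

/-! ### Consequences of the pentagon, and equality of the two contractions. -/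

section associators
variable {K : Type*} [Field K] {m n p q : ℕ} {φ : List (Fin 2) → K}
open PowerSeries

theorem isLinear_idWord (n : ℕ) : (idWord n).IsLinear fun _ => true := by
  rw [isLinear_iff]
  intro k s
  cases s <;> simp [idWord, List.count_cons]

theorem comp_idWord (x : A K 0 n) : comp (cls K (idWord n)) x = x := by
  refine A_hom_ext (g := LinearMap.id) (fun w hw => ?_) x
  rw [comp_cls_linear_pos (isLinear_idWord n) (ends_idWord n) hw, LinearMap.id_apply]
  congr 1
  funext i
  exact List.append_nil _

theorem act_idWord (f : PowerSeries (A K 0 n)) : act (idWord n) f = f := by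
  ext k
  rw [coeff_act, comp_idWord]

theorem act_act {W : Word q p} {V : Word n q} (hW : W.ends = ∅) (hV : V.ends = ∅)
    (f : PowerSeries (A K 0 n)) : act W (act V f) = act (W.fill V) f := by
  ext k
  rw [coeff_act, coeff_act, coeff_act, comp_comp' hW hV]

theorem subs_zero_zero {B : Type*} [Ring B] [Algebra K B] (h : φ [] = 1) :
    subs φ (0 : B) 0 = 1 := by
  ext k
  rw [subs, coeff_mk, coeff_one]
  have h0 : ![(0 : B), 0] = fun _ => 0 := by funext i; fin_cases i <;> rfl
  cases k with
  | zero => simp [h]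
  | succ k => simp [h0]

theorem map_pull_subs (f : Fin p → Option (Fin q)) (x y : A K 0 q) :
    PowerSeries.map (pull K f : A K 0 q →+* A K 0 p) (subs φ x y)
      = subs φ (pull K f x) (pull K f y) := map_subs _ _ _ _

/-- The pentagon for chords. -/
theorem pentagon_chord (hφ : IsDrinfeldAssociator φ) :
    subs φ (chord K (0 : Fin 4) 1) (chord K 1 2 + chord K 1 3)
        * subs φ (chord K 0 2 + chord K 1 2) (chord K 2 3)
      = subs φ (chord K 1 2) (chord K 2 3) * subs φ (chord K 0 1 + chord K 0 2) (chord K 1 3 + chord K 2 3)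
        * subs φ (chord K 0 1) (chord K 1 2) := by
  have := congrArg (PowerSeries.map (chordHom K 4 : UKD K 4 →+* A K 0 4)) hφ.pentagon
  simpa only [map_mul, map_subs, map_add, chordHom_tgen] using this

/-- Deleting the last two strands turns the pentagon into `g = g * g` with `g` a unit. -/
theorem subs_chord_zero (hφ : IsDrinfeldAssociator φ) : subs φ (chord K (0 : Fin 4) 1) 0 = 1 := by
  have h0 := hφ.groupLike.1
  have h := congrArg (PowerSeries.map
    ((pull K ![some 0, some 1, none, none] : A K 0 4 →ₐ[K] A K 0 4) : A K 0 4 →+* A K 0 4)) (pentagon_chord hφ)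
  simp only [map_mul, map_pull_subs, map_add, pull_chord] at h
  simp [Fin.sum_univ_four, subs_zero_zero h0] at h
  exact ((isUnit_subs h0 _ _).mul_left_cancel ((mul_one _).trans h)).symm

/-- As before, with the first two strands deleted. -/
theorem subs_zero_chord (hφ : IsDrinfeldAssociator φ) : subs φ 0 (chord K (2 : Fin 4) 3) = 1 := by
  have h0 := hφ.groupLike.1
  have h := congrArg (PowerSeries.map
    ((pull K ![none, none, some 2, some 3] : A K 0 4 →ₐ[K] A K 0 4) : A K 0 4 →+* A K 0 4)) (pentagon_chord hφ)
  simp only [map_mul, map_pull_subs, map_add, pull_chord] at h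
  simp [Fin.sum_univ_four, subs_zero_zero h0] at h
  exact ((isUnit_subs h0 _ _).mul_left_cancel ((mul_one _).trans h)).symm

variable (K) in
/-- The associator on three strands. -/
noncomputable def assocPS (φ : List (Fin 2) → K) : PowerSeries (A K 0 3) :=
  subs φ (chord K 0 1) (chord K 1 2)

theorem act_assocPS (f : Fin p → Option (Fin 3)) : act (pullWord f) (assocPS K φ)
    = subs φ (pull K f (chord K 0 1)) (pull K f (chord K 1 2)) := by
  rw [act_pullWord, assocPS, map_pull_subs]

/-- The words of the two contractions of a tensor with three factors. -/
def zigzag (s : Bool) : Word 3 1 := fun _ => [.gen 0 s, .gen 1 (!s), .gen 2 s]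

/-- The contraction of `φ` along `x₀ x₁⁻¹ x₂` equals that of `φ⁻¹` along `x₀⁻¹ x₁ x₂⁻¹`, so one `ν`
serves both contraction axioms. Solve the pentagon so that `φ⁻¹ ⊗ η` appears on the right and
contract all of it along one alternating word. Every factor with a doubled strand then becomes
trivial. -/
theorem act_zigzag (hφ : IsDrinfeldAssociator φ) {ψ : PowerSeries (A K 0 3)}
    (h : assocPS K φ * ψ = 1) : act (zigzag true) (assocPS K φ) = act (zigzag false) ψ := by
  have h0 := hφ.groupLike.1
  -- The signs alternate so that any two adjacent arcs, in particular the two copies of a doubled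
  -- strand, are traversed in opposite directions.
  set F : Word 4 1 := fun _ => [.gen 0 false, .gen 1 true, .gen 2 false, .gen 3 true] with hF
  have hFe : F.ends = ∅ := by rw [ends_eq_empty_iff]; simp [hF]
  have hpent : act (pullWord ![none, some 0, some 1, some 2]) (assocPS K φ)
      * act (pullWord ![some 0, some 1, some 1, some 2]) (assocPS K φ)
      = act (pullWord ![some 0, some 1, some 2, some 2]) (assocPS K φ)
      * (act (pullWord ![some 0, some 0, some 1, some 2]) (assocPS K φ)
        * act (pullWord ![some 0, some 1, some 2, none]) ψ) := by
    have h1 : act (pullWord ![some 0, some 1, some 2, none]) (assocPS K φ)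
        * act (pullWord ![some 0, some 1, some 2, none]) ψ = 1 := by
      rw [act_pullWord, act_pullWord, ← map_mul, h, map_one]
    have h2 := pentagon_chord hφ
    have h3 : ∀ a b c d e f : PowerSeries (A K 0 4), d * e = a * b * c → c * f = 1 →
        a * b = d * (e * f) := by
      intro a b c d e f h h'
      rw [← mul_assoc, h, mul_assoc, h', mul_one]
    refine h3 _ _ _ _ _ _ ?_ h1
    simp only [act_assocPS, pull_chord]
    simpa [Fin.sum_univ_four] using h2
  have c1 : act F (act (pullWord ![none, some 0, some 1, some 2]) (assocPS K φ)
      * act (pullWord ![some 0, some 1, some 1, some 2]) (assocPS K φ))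
      = act (zigzag true) (assocPS K φ) := by
    -- The middle strand of the second factor enters as `y₁ (x₁ y₁)⁻¹` and cancels. Deleting it
    -- kills both chords of `φ`, so only the first factor is left.
    rw [act_mul_eq (U' := pullWord ![none, some 0, some 1, some 2])
      (V' := pullWord ![some 0, none, none, some 2]) (comp_eq_of_freeReduce (ends_pullWord _)
      (ends_pullWord _) (ends_pullWord _) (ends_pullWord _) hFe (by decide))]
    have : act (pullWord ![some 0, none, none, some 2]) (assocPS K φ) = 1 := by
      simp only [act_assocPS, pull_chord]
      simp [Fin.sum_univ_four, subs_zero_zero h0]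
    rw [this, mul_one, act_act hFe (ends_pullWord _)]
    congr 1
  have c2 : ∀ y : PowerSeries (A K 0 4),
      act F (act (pullWord ![some 0, some 1, some 2, some 2]) (assocPS K φ) * y) = act F y := by
    intro y
    -- The doubled last strand of the first factor enters as `u₂⁻¹ u₂`. Once it is deleted the
    -- factor is `φ(t, 0) = 1`.
    rw [← act_idWord y, act_mul_eq (U' := pullWord ![some 0, some 1, none, none])
      (V' := idWord 4) (comp_eq_of_freeReduce (ends_pullWord _)
      (ends_idWord _) (ends_pullWord _) (ends_idWord _) hFe (by decide))]
    have : act (pullWord ![some 0, some 1, none, none]) (assocPS K φ) = 1 := by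
      simp only [act_assocPS, pull_chord]
      simp [Fin.sum_univ_four, subs_chord_zero hφ]
    rw [this, one_mul]
  have c3 : act F (act (pullWord ![some 0, some 0, some 1, some 2]) (assocPS K φ)
      * act (pullWord ![some 0, some 1, some 2, none]) ψ) = act (zigzag false) ψ := by
    -- The doubled first strand cancels likewise and leaves `φ(0, t) = 1`; the rest is the
    -- contraction of `ψ`.
    rw [act_mul_eq (U' := pullWord ![none, none, some 1, some 2])
      (V' := pullWord ![some 0, some 1, some 2, none]) (comp_eq_of_freeReduce (ends_pullWord _)
      (ends_pullWord _) (ends_pullWord _) (ends_pullWord _) hFe (by decide))]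
    have : act (pullWord ![none, none, some 1, some 2]) (assocPS K φ) = 1 := by
      simp only [act_assocPS, pull_chord]
      simp [Fin.sum_univ_four, subs_zero_chord hφ]
    rw [this, one_mul, act_act hFe (ends_pullWord _)]
    congr 1
  rw [← c1, hpent, c2, c3]

end associators
end JacobiHB

namespace JacobiHB

/-! ### Axioms of the Casimir Hopf algebra, and the words of the strand operations. -/

section hopfAlgebra
variable {K : Type*} [Field K]

/-- Here and in the lemmas that follow, all morphisms are chordless diagrams. Composition is
`Word.fill` and `⊗` is `juxt`, so each identity is an equality of concrete words and is decided by
evaluation. -/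
theorem casimir_mul_assoc : mu K ∘ₕ (mu K ⊗ₕ idn K 1) = mu K ∘ₕ (idn K 1 ⊗ₕ mu K) := by
  simp (disch := decide) only [mu, idn, diag_tens_diag, diag_comp_diag]
  exact congrArg (HatA.diag K) (by decide)

theorem casimir_unit_mul : mu K ∘ₕ (eta K ⊗ₕ idn K 1) = idn K 1 := by
  simp (disch := decide) only [mu, eta, idn, diag_tens_diag, diag_comp_diag]
  exact congrArg (HatA.diag K) (by decide)

theorem casimir_mul_unit : mu K ∘ₕ (idn K 1 ⊗ₕ eta K) = idn K 1 := by
  simp (disch := decide) only [mu, eta, idn, diag_tens_diag, diag_comp_diag]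
  exact congrArg (HatA.diag K) (by decide)

theorem casimir_comul_mul : Delta K ∘ₕ mu K = mulN (mu K) 2 ∘ₕ (Delta K ⊗ₕ Delta K) := by
  rw [mulN_mu (by decide)]
  simp (disch := decide) only [mu, Delta, diag_tens_diag, diag_comp_diag]
  exact congrArg (HatA.diag K) (by decide)

theorem casimir_comul_unit : Delta K ∘ₕ eta K = eta K ⊗ₕ eta K := by
  simp (disch := decide) only [eta, Delta, diag_tens_diag, diag_comp_diag]
  exact congrArg (HatA.diag K) (by decide)

theorem casimir_counit_mul : eps K ∘ₕ mu K = eps K ⊗ₕ eps K := by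
  simp (disch := decide) only [mu, eps, diag_tens_diag, diag_comp_diag]
  exact congrArg (HatA.diag K) (by decide)

theorem casimir_counit_unit : eps K ∘ₕ eta K = idn K 0 := by
  simp (disch := decide) only [eta, eps, idn, diag_comp_diag]
  exact congrArg (HatA.diag K) (by decide)

theorem casimir_counit_comul : (eps K ⊗ₕ idn K 1) ∘ₕ Delta K = idn K 1 := by
  simp (disch := decide) only [Delta, eps, idn, diag_tens_diag, diag_comp_diag]
  exact congrArg (HatA.diag K) (by decide)

theorem casimir_comul_counit : (idn K 1 ⊗ₕ eps K) ∘ₕ Delta K = idn K 1 := by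
  simp (disch := decide) only [Delta, eps, idn, diag_tens_diag, diag_comp_diag]
  exact congrArg (HatA.diag K) (by decide)

theorem casimir_antipode_mul : anti K ∘ₕ mu K = mu K ∘ₕ swap K 1 1 ∘ₕ (anti K ⊗ₕ anti K) := by
  simp (disch := decide) only [mu, anti, swap, diag_tens_diag, diag_comp_diag]
  exact congrArg (HatA.diag K) (by decide)

theorem casimir_antipode_unit : anti K ∘ₕ eta K = eta K := by
  simp (disch := decide) only [eta, anti, diag_comp_diag]
  exact congrArg (HatA.diag K) (by decide)

theorem casimir_antipode_antipode : anti K ∘ₕ anti K = idn K 1 := by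
  simp (disch := decide) only [idn, anti, diag_comp_diag]
  exact congrArg (HatA.diag K) (by decide)

theorem casimir_cocommutative : swap K 1 1 ∘ₕ Delta K = Delta K := by
  simp (disch := decide) only [Delta, swap, diag_comp_diag]
  exact congrArg (HatA.diag K) (by decide)

theorem mulIter_three : mulIter (mu K) (eta K) 3 = HatA.diag K (prodWord 3) := by
  simp (disch := decide) only [mulIter, mu, idn, diag_tens_diag, diag_comp_diag]
  exact congrArg (HatA.diag K) (by decide)

theorem mulIter_five : mulIter (mu K) (eta K) 5 = HatA.diag K (prodWord 5) := by
  simp (disch := decide) only [mulIter, mu, idn, diag_tens_diag, diag_comp_diag]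
  exact congrArg (HatA.diag K) (by decide)

theorem id_comul_id_eq : (idn K 1 ⊗ₕ Delta K ⊗ₕ idn K 1 : HatA K 3 4)
    = HatA.diag K (pullWord ![some 0, some 1, some 1, some 2]) := by
  simp (disch := decide) only [idn, Delta, diag_tens_diag]
  exact congrArg (HatA.diag K) (by decide)

theorem id_id_comul_eq : (idn K 1 ⊗ₕ idn K 1 ⊗ₕ Delta K : HatA K 3 4)
    = HatA.diag K (pullWord ![some 0, some 1, some 2, some 2]) := by
  simp (disch := decide) only [idn, Delta, diag_tens_diag]
  exact congrArg (HatA.diag K) (by decide)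

theorem comul_id_id_eq : (Delta K ⊗ₕ idn K 1 ⊗ₕ idn K 1 : HatA K 3 4)
    = HatA.diag K (pullWord ![some 0, some 0, some 1, some 2]) := by
  simp (disch := decide) only [idn, Delta, diag_tens_diag]
  exact congrArg (HatA.diag K) (by decide)

theorem id_counit_id_eq : (idn K 1 ⊗ₕ eps K ⊗ₕ idn K 1 : HatA K 3 2)
    = HatA.diag K (pullWord ![some 0, some 2]) := by
  simp (disch := decide) only [idn, eps, diag_tens_diag]
  exact congrArg (HatA.diag K) (by decide)

theorem id_id_unit_eq : (idn K 1 ⊗ₕ idn K 1 ⊗ₕ eta K : HatA K 2 3)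
    = HatA.diag K (pullWord ![some 0, some 1, none]) := by
  simp (disch := decide) only [idn, eta, diag_tens_diag]
  exact congrArg (HatA.diag K) (by decide)

theorem unit_id_id_eq : (eta K ⊗ₕ idn K 1 ⊗ₕ idn K 1 : HatA K 2 3)
    = HatA.diag K (pullWord ![none, some 0, some 1]) := by
  simp (disch := decide) only [idn, eta, diag_tens_diag]
  exact congrArg (HatA.diag K) (by decide)

theorem id_unit_id_eq : (idn K 1 ⊗ₕ eta K ⊗ₕ idn K 1 : HatA K 2 3)
    = HatA.diag K (pullWord ![some 0, none, some 1]) := by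
  simp (disch := decide) only [idn, eta, diag_tens_diag]
  exact congrArg (HatA.diag K) (by decide)

theorem comul_id_eq : (Delta K ⊗ₕ idn K 1 : HatA K 2 3)
    = HatA.diag K (pullWord ![some 0, some 0, some 1]) := by
  simp (disch := decide) only [idn, Delta, diag_tens_diag]
  exact congrArg (HatA.diag K) (by decide)

theorem id_comul_eq : (idn K 1 ⊗ₕ Delta K : HatA K 2 3)
    = HatA.diag K (pullWord ![some 0, some 1, some 1]) := by
  simp (disch := decide) only [idn, Delta, diag_tens_diag]
  exact congrArg (HatA.diag K) (by decide)

/-- The list records for each position the factor that arrives there, that is, the inverse of the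
permutation. -/
theorem perm312_eq : perm K perm312 = HatA.diag K (pullWord ![some 1, some 2, some 0]) :=
  congrArg (HatA.diag K) (by decide)

theorem perm132_eq : perm K perm132 = HatA.diag K (pullWord ![some 0, some 2, some 1]) :=
  congrArg (HatA.diag K) (by decide)

theorem perm231_eq : perm K perm231 = HatA.diag K (pullWord ![some 2, some 0, some 1]) :=
  congrArg (HatA.diag K) (by decide)

theorem perm213_eq : perm K perm213 = HatA.diag K (pullWord ![some 1, some 0, some 2]) :=
  congrArg (HatA.diag K) (by decide)

theorem swap_eq : swap K 1 1 = HatA.diag K (pullWord ![some 1, some 0]) :=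
  congrArg (HatA.diag K) (by decide)

theorem Delta_eq : Delta K = HatA.diag K (pullWord ![some 0, some 0]) :=
  congrArg (HatA.diag K) (by decide)

end hopfAlgebra
end JacobiHB

namespace JacobiHB

/-! ### The associator, the braiding and the ribbon element as power series. -/

section elements
variable {K : Type*} [Field K] {m n p q : ℕ} {φ : List (Fin 2) → K}
open PowerSeries

theorem toPS_smul (c : K) (x : HatA K 0 n) : toPS (c • x) = c • toPS x := by
  ext k
  rw [coeff_toPS, coeff_smul, coeff_toPS]
  rfl

theorem toPS_pull_comp (f : Fin p → Option (Fin q)) (x : HatA K 0 q) :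
    toPS (HatA.diag K (pullWord f) ∘ₕ x)
      = PowerSeries.map (pull K f : A K 0 q →+* A K 0 p) (toPS x) := by
  rw [toPS_diag_comp (ends_pullWord f), act_pullWord]

/-- Two chord ends make degree `1`. -/
theorem toPS_cas : toPS (cas K) = monomial 1 (chord K (0 : Fin 2) 1) := by
  have h : (![[.cend (0, false)], [.cend (0, true)]] : Word 0 2) = chordWord 0 0 1 := by decide
  ext k
  rw [coeff_toPS, coeff_monomial, cas, h]
  refine if_congr ?_ rfl rfl
  rw [ends_chordWord, Finset.card_pair (by decide)]
  omega

theorem map_monomial {R S : Type*} [Ring R] [Ring S] (g : R →+* S) (k : ℕ) (x : R) :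
    PowerSeries.map g (monomial k x) = monomial k (g x) := by
  ext j
  rw [coeff_map, coeff_monomial, coeff_monomial, apply_ite g, map_zero]

theorem toPS_c12 : toPS (c12 K) = monomial 1 (chord K 0 1) := by
  rw [c12, id_id_unit_eq, toPS_pull_comp, toPS_cas, map_monomial]
  congr 1
  refine (pull_chord _ _ _).trans ?_
  simp [Fin.sum_univ_three]

theorem toPS_c23 : toPS (c23 K) = monomial 1 (chord K 1 2) := by
  rw [c23, unit_id_id_eq, toPS_pull_comp, toPS_cas, map_monomial]
  congr 1
  refine (pull_chord _ _ _).trans ?_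
  simp [Fin.sum_univ_three]

theorem toPS_assocElt : toPS (assocElt φ) = assocPS K φ :=
  toPS_evalSeries (by decide) φ toPS_c12 toPS_c23

theorem smul_monomial (c : K) (k : ℕ) (x : A K 0 n) :
    c • (monomial k x : PowerSeries (A K 0 n)) = monomial k (c • x) := by
  ext j
  rw [coeff_smul, coeff_monomial, coeff_monomial, smul_ite, smul_zero]

theorem toPS_braiding : toPS (expConv ((2⁻¹ : K) • cas K)) = expSeries K ((2⁻¹ : K) • chord K 0 1) := by
  refine toPS_expConv (by decide) ?_
  rw [toPS_smul, toPS_cas, smul_monomial]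

theorem toPS_ribbon :
    toPS (expConv ((2⁻¹ : K) • (mu K ∘ₕ cas K))) = expSeries K ((2⁻¹ : K) • chord K 0 0) := by
  refine toPS_expConv (by decide) ?_
  rw [toPS_smul, mu_eq]
  have : toPS (HatA.diag K (muWord 1) ∘ₕ cas K) = act (muWord 1) (toPS (cas K)) :=
    toPS_diag_comp (ends_muWord 1) (cas K)
  rw [this, toPS_cas]
  have h := act_monomial (muWord 1) 1 (chord K (0 : Fin 2) 1)
  rw [comp_mu_chord] at h
  rw [h, smul_monomial]

theorem toPS_tens (x : HatA K 0 p) (y : HatA K 0 q) : toPS (x ⊗ₕ y : HatA K 0 (p + q))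
    = PowerSeries.map (pull K (inclLeft p q) : A K 0 p →+* A K 0 (p + q)) (toPS x)
      * PowerSeries.map (pull K (inclRight p q) : A K 0 q →+* A K 0 (p + q)) (toPS y) := by
  ext k
  rw [coeff_toPS, coeff_mul]
  refine (Finset.sum_congr rfl fun ij _ => ?_ : ∑ ij ∈ Finset.HasAntidiagonal.antidiagonal k,
    (tens (x.1 ij.1) (y.1 ij.2) : A K 0 (p + q)) = _)
  rw [coeff_map, coeff_map, coeff_toPS, coeff_toPS]
  exact tens_eq_mul _ _

/-- Degree by degree this is `comp_mu_bead_comm` on one arc. -/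
theorem special_mu (x : HatA K 0 1) :
    mu K ∘ₕ (idn K 1 ⊗ₕ x) = mu K ∘ₕ (x ⊗ₕ idn K 1 : HatA K 1 2) := by
  have hid : idn K 1 = HatA.diag K (beadWord 1) := congrArg (HatA.diag K) (by decide)
  refine HatA.ext fun k => ?_
  rw [mu_eq, hid]
  refine (diag_comp_apply (ends_muWord 1) _ k).trans
    (Eq.trans ?_ (diag_comp_apply (ends_muWord 1) _ k).symm)
  rw [diag_tens_apply ends_beadWord]
  refine (comp_mu_bead_comm (x.1 k)).symm.trans (congrArg _ ?_)
  exact (tens_diag_apply ends_beadWord x k).symm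

/-- By `comp_mu_bead` the coproduct word can be pulled out in front of `x * y = 1`. The cases `n =
3` and `n = 2` give quasi-coassociativity and the conjugation axiom for `R`. -/
theorem conv_conv_bead (hn : n ≤ 4) {x y : HatA K 0 n} (h : toPS x * toPS y = 1) :
    (conv (mu K) (conv (mu K) x (HatA.diag K (beadWord n))) y : HatA K 1 n)
      = HatA.diag K (beadWord n) := by
  refine HatA.ext fun k => ?_
  have h1 : ∀ i, (conv (mu K) x (HatA.diag K (beadWord n)) : HatA K 1 n).1 i
      = (comp (cls K (muWord n)) (tens (x.1 i) (cls K (beadWord n)) : A K 1 (n + n)) : A K 1 n) := by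
    intro i
    rw [conv, mulN_mu hn]
    refine (diag_comp_apply (ends_muWord n) _ i).trans (congrArg _ ?_)
    exact tens_diag_apply ends_beadWord x i
  have h2 : (conv (mu K) (conv (mu K) x (HatA.diag K (beadWord n))) y : HatA K 1 n).1 k
      = ∑ ij ∈ Finset.HasAntidiagonal.antidiagonal k, (comp (cls K (muWord n))
        (tens ((conv (mu K) x (HatA.diag K (beadWord n)) : HatA K 1 n).1 ij.1) (y.1 ij.2) :
          A K 1 (n + n)) : A K 1 n) := by
    rw [conv, mulN_mu hn]
    refine (diag_comp_apply (ends_muWord n) _ k).trans ?_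
    exact map_sum (comp (cls K (muWord n)) : A K 1 (n + n) →ₗ[K] A K 1 n)
      (fun ij : ℕ × ℕ => (tens ((conv (mu K) x (HatA.diag K (beadWord n)) : HatA K 1 n).1 ij.1)
        (y.1 ij.2) : A K 1 (n + n))) (Finset.HasAntidiagonal.antidiagonal k)
  have h3 : ∑ ij ∈ Finset.HasAntidiagonal.antidiagonal k, x.1 ij.1 * y.1 ij.2
      = if k = 0 then 1 else 0 := by
    have := congrArg (coeff k) h
    rw [coeff_mul, coeff_one] at this
    simpa only [coeff_toPS] using this
  have h4 : ∀ z : A K 0 n, (comp (cls K (muWord n)) (tens (cls K (beadWord n)) z : A K 1 (n + n))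
      : A K 1 n) = ((comp (cls K (muWord n)) : A K 1 (n + n) →ₗ[K] A K 1 n) ∘ₗ
        (tens (cls K (beadWord n)) : A K 0 n →ₗ[K] A K 1 (n + n))) z := fun z => rfl
  rw [h2]
  simp only [h1]
  rw [Finset.sum_congr rfl fun ij _ => (comp_mu_bead (x.1 ij.1) (y.1 ij.2)).trans (h4 _), ← map_sum,
    h3, diag_apply ends_beadWord]
  split_ifs
  · exact comp_mu_one _
  · exact map_zero _

theorem idn_one_eq : idn K 1 = HatA.diag K (signWord true) := congrArg (HatA.diag K) (by decide)

theorem antipode_convolution (s : Bool) (x : HatA K 0 1) : mulIter (mu K) (eta K) 3 ∘ₕ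
    (HatA.diag K (signWord s) ⊗ₕ x ⊗ₕ HatA.diag K (signWord (!s)) : HatA K 2 3) ∘ₕ Delta K
      = x ∘ₕ eps K := by
  refine HatA.ext fun k => ?_
  rw [mulIter_three]
  refine (diag_comp_apply (ends_prodWord 3) _ k).trans ?_
  refine Eq.trans ?_ (comp_diag_apply (W := counitWord) (by decide) x k).symm
  refine Eq.trans (congrArg _ ?_) (antipode_convolution_aux s (x.1 k))
  refine (comp_diag_apply ends_beadWord _ k).trans ?_
  rw [diag_tens_apply (ends_signWord s), tens_diag_apply (ends_signWord _)]

/-- The graded form of `comp_prodWord_five`: the sums over degrees of `b`, `a` and `f` are regrouped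
into a triple Cauchy product. -/
theorem toPS_prod_five (s t r : Bool) (b a : HatA K 0 1) (f : HatA K 0 3) :
    toPS (mulIter (mu K) (eta K) 5 ∘ₕ (HatA.diag K (signWord s) ⊗ₕ b ⊗ₕ HatA.diag K (signWord t) ⊗ₕ
      a ⊗ₕ HatA.diag K (signWord r) : HatA K 3 5) ∘ₕ f)
      = toPS b * toPS a * act (fun _ => [.gen 0 s, .gen 1 t, .gen 2 r]) (toPS f) := by
  ext k
  rw [mulIter_five, toPS_diag_comp (ends_prodWord 5), coeff_act, coeff_toPS, coeff_mul]
  have h : ∀ i, (HatA.diag K (signWord s) ⊗ₕ b ⊗ₕ HatA.diag K (signWord t) ⊗ₕ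
      a ⊗ₕ HatA.diag K (signWord r) : HatA K 3 5).1 i
      = ∑ ij ∈ Finset.HasAntidiagonal.antidiagonal i, (tens (cls K (signWord s)) (tens (b.1 ij.1)
        (tens (cls K (signWord t)) (tens (a.1 ij.2) (cls K (signWord r))))) : A K 3 5) := by
    intro i
    rw [diag_tens_apply (ends_signWord s)]
    have h1 : (b ⊗ₕ HatA.diag K (signWord t) ⊗ₕ a ⊗ₕ HatA.diag K (signWord r)).1 i
        = ∑ ij ∈ Finset.HasAntidiagonal.antidiagonal i,
          tens (b.1 ij.1) ((HatA.diag K (signWord t) ⊗ₕ a ⊗ₕ HatA.diag K (signWord r)).1 ij.2) := rfl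
    rw [h1, map_sum]
    refine Finset.sum_congr rfl fun ij _ => ?_
    rw [diag_tens_apply (ends_signWord t), tens_diag_apply (ends_signWord r)]
  have h' : ((HatA.diag K (signWord s) ⊗ₕ b ⊗ₕ HatA.diag K (signWord t) ⊗ₕ
      a ⊗ₕ HatA.diag K (signWord r) : HatA K 3 5) ∘ₕ f).1 k
      = ∑ ij ∈ Finset.HasAntidiagonal.antidiagonal k, comp ((HatA.diag K (signWord s) ⊗ₕ b ⊗ₕ
        HatA.diag K (signWord t) ⊗ₕ a ⊗ₕ HatA.diag K (signWord r) : HatA K 3 5).1 ij.1) (f.1 ij.2) :=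
    rfl
  rw [h', map_sum]
  refine Finset.sum_congr rfl fun ij _ => ?_
  rw [h, map_sum, LinearMap.sum_apply, map_sum, coeff_mul, Finset.sum_mul]
  refine Finset.sum_congr rfl fun ij' _ => ?_
  rw [coeff_toPS, coeff_toPS, coeff_act, coeff_toPS]
  exact comp_prodWord_five s t r _ _ _

end elements
end JacobiHB

namespace JacobiHB

/-! ### The quasi-Hopf, hexagon and ribbon axioms. -/

section ribbon
variable {K : Type*} [Field K] {n : ℕ} {φ : List (Fin 2) → K}
open PowerSeries

/-- The binomial theorem; characteristic `0` is needed to divide by the factorials. -/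
theorem expSeries_add [CharZero K] {B : Type*} [Ring B] [Algebra K B] {a b : B} (h : Commute a b) :
    expSeries K (a + b) = expSeries K a * expSeries K b := by
  ext k
  rw [coeff_mul, expSeries, expSeries, expSeries, coeff_mk, h.add_pow', Finset.smul_sum]
  refine Finset.sum_congr rfl fun ij hij => ?_
  rw [coeff_mk, coeff_mk, smul_mul_smul_comm, ← Nat.cast_smul_eq_nsmul K, smul_smul]
  congr 1
  have hij := Finset.HasAntidiagonal.mem_antidiagonal.1 hij
  have h1 := Nat.choose_mul_factorial_mul_factorial (Nat.le.intro hij)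
  rw [← hij, Nat.add_sub_cancel_left, hij] at h1
  have h2 : ((k.choose ij.1 : ℕ) : K) * (ij.1.factorial : K) * (ij.2.factorial : K) = k.factorial := by
    exact_mod_cast h1
  have e0 : (k.factorial : K) ≠ 0 := Nat.cast_ne_zero.2 k.factorial_ne_zero
  have e1 : (ij.1.factorial : K) ≠ 0 := Nat.cast_ne_zero.2 (Nat.factorial_ne_zero _)
  have e2 : (ij.2.factorial : K) ≠ 0 := Nat.cast_ne_zero.2 (Nat.factorial_ne_zero _)
  field_simp
  rw [← h2]

theorem mul_comm_powerSeries (x y : PowerSeries (A K 0 1)) : x * y = y * x := by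
  ext k
  rw [coeff_mul, coeff_mul, ← Finset.Nat.sum_antidiagonal_swap]
  exact Finset.sum_congr rfl fun ij _ => mul_comm_one _ _

theorem coeff_zero_assocElt (hφ : IsDrinfeldAssociator φ) : (assocElt φ).1 0 = 1 := by
  rw [← coeff_toPS, toPS_assocElt, assocPS, coeff_zero_eq_constantCoeff_apply,
    constantCoeff_subs hφ.groupLike.1]

/-- The inverse of `ν` is the contraction of `φ` along `x₀ x₁⁻¹ x₂`. -/
theorem toPS_zigzag : toPS (mulIter (mu K) (eta K) 3 ∘ₕ
    (idn K 1 ⊗ₕ anti K ⊗ₕ idn K 1 : HatA K 3 3) ∘ₕ assocElt φ)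
      = act (zigzag true) (assocPS K φ) := by
  have h : (idn K 1 ⊗ₕ anti K ⊗ₕ idn K 1 : HatA K 3 3)
      = HatA.diag K (fun i => [.gen i (i ≠ 1)] : Word 3 3) := by
    simp (disch := decide) only [idn, anti, diag_tens_diag]
    exact congrArg (HatA.diag K) (by decide)
  rw [mulIter_three, h, toPS_diag_comp (ends_prodWord 3), toPS_diag_comp (by decide),
    act_act (ends_prodWord 3) (by decide), toPS_assocElt]
  congr 1

/-- `Delta` is strictly coassociative: both iterated coproducts are the word with the same bead on
three arcs, and conjugation by `φ` fixes it. -/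
theorem casimir_quasi_coassoc {ψ : HatA K 0 3} (h : toPS (assocElt φ) * toPS ψ = 1) :
    (idn K 1 ⊗ₕ Delta K) ∘ₕ Delta K
      = conv (mu K) (conv (mu K) (assocElt φ) ((Delta K ⊗ₕ idn K 1) ∘ₕ Delta K)) ψ := by
  have h1 : (idn K 1 ⊗ₕ Delta K) ∘ₕ Delta K = HatA.diag K (beadWord 3) := by
    simp (disch := decide) only [idn, Delta, diag_tens_diag, diag_comp_diag]
    exact congrArg (HatA.diag K) (by decide)
  have h2 : (Delta K ⊗ₕ idn K 1) ∘ₕ Delta K = HatA.diag K (beadWord 3) := by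
    simp (disch := decide) only [idn, Delta, diag_tens_diag, diag_comp_diag]
    exact congrArg (HatA.diag K) (by decide)
  rw [h1, h2]
  exact (conv_conv_bead (by decide) h).symm

theorem inclRight_one_three : inclRight 1 3 = ![none, some 0, some 1, some 2] := by decide
theorem inclLeft_three_one : inclLeft 3 1 = ![some 0, some 1, some 2, none] := by decide
theorem inclRight_one_two : inclRight 1 2 = ![none, some 0, some 1] := by decide
theorem inclLeft_two_one : inclLeft 2 1 = ![some 0, some 1, none] := by decide
theorem inclLeft_one_one : inclLeft 1 1 = ![some 0, none] := by decide
theorem inclRight_one_one : inclRight 1 1 = ![none, some 0] := by decide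

theorem toPS_unit_tens (x : HatA K 0 n) : toPS (eta K ⊗ₕ x : HatA K 0 (1 + n))
    = PowerSeries.map (pull K (inclRight 1 n) : A K 0 n →+* A K 0 (1 + n)) (toPS x) :=
  (toPS_tens _ _).trans (by rw [toPS_eta, map_one, one_mul])

theorem toPS_tens_unit (x : HatA K 0 n) : toPS (x ⊗ₕ eta K : HatA K 0 (n + 1))
    = PowerSeries.map (pull K (inclLeft n 1) : A K 0 n →+* A K 0 (n + 1)) (toPS x) :=
  (toPS_tens _ _).trans (by rw [toPS_eta, map_one, mul_one])

/-- Doubling or inserting a strand acts on the two chords of `φ` through `pull_chord`, which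
produces precisely the arguments in the pentagon for chords, with its sides exchanged. -/
theorem casimir_pentagon (hφ : IsDrinfeldAssociator φ) :
    conv0 (mu K) (conv0 (mu K) (n := 4) (eta K ⊗ₕ assocElt φ)
        ((idn K 1 ⊗ₕ Delta K ⊗ₕ idn K 1 : HatA K 3 4) ∘ₕ assocElt φ)) (assocElt φ ⊗ₕ eta K)
      = conv0 (mu K) (n := 4) ((idn K 1 ⊗ₕ idn K 1 ⊗ₕ Delta K : HatA K 3 4) ∘ₕ assocElt φ)
        ((Delta K ⊗ₕ idn K 1 ⊗ₕ idn K 1 : HatA K 3 4) ∘ₕ assocElt φ) := by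
  apply toPS_injective
  have h1 := toPS_unit_tens (assocElt φ)
  have h2 := toPS_tens_unit (assocElt φ)
  rw [inclRight_one_three] at h1
  rw [inclLeft_three_one] at h2
  rw [toPS_conv0 (by decide), toPS_conv0 (by decide), toPS_conv0 (by decide), id_comul_id_eq,
    id_id_comul_eq, comul_id_id_eq, toPS_pull_comp, toPS_pull_comp, toPS_pull_comp]
  refine (congrArg₂ _ (congrArg₂ _ h1 rfl) h2).trans ?_
  simp only [toPS_assocElt, assocPS, map_pull_subs, pull_chord]
  simpa [Fin.sum_univ_four] using (pentagon_chord hφ).symm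

/-- Both chords in `φ(c₁₂, c₂₃)` end on the deleted middle strand. -/
theorem casimir_counit_assoc (hφ : IsDrinfeldAssociator φ) :
    (idn K 1 ⊗ₕ eps K ⊗ₕ idn K 1 : HatA K 3 2) ∘ₕ assocElt φ = eta K ⊗ₕ eta K := by
  apply toPS_injective
  have h1 := toPS_unit_tens (eta K)
  rw [toPS_eta, map_one] at h1
  rw [id_counit_id_eq, toPS_pull_comp]
  refine Eq.trans ?_ h1.symm
  simp only [toPS_assocElt, assocPS, map_pull_subs, pull_chord]
  simp [subs_zero_zero hφ.groupLike.1]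

theorem map_inverse_subs {B C : Type*} [Ring B] [Algebra K B] [Ring C] [Algebra K C] (g : B →ₐ[K] C)
    (h : φ [] = 1) (a b : B) : PowerSeries.map (g : B →+* C) (Ring.inverse (subs φ a b))
      = Ring.inverse (subs φ (g a) (g b)) := by
  rw [map_ringInverse _ (isUnit_subs h a b), map_subs]

/-- The hexagon in the completed enveloping algebra is carried over by `chordHom`. On the other side
`pull_chord` computes the effect of doubling and permuting strands; the symmetry of chords puts the
indices in order. -/
theorem casimir_hexagon_left (hφ : IsDrinfeldAssociator φ) {ψ : HatA K 0 3}
    (h : toPS (assocElt φ) * toPS ψ = 1) (h' : toPS ψ * toPS (assocElt φ) = 1) :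
    (Delta K ⊗ₕ idn K 1 : HatA K 2 3) ∘ₕ expConv ((2⁻¹ : K) • cas K)
      = convList (mu K) (eta K) (n := 3) [perm K perm312 ∘ₕ assocElt φ,
        (idn K 1 ⊗ₕ eta K ⊗ₕ idn K 1 : HatA K 2 3) ∘ₕ expConv ((2⁻¹ : K) • cas K),
        perm K perm132 ∘ₕ ψ, eta K ⊗ₕ expConv ((2⁻¹ : K) • cas K), assocElt φ] := by
  have h0 := hφ.groupLike.1
  apply toPS_injective
  have h1 := toPS_unit_tens (expConv ((2⁻¹ : K) • cas K))
  rw [inclRight_one_two] at h1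
  rw [toPS_assocElt] at h h'
  have h2 : toPS ψ = Ring.inverse (assocPS K φ) := (ringInverse_eq h h').symm
  have h3 := congrArg (PowerSeries.map (chordHom K 3 : UKD K 3 →+* A K 0 3)) hφ.hexagon_left
  simp only [map_mul, map_subs, map_expSeries, map_inverse_subs _ h0, map_smul, map_add,
    chordHom_tgen] at h3
  rw [toPS_convList (by decide), comul_id_eq, id_unit_id_eq]
  simp only [List.map_cons, List.map_nil, List.prod_cons, List.prod_nil, mul_one]
  refine Eq.trans ?_ (congrArg₂ _ rfl (congrArg₂ _ rfl (congrArg₂ _ rfl (congrArg₂ _ h1.symm rfl))))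
  rw [perm312_eq, perm132_eq, toPS_pull_comp, toPS_pull_comp, toPS_pull_comp, toPS_pull_comp, h2]
  simp only [toPS_assocElt, assocPS, map_pull_subs, map_inverse_subs _ h0, toPS_braiding,
    map_expSeries, map_smul, pull_chord]
  simpa [Fin.sum_univ_three, chord_comm (2 : Fin 3), mul_assoc, -smul_add] using h3

theorem casimir_hexagon_right (hφ : IsDrinfeldAssociator φ) {ψ : HatA K 0 3}
    (h : toPS (assocElt φ) * toPS ψ = 1) (h' : toPS ψ * toPS (assocElt φ) = 1) :
    (idn K 1 ⊗ₕ Delta K : HatA K 2 3) ∘ₕ expConv ((2⁻¹ : K) • cas K)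
      = convList (mu K) (eta K) (n := 3) [perm K perm231 ∘ₕ ψ,
        (idn K 1 ⊗ₕ eta K ⊗ₕ idn K 1 : HatA K 2 3) ∘ₕ expConv ((2⁻¹ : K) • cas K),
        perm K perm213 ∘ₕ assocElt φ, expConv ((2⁻¹ : K) • cas K) ⊗ₕ eta K, ψ] := by
  have h0 := hφ.groupLike.1
  apply toPS_injective
  have h1 := toPS_tens_unit (expConv ((2⁻¹ : K) • cas K))
  rw [inclLeft_two_one] at h1
  rw [toPS_assocElt] at h h'
  have h2 : toPS ψ = Ring.inverse (assocPS K φ) := (ringInverse_eq h h').symm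
  have h3 := congrArg (PowerSeries.map (chordHom K 3 : UKD K 3 →+* A K 0 3)) hφ.hexagon_right
  simp only [map_mul, map_subs, map_expSeries, map_inverse_subs _ h0, map_smul, map_add,
    chordHom_tgen] at h3
  rw [toPS_convList (by decide), id_comul_eq, id_unit_id_eq]
  simp only [List.map_cons, List.map_nil, List.prod_cons, List.prod_nil, mul_one]
  refine Eq.trans ?_ (congrArg₂ _ rfl (congrArg₂ _ rfl (congrArg₂ _ rfl (congrArg₂ _ h1.symm rfl))))
  rw [perm231_eq, perm213_eq, toPS_pull_comp, toPS_pull_comp, toPS_pull_comp, toPS_pull_comp, h2]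
  simp only [toPS_assocElt, assocPS, map_pull_subs, map_inverse_subs _ h0, toPS_braiding,
    map_expSeries, map_smul, pull_chord]
  simpa [Fin.sum_univ_three, chord_comm (2 : Fin 3), chord_comm (1 : Fin 3) 0, mul_assoc,
    -smul_add] using h3

theorem casimir_triangular : swap K 1 1 ∘ₕ expConv ((2⁻¹ : K) • cas K)
    = expConv ((2⁻¹ : K) • cas K) := by
  apply toPS_injective
  rw [swap_eq, toPS_pull_comp, toPS_braiding, map_expSeries, map_smul, pull_chord]
  simp [Fin.sum_univ_two, chord_comm (1 : Fin 2) 0]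

theorem casimir_antipode_ribbon : anti K ∘ₕ expConv ((2⁻¹ : K) • (mu K ∘ₕ cas K))
    = expConv ((2⁻¹ : K) • (mu K ∘ₕ cas K)) := by
  apply toPS_injective
  have h : anti K = HatA.diag K (signWord false) := rfl
  rw [h, toPS_diag_comp (ends_signWord false), toPS_ribbon]
  ext k
  rw [coeff_act, expSeries, coeff_mk, map_smul, smul_pow, map_smul, comp_antipode_chord_pow]

/-- Doubling the arc of an isolated chord gives an isolated chord on each copy and the chord between
the copies twice. The latter account for `PR * R`, the former for `r ⊗ r`, and the exponential
splits because all of them commute. -/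
theorem casimir_comul_ribbon [CharZero K] : Delta K ∘ₕ expConv ((2⁻¹ : K) • (mu K ∘ₕ cas K))
    = convList (mu K) (eta K) (n := 2) [swap K 1 1 ∘ₕ expConv ((2⁻¹ : K) • cas K),
      expConv ((2⁻¹ : K) • cas K),
      expConv ((2⁻¹ : K) • (mu K ∘ₕ cas K)) ⊗ₕ expConv ((2⁻¹ : K) • (mu K ∘ₕ cas K))] := by
  apply toPS_injective
  have h1 := toPS_tens (expConv ((2⁻¹ : K) • (mu K ∘ₕ cas K))) (expConv ((2⁻¹ : K) • (mu K ∘ₕ cas K)))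
  rw [inclLeft_one_one, inclRight_one_one] at h1
  rw [toPS_convList (by decide), casimir_triangular]
  simp only [List.map_cons, List.map_nil, List.prod_cons, List.prod_nil, mul_one]
  refine Eq.trans ?_ (congrArg₂ _ rfl (congrArg₂ _ rfl h1.symm))
  rw [Delta_eq, toPS_pull_comp, toPS_braiding, toPS_ribbon, map_expSeries]
  -- Grouped in the order of the factors `PR`, `R` and `r ⊗ r`.
  have h2 : (pull K ![some 0, some 0]) ((2⁻¹ : K) • chord K (0 : Fin 1) 0) = (2⁻¹ : K) • chord K 0 1
      + ((2⁻¹ : K) • chord K 0 1 + ((2⁻¹ : K) • chord K 0 0 + (2⁻¹ : K) • chord K 1 1)) := by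
    rw [map_smul, pull_chord]
    simp only [Fin.sum_univ_two, chord_comm (1 : Fin 2) 0]
    simp
    abel
  have h3 : (pull K ![some 0, none]) ((2⁻¹ : K) • chord K (0 : Fin 1) 0)
      = (2⁻¹ : K) • chord K (0 : Fin 2) 0 := by
    rw [map_smul, pull_chord]
    simp [Fin.sum_univ_two]
  have h4 : (pull K ![none, some 0]) ((2⁻¹ : K) • chord K (0 : Fin 1) 0)
      = (2⁻¹ : K) • chord K (1 : Fin 2) 1 := by
    rw [map_smul, pull_chord]
    simp [Fin.sum_univ_two]
  have c0 : Commute (chord K (0 : Fin 2) 1) (chord K 0 0) :=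
    (chord_self_commute 0 1 (by decide)).symm
  have c1 : Commute (chord K (0 : Fin 2) 1) (chord K 1 1) := by
    rw [chord_comm]; exact (chord_self_commute 1 0 (by decide)).symm
  have c2 : Commute (chord K (0 : Fin 2) 0) (chord K 1 1) :=
    chord_commute _ _ _ _ (by decide) (by decide) (by decide) (by decide)
  have s : ∀ {x y : A K 0 2}, Commute x y → Commute ((2⁻¹ : K) • x) ((2⁻¹ : K) • y) :=
    fun h => (h.smul_left _).smul_right _
  rw [h2, expSeries_add ((Commute.refl _).add_right ((s c0).add_right (s c1))),
    expSeries_add ((s c0).add_right (s c1)), expSeries_add (s c2)]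
  have e3 := map_expSeries (K := K) (pull K ![some 0, none] : A K 0 1 →ₐ[K] A K 0 2)
    ((2⁻¹ : K) • chord K 0 0)
  have e4 := map_expSeries (K := K) (pull K ![none, some 0] : A K 0 1 →ₐ[K] A K 0 2)
    ((2⁻¹ : K) • chord K 0 0)
  rw [h3] at e3
  rw [h4] at e4
  exact congrArg₂ _ rfl (congrArg₂ _ rfl (congrArg₂ _ e3.symm e4.symm))

end ribbon
end JacobiHB

/-! ### Assembly of the ribbon quasi-Hopf algebra. -/

theorem theorem1p7 {K : Type*} [Field K] [CharZero K] (φ : List (Fin 2) → K)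
    (hφ : IsDrinfeldAssociator φ) (β βinv : HatA K 0 1)
    (hβ : IsConvInv (mu K) (eta K) β βinv) :
    ∃ ν : HatA K 0 1, IsNu φ ν ∧ ∃ H : RibbonQuasiHopf K,
      H.mul = mu K ∧ H.unit = eta K ∧ H.comul = Delta K ∧ H.counit = eps K ∧
      H.antipode = anti K ∧ H.assoc = assocElt φ ∧ H.alpha = conv0 (mu K) ν βinv ∧ H.beta = β ∧
      H.R = expConv ((2⁻¹ : K) • cas K) ∧ H.r = expConv ((2⁻¹ : K) • (mu K ∘ₕ cas K)) ∧
      H.IsTriangular ∧ H.IsCocommutative ∧ H.IsSpecial := by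
  have h0 := hφ.groupLike.1
  obtain ⟨ψ, hψ, hψ'⟩ := exists_inverse (assocElt φ) (coeff_zero_assocElt hφ)
  obtain ⟨Rinv, hR, hR'⟩ := exists_inverse (expConv ((2⁻¹ : K) • cas K)) (by
    rw [← coeff_toPS, toPS_braiding, PowerSeries.coeff_zero_eq_constantCoeff_apply,
      constantCoeff_expSeries])
  obtain ⟨rinv, hr, hr'⟩ := exists_inverse (expConv ((2⁻¹ : K) • (mu K ∘ₕ cas K))) (by
    rw [← coeff_toPS, toPS_ribbon, PowerSeries.coeff_zero_eq_constantCoeff_apply,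
      constantCoeff_expSeries])
  -- `M` is the contraction of the associator. Its degree `0` part is `1`, so it is
  -- convolution-invertible, with inverse `ν`.
  obtain ⟨M, hM⟩ : ∃ M : HatA K 0 1, M = mulIter (mu K) (eta K) 3 ∘ₕ
    (idn K 1 ⊗ₕ anti K ⊗ₕ idn K 1 : HatA K 3 3) ∘ₕ assocElt φ := ⟨_, rfl⟩
  have hMps : toPS M = act (zigzag true) (assocPS K φ) := by rw [hM, toPS_zigzag]
  obtain ⟨ν, hν, hν'⟩ := exists_inverse M (by
    rw [← coeff_toPS, hMps, coeff_act, ← toPS_assocElt, coeff_toPS, coeff_zero_assocElt hφ]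
    exact comp_one (by decide))
  obtain ⟨hβ1, hβ2⟩ := (isConvInv_iff (by decide) β βinv).1 hβ
  have hα : toPS (conv0 (mu K) ν βinv) = toPS ν * toPS βinv := toPS_conv0 (by decide) _ _
  -- The contraction of the inverse associator is `M` as well, by the pentagon; hence the same `ν`
  -- works for the second contraction axiom.
  have hψM : act (zigzag false) (toPS ψ) = toPS M := by
    rw [toPS_assocElt] at hψ
    rw [hMps, act_zigzag hφ hψ]
  have hid := idn_one_eq (K := K)
  -- The inverse of `α = ν * β⁻¹` is `β * M`.
  have hαi : IsConvInv (mu K) (eta K) (conv0 (mu K) ν βinv) (conv0 (mu K) β M) := by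
    rw [isConvInv_iff (by decide), hα, toPS_conv0 (by decide)]
    constructor
    · rw [mul_assoc, ← mul_assoc (toPS βinv), hβ2, one_mul, hν']
    · rw [mul_assoc, ← mul_assoc (toPS M), hν, one_mul, hβ1]
  refine ⟨ν, ?_, ⟨{
    mul := mu K
    unit := eta K
    mul_assoc := casimir_mul_assoc
    unit_mul := casimir_unit_mul
    mul_unit := casimir_mul_unit
    comul := Delta K
    comul_mul := casimir_comul_mul
    comul_unit := casimir_comul_unit
    counit := eps K
    counit_mul := casimir_counit_mul
    counit_unit := casimir_counit_unit
    assoc := assocElt φ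
    assocInv := ψ
    assoc_inv := (isConvInv_iff (by decide) _ _).2 ⟨hψ, hψ'⟩
    counit_comul := casimir_counit_comul
    comul_counit := casimir_comul_counit
    quasi_coassoc := casimir_quasi_coassoc hψ
    pentagon := casimir_pentagon hφ
    counit_assoc := casimir_counit_assoc hφ
    antipode := anti K
    antipode_mul := casimir_antipode_mul
    antipode_unit := casimir_antipode_unit
    -- The antipode is an involution.
    antipode_iso := ⟨anti K, casimir_antipode_antipode, casimir_antipode_antipode⟩
    alpha := conv0 (mu K) ν βinv
    alphaInv := conv0 (mu K) β M
    alpha_inv := hαi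
    beta := β
    betaInv := βinv
    beta_inv := hβ
    antipode_alpha := by rw [hid]; exact antipode_convolution false _
    antipode_beta := by rw [hid]; exact antipode_convolution true _
    antipode_assoc := by
      apply toPS_injective
      rw [hid, toPS_eta]
      refine (toPS_prod_five true false true β (conv0 (mu K) ν βinv) (assocElt φ)).trans ?_
      refine (congrArg (fun x => toPS β * toPS (conv0 (mu K) ν βinv) * x)
        ((congrArg _ toPS_assocElt).trans hMps.symm)).trans ?_
      show toPS β * toPS (conv0 (mu K) ν βinv) * toPS M = 1
      -- Here commutativity of diagrams on one arc enters: `β ν β⁻¹ M = β β⁻¹ ν M = 1`.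
      rw [hα, mul_comm_powerSeries (toPS ν), ← mul_assoc, hβ1, one_mul, hν']
    antipode_assocInv := by
      apply toPS_injective
      rw [hid, toPS_eta]
      refine (toPS_prod_five false true false (conv0 (mu K) ν βinv) β ψ).trans ?_
      refine (congrArg (fun x => toPS (conv0 (mu K) ν βinv) * toPS β * x) hψM).trans ?_
      show toPS (conv0 (mu K) ν βinv) * toPS β * toPS M = 1
      rw [hα, mul_assoc (toPS ν), hβ2, mul_one, hν']
    R := expConv ((2⁻¹ : K) • cas K)
    RInv := Rinv
    R_inv := (isConvInv_iff (by decide) _ _).2 ⟨hR, hR'⟩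
    -- Conjugation by `R` fixes the coproduct, which equals its opposite by cocommutativity.
    R_comul := (conv_conv_bead (by decide) hR).trans casimir_cocommutative.symm
    comul_R_left := casimir_hexagon_left hφ hψ hψ'
    comul_R_right := casimir_hexagon_right hφ hψ hψ'
    r := expConv ((2⁻¹ : K) • (mu K ∘ₕ cas K))
    rInv := rinv
    r_inv := (isConvInv_iff (by decide) _ _).2 ⟨hr, hr'⟩
    antipode_r := casimir_antipode_ribbon
    comul_r := casimir_comul_ribbon }, rfl, rfl, rfl, rfl, rfl, rfl, rfl, rfl, rfl, rfl,
    casimir_triangular, casimir_cocommutative, special_mu⟩⟩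
  exact (isConvInv_iff (by decide) _ _).2 ⟨hM ▸ hν', hM ▸ hν⟩
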